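/- **Setup.** Let $\mathfrak g$ be a finite-dimensional simple Lie algebra over $\mathbb C$ with Cartan subalgebra $\mathfrak t$, a system of simple roots $\alpha_1,\dots,\alpha_r$, the corresponding decomposition $\mathfrak g=\mathfrak n_+\oplus\mathfrak t\oplus\mathfrak n_-$, highest root $\theta$, half-sum $\rho$ of the positive roots, Coxeter number $h=\operatorname{ht}\theta+1$ and dual Coxeter number $h^\vee=1+\rho(\theta^\vee)$. Let $(\cdot|\cdot)$ be the invariant form with $(\theta^\vee|\theta^\vee)=2$, and let $\widehat{\mathfrak g}=\mathbb C[z,z^{-1}]\otimes\mathfrak g\oplus\mathbb CK\oplus\mathbb Cd$ be the affine Kac–Moody algebra: $[z^mx,z^ny]=z^{m+n}[x,y]+m\,\delta_{m,-n}(x|y)K$, $K$ is central, $[d,z^mx]=m\,z^mx$. Grade $\widehat{\mathfrak g}$ by giving $z^m\otimes\mathfrak g_\alpha$ the degree $\operatorname{ht}\alpha+hm$ (with $\mathfrak g_0=\mathfrak t$, $\operatorname{ht}0=0$) and $K,d$ the degree $0$. Then $\widehat{\mathfrak g}_0=\mathfrak t\oplus\mathbb CK\oplus\mathbb Cd$ and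 $$\widehat{\mathfrak g}_+=\bigoplus_{n>0}\widehat{\mathfrak g}_n=\mathfrak n_+\oplus z\mathbb C[z]\otimes\mathfrak g,\qquad \widehat{\mathfrak g}_-=\bigoplus_{n\le0}\widehat{\mathfrak g}_n=\mathfrak n_-\oplus z^{-1}\mathbb C[z^{-1}]\otimes\mathfrak g\oplus\widehat{\mathfrak g}_0 .$$ Let $\beta$ be the functional on $\widehat{\mathfrak g}$ with $\beta|_{\mathfrak t}=2\rho$, $\beta(K)=2h^\vee$, $\beta(d)=1$, which vanishes on all root spaces. Let $$\mathfrak a=(\mathbb C[z,z^{-1}]\otimes\mathfrak n_-)\oplus(z\mathbb C[z]\otimes\mathfrak t),\qquad \bar{\mathfrak a}=(\mathbb C[z,z^{-1}]\otimes\mathfrak n_+)\oplus(\mathbb C[z^{-1}]\otimes\mathfrak t)\oplus\mathbb CK\oplus\mathbb Cd,$$ and let $\mathfrak a_\pm=\mathfrak a\cap\widehat{\mathfrak g}_\pm$, $\bar{\mathfrak a}_\pm=\bar{\mathfrak a}\cap\widehat{\mathfrak g}_\pm$. Write $U=U(\widehat{\mathfrak g})$, with the induced grading. For a vector space $M$ let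 $\operatorname{Hom}(U,M)$ be the space of linear maps $U\to M$ that vanish on $U_n$ for all sufficiently large $n$. Let $\widehat{\mathfrak g}$ act on $\operatorname{Hom}(U,U)$ by $(xf)(u)=xf(u)+f(ux)$, and let $\operatorname{US}$ be the image of $$\operatorname{Hom}(U,U)^{\widehat{\mathfrak g}_-,-\beta}=\{f:\ xf(u)+f(ux)=\beta(x)f(u)\ \text{ for all }x\in\widehat{\mathfrak g}_-,\,u\in U\}$$ in the coinvariants of $\widehat{\mathfrak g}_+$ on $\operatorname{Hom}(U,U)$. The formulas $(xf)(u)=f(-xu)$ and $(fx)(u)=f(u)x$ make $\operatorname{US}$ a $\widehat{\mathfrak g}$-bimodule. For a character $\lambda$ of $\widehat{\mathfrak g}_0$ let $\mathbb C_\lambda=\mathbb Cw_\lambda$ be the corresponding one-dimensional representation, extended by zero to $\bar{\mathfrak a}$, to $\widehat{\mathfrak g}_-$ and to $\widehat{\mathfrak g}_+\oplus\widehat{\mathfrak g}_0$. Let $\bar{\mathfrak a}$ act on $\operatorname{US}\otimes\mathbb C_\lambda$ by $x(u\otimes w)=-ux\otimes w+u\otimes xw$. The Wakimoto module $$W(\lambda)=\operatorname{S-ind}_{\bar{\mathfrak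 a}}^{\widehat{\mathfrak g}}\mathbb C_\lambda$$ is the image of $\{v\in\operatorname{US}\otimes\mathbb C_\lambda:\ xv+\beta(x)v=0\ \text{ for all } x\in\bar{\mathfrak a}_+\}$ in the quotient of $\operatorname{US}\otimes\mathbb C_\lambda$ by the span of all $xv+\beta(x)v$ with $x\in\bar{\mathfrak a}_-$; it is a $\widehat{\mathfrak g}$-module by the left action on $\operatorname{US}$. Let $V(\lambda)=\operatorname{Ind}_{\widehat{\mathfrak g}_+\oplus\widehat{\mathfrak g}_0}^{\widehat{\mathfrak g}}\mathbb C_\lambda=U\otimes_{U(\widehat{\mathfrak g}_+\oplus\widehat{\mathfrak g}_0)}\mathbb C_\lambda$ be the Verma module, and let $V^*(\lambda)=\operatorname{Coind}_{\widehat{\mathfrak g}_-}^{\widehat{\mathfrak g}}\mathbb C_\lambda=\operatorname{Hom}_{\widehat{\mathfrak g}_-}(U,\mathbb C_\lambda)$, with the action $(xf)(u)=f(ux)$, be the contragredient Verma module (here $\operatorname{Hom}$ has the restricted meaning above). **Proposition.** 1. Let $(x_i)$ and $(y_j)$ be bases of $\mathfrak a_+$ and of $\mathfrak a_-$ that consist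 of root vectors of $\widehat{\mathfrak g}$, each indexed by a linearly ordered set. Let $n=(n_i)$ and $l=(l_j)$ run over the finitely supported families of non-negative integers. Let $\big(\prod_ix_i^{n_i}\big)^*\in U(\mathfrak a_+)^*$ denote the elements dual to the basis of ordered monomials of $U(\mathfrak a_+)$. For all $n,l$ there is exactly one vector $$\Big(\prod_i x_i^{n_i}\Big)^*\otimes\prod_jy_j^{l_j}\otimes w_\lambda\ \in\ W(\lambda)$$ that is the class of $f\otimes w_\lambda$ for some $f\in\operatorname{Hom}(U,U)^{\widehat{\mathfrak g}_-,-\beta}$ with $f(U(\widehat{\mathfrak g}_+))\subset U(\mathfrak a_-)$ and $f|_{U(\mathfrak a_+)}=\big(\prod_ix_i^{n_i}\big)^*\otimes\prod_jy_j^{l_j}$, and these vectors form a basis of $W(\lambda)$. 2. The weight spaces of $W(\lambda)$, $V(\lambda)$ and $V^*(\lambda)$ with respect to $\widehat{\mathfrak g}_0$ are finite-dimensional. For the formal character $\operatorname{ch}M=\sum_{\mu\in\widehat{\mathfrak g}_0^*}\dim M_\mu\,e^\mu$ one has $$\operatorname{ch}W(\lambda)=\operatorname{ch}V(\lambda)=\operatorname{ch}V^*(\lambda)=e^\lambda\prod_{\alpha\in\Delta_+}(1-e^{-\alpha})^{-\operatorname{mult}\alpha},$$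 where $\Delta_+$ is the set of positive roots of $\widehat{\mathfrak g}$ (the roots that are non-zero combinations of $\alpha_1,\dots,\alpha_r$ and $\alpha_0=\delta-\theta$, where $\delta(d)=1$ and $\delta=0$ on $\mathfrak t\oplus\mathbb CK$, with non-negative integral coefficients), $\operatorname{mult}\alpha=\dim\widehat{\mathfrak g}_\alpha$, and the product is taken in the formal power series in $e^{-\alpha_0},\dots,e^{-\alpha_r}$. -/

import Mathlib

open scoped TensorProduct

noncomputable section

namespace Wakimoto

section SemiInvariants

variable {V : Type*} [AddCommGroup V] [Module ℂ V] {A : Type*}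

/-- The invariants `(V ⊗ ℒ_χ)^P`: the vectors killed by all `x ∈ P` under `x ↦ ρ(x) + χ(x)`. -/
def invariants (ρ : A → Module.End ℂ V) (χ : A → ℂ) (P : Set A) : Submodule ℂ V :=
  ⨅ x ∈ P, LinearMap.ker (ρ x + χ x • LinearMap.id)

/-- The subspace `Q (V ⊗ ℒ_χ)`, spanned by the images of all `ρ(x) + χ(x)`, `x ∈ Q`. -/
def boundaries (ρ : A → Module.End ℂ V) (χ : A → ℂ) (Q : Set A) : Submodule ℂ V :=
  ⨆ x ∈ Q, LinearMap.range (ρ x + χ x • LinearMap.id)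

/-- The semi-invariants `(V)^P_Q`: the image of the invariants `(V ⊗ ℒ_χ)^P` in the coinvariants
`(V ⊗ ℒ_χ)_Q`. -/
def semiInvariants (ρ : A → Module.End ℂ V) (χ : A → ℂ) (P Q : Set A) :
    Submodule ℂ (V ⧸ boundaries ρ χ Q) :=
  (invariants ρ χ P).map (boundaries ρ χ Q).mkQ

variable {ρ : A → Module.End ℂ V} {χ : A → ℂ} {P Q : Set A}

theorem invariants_le_comap (S : Module.End ℂ V) (hS : ∀ x, Commute S (ρ x)) :
    invariants ρ χ P ≤ (invariants ρ χ P).comap S := by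
  intro v hv
  simp only [invariants, Submodule.mem_comap, Submodule.mem_iInf, LinearMap.mem_ker,
    LinearMap.add_apply, LinearMap.smul_apply, LinearMap.id_apply] at hv ⊢
  intro x hx
  have h := LinearMap.congr_fun (hS x) v
  simp only [Module.End.mul_apply] at h
  rw [← h, ← map_smul, ← map_add, hv x hx, map_zero]

theorem boundaries_le_comap (S : Module.End ℂ V) (hS : ∀ x, Commute S (ρ x)) :
    boundaries ρ χ Q ≤ (boundaries ρ χ Q).comap S := by
  refine iSup₂_le fun x hx => ?_
  rintro _ ⟨v, rfl⟩
  have h := LinearMap.congr_fun (hS x) v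
  simp only [Module.End.mul_apply] at h
  refine Submodule.mem_iSup_of_mem x (Submodule.mem_iSup_of_mem hx ⟨S v, ?_⟩)
  simp [h]

/-- An endomorphism commuting with the action `ρ` acts on the semi-invariants. -/
def semiInvariantsMap (S : Module.End ℂ V) (hS : ∀ x, Commute S (ρ x)) :
    Module.End ℂ (semiInvariants ρ χ P Q) :=
  ((boundaries ρ χ Q).mapQ (boundaries ρ χ Q) S (boundaries_le_comap S hS)).restrict <| by
    rintro _ ⟨v, hv, rfl⟩
    exact ⟨S v, invariants_le_comap S hS hv, rfl⟩

theorem semiInvariantsMap_mk (S : Module.End ℂ V) (hS : ∀ x, Commute S (ρ x)) (v : V)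
    (hv : (boundaries ρ χ Q).mkQ v ∈ semiInvariants ρ χ P Q) :
    (semiInvariantsMap S hS ⟨_, hv⟩ : V ⧸ boundaries ρ χ Q) = (boundaries ρ χ Q).mkQ (S v) := rfl

theorem semiInvariantsMap_commute (S S' : Module.End ℂ V) (hS : ∀ x, Commute S (ρ x))
    (hS' : ∀ x, Commute S' (ρ x)) (h : Commute S S') :
    Commute (semiInvariantsMap (χ := χ) (P := P) (Q := Q) S hS) (semiInvariantsMap S' hS') := by
  refine LinearMap.ext ?_
  rintro ⟨_, v, hv, rfl⟩
  apply Subtype.ext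
  exact congrArg (boundaries ρ χ Q).mkQ (LinearMap.congr_fun h v)

end SemiInvariants

section Graded

attribute [local instance 100] LieRing.ofAssociativeRing

variable {L : Type*} [LieRing L] [LieAlgebra ℂ L]

variable (L) in
/-- A `ℤ`-grading `L = ⊕ Lₙ` together with a functional `β`: the data of a semi-infinite structure
that enter the definitions below. -/
structure SemiInfinite where
  gr : ℤ → Submodule ℂ L
  iSup_gr : ⨆ n, gr n = ⊤
  beta : L →ₗ[ℂ] ℂ

variable (L) in
/-- The universal enveloping algebra. -/
abbrev U : Type _ := UniversalEnvelopingAlgebra ℂ L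

/-- The canonical map `L → U(L)`. -/
def toU : L →ₗ[ℂ] U L := (UniversalEnvelopingAlgebra.ι ℂ : L →ₗ⁅ℂ⁆ _).toLinearMap

/-- The subalgebra `U(S)` of `U(L)` generated by a subspace (subalgebra) `S` of `L`. -/
def subU (S : Submodule ℂ L) : Subalgebra ℂ (U L) := Algebra.adjoin ℂ (toU '' (S : Set L))

namespace SemiInfinite

variable (G : SemiInfinite L)

/-- `L₊ = ⊕_{n > 0} Lₙ`. -/
def plus : Submodule ℂ L := ⨆ n : {n : ℤ // 0 < n}, G.gr n

/-- `L₋ = ⊕_{n ≤ 0} Lₙ`. -/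
def minus : Submodule ℂ L := ⨆ n : {n : ℤ // n ≤ 0}, G.gr n

/-- The induced grading of `U(L)`. -/
def grU (n : ℤ) : Submodule ℂ (U L) :=
  Submodule.span ℂ {u | ∃ l : List (ℤ × L), (∀ p ∈ l, p.2 ∈ G.gr p.1) ∧
    (l.map Prod.fst).sum = n ∧ u = (l.map fun p => toU p.2).prod}

/-- `Hom(U(L), V)` in the graded sense `⊕_{n > 0} Hom(Uₙ, V) ⊕ ∏_{n ≤ 0} Hom(Uₙ, V)`: the linear
maps that vanish on `Uₙ` for all sufficiently large `n`. -/
def homU (V : Type*) [AddCommGroup V] [Module ℂ V] : Submodule ℂ (U L →ₗ[ℂ] V) where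
  carrier := {f | ∃ N : ℤ, ∀ n ≥ N, ∀ u ∈ G.grU n, f u = 0}
  zero_mem' := ⟨0, fun _ _ _ _ => rfl⟩
  add_mem' := by
    rintro f g ⟨N, hN⟩ ⟨N', hN'⟩
    refine ⟨max N N', fun n hn u hu => ?_⟩
    rw [LinearMap.add_apply, hN n (le_trans (le_max_left _ _) hn) u hu,
      hN' n (le_trans (le_max_right _ _) hn) u hu, add_zero]
  smul_mem' := by
    rintro c f ⟨N, hN⟩
    exact ⟨N, fun n hn u hu => by rw [LinearMap.smul_apply, hN n hn u hu, smul_zero]⟩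

theorem toU_mul_mem {k n : ℤ} {x : L} (hx : x ∈ G.gr k) {u : U L} (hu : u ∈ G.grU n) :
    toU x * u ∈ G.grU (n + k) := by
  induction hu using Submodule.span_induction with
  | zero => rw [mul_zero]; exact zero_mem _
  | add a b _ _ ha hb => rw [mul_add]; exact add_mem ha hb
  | smul c a _ ha => rw [mul_smul_comm]; exact Submodule.smul_mem _ c ha
  | mem u hu =>
    obtain ⟨l, hl, hs, rfl⟩ := hu
    refine Submodule.subset_span ⟨(k, x) :: l, ?_, ?_, ?_⟩
    · intro p hp
      rcases List.mem_cons.1 hp with rfl | hp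
      · exact hx
      · exact hl p hp
    · simp [hs, add_comm]
    · simp

theorem mul_toU_mem {k n : ℤ} {x : L} (hx : x ∈ G.gr k) {u : U L} (hu : u ∈ G.grU n) :
    u * toU x ∈ G.grU (n + k) := by
  induction hu using Submodule.span_induction with
  | zero => rw [zero_mul]; exact zero_mem _
  | add a b _ _ ha hb => rw [add_mul]; exact add_mem ha hb
  | smul c a _ ha => rw [smul_mul_assoc]; exact Submodule.smul_mem _ c ha
  | mem u hu =>
    obtain ⟨l, hl, hs, rfl⟩ := hu
    refine Submodule.subset_span ⟨l ++ [(k, x)], ?_, ?_, ?_⟩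
    · intro p hp
      rcases List.mem_append.1 hp with hp | hp
      · exact hl p hp
      · rw [List.mem_singleton.1 hp]; exact hx
    · simp [hs]
    · simp

theorem homU_comp_of_shift {V : Type*} [AddCommGroup V] [Module ℂ V] (F : L →ₗ[ℂ] Module.End ℂ (U L))
    (hF : ∀ k x, x ∈ G.gr k → ∀ n u, u ∈ G.grU n → F x u ∈ G.grU (n + k))
    {f : U L →ₗ[ℂ] V} (hf : f ∈ G.homU V) (x : L) : f ∘ₗ F x ∈ G.homU V := by
  have hx : x ∈ ⨆ n, G.gr n := G.iSup_gr ▸ Submodule.mem_top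
  induction hx using Submodule.iSup_induction' with
  | zero => rw [map_zero, LinearMap.comp_zero]; exact zero_mem _
  | add a b _ _ ha hb => rw [map_add, LinearMap.comp_add]; exact add_mem ha hb
  | mem k x hx =>
    obtain ⟨N, hN⟩ := hf
    exact ⟨N - k, fun n hn u hu => hN _ (by omega) _ (hF k x hx n u hu)⟩

theorem comp_mulLeft_mem {V : Type*} [AddCommGroup V] [Module ℂ V]
    {f : U L →ₗ[ℂ] V} (hf : f ∈ G.homU V) (x : L) :
    f ∘ₗ LinearMap.mulLeft ℂ (toU x) ∈ G.homU V :=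
  G.homU_comp_of_shift ((LinearMap.mul ℂ (U L)) ∘ₗ toU)
    (fun _ _ hx _ _ hu => G.toU_mul_mem hx hu) hf x

theorem comp_mulRight_mem {V : Type*} [AddCommGroup V] [Module ℂ V]
    {f : U L →ₗ[ℂ] V} (hf : f ∈ G.homU V) (x : L) :
    f ∘ₗ LinearMap.mulRight ℂ (toU x) ∈ G.homU V :=
  G.homU_comp_of_shift ((LinearMap.mul ℂ (U L)).flip ∘ₗ toU)
    (fun _ _ hx _ _ hu => G.mul_toU_mem hx hu) hf x

theorem comp_left_mem {V W : Type*} [AddCommGroup V] [Module ℂ V] [AddCommGroup W] [Module ℂ W]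
    {f : U L →ₗ[ℂ] V} (hf : f ∈ G.homU V) (φ : V →ₗ[ℂ] W) : φ ∘ₗ f ∈ G.homU W := by
  obtain ⟨N, hN⟩ := hf
  exact ⟨N, fun n hn u hu => by rw [LinearMap.comp_apply, hN n hn u hu, map_zero]⟩

/-- The space `Hom(U(L), U(L))`. -/
abbrev HomUU : Type _ := G.homU (U L)

/-- The action `(x f)(u) = x f(u) + f(u x)` on `Hom(U(L), U(L))`. -/
def diagAct (x : L) : Module.End ℂ G.HomUU where
  toFun f := ⟨LinearMap.mulLeft ℂ (toU x) ∘ₗ f.1 + f.1 ∘ₗ LinearMap.mulRight ℂ (toU x),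
    add_mem (G.comp_left_mem f.2 _) (G.comp_mulRight_mem f.2 x)⟩
  map_add' f g := by ext u; simp [mul_add]; abel
  map_smul' c f := by ext u; simp

/-- The left action `(x f)(u) = f(-x u)` on `Hom(U(L), U(L))`. -/
def leftAct (x : L) : Module.End ℂ G.HomUU where
  toFun f := ⟨f.1 ∘ₗ LinearMap.mulLeft ℂ (toU (-x)), G.comp_mulLeft_mem f.2 (-x)⟩
  map_add' _ _ := rfl
  map_smul' _ _ := rfl

/-- The right action `(f x)(u) = f(u) x` on `Hom(U(L), U(L))`. -/
def rightAct (x : L) : Module.End ℂ G.HomUU where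
  toFun f := ⟨LinearMap.mulRight ℂ (toU x) ∘ₗ f.1, G.comp_left_mem f.2 _⟩
  map_add' f g := by ext u; simp [add_mul]
  map_smul' c f := by ext u; simp

theorem leftAct_commute (x y : L) : Commute (G.leftAct x) (G.diagAct y) := by
  refine LinearMap.ext fun f => Subtype.ext (LinearMap.ext fun u => ?_)
  simp [leftAct, diagAct, mul_assoc]

theorem rightAct_commute (x y : L) : Commute (G.rightAct x) (G.diagAct y) := by
  refine LinearMap.ext fun f => Subtype.ext (LinearMap.ext fun u => ?_)
  simp [rightAct, diagAct, mul_assoc, add_mul]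

theorem leftAct_rightAct_commute (x y : L) : Commute (G.leftAct x) (G.rightAct y) :=
  LinearMap.ext fun _ => Subtype.ext (LinearMap.ext fun _ => rfl)

/-- The universal semijective bimodule `US = Hom(U(L), U(L))^{L₋}_{L₊}`, the semi-invariants of the
action `diagAct` for the opposite grading and for the functional `-β`. -/
def US : Type _ := semiInvariants (V := G.HomUU) G.diagAct (fun x => -G.beta x) G.minus G.plus

instance : AddCommGroup G.US := inferInstanceAs (AddCommGroup
  (semiInvariants (V := G.HomUU) G.diagAct (fun x => -G.beta x) G.minus G.plus))

instance : Module ℂ G.US := inferInstanceAs (Module ℂ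
  (semiInvariants (V := G.HomUU) G.diagAct (fun x => -G.beta x) G.minus G.plus))

/-- The subspace of `Hom(U(L), U(L))` of all `f` with `x f(u) + f(u x) - β(x) f(u) = 0` for
`x ∈ L₋`; its image in the coinvariants is `US`. -/
abbrev preUS : Submodule ℂ G.HomUU := invariants (V := G.HomUU) G.diagAct (fun x => -G.beta x) G.minus

/-- The class in `US` of an invariant element of `Hom(U(L), U(L))`. -/
def mkUS (f : G.preUS) : G.US := ⟨Submodule.mkQ _ f.1, f.1, f.2, rfl⟩

/-- The left action of `L` on `US`. -/
def leftUS (x : L) : Module.End ℂ G.US := semiInvariantsMap (G.leftAct x) (G.leftAct_commute x)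

/-- The right action of `L` on `US`. -/
def rightUS (x : L) : Module.End ℂ G.US := semiInvariantsMap (G.rightAct x) (G.rightAct_commute x)

variable (H : LieSubalgebra ℂ L) {V : Type*} [AddCommGroup V] [Module ℂ V]
  (σ : H →ₗ⁅ℂ⁆ Module.End ℂ V)

/-- The action `h (u ⊗ v) = -u h ⊗ v + u ⊗ h v` of `H` on `US ⊗ V`. -/
def tensorAct (h : H) : Module.End ℂ (G.US ⊗[ℂ] V) :=
  -(G.rightUS h).rTensor V + (σ h).lTensor G.US

/-- The semi-induced module `S-ind_H^L V = US ⊗^{H₊}_{H₋} V` of a representation `σ` of a graded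
subalgebra `H` on `V`, with `H± = H ∩ L±`. -/
abbrev SInd : Submodule ℂ (G.US ⊗[ℂ] V ⧸ boundaries (G.tensorAct H σ) (fun h : H => G.beta (h : L))
    {h : H | (h : L) ∈ G.minus}) :=
  semiInvariants (G.tensorAct H σ) (fun h : H => G.beta (h : L)) {h : H | (h : L) ∈ G.plus}
    {h : H | (h : L) ∈ G.minus}

theorem leftUS_tensor_commute (x : L) (h : H) :
    Commute ((G.leftUS x).rTensor V) (G.tensorAct H σ h) := by
  have h1 : Commute (G.leftUS x) (G.rightUS h) :=
    semiInvariantsMap_commute _ _ _ _ (G.leftAct_rightAct_commute x h)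
  refine TensorProduct.ext' fun u v => ?_
  have h2 := LinearMap.congr_fun h1 u
  simp only [Module.End.mul_apply] at h2
  simp [tensorAct, h2]

/-- The action of `L` on the semi-induced module, coming from the left action on `US`. -/
def actSInd (x : L) : Module.End ℂ (G.SInd H σ) :=
  semiInvariantsMap ((G.leftUS x).rTensor V) (G.leftUS_tensor_commute H σ x)

/-- The subspace of `U(L) ⊗ V` spanned by all `u h ⊗ v - u ⊗ h v`, `h ∈ H`. -/
def indRel : Submodule ℂ (U L ⊗[ℂ] V) :=
  Submodule.span ℂ {w | ∃ (u : U L) (h : H) (v : V),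
    w = (u * toU (h : L)) ⊗ₜ[ℂ] v - u ⊗ₜ[ℂ] σ h v}

end SemiInfinite

section Induced

variable (H : LieSubalgebra ℂ L) {V : Type*} [AddCommGroup V] [Module ℂ V]
  (σ : H →ₗ⁅ℂ⁆ Module.End ℂ V)

/-- The induced module `Ind_H^L V = U(L) ⊗_{U(H)} V`. -/
abbrev Ind : Type _ := (U L ⊗[ℂ] V) ⧸ SemiInfinite.indRel H σ

/-- The action of `L` on the induced module by left multiplication. -/
def actInd (x : L) : Module.End ℂ (Ind H σ) :=
  Submodule.mapQ _ _ ((LinearMap.mulLeft ℂ (toU x)).rTensor V) <| by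
    rw [SemiInfinite.indRel, Submodule.span_le]
    rintro _ ⟨u, h, v, rfl⟩
    refine Submodule.subset_span ⟨toU x * u, h, v, ?_⟩
    simp [mul_assoc]

variable (G : SemiInfinite L)

/-- The coinduced module `Coind_H^L V = Hom_H(U(L), V)`, with `Hom` in the graded sense. -/
def Coind : Submodule ℂ (G.homU V) where
  carrier := {f | ∀ (h : H) (u : U L), f.1 (toU (h : L) * u) = σ h (f.1 u)}
  zero_mem' h u := by simp
  add_mem' := by intro f g hf hg h u; simp [hf h u, hg h u]
  smul_mem' := by intro c f hf h u; simp [hf h u]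

/-- The action `(x f)(u) = f(u x)` of `L` on the coinduced module. -/
def actCoind (x : L) : Module.End ℂ (Coind H σ G) where
  toFun f := ⟨⟨f.1.1 ∘ₗ LinearMap.mulRight ℂ (toU x), G.comp_mulRight_mem f.1.2 x⟩,
    fun h u => by simpa [mul_assoc] using f.2 h (u * toU x)⟩
  map_add' _ _ := rfl
  map_smul' _ _ := rfl

end Induced
end Graded

open LieAlgebra LieAlgebra.IsKilling LieModule

section Loop

variable {𝔤 : Type*} [LieRing 𝔤] [LieAlgebra ℂ 𝔤]

/-- The degree derivation `z d/dz` of `ℂ[z, z⁻¹]`. -/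
def eulerLaurent : AddMonoidAlgebra ℂ ℤ →ₗ[ℂ] AddMonoidAlgebra ℂ ℤ :=
  (AddMonoidAlgebra.basis ℤ ℂ).constr ℂ fun n => AddMonoidAlgebra.single n (n : ℂ)

variable (𝔤) in
/-- The loop algebra `ℂ[z, z⁻¹] ⊗ 𝔤`. -/
def Loop : Type _ := loopAlgebra ℂ ℤ 𝔤

instance : LieRing (Loop 𝔤) := inferInstanceAs (LieRing (loopAlgebra ℂ ℤ 𝔤))

instance : LieAlgebra ℂ (Loop 𝔤) := inferInstanceAs (LieAlgebra ℂ (loopAlgebra ℂ ℤ 𝔤))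

/-- The degree derivation `z d/dz ⊗ 1` of the loop algebra. -/
def euler : Loop 𝔤 →ₗ[ℂ] Loop 𝔤 := LinearMap.rTensor (M := 𝔤) eulerLaurent

/-- The loop `zⁿ ⊗ x`. -/
def loop (n : ℤ) : 𝔤 →ₗ[ℂ] Loop 𝔤 := TensorProduct.mk ℂ _ 𝔤 (AddMonoidAlgebra.single n (1 : ℂ))

/-- The coefficient of `zⁿ` in a loop. -/
def coeff (n : ℤ) : Loop 𝔤 →ₗ[ℂ] 𝔤 :=
  Finsupp.lapply n ∘ₗ (LoopAlgebra.toFinsupp ℂ ℤ 𝔤).toLinearMap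

theorem coeff_loop (m n : ℤ) (x : 𝔤) : coeff m (loop n x) = if n = m then x else 0 := by
  classical
  change LoopAlgebra.toFinsupp ℂ ℤ 𝔤 (AddMonoidAlgebra.single n (1 : ℂ) ⊗ₜ[ℂ] x) m = _
  rw [LoopAlgebra.toFinsupp_single_tmul, Finsupp.single_apply]

theorem euler_loop (n : ℤ) (x : 𝔤) : euler (loop n x) = (n : ℂ) • loop n x := by
  have h : eulerLaurent (AddMonoidAlgebra.single n 1) =
      (n : ℂ) • AddMonoidAlgebra.single n (1 : ℂ) := by
    have := (AddMonoidAlgebra.basis ℤ ℂ).constr_basis ℂ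
      (fun n => AddMonoidAlgebra.single n (n : ℂ)) n
    refine this.trans ?_
    rw [AddMonoidAlgebra.smul_single, smul_eq_mul, mul_one]
  change eulerLaurent (AddMonoidAlgebra.single n 1) ⊗ₜ[ℂ] x =
    (n : ℂ) • (AddMonoidAlgebra.single n (1 : ℂ) ⊗ₜ[ℂ] x)
  rw [h, TensorProduct.smul_tmul']

theorem loop_lie (m n : ℤ) (x y : 𝔤) : ⁅loop m x, loop n y⁆ = loop (m + n) ⁅x, y⁆ := by
  change ⁅(AddMonoidAlgebra.single m (1 : ℂ) ⊗ₜ[ℂ] x : loopAlgebra ℂ ℤ 𝔤),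
    (AddMonoidAlgebra.single n (1 : ℂ) ⊗ₜ[ℂ] y : loopAlgebra ℂ ℤ 𝔤)⁆ =
    AddMonoidAlgebra.single (m + n) (1 : ℂ) ⊗ₜ[ℂ] ⁅x, y⁆
  rw [LieAlgebra.ExtendScalars.bracket_tmul, AddMonoidAlgebra.single_mul_single, one_mul]

theorem loop_induction {p : Loop 𝔤 → Prop} (f : Loop 𝔤)
    (h1 : ∀ n x, p (loop n x)) (h0 : p 0) (hadd : ∀ f g, p f → p g → p (f + g)) : p f := by
  have hs : ∀ (q : ℤ →₀ 𝔤), p ((LoopAlgebra.toFinsupp ℂ ℤ 𝔤).symm q) := by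
    intro q
    induction q using Finsupp.induction_linear with
    | zero => rw [map_zero]; exact h0
    | add a b ha hb => rw [map_add]; exact hadd _ _ ha hb
    | single n x => rw [LoopAlgebra.toFinsupp_symm_single]; exact h1 n x
  exact (LinearEquiv.symm_apply_apply (LoopAlgebra.toFinsupp ℂ ℤ 𝔤) f) ▸
    hs (LoopAlgebra.toFinsupp ℂ ℤ 𝔤 f)

theorem euler_lie (f g : Loop 𝔤) : euler ⁅f, g⁆ = ⁅euler f, g⁆ + ⁅f, euler g⁆ := by
  induction f using loop_induction with
  | h0 => simp
  | hadd a b ha hb => simp only [add_lie, map_add, ha, hb]; abel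
  | h1 m x =>
    induction g using loop_induction with
    | h0 => simp
    | hadd a b ha hb => simp only [lie_add, map_add, ha, hb]; abel
    | h1 n y =>
      rw [euler_loop, euler_loop, loop_lie, euler_loop, smul_lie, lie_smul, loop_lie, ← add_smul]
      push_cast
      rfl

end Loop

section Affine

variable {𝔤 : Type*} [LieRing 𝔤] [LieAlgebra ℂ 𝔤] [FiniteDimensional ℂ 𝔤] [LieAlgebra.IsSimple ℂ 𝔤]
  (T : LieSubalgebra ℂ 𝔤) [T.IsCartanSubalgebra]

/-- The invariant form `(·|·)` on `𝔤` for which `(θ^∨|θ^∨) = 2`; for `θ` the highest root this is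
the normalized invariant form. -/
def normForm (θ : T.root) : LinearMap.BilinForm ℂ 𝔤 :=
  (2 / killingForm ℂ 𝔤 (coroot (θ : Weight ℂ T 𝔤) : T) (coroot (θ : Weight ℂ T 𝔤) : T)) •
    killingForm ℂ 𝔤

theorem normForm_isSymm (θ : T.root) : (normForm T θ).IsSymm := by
  constructor
  intro x y
  simp only [normForm, LinearMap.smul_apply]
  congr 1
  exact LieModule.traceForm_comm ℂ 𝔤 𝔤 x y

theorem normForm_lieInvariant (θ : T.root) : (normForm T θ).lieInvariant 𝔤 := by
  intro x y z
  have := LieModule.traceForm_lieInvariant ℂ 𝔤 𝔤 x y z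
  simp only [normForm, LinearMap.smul_apply, this, smul_neg]

/-- The residue pairing `(f, g) ↦ Res (f | dg)`. -/
def residue (θ : T.root) : Loop 𝔤 →ₗ[ℂ] Loop 𝔤 →ₗ[ℂ] ℂ :=
  LoopAlgebra.residuePairing ℂ ℤ 𝔤 (normForm T θ)

/-- The cocycle `(zᵐ ⊗ x, zⁿ ⊗ y) ↦ m δ_{m,-n} (x|y)` on the loop algebra. -/
def cocycle (θ : T.root) (f g : Loop 𝔤) : ℂ :=
  - residue T θ f g

theorem cocycle_loop (θ : T.root) (m n : ℤ) (x y : 𝔤) :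
    cocycle T θ (loop m x) (loop n y) = if m + n = 0 then (m : ℂ) * normForm T θ x y else 0 := by
  classical
  change - LoopAlgebra.residuePairing ℂ ℤ 𝔤 (normForm T θ)
    (AddMonoidAlgebra.single m (1 : ℂ) ⊗ₜ[ℂ] x) (AddMonoidAlgebra.single n (1 : ℂ) ⊗ₜ[ℂ] y) = _
  simp only [LoopAlgebra.residuePairing_apply_apply,
    LoopAlgebra.toFinsupp_single_tmul, Finsupp.single_apply]
  rw [Finsupp.sum_single_index (by simp)]
  by_cases h : m + n = 0
  · have : m = -n := by omega
    subst this
    simp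
  · have : m ≠ -n := by omega
    simp [h, this]

/-- The affine Kac–Moody algebra `ℂ[z, z⁻¹] ⊗ 𝔤 ⊕ ℂ K ⊕ ℂ d`; an element is a triple consisting of
its loop part, its coefficient at `K` and its coefficient at `d`. -/
def AffineLie (_θ : T.root) : Type _ := Loop 𝔤 × ℂ × ℂ

namespace AffineLie

variable {T} {θ : T.root}

instance : AddCommGroup (AffineLie T θ) :=
  inferInstanceAs (AddCommGroup (Loop 𝔤 × ℂ × ℂ))

instance : Module ℂ (AffineLie T θ) :=
  inferInstanceAs (Module ℂ (Loop 𝔤 × ℂ × ℂ))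

/-- `[f + kK + sd, g + lK + td] = [f, g] + s z(dg/dz) - t z(df/dz) + c(f, g) K`. -/
instance : Bracket (AffineLie T θ) (AffineLie T θ) where
  bracket X Y := (⁅X.1, Y.1⁆ + X.2.2 • euler Y.1 - Y.2.2 • euler X.1, cocycle T θ X.1 Y.1, 0)

theorem lie_def (X Y : AffineLie T θ) :
    ⁅X, Y⁆ = (⁅X.1, Y.1⁆ + X.2.2 • euler Y.1 - Y.2.2 • euler X.1, cocycle T θ X.1 Y.1, 0) := rfl

theorem cocycle_add_left (f g h : Loop 𝔤) :
    cocycle T θ (f + g) h = cocycle T θ f h + cocycle T θ g h := by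
  simp only [cocycle, map_add, LinearMap.add_apply]; ring

theorem cocycle_add_right (f g h : Loop 𝔤) :
    cocycle T θ f (g + h) = cocycle T θ f g + cocycle T θ f h := by
  simp only [cocycle, map_add]; ring

theorem cocycle_smul_left (c : ℂ) (f g : Loop 𝔤) :
    cocycle T θ (c • f) g = c * cocycle T θ f g := by
  simp only [cocycle, map_smul, LinearMap.smul_apply, smul_eq_mul]; ring

theorem cocycle_smul_right (c : ℂ) (f g : Loop 𝔤) :
    cocycle T θ f (c • g) = c * cocycle T θ f g := by
  simp only [cocycle, map_smul, smul_eq_mul]; ring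

theorem cocycle_zero_left (f : Loop 𝔤) : cocycle T θ 0 f = 0 := by
  simp only [cocycle, map_zero, LinearMap.zero_apply, neg_zero]

theorem cocycle_zero_right (f : Loop 𝔤) : cocycle T θ f 0 = 0 := by
  simp only [cocycle, map_zero, neg_zero]

theorem cocycle_self (f : Loop 𝔤) : cocycle T θ f f = 0 := by
  have h := (LoopAlgebra.twoCochainOfBilinear ℂ ℤ 𝔤 (normForm T θ) (normForm_isSymm T θ)).property
  rw [LieModule.Cohomology.mem_twoCochain_iff] at h
  have h2 := (TrivialLieModule.equiv ℂ (loopAlgebra ℂ ℤ 𝔤) ℂ).symm.map_eq_zero_iff.1 (h f)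
  change - LoopAlgebra.residuePairing ℂ ℤ 𝔤 (normForm T θ) f f = 0
  rw [h2, neg_zero]

theorem cocycle_jacobi (f g h : Loop 𝔤) :
    cocycle T θ f ⁅g, h⁆ = cocycle T θ ⁅f, g⁆ h + cocycle T θ g ⁅f, h⁆ := by
  have := (LieModule.Cohomology.mem_twoCocycle_iff_of_trivial _ _ _ _).1
    (LoopAlgebra.twoCocycleOfBilinear ℂ ℤ 𝔤 (normForm T θ) (normForm_lieInvariant T θ)
      (normForm_isSymm T θ)).property f g h
  have h2 : residue T θ f ⁅g, h⁆ = residue T θ ⁅f, g⁆ h + residue T θ g ⁅f, h⁆ :=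
    (TrivialLieModule.equiv ℂ (loopAlgebra ℂ ℤ 𝔤) ℂ).symm.injective this
  simp only [cocycle, h2]; ring

theorem cocycle_euler (f g : Loop 𝔤) :
    cocycle T θ (euler f) g + cocycle T θ f (euler g) = 0 := by
  induction f using loop_induction with
  | h0 => simp [cocycle_zero_left]
  | hadd a b ha hb =>
    simp only [map_add, cocycle_add_left]; linear_combination ha + hb
  | h1 m x =>
    induction g using loop_induction with
    | h0 => simp [cocycle_zero_right]
    | hadd a b ha hb =>
      simp only [map_add, cocycle_add_right]; linear_combination ha + hb
    | h1 n y =>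
      rw [euler_loop, euler_loop, cocycle_smul_left, cocycle_smul_right, cocycle_loop]
      split_ifs with h
      · have : (m : ℂ) + n = 0 := by exact_mod_cast h
        linear_combination ((m : ℂ) * normForm T θ x y) * this
      · simp

instance : LieRing (AffineLie T θ) where
  add_lie X Y Z := by
    refine Prod.ext ?_ (Prod.ext ?_ ?_)
    · change ⁅X.1 + Y.1, Z.1⁆ + (X.2.2 + Y.2.2) • euler Z.1 - Z.2.2 • euler (X.1 + Y.1) =
        (⁅X.1, Z.1⁆ + X.2.2 • euler Z.1 - Z.2.2 • euler X.1) +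
        (⁅Y.1, Z.1⁆ + Y.2.2 • euler Z.1 - Z.2.2 • euler Y.1)
      simp only [add_lie, map_add, smul_add, add_smul]; abel
    · exact cocycle_add_left X.1 Y.1 Z.1
    · exact (add_zero (0 : ℂ)).symm
  lie_add X Y Z := by
    refine Prod.ext ?_ (Prod.ext ?_ ?_)
    · change ⁅X.1, Y.1 + Z.1⁆ + X.2.2 • euler (Y.1 + Z.1) - (Y.2.2 + Z.2.2) • euler X.1 =
        (⁅X.1, Y.1⁆ + X.2.2 • euler Y.1 - Y.2.2 • euler X.1) +
        (⁅X.1, Z.1⁆ + X.2.2 • euler Z.1 - Z.2.2 • euler X.1)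
      simp only [lie_add, map_add, smul_add, add_smul]; abel
    · exact cocycle_add_right X.1 Y.1 Z.1
    · exact (add_zero (0 : ℂ)).symm
  lie_self X := by
    refine Prod.ext ?_ (Prod.ext ?_ rfl)
    · change ⁅X.1, X.1⁆ + X.2.2 • euler X.1 - X.2.2 • euler X.1 = 0
      simp
    · exact cocycle_self X.1
  leibniz_lie X Y Z := by
    refine Prod.ext ?_ (Prod.ext ?_ ?_)
    · change ⁅X.1, ⁅Y.1, Z.1⁆ + Y.2.2 • euler Z.1 - Z.2.2 • euler Y.1⁆ +
          X.2.2 • euler (⁅Y.1, Z.1⁆ + Y.2.2 • euler Z.1 - Z.2.2 • euler Y.1) -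
          (0 : ℂ) • euler X.1 =
        (⁅⁅X.1, Y.1⁆ + X.2.2 • euler Y.1 - Y.2.2 • euler X.1, Z.1⁆ + (0 : ℂ) • euler Z.1 -
          Z.2.2 • euler (⁅X.1, Y.1⁆ + X.2.2 • euler Y.1 - Y.2.2 • euler X.1)) +
        (⁅Y.1, ⁅X.1, Z.1⁆ + X.2.2 • euler Z.1 - Z.2.2 • euler X.1⁆ +
          Y.2.2 • euler (⁅X.1, Z.1⁆ + X.2.2 • euler Z.1 - Z.2.2 • euler X.1) -
          (0 : ℂ) • euler Y.1)
      simp only [lie_add, lie_sub, add_lie, sub_lie, lie_smul, smul_lie, map_add, map_sub,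
        map_smul, euler_lie, smul_add, smul_sub, zero_smul, leibniz_lie X.1 Y.1 Z.1,
        smul_comm Y.2.2 X.2.2, smul_comm Z.2.2 X.2.2, smul_comm Z.2.2 Y.2.2]
      rw [← lie_skew Y.1 (euler X.1)]
      simp only [smul_neg]
      abel
    · change cocycle T θ X.1 (⁅Y.1, Z.1⁆ + Y.2.2 • euler Z.1 - Z.2.2 • euler Y.1) =
        cocycle T θ (⁅X.1, Y.1⁆ + X.2.2 • euler Y.1 - Y.2.2 • euler X.1) Z.1 +
        cocycle T θ Y.1 (⁅X.1, Z.1⁆ + X.2.2 • euler Z.1 - Z.2.2 • euler X.1)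
      have skew : ∀ f g : Loop 𝔤, cocycle T θ f g = - cocycle T θ g f := by
        intro f g
        have := cocycle_self (T := T) (θ := θ) (f + g)
        rw [cocycle_add_left, cocycle_add_right, cocycle_add_right, cocycle_self,
          cocycle_self] at this
        linear_combination this
      simp only [sub_eq_add_neg, ← neg_smul, cocycle_add_left, cocycle_add_right,
        cocycle_smul_left, cocycle_smul_right]
      linear_combination cocycle_jacobi (θ := θ) X.1 Y.1 Z.1 + Y.2.2 * cocycle_euler (θ := θ) X.1 Z.1
        - X.2.2 * cocycle_euler (θ := θ) Y.1 Z.1 - Z.2.2 * cocycle_euler (θ := θ) X.1 Y.1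
        + Z.2.2 * skew (euler X.1) Y.1
    · exact (add_zero (0 : ℂ)).symm

instance : LieAlgebra ℂ (AffineLie T θ) where
  lie_smul c X Y := by
    refine Prod.ext ?_ (Prod.ext ?_ ?_)
    · change ⁅X.1, c • Y.1⁆ + X.2.2 • euler (c • Y.1) - (c * Y.2.2) • euler X.1 =
        c • (⁅X.1, Y.1⁆ + X.2.2 • euler Y.1 - Y.2.2 • euler X.1)
      simp only [lie_smul, map_smul, smul_sub, smul_add, mul_smul, smul_comm c X.2.2]
    · exact cocycle_smul_right (θ := θ) c X.1 Y.1
    · exact (mul_zero c).symm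

end AffineLie

section Sectors

attribute [local instance 100] LieRing.ofAssociativeRing

variable (b : (rootSystem T).Base) (θ : T.root)

/-- The height of a weight of the adjoint representation: the height of a root, and `0` for the
zero weight. In particular a weight of positive (negative) height is a positive (negative) root. -/
def wtHeight (α : Weight ℂ T 𝔤) : ℤ := by
  classical
  exact if h : α ∈ T.root then b.height ⟨α, h⟩ else 0

/-- `θ` is the highest root: the root of maximal height. -/
def IsHighest : Prop := ∀ α : T.root, b.height α ≤ b.height θ

/-- The Coxeter number `ht θ + 1`. -/
def coxeter : ℤ := b.height θ + 1

/-- The projection `𝔤 = 𝔫₊ ⊕ 𝔱 ⊕ 𝔫₋ → 𝔱`, that is, the orthogonal projection for the Killing form. -/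
def projT : 𝔤 →ₗ[ℂ] T :=
  (cartanEquivDual T).symm.toLinearMap ∘ₗ T.toSubmodule.subtype.dualMap ∘ₗ killingForm ℂ 𝔤

theorem projT_coe (t : T) : projT T (t : 𝔤) = t := by
  simp only [projT, LinearMap.comp_apply, LinearEquiv.coe_coe, LinearEquiv.symm_apply_eq]
  ext s
  rw [cartanEquivDual_apply_apply]
  rfl

theorem projT_rootSpace {α : T → ℂ} (hα : α ≠ 0) {x : 𝔤} (hx : x ∈ rootSpace T α) :
    projT T x = 0 := by
  simp only [projT, LinearMap.comp_apply, LinearEquiv.coe_coe, LinearEquiv.symm_apply_eq, map_zero]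
  ext s
  refine killingForm_apply_eq_zero_of_mem_rootSpace_of_add_ne_zero ℂ 𝔤 T hx
    (β := 0) ?_ (by simpa using hα)
  simp

/-- The embedding of the loop algebra (as a vector space). -/
def ofLoop : Loop 𝔤 →ₗ[ℂ] AffineLie T θ := LinearMap.inl ℂ (Loop 𝔤) (ℂ × ℂ)

/-- The central element `K`. -/
def elK : AffineLie T θ := ((0 : Loop 𝔤), (1 : ℂ), (0 : ℂ))

/-- The derivation `d = z d/dz`. -/
def elD : AffineLie T θ := ((0 : Loop 𝔤), (0 : ℂ), (1 : ℂ))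

set_option linter.unusedSectionVars false in
theorem affine_ext {X Y : AffineLie T θ} (h1 : X.1 = Y.1) (h2 : X.2.1 = Y.2.1)
    (h3 : X.2.2 = Y.2.2) : X = Y := Prod.ext h1 (Prod.ext h2 h3)

theorem affine_eq (X : AffineLie T θ) :
    X = ofLoop T θ X.1 + X.2.1 • elK T θ + X.2.2 • elD T θ := by
  refine affine_ext T θ ?_ ?_ ?_
  · change X.1 = X.1 + X.2.1 • (0 : Loop 𝔤) + X.2.2 • (0 : Loop 𝔤)
    simp
  · change X.2.1 = 0 + X.2.1 * 1 + X.2.2 * 0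
    simp
  · change X.2.2 = 0 + X.2.1 * 0 + X.2.2 * 1
    simp

theorem lie_ofLoop (m n : ℤ) (x y : 𝔤) :
    ⁅ofLoop T θ (loop m x), ofLoop T θ (loop n y)⁆ =
      ofLoop T θ (loop (m + n) ⁅x, y⁆) + cocycle T θ (loop m x) (loop n y) • elK T θ := by
  refine affine_ext T θ ?_ ?_ ?_
  · change ⁅loop m x, loop n y⁆ + (0 : ℂ) • euler (loop n y) - (0 : ℂ) • euler (loop m x) =
      loop (m + n) ⁅x, y⁆ + _ • (0 : Loop 𝔤)
    rw [loop_lie]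
    simp
  · change cocycle T θ (loop m x) (loop n y) = 0 + _ * 1
    rw [zero_add, mul_one]
  · change (0 : ℂ) = 0 + _ * 0
    rw [zero_add, mul_zero]

theorem elK_lie (X : AffineLie T θ) : ⁅elK T θ, X⁆ = 0 := by
  refine affine_ext T θ ?_ ?_ rfl
  · change ⁅(0 : Loop 𝔤), X.1⁆ + (0 : ℂ) • euler X.1 - X.2.2 • euler (0 : Loop 𝔤) = 0
    simp
  · exact AffineLie.cocycle_zero_left X.1

theorem elD_lie_ofLoop (m : ℤ) (x : 𝔤) :
    ⁅elD T θ, ofLoop T θ (loop m x)⁆ = (m : ℂ) • ofLoop T θ (loop m x) := by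
  refine affine_ext T θ ?_ ?_ ?_
  · change ⁅(0 : Loop 𝔤), loop m x⁆ + (1 : ℂ) • euler (loop m x) - (0 : ℂ) • euler (0 : Loop 𝔤) =
      (m : ℂ) • loop m x
    rw [euler_loop]
    simp
  · change cocycle T θ 0 (loop m x) = (m : ℂ) * 0
    rw [AffineLie.cocycle_zero_left, mul_zero]
  · exact (mul_zero (m : ℂ)).symm

/-- The Cartan subalgebra `𝔤̂₀ = 𝔱 ⊕ ℂ K ⊕ ℂ d`. -/
def cartan : T × ℂ × ℂ →ₗ[ℂ] AffineLie T θ :=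
  LinearMap.prodMap (loop 0 ∘ₗ T.toSubmodule.subtype) LinearMap.id

/-- The projection of `𝔤̂` to `𝔤̂₀` along the sum of the root spaces. -/
def projCartan : AffineLie T θ →ₗ[ℂ] T × ℂ × ℂ :=
  LinearMap.prodMap (projT T ∘ₗ coeff 0) LinearMap.id

theorem projCartan_cartan (h : T × ℂ × ℂ) : projCartan T θ (cartan T θ h) = h := by
  refine Prod.ext ?_ rfl
  change projT T (coeff 0 (loop 0 (h.1 : 𝔤))) = h.1
  rw [coeff_loop, if_pos rfl, projT_coe]

variable (P : Weight ℂ T 𝔤 → ℤ → Prop)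

/-- The elements `zᵐ ⊗ x` with `x` in the weight space `𝔤_α` and `P α m`. -/
def sectorSet : Set (AffineLie T θ) :=
  {X | ∃ (α : Weight ℂ T 𝔤) (m : ℤ) (x : 𝔤), P α m ∧ x ∈ rootSpace T α ∧ X = ofLoop T θ (loop m x)}

/-- The sum of all `zᵐ ⊗ 𝔤_α` with `P α m`. -/
def sector : Submodule ℂ (AffineLie T θ) := Submodule.span ℂ (sectorSet T θ P)

variable {T P} in
/-- If `P` is closed under addition, the sum of `ℂ K ⊕ ℂ d` and all `zᵐ ⊗ 𝔤_α` with `P α m` is a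
subalgebra. -/
def sectorAlg (hP : ∀ (α β γ : Weight ℂ T 𝔤) (m n : ℤ), P α m → P β n →
    (γ : T → ℂ) = α + β → P γ (m + n)) : LieSubalgebra ℂ (AffineLie T θ) where
  toSubmodule := Submodule.span ℂ (sectorSet T θ P ∪ {elK T θ, elD T θ})
  lie_mem' := by
    intro X Y hX hY
    change X ∈ Submodule.span ℂ (sectorSet T θ P ∪ {elK T θ, elD T θ}) at hX
    change Y ∈ Submodule.span ℂ (sectorSet T θ P ∪ {elK T θ, elD T θ}) at hY
    change ⁅X, Y⁆ ∈ Submodule.span ℂ (sectorSet T θ P ∪ {elK T θ, elD T θ})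
    have hK : elK T θ ∈ Submodule.span ℂ (sectorSet T θ P ∪ {elK T θ, elD T θ}) :=
      Submodule.subset_span (by simp)
    induction hX using Submodule.span_induction with
    | zero => rw [zero_lie]; exact zero_mem _
    | add a c _ _ ha hc => rw [add_lie]; exact add_mem ha hc
    | smul r a _ ha => rw [smul_lie]; exact Submodule.smul_mem _ r ha
    | mem X hX =>
      induction hY using Submodule.span_induction with
      | zero => rw [lie_zero]; exact zero_mem _
      | add a c _ _ ha hc => rw [lie_add]; exact add_mem ha hc
      | smul r a _ ha => rw [lie_smul]; exact Submodule.smul_mem _ r ha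
      | mem Y hY =>
        have hd : ∀ Z ∈ sectorSet T θ P ∪ {elK T θ, elD T θ}, ⁅elD T θ, Z⁆ ∈
            Submodule.span ℂ (sectorSet T θ P ∪ {elK T θ, elD T θ}) := by
          rintro Z (⟨α, m, x, hα, hx, rfl⟩ | rfl | rfl)
          · rw [elD_lie_ofLoop]
            exact Submodule.smul_mem _ _ (Submodule.subset_span (Or.inl ⟨α, m, x, hα, hx, rfl⟩))
          · rw [← lie_skew, elK_lie, neg_zero]; exact zero_mem _
          · rw [lie_self]; exact zero_mem _
        rcases hX with ⟨α, m, x, hα, hx, rfl⟩ | rfl | rfl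
        · rcases hY with ⟨β, n, y, hβ, hy, rfl⟩ | rfl | rfl
          · rw [lie_ofLoop]
            refine add_mem ?_ (Submodule.smul_mem _ _ hK)
            have hxy := lie_mem_genWeightSpace_of_mem_genWeightSpace hx hy
            by_cases h0 : genWeightSpace 𝔤 ((α : T → ℂ) + (β : T → ℂ)) = ⊥
            · rw [h0, LieSubmodule.mem_bot] at hxy
              rw [hxy, map_zero, map_zero]
              exact zero_mem _
            · exact Submodule.subset_span (Or.inl ⟨⟨_, h0⟩, m + n, ⁅x, y⁆,
                hP α β ⟨_, h0⟩ m n hα hβ rfl, hxy, rfl⟩)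
          · rw [← lie_skew, elK_lie, neg_zero]; exact zero_mem _
          · rw [← lie_skew]
            exact neg_mem (hd _ (Or.inl ⟨α, m, x, hα, hx, rfl⟩))
        · rw [elK_lie]; exact zero_mem _
        · exact hd Y hY

variable {T P} in
/-- The one-dimensional representation `ℂ_λ` of such a subalgebra `𝔥`, for a character `λ` of
`𝔤̂₀ = 𝔱 ⊕ ℂ K ⊕ ℂ d` extended by zero to the root spaces in `𝔥`; it exists when `𝔥` does not
contain two opposite root spaces. -/
def charRep (hP : ∀ (α β γ : Weight ℂ T 𝔤) (m n : ℤ), P α m → P β n →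
      (γ : T → ℂ) = α + β → P γ (m + n))
    (hP' : ∀ (α β : Weight ℂ T 𝔤) (m n : ℤ), P α m → P β n → (α : T → ℂ) + β = 0 → m + n = 0 →
      α.IsZero ∧ m = 0)
    (lam : Module.Dual ℂ (T × ℂ × ℂ)) : sectorAlg θ hP →ₗ⁅ℂ⁆ Module.End ℂ ℂ where
  toFun h := lam (projCartan T θ h) • LinearMap.id
  map_add' g h := by
    rw [show ((g + h : sectorAlg θ hP) : AffineLie T θ) = g + h from rfl, map_add, map_add,
      add_smul]
  map_smul' c h := by
    rw [show ((c • h : sectorAlg θ hP) : AffineLie T θ) = c • (h : AffineLie T θ) from rfl,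
      map_smul, map_smul, smul_assoc, RingHom.id_apply]
  map_lie' := by
    rintro ⟨X, hX⟩ ⟨Y, hY⟩
    have hz : projCartan T θ ⁅X, Y⁆ = 0 := by
      change X ∈ Submodule.span ℂ (sectorSet T θ P ∪ {elK T θ, elD T θ}) at hX
      change Y ∈ Submodule.span ℂ (sectorSet T θ P ∪ {elK T θ, elD T θ}) at hY
      have hd : ∀ Z ∈ sectorSet T θ P ∪ {elK T θ, elD T θ},
          projCartan T θ ⁅elD T θ, Z⁆ = 0 := by
        rintro Z (⟨α, m, x, hα, hx, rfl⟩ | rfl | rfl)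
        · rw [elD_lie_ofLoop, map_smul]
          by_cases hm : m = 0
          · rw [hm, Int.cast_zero, zero_smul]
          · have : projCartan T θ (ofLoop T θ (loop m x)) = 0 := by
              refine Prod.ext ?_ rfl
              change projT T (coeff 0 (loop m x)) = 0
              rw [coeff_loop, if_neg hm, map_zero]
            rw [this, smul_zero]
        · rw [← lie_skew, elK_lie, neg_zero, map_zero]
        · rw [lie_self, map_zero]
      induction hX using Submodule.span_induction with
      | zero => rw [zero_lie, map_zero]
      | add a c _ _ ha hc => rw [add_lie, map_add, ha, hc, add_zero]
      | smul r a _ ha => rw [smul_lie, map_smul, ha, smul_zero]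
      | mem X hX =>
        induction hY using Submodule.span_induction with
        | zero => rw [lie_zero, map_zero]
        | add a c _ _ ha hc => rw [lie_add, map_add, ha, hc, add_zero]
        | smul r a _ ha => rw [lie_smul, map_smul, ha, smul_zero]
        | mem Y hY =>
          rcases hX with ⟨α, m, x, hα, hx, rfl⟩ | rfl | rfl
          · rcases hY with ⟨β, n, y, hβ, hy, rfl⟩ | rfl | rfl
            · rw [lie_ofLoop, cocycle_loop]
              by_cases hmn : m + n = 0
              swap
              · rw [if_neg hmn, zero_smul, add_zero]
                refine Prod.ext ?_ rfl
                change projT T (coeff 0 (loop (m + n) ⁅x, y⁆)) = 0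
                rw [coeff_loop, if_neg hmn, map_zero]
              have hxy := lie_mem_genWeightSpace_of_mem_genWeightSpace hx hy
              by_cases hab : (α : T → ℂ) + β = 0
              · obtain ⟨ha, rfl⟩ := hP' α β m n hα hβ hab hmn
                have hb : (β : T → ℂ) = 0 := by
                  rw [show (α : T → ℂ) = 0 from ha, zero_add] at hab
                  exact hab
                rw [show (α : T → ℂ) = 0 from ha, rootSpace_zero_eq] at hx
                rw [hb, rootSpace_zero_eq] at hy
                have : ⁅x, y⁆ = 0 := by
                  have h := trivial_lie_zero T T ⟨x, hx⟩ ⟨y, hy⟩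
                  exact congrArg Subtype.val h
                rw [this]
                simp
              · have h1 : normForm T θ x y = 0 := by
                  simp only [normForm, LinearMap.smul_apply]
                  rw [killingForm_apply_eq_zero_of_mem_rootSpace_of_add_ne_zero ℂ 𝔤 T hx hy hab,
                    smul_zero]
                rw [h1, mul_zero, ite_self, zero_smul, add_zero]
                refine Prod.ext ?_ rfl
                change projT T (coeff 0 (loop (m + n) ⁅x, y⁆)) = 0
                rw [coeff_loop, if_pos hmn, projT_rootSpace T hab hxy]
            · rw [← lie_skew, elK_lie, neg_zero, map_zero]
            · rw [← lie_skew, map_neg, hd _ (Or.inl ⟨α, m, x, hα, hx, rfl⟩), neg_zero]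
          · rw [elK_lie, map_zero]
          · exact hd Y hY
    have hz' : projCartan T θ ((⁅(⟨X, hX⟩ : sectorAlg θ hP), (⟨Y, hY⟩ : sectorAlg θ hP)⁆ :
        sectorAlg θ hP) : AffineLie T θ) = 0 := hz
    refine LinearMap.ext fun c => ?_
    simp only [hz', map_zero, zero_smul, LieRing.of_associative_ring_bracket]
    simp [mul_comm, mul_left_comm]

theorem wtHeight_eq_zero {α : Weight ℂ T 𝔤} : wtHeight T b α = 0 ↔ α.IsZero := by
  classical
  unfold wtHeight
  split_ifs with h
  · refine ⟨fun h0 => absurd h0 (b.height_ne_zero _), fun h0 => ?_⟩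
    simp at h
    exact absurd h0 h
  · simpa using h

theorem wtHeight_add {α β γ : Weight ℂ T 𝔤} (h : (γ : T → ℂ) = α + β) :
    wtHeight T b γ = wtHeight T b α + wtHeight T b β := by
  classical
  have key : ∀ α : Weight ℂ T 𝔤, ∀ hα : α ∈ T.root, wtHeight T b α = b.height ⟨α, hα⟩ := by
    intro α hα
    simp [wtHeight, hα]
  have hr : ∀ α : Weight ℂ T 𝔤, ¬ α.IsZero → α ∈ T.root := by
    intro α hα
    simpa using hα
  by_cases ha : α.IsZero
  · have : γ = β := by
      apply DFunLike.coe_injective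
      rw [h, show (α : T → ℂ) = 0 from ha, zero_add]
    rw [this, (wtHeight_eq_zero T b).2 ha, zero_add]
  by_cases hb : β.IsZero
  · have : γ = α := by
      apply DFunLike.coe_injective
      rw [h, show (β : T → ℂ) = 0 from hb, add_zero]
    rw [this, (wtHeight_eq_zero T b).2 hb, add_zero]
  by_cases hc : γ.IsZero
  · rw [(wtHeight_eq_zero T b).2 hc, key α (hr α ha), key β (hr β hb)]
    have hβ : β = -α := by
      apply DFunLike.coe_injective
      rw [Weight.coe_neg]
      rw [show (γ : T → ℂ) = 0 from hc] at h
      exact (neg_eq_of_add_eq_zero_right h.symm).symm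
    have h1 := b.height_reflectionPerm_self ⟨α, hr α ha⟩
    have e : (⟨β, hr β hb⟩ : T.root) =
        (rootSystem T).reflectionPerm ⟨α, hr α ha⟩ ⟨α, hr α ha⟩ := by
      apply (rootSystem T).root.injective
      rw [RootPairing.root_reflectionPerm, RootPairing.reflection_apply_self]
      ext t
      simp [hβ]
    rw [e]
    change b.height ((rootSystem T).reflectionPerm ⟨α, hr α ha⟩ ⟨α, hr α ha⟩) = _ at h1
    rw [h1, add_neg_cancel]
  · rw [key α (hr α ha), key β (hr β hb), key γ (hr γ hc)]
    refine b.height_add ?_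
    ext t
    exact congrFun h t

end Sectors

section Wakimoto

attribute [local instance 100] LieRing.ofAssociativeRing

variable (b : (rootSystem T).Base) (θ : T.root)

theorem wtHeight_add_eq_zero {α β : Weight ℂ T 𝔤} (h : (α : T → ℂ) + β = 0) :
    wtHeight T b α + wtHeight T b β = 0 := by
  classical
  by_cases ha : α.IsZero
  · have hb : β.IsZero := by
      rw [show (α : T → ℂ) = 0 from ha, zero_add] at h
      exact h
    rw [(wtHeight_eq_zero T b).2 ha, (wtHeight_eq_zero T b).2 hb, add_zero]
  · have hβ : β = -α := by
      apply DFunLike.coe_injective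
      rw [Weight.coe_neg]
      exact (neg_eq_of_add_eq_zero_right h).symm
    have hα : α ∈ T.root := by simpa using ha
    have hb : β ∈ T.root := by
      have : (-α).IsNonZero := by simpa using hα
      simpa [hβ] using this
    have h1 := b.height_reflectionPerm_self ⟨α, hα⟩
    have e : (⟨β, hb⟩ : T.root) = (rootSystem T).reflectionPerm ⟨α, hα⟩ ⟨α, hα⟩ := by
      apply (rootSystem T).root.injective
      rw [RootPairing.root_reflectionPerm, RootPairing.reflection_apply_self]
      ext t
      simp [hβ]
    have h2 : wtHeight T b α = b.height ⟨α, hα⟩ := by simp only [wtHeight, hα, dite_true]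
    have h3 : wtHeight T b β = b.height ⟨β, hb⟩ := by simp only [wtHeight, hb, dite_true]
    rw [h2, h3, e]
    change b.height ((rootSystem T).reflectionPerm ⟨α, hα⟩ ⟨α, hα⟩) = _ at h1
    rw [h1, add_neg_cancel]

variable {T b θ} in
theorem IsHighest.wtHeight_le (hθ : IsHighest T b θ) (α : Weight ℂ T 𝔤) :
    wtHeight T b α ≤ b.height θ := by
  classical
  have h0 : 0 ≤ b.height θ := by
    have h1 := b.height_reflectionPerm_self θ
    change b.height ((rootSystem T).reflectionPerm θ θ) = _ at h1
    have := hθ ((rootSystem T).reflectionPerm θ θ)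
    omega
  unfold wtHeight
  split_ifs with h
  · exact hθ _
  · exact h0

variable {T b θ} in
theorem IsHighest.isolated (hθ : IsHighest T b θ) {α β : Weight ℂ T 𝔤} {m : ℤ}
    (hab : (α : T → ℂ) + β = 0) (h0 : wtHeight T b α + coxeter T b θ * m = 0) :
    α.IsZero ∧ m = 0 := by
  have h1 := hθ.wtHeight_le α
  have h2 := hθ.wtHeight_le β
  have h3 := wtHeight_add_eq_zero T b hab
  unfold coxeter at h0
  have hm : m = 0 := by
    by_contra hm
    rcases lt_or_gt_of_ne hm with h | h <;> nlinarith
  refine ⟨(wtHeight_eq_zero T b).1 ?_, hm⟩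
  rw [hm, mul_zero, add_zero] at h0
  exact h0

/-- The grading of `𝔤̂`: `zᵐ ⊗ x` with `x ∈ 𝔤_α` has degree `ht α + h m`, where `h` is the Coxeter
number, and `K`, `d` have degree `0`. So the root vectors of simple (negative simple) roots have
degree `1` (`-1`), and `z` has degree `h`. -/
def gradeSet (n : ℤ) : Set (AffineLie T θ) :=
  sectorSet T θ (fun α m => wtHeight T b α + coxeter T b θ * m = n) ∪
    {X | n = 0 ∧ (X = elK T θ ∨ X = elD T θ)}

/-- `2ρ`, the sum of the positive roots of `𝔤`. -/
def twoRho : Module.Dual ℂ T := by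
  classical
  exact ∑ α : T.root, if b.IsPos α then (α : Weight ℂ T 𝔤).toLinear else 0

/-- The dual Coxeter number `h^∨ = 1 + ρ(θ^∨)`, for `θ` the highest root. -/
def dualCoxeter : ℂ := 1 + twoRho T b (coroot (θ : Weight ℂ T 𝔤)) / 2

/-- The functional `β` on `𝔤̂₀`: `β = 2ρ` on `𝔱`, `β(K) = 2h^∨` and `β(d) = 1`. -/
def betaCartan : Module.Dual ℂ (T × ℂ × ℂ) :=
  LinearMap.coprod (twoRho T b)
    (LinearMap.coprod ((2 * dualCoxeter T b θ) • LinearMap.id) LinearMap.id)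

/-- The semi-infinite structure on `𝔤̂`. -/
def affineSemiInfinite : SemiInfinite (AffineLie T θ) where
  gr n := Submodule.span ℂ (gradeSet T b θ n)
  iSup_gr := by
    rw [eq_top_iff]
    intro X _
    rw [affine_eq T θ X]
    have hK : ∀ Z, Z = elK T θ ∨ Z = elD T θ →
        Z ∈ ⨆ n, Submodule.span ℂ (gradeSet T b θ n) := fun Z hZ =>
      Submodule.mem_iSup_of_mem 0 (Submodule.subset_span (Or.inr ⟨rfl, hZ⟩))
    refine add_mem (add_mem ?_ (Submodule.smul_mem _ _ (hK _ (Or.inl rfl))))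
      (Submodule.smul_mem _ _ (hK _ (Or.inr rfl)))
    induction X.1 using loop_induction with
    | h0 => rw [map_zero]; exact zero_mem _
    | hadd f g hf hg => rw [map_add]; exact add_mem hf hg
    | h1 m x =>
      have hx : x ∈ ⨆ α : Weight ℂ T 𝔤, (rootSpace T α).toSubmodule := by
        rw [← LieSubmodule.iSup_toSubmodule, iSup_genWeightSpace_eq_top' ℂ T 𝔤]
        trivial
      induction hx using Submodule.iSup_induction' with
      | zero => rw [map_zero, map_zero]; exact zero_mem _
      | add x y _ _ hx hy => rw [map_add, map_add]; exact add_mem hx hy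
      | mem α x hx =>
        exact Submodule.mem_iSup_of_mem (wtHeight T b α + coxeter T b θ * m)
          (Submodule.subset_span (Or.inl ⟨α, m, x, rfl, hx, rfl⟩))
  beta := betaCartan T b θ ∘ₗ projCartan T θ

/-- `𝔤̂₋ = 𝔫₋ ⊕ (z⁻¹ℂ[z⁻¹] ⊗ 𝔤) ⊕ 𝔱 ⊕ ℂ K ⊕ ℂ d`, the part of degree `≤ 0`, as a subalgebra. -/
def affineMinus : LieSubalgebra ℂ (AffineLie T θ) :=
  sectorAlg θ (P := fun α m => wtHeight T b α + coxeter T b θ * m ≤ 0) <| by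
    intro α β γ m n h1 h2 h
    rw [wtHeight_add T b h, mul_add]
    omega

/-- `𝔤̂₊ ⊕ 𝔤̂₀`, the part of degree `≥ 0`, as a subalgebra. -/
def affineBorel : LieSubalgebra ℂ (AffineLie T θ) :=
  sectorAlg θ (P := fun α m => 0 ≤ wtHeight T b α + coxeter T b θ * m) <| by
    intro α β γ m n h1 h2 h
    rw [wtHeight_add T b h, mul_add]
    omega

/-- `𝔞 = (ℂ[z, z⁻¹] ⊗ 𝔫₋) ⊕ (zℂ[z] ⊗ 𝔱)`. -/
def aSpace : Submodule ℂ (AffineLie T θ) :=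
  sector T θ fun α m => wtHeight T b α < 0 ∨ wtHeight T b α = 0 ∧ 0 < m

/-- `𝔞̄ = (ℂ[z, z⁻¹] ⊗ 𝔫₊) ⊕ (ℂ[z⁻¹] ⊗ 𝔱) ⊕ ℂ K ⊕ ℂ d`. -/
def aBar : LieSubalgebra ℂ (AffineLie T θ) :=
  sectorAlg θ (P := fun α m => 0 < wtHeight T b α ∨ wtHeight T b α = 0 ∧ m ≤ 0) <| by
    intro α β γ m n h1 h2 h
    rw [wtHeight_add T b h]
    omega

/-- `𝔞₊ = 𝔞 ∩ 𝔤̂₊`. -/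
def aPlus : Submodule ℂ (AffineLie T θ) := aSpace T b θ ⊓ (affineSemiInfinite T b θ).plus

/-- `𝔞₋ = 𝔞 ∩ 𝔤̂₋`. -/
def aMinus : Submodule ℂ (AffineLie T θ) := aSpace T b θ ⊓ (affineSemiInfinite T b θ).minus

variable (lam : Module.Dual ℂ (T × ℂ × ℂ))

/-- The representation `ℂ_λ` of `𝔞̄`. -/
def aBarRep : aBar T b θ →ₗ⁅ℂ⁆ Module.End ℂ ℂ :=
  charRep (P := fun α m => 0 < wtHeight T b α ∨ wtHeight T b α = 0 ∧ m ≤ 0) θ _ (by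
    intro α β m n h1 h2 h hmn
    have := wtHeight_add_eq_zero T b h
    rw [← wtHeight_eq_zero T b]
    omega) lam

variable {T b θ} in
/-- The representation `ℂ_λ` of `𝔤̂₋`. -/
def minusRep (hθ : IsHighest T b θ) : affineMinus T b θ →ₗ⁅ℂ⁆ Module.End ℂ ℂ :=
  charRep (P := fun α m => wtHeight T b α + coxeter T b θ * m ≤ 0) θ _ (by
    intro α β m n h1 h2 h hmn
    have h3 := wtHeight_add_eq_zero T b h
    refine hθ.isolated h ?_
    have h4 : coxeter T b θ * m + coxeter T b θ * n = 0 := by rw [← mul_add, hmn, mul_zero]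
    omega) lam

variable {T b θ} in
/-- The representation `ℂ_λ` of `𝔤̂₊ ⊕ 𝔤̂₀`. -/
def borelRep (hθ : IsHighest T b θ) : affineBorel T b θ →ₗ⁅ℂ⁆ Module.End ℂ ℂ :=
  charRep (P := fun α m => 0 ≤ wtHeight T b α + coxeter T b θ * m) θ _ (by
    intro α β m n h1 h2 h hmn
    have h3 := wtHeight_add_eq_zero T b h
    refine hθ.isolated h ?_
    have h4 : coxeter T b θ * m + coxeter T b θ * n = 0 := by rw [← mul_add, hmn, mul_zero]
    omega) lam

/-- The Wakimoto module `W(λ) = S-ind_{𝔞̄}^{𝔤̂} ℂ_λ`. -/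
abbrev WakimotoModule : Type _ :=
  (affineSemiInfinite T b θ).SInd (aBar T b θ) (aBarRep T b θ lam)

/-- The action of `𝔤̂` on `W(λ)`. -/
def actWakimoto (X : AffineLie T θ) : Module.End ℂ (WakimotoModule T b θ lam) :=
  (affineSemiInfinite T b θ).actSInd _ _ X

variable {T b θ} in
/-- The Verma module `V(λ) = Ind_{𝔤̂₊ ⊕ 𝔤̂₀}^{𝔤̂} ℂ_λ`. -/
abbrev VermaModule (hθ : IsHighest T b θ) : Type _ :=
  Ind (affineBorel T b θ) (borelRep lam hθ)

variable {T b θ} in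
/-- The contragredient Verma module `V^*(λ) = Coind_{𝔤̂₋}^{𝔤̂} ℂ_λ`. -/
def ContragredientVermaModule (hθ : IsHighest T b θ) : Type _ :=
  Coind (affineMinus T b θ) (minusRep lam hθ) (affineSemiInfinite T b θ)

instance (hθ : IsHighest T b θ) : AddCommGroup (ContragredientVermaModule lam hθ) :=
  inferInstanceAs (AddCommGroup (Coind (affineMinus T b θ) (minusRep lam hθ)
    (affineSemiInfinite T b θ)))

instance (hθ : IsHighest T b θ) : Module ℂ (ContragredientVermaModule lam hθ) :=
  inferInstanceAs (Module ℂ (Coind (affineMinus T b θ) (minusRep lam hθ)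
    (affineSemiInfinite T b θ)))

variable {T b θ} in
/-- The action of `𝔤̂` on `V(λ)`. -/
def actVerma (hθ : IsHighest T b θ) (X : AffineLie T θ) : Module.End ℂ (VermaModule lam hθ) :=
  actInd _ _ X

variable {T b θ} in
/-- The action of `𝔤̂` on `V^*(λ)`. -/
def actContragredientVerma (hθ : IsHighest T b θ) (X : AffineLie T θ) :
    Module.End ℂ (ContragredientVermaModule lam hθ) :=
  actCoind (affineMinus T b θ) (minusRep lam hθ) (affineSemiInfinite T b θ) X

section Weights

variable {V : Type*} [AddCommGroup V] [Module ℂ V] (act : AffineLie T θ → Module.End ℂ V)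

/-- The weight space `V_μ`, `μ ∈ 𝔤̂₀^*`, for an action of `𝔤̂` on `V`. -/
def wtSpace (μ : Module.Dual ℂ (T × ℂ × ℂ)) : Submodule ℂ V :=
  ⨅ h : T × ℂ × ℂ, LinearMap.ker (act (cartan T θ h) - μ h • LinearMap.id)

/-- The formal character `ch V = ∑_μ dim V_μ e^μ`, as the function `μ ↦ dim V_μ`. -/
def formalCharacter (μ : Module.Dual ℂ (T × ℂ × ℂ)) : ℕ := Module.finrank ℂ (wtSpace T θ act μ)

/-- The root space `𝔤̂_γ`. -/
def affineRootSpace (γ : Module.Dual ℂ (T × ℂ × ℂ)) : Submodule ℂ (AffineLie T θ) :=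
  wtSpace T θ (fun X => LieAlgebra.ad ℂ (AffineLie T θ) X) γ

/-- The simple roots of `𝔤̂`: the simple roots `α_i` of `𝔤`, and `α_0 = δ - θ`. -/
def simpleRoot : Option b.support → Module.Dual ℂ (T × ℂ × ℂ)
  | some i => (i.1 : Weight ℂ T 𝔤).toLinear ∘ₗ LinearMap.fst ℂ T (ℂ × ℂ)
  | none => LinearMap.snd ℂ ℂ ℂ ∘ₗ LinearMap.snd ℂ T (ℂ × ℂ) -
      (θ : Weight ℂ T 𝔤).toLinear ∘ₗ LinearMap.fst ℂ T (ℂ × ℂ)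

/-- The element `∑ m_i α_i` of the positive cone of the root lattice. -/
def latticePt (m : Option b.support →₀ ℕ) : Module.Dual ℂ (T × ℂ × ℂ) :=
  m.sum fun i k => k • simpleRoot T b θ i

/-- The set `Δ₊` of positive roots of `𝔤̂`, each given by its coordinates with respect to the simple
roots. -/
def PosRoot : Type _ :=
  {m : Option b.support →₀ ℕ // m ≠ 0 ∧ affineRootSpace T θ (latticePt T b θ m) ≠ ⊥}

/-- The factor `(1 - e^{-α})^{-mult α}`, a formal power series in the variables `e^{-α_i}`. -/
def rootFactor (α : PosRoot T b θ) : MvPowerSeries (Option b.support) ℤ :=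
  MvPowerSeries.invOfUnit (1 - MvPowerSeries.monomial α.1 1) 1 ^
    Module.finrank ℂ (affineRootSpace T θ (latticePt T b θ α.1))

open scoped MvPowerSeries.WithPiTopology in
/-- `F` is the (convergent) infinite product `∏_{α ∈ Δ₊} (1 - e^{-α})^{-mult α}`. -/
def IsRootProduct (F : MvPowerSeries (Option b.support) ℤ) : Prop :=
  HasProd (rootFactor T b θ) F

/-- The weight spaces of `V` are finite-dimensional and `ch V = e^λ F`, for a formal power series
`F` in the variables `e^{-α_i}`. -/
structure CharacterEq (F : MvPowerSeries (Option b.support) ℤ) : Prop where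
  finite : ∀ μ, Module.Finite ℂ (wtSpace T θ act μ)
  coeff_eq : ∀ m, (formalCharacter T θ act (lam - latticePt T b θ m) : ℤ) = MvPowerSeries.coeff m F
  eq_zero : ∀ μ, (∀ m, μ ≠ lam - latticePt T b θ m) → formalCharacter T θ act μ = 0

end Weights

/-- The ordered monomial `∏ e_i^{n_i}` in `U(L)`. -/
def pbwMonomial {L : Type*} [LieRing L] [LieAlgebra ℂ L] {ι : Type*} [LinearOrder ι]
    (e : ι → L) (n : ι →₀ ℕ) : U L :=
  ((n.support.sort (· ≤ ·)).map fun i => toU (e i) ^ n i).prod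

/-- The element `v` of `W(λ)` is the vector `(∏ x_i^{n_i})^* ⊗ ∏ y_j^{l_j} ⊗ w_λ`: it is the class
of `f ⊗ w_λ`, where `f` is an `𝔤̂₋`-invariant element of `Hom(U(𝔤̂), U(𝔤̂))` that maps `U(𝔤̂₊)` to
`U(𝔞₋)` and whose restriction to `U(𝔞₊)` is `(∏ x_i^{n_i})^* ⊗ ∏ y_j^{l_j}`, where `(∏ x_i^{n_i})^*`
is the element of `U(𝔞₊)^*` dual to the monomial `∏ x_i^{n_i}`. -/
def IsBasisVector {ι κ : Type*} [LinearOrder ι] [LinearOrder κ]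
    (x : ι → AffineLie T θ) (y : κ → AffineLie T θ) (n : ι →₀ ℕ) (l : κ →₀ ℕ)
    (v : WakimotoModule T b θ lam) : Prop :=
  ∃ f : (affineSemiInfinite T b θ).preUS,
    (∀ u ∈ subU (affineSemiInfinite T b θ).plus, f.1.1 u ∈ subU (aMinus T b θ)) ∧
    f.1.1 (pbwMonomial x n) = pbwMonomial y l ∧
    (∀ n', n' ≠ n → f.1.1 (pbwMonomial x n') = 0) ∧
    v.1 = Submodule.Quotient.mk ((affineSemiInfinite T b θ).mkUS f ⊗ₜ[ℂ] (1 : ℂ))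

end Wakimoto

end Affine

end Wakimoto

end

/-!
Everything is deduced from a description of the bimodule `US` that only involves enveloping algebras,
together with the verification of its hypotheses for `𝔤̂`.

Let `L` be graded with `P = L₊`, `M = L₋`, so that `U(L) = U(P) ⊗ U(M)` by the
Poincaré-Birkhoff-Witt theorem (`pbwBasis`, `mulEquiv`). For `f` in `Hom(U(L), U(L))` let `Psi f u`
be the partial trace over `U(P)` of `p ↦ f(u S(p))`, with `S` the antipode. As partial traces are
cyclic, `Psi` kills the boundaries of `L₊` (`Psi_diagAct`), and on maps with values in `U(M)` it
does nothing (`Psi_of_range`). Every `f` is congruent modulo boundaries to a map of the latter kind,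
by a Neumann series that is finite at each argument because `f` vanishes in large degrees
(`exists_boundary`); hence the kernel of `Psi` is exactly the space of boundaries. On the invariants
of `L₋` the map `Psi f` is equivariant for `M` (`TriangularFrame.equivariant`) and so is determined by
its restriction to `U(P)`. This makes `US` isomorphic to the space of maps `U(P) → U(M)` that vanish
in large degrees (`Phi_injective`, `Phi_lift`). Equivariance is where `β` enters. It is only needed
for generators of `M`: it is formal for elements of degree `0`, and for a Chevalley generator `y` of
degree `-1` with `[y, L₁] ⊆ ℂ h` exchanging two operators under the trace produces the term
`β(h)`, which cancels against `[h, y] = -β(h) y`.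

For a graded subalgebra `H = H₊ ⊕ H₋` with graded complements `𝔞₊ ⊕ H₊ = L₊`, `𝔞₋ ⊕ H₋ = L₋` and a
character of `H`, restriction to `U(𝔞₊)` and projection to `U(𝔞₋)` identify the semi-induced module
with the maps `U(𝔞₊) → U(𝔞₋)` that vanish in large degrees (`SemiInductionFrame.resEquiv`).
Surjectivity holds because translates of the functional dual to a basis vector of `U(𝔞₊)` have, up to
terms of lower order, arbitrary values (`exists_res_sub_mem`). Injectivity is an induction on the
degree, in which the invariance under `x ∈ H₊` is evaluated by a second partial trace, over `H₊`
(`q_eq_zero`). The functionals `(∏ x_i^{n_i})^* ⊗ ∏ y_j^{l_j}` are a basis of that space of maps, and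
`exists_rep_iff` identifies the representatives that define them.

For `𝔤̂` the hypotheses amount to generation of `𝔤̂₊` and `𝔤̂₋` in degrees `1` and `-1`, which follows
from the fact that a simple Lie algebra is spanned by the brackets with simple root vectors and with a
lowest root vector (`HeightFunction.mem_span_lie`), and to `β(α_i^∨) = 2` for `i = 0, …, r`
(`IsHighest.chevalley`), which for `i = 0` is the normalization `β(K) = 2h^∨`.

Finally, the weights of `𝔞₋` are the negatives of the positive roots that are not accounted for by
`𝔞₊` (`exists_index_equiv`). So `W(λ)`, `V(λ)` and `V^*(λ)` all have a basis of weight vectors indexed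
by the families of multiplicities on a basis of `𝔤̂₊`, of weight `λ` minus the sum of the roots
(`characterEq_of_basis`), and the generating function of these families is the product over the
positive roots (`isRootProduct_partitionSeries`).
-/

/-! ### The Poincaré-Birkhoff-Witt theorem -/

noncomputable section

namespace Wakimoto

section PBW

set_option linter.unusedSectionVars false

theorem basis_induction {V I : Type*} [AddCommGroup V] [Module ℂ V] (e : Module.Basis I ℂ V)
    {p : V → Prop} (x : V) (zero : p 0) (add : ∀ a b, p a → p b → p (a + b))
    (smul : ∀ (c : ℂ) a, p a → p (c • a)) (basis : ∀ i, p (e i)) : p x := by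
  have hx : x ∈ Submodule.span ℂ (Set.range e) := e.span_eq ▸ Submodule.mem_top
  induction hx using Submodule.span_induction with
  | zero => exact zero
  | add a b _ _ ha hb => exact add a b ha hb
  | smul c a _ ha => exact smul c a ha
  | mem x hx => obtain ⟨i, rfl⟩ := hx; exact basis i

attribute [local instance 100] LieRing.ofAssociativeRing

variable {L : Type*} [LieRing L] [LieAlgebra ℂ L] {I : Type*} [LinearOrder I]

/-- The truncated action of a Lie algebra with ordered basis `e` on the free module on multisets of
indices (a copy of its symmetric algebra): `pbwAct e n` is the action on multisets with at most `n`
elements. The action of `e i` on a multiset with least element `j < i` is the one that is forced by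
`e i · e j = e j · e i + ⁅e i, e j⁆`. -/
def pbwAct (e : Module.Basis I ℂ L) : ℕ → L →ₗ[ℂ] Module.End ℂ (Multiset I →₀ ℂ)
  | 0 => e.constr ℂ fun i => Finsupp.linearCombination ℂ fun M => Finsupp.single (i ::ₘ M) 1
  | n + 1 => e.constr ℂ fun i => Finsupp.linearCombination ℂ fun M =>
      if M.card ≤ n then pbwAct e n (e i) (Finsupp.single M 1) else
        match M.sort (· ≤ ·) with
        | [] => Finsupp.single (i ::ₘ M) 1
        | j :: l => if i ≤ j then Finsupp.single (i ::ₘ M) 1 else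
            Finsupp.single (i ::ₘ M) 1
              + pbwAct e n (e j) (pbwAct e n (e i) (Finsupp.single (l : Multiset I) 1)
                - Finsupp.single (i ::ₘ (l : Multiset I)) 1)
              + pbwAct e n ⁅e i, e j⁆ (Finsupp.single (l : Multiset I) 1)

/-- The span of the multisets with at most `n` elements. -/
def multisetFil (I : Type*) (n : ℕ) : Submodule ℂ (Multiset I →₀ ℂ) :=
  Submodule.span ℂ {v | ∃ M : Multiset I, M.card ≤ n ∧ v = Finsupp.single M 1}

theorem single_mem_multisetFil {n : ℕ} {M : Multiset I} (h : M.card ≤ n) :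
    Finsupp.single M 1 ∈ multisetFil I n := Submodule.subset_span ⟨M, h, rfl⟩

theorem multisetFil_mono {m n : ℕ} (h : m ≤ n) : multisetFil I m ≤ multisetFil I n :=
  Submodule.span_mono fun _ ⟨M, hM, hv⟩ => ⟨M, hM.trans h, hv⟩

variable (e : Module.Basis I ℂ L)

theorem pbwAct_zero_single (i : I) (M : Multiset I) :
    pbwAct e 0 (e i) (Finsupp.single M 1) = Finsupp.single (i ::ₘ M) 1 := by
  rw [pbwAct, e.constr_basis, Finsupp.linearCombination_single, one_smul]

theorem pbwAct_succ_of_le (n : ℕ) (x : L) {v : Multiset I →₀ ℂ} (hv : v ∈ multisetFil I n) :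
    pbwAct e (n + 1) x v = pbwAct e n x v := by
  induction hv using Submodule.span_induction with
  | zero => simp
  | add a b _ _ ha hb => rw [map_add, map_add, ha, hb]
  | smul c a _ ha => rw [map_smul, map_smul, ha]
  | mem v hv =>
    obtain ⟨M, hM, rfl⟩ := hv
    have : ((pbwAct e (n + 1)).flip (Finsupp.single M 1)) =
        ((pbwAct e n).flip (Finsupp.single M 1)) := by
      refine e.ext fun i => ?_
      rw [LinearMap.flip_apply, LinearMap.flip_apply, pbwAct, e.constr_basis,
        Finsupp.linearCombination_single, one_smul, if_pos hM]
    exact LinearMap.congr_fun this x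

theorem pbwAct_of_le {m n : ℕ} (h : m ≤ n) (x : L) {v : Multiset I →₀ ℂ}
    (hv : v ∈ multisetFil I m) : pbwAct e n x v = pbwAct e m x v := by
  induction n, h using Nat.le_induction with
  | base => rfl
  | succ n hn ih => rw [pbwAct_succ_of_le e n x (multisetFil_mono hn hv), ih]

/-- The action of a Lie algebra with ordered basis on the free module on multisets. -/
def pbwRep : L →ₗ[ℂ] Module.End ℂ (Multiset I →₀ ℂ) :=
  e.constr ℂ fun i => Finsupp.linearCombination ℂ fun M =>
    pbwAct e M.card (e i) (Finsupp.single M 1)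

theorem pbwRep_eq (n : ℕ) (x : L) {v : Multiset I →₀ ℂ} (hv : v ∈ multisetFil I n) :
    pbwRep e x v = pbwAct e n x v := by
  induction hv using Submodule.span_induction with
  | zero => simp
  | add a b _ _ ha hb => rw [map_add, map_add, ha, hb]
  | smul c a _ ha => rw [map_smul, map_smul, ha]
  | mem v hv =>
    obtain ⟨M, hM, rfl⟩ := hv
    have : ((pbwRep e).flip (Finsupp.single M 1)) = ((pbwAct e n).flip (Finsupp.single M 1)) := by
      refine e.ext fun i => ?_
      rw [LinearMap.flip_apply, LinearMap.flip_apply, pbwRep, e.constr_basis,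
        Finsupp.linearCombination_single, one_smul,
        pbwAct_of_le e hM _ (single_mem_multisetFil le_rfl)]
    exact LinearMap.congr_fun this x

theorem pbwAct_succ_single (n : ℕ) (i : I) (M : Multiset I) :
    pbwAct e (n + 1) (e i) (Finsupp.single M 1) =
      if M.card ≤ n then pbwAct e n (e i) (Finsupp.single M 1) else
        match M.sort (· ≤ ·) with
        | [] => Finsupp.single (i ::ₘ M) 1
        | j :: l => if i ≤ j then Finsupp.single (i ::ₘ M) 1 else
            Finsupp.single (i ::ₘ M) 1
              + pbwAct e n (e j) (pbwAct e n (e i) (Finsupp.single (l : Multiset I) 1)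
                - Finsupp.single (i ::ₘ (l : Multiset I)) 1)
              + pbwAct e n ⁅e i, e j⁆ (Finsupp.single (l : Multiset I) 1) := by
  rw [pbwAct, e.constr_basis, Finsupp.linearCombination_single, one_smul]

theorem exists_min_cons {M : Multiset I} (h : M ≠ 0) :
    ∃ j N, M = j ::ₘ N ∧ (∀ k ∈ N, j ≤ k) ∧ M.sort (· ≤ ·) = j :: N.sort (· ≤ ·) := by
  have h1 := Multiset.sort_eq M (· ≤ ·)
  have h2 := Multiset.pairwise_sort M (· ≤ ·)
  rcases hl : M.sort (· ≤ ·) with _ | ⟨j, l⟩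
  · rw [hl] at h1; exact absurd h1.symm h
  · rw [hl] at h1 h2
    have h3 : ∀ k ∈ (l : Multiset I), j ≤ k := fun k hk => (List.pairwise_cons.1 h2).1 k hk
    refine ⟨j, l, h1.symm, h3, ?_⟩
    rw [← hl, ← h1]
    exact Multiset.sort_cons _ _ _ h3

theorem pbwRep_of_min {i : I} {M : Multiset I} (h : ∀ j ∈ M, i ≤ j) :
    pbwRep e (e i) (Finsupp.single M 1) = Finsupp.single (i ::ₘ M) 1 := by
  rw [pbwRep_eq e M.card _ (single_mem_multisetFil le_rfl)]
  rcases hn : M.card with _ | n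
  · exact pbwAct_zero_single e i M
  · rw [pbwAct_succ_single, if_neg (by omega)]
    have hM : M ≠ 0 := by rintro rfl; simp at hn
    obtain ⟨j, N, rfl, -, hs⟩ := exists_min_cons hM
    rw [hs]
    simp only
    rw [if_pos (h j (by simp))]

/-- The action of `e i` agrees with adding the index `i`, up to multisets with fewer elements. -/
theorem pbwAct_mem (n : ℕ) (x : L) {m : ℕ} (hm : m ≤ n) {v : Multiset I →₀ ℂ}
    (hv : v ∈ multisetFil I m) : pbwAct e n x v ∈ multisetFil I (m + 1) ∧
      ∀ i M, M.card ≤ n → pbwAct e n (e i) (Finsupp.single M 1) - Finsupp.single (i ::ₘ M) 1 ∈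
        multisetFil I M.card := by
  -- the second statement implies the first one
  have key : ∀ n, (∀ i (M : Multiset I), M.card ≤ n →
      pbwAct e n (e i) (Finsupp.single M 1) - Finsupp.single (i ::ₘ M) 1 ∈ multisetFil I M.card) →
      ∀ m ≤ n, ∀ (x : L), ∀ v ∈ multisetFil I m, pbwAct e n x v ∈ multisetFil I (m + 1) := by
    intro n h m hm x v hv
    induction hv using Submodule.span_induction with
    | zero => simp
    | add a b _ _ ha hb => rw [map_add]; exact add_mem ha hb
    | smul c a _ ha => rw [map_smul]; exact Submodule.smul_mem _ _ ha
    | mem v hv =>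
      obtain ⟨M, hM, rfl⟩ := hv
      induction x using basis_induction e with
      | zero => simp
      | add a b ha hb => rw [map_add]; exact add_mem ha hb
      | smul c a ha => rw [map_smul]; exact Submodule.smul_mem _ _ ha
      | basis i =>
        have := add_mem (multisetFil_mono (show M.card ≤ m + 1 by omega) (h i M (hM.trans hm)))
          (single_mem_multisetFil (show (i ::ₘ M).card ≤ m + 1 by simpa using hM))
        rwa [sub_add_cancel] at this
  have main : ∀ n, (∀ i (M : Multiset I), M.card ≤ n →
      pbwAct e n (e i) (Finsupp.single M 1) - Finsupp.single (i ::ₘ M) 1 ∈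
        multisetFil I M.card) := by
    intro n
    induction n with
    | zero => intro i M _; rw [pbwAct_zero_single, sub_self]; exact zero_mem _
    | succ n ih =>
      intro i M hM
      rw [pbwAct_succ_single]
      split_ifs with h
      · exact ih i M h
      · have hM0 : M ≠ 0 := by rintro rfl; simp at h
        obtain ⟨j, N, rfl, -, hs⟩ := exists_min_cons hM0
        rw [Multiset.card_cons] at h hM
        have hN : N.card = n := by omega
        rw [hs]
        simp only [Multiset.sort_eq]
        split_ifs
        · rw [sub_self]; exact zero_mem _
        · rw [add_assoc, add_sub_cancel_left, Multiset.card_cons]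
          exact add_mem (key n ih _ hN.le _ _ (ih i N hN.le))
            (key n ih _ hN.le _ _ (single_mem_multisetFil le_rfl))
  exact ⟨key n (main n) m hm x v hv, main n⟩

theorem pbwRep_sub_mem (i : I) (M : Multiset I) :
    pbwRep e (e i) (Finsupp.single M 1) - Finsupp.single (i ::ₘ M) 1 ∈ multisetFil I M.card := by
  rw [pbwRep_eq e M.card _ (single_mem_multisetFil le_rfl)]
  exact (pbwAct_mem e M.card (e i) le_rfl (single_mem_multisetFil le_rfl)).2 i M le_rfl

/-- The commutation relation where it holds by construction. -/
theorem pbwRep_lie_of_min {i j : I} {N : Multiset I} (hj : ∀ k ∈ N, j ≤ k) (hij : j < i) :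
    pbwRep e (e i) (pbwRep e (e j) (Finsupp.single N 1)) =
      pbwRep e (e j) (pbwRep e (e i) (Finsupp.single N 1)) +
        pbwRep e ⁅e i, e j⁆ (Finsupp.single N 1) := by
  have hw := pbwRep_sub_mem e i N
  have h1 : pbwRep e (e j) (Finsupp.single (i ::ₘ N) 1) = Finsupp.single (j ::ₘ i ::ₘ N) 1 :=
    pbwRep_of_min e fun k hk => by
      rcases Multiset.mem_cons.1 hk with rfl | hk
      · exact hij.le
      · exact hj k hk
  rw [pbwRep_of_min e hj, pbwRep_eq e (N.card + 1) _ (single_mem_multisetFil (by simp)),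
    pbwAct_succ_single, if_neg (by simp), Multiset.sort_cons _ _ _ hj]
  simp only [Multiset.sort_eq]
  rw [if_neg (not_le.2 hij)]
  rw [← pbwRep_eq e N.card (e i) (single_mem_multisetFil le_rfl),
    ← pbwRep_eq e N.card ⁅e i, e j⁆ (single_mem_multisetFil le_rfl), ← pbwRep_eq e N.card (e j) hw,
    map_sub, h1, Multiset.cons_swap]
  abel

/-- By induction on the number of factors: the action of `e i` and `e j` on `k ::ₘ P`, with `k`
smaller than all other indices, is reduced to the action on smaller multisets, and the Jacobi
identity matches the results. -/
theorem pbwRep_lie_aux (n : ℕ) : ∀ (x y : L), ∀ v ∈ multisetFil I n,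
    pbwRep e x (pbwRep e y v) - pbwRep e y (pbwRep e x v) = pbwRep e ⁅x, y⁆ v := by
  induction n using Nat.strong_induction_on with
  | _ n ih =>
  intro x y v hv
  induction hv using Submodule.span_induction with
  | zero => simp
  | add a b _ _ ha hb => simp only [map_add, ← ha, ← hb]; abel
  | smul c a _ ha => simp only [map_smul, ← ha, smul_sub]
  | mem v hv =>
    obtain ⟨N, hN, rfl⟩ := hv
    induction x using basis_induction e with
    | zero => simp
    | add a b ha hb => simp only [map_add, add_lie, LinearMap.add_apply, ← ha, ← hb]; abel
    | smul c a ha => simp only [map_smul, smul_lie, LinearMap.smul_apply, ← ha, smul_sub]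
    | basis i =>
    induction y using basis_induction e with
    | zero => simp
    | add a b ha hb => simp only [map_add, lie_add, LinearMap.add_apply, ← ha, ← hb]; abel
    | smul c a ha => simp only [map_smul, lie_smul, LinearMap.smul_apply, ← ha, smul_sub]
    | basis j =>
    -- the cases where one of the two indices is minimal
    have hmin : ∀ i j : I, (∀ k ∈ N, j ≤ k) → j ≤ i →
        pbwRep e (e i) (pbwRep e (e j) (Finsupp.single N 1)) -
          pbwRep e (e j) (pbwRep e (e i) (Finsupp.single N 1)) =
        pbwRep e ⁅e i, e j⁆ (Finsupp.single N 1) := by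
      intro i j h hij
      rcases hij.eq_or_lt with rfl | hij
      · simp
      · rw [pbwRep_lie_of_min e h hij]; abel
    by_cases hi : ∀ k ∈ N, i ≤ k
    · by_cases hj : ∀ k ∈ N, j ≤ k
      · rcases le_total j i with h | h
        · exact hmin i j hj h
        · rw [← neg_inj, neg_sub, hmin j i hi h, ← lie_skew, map_neg, LinearMap.neg_apply]
      · push Not at hj
        obtain ⟨k, hk, hkj⟩ := hj
        rw [← neg_inj, neg_sub, hmin j i hi ((hi k hk).trans hkj.le), ← lie_skew, map_neg,
          LinearMap.neg_apply]
    by_cases hj : ∀ k ∈ N, j ≤ k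
    · push Not at hi
      obtain ⟨k, hk, hki⟩ := hi
      exact hmin i j hj ((hj k hk).trans hki.le)
    -- the overlap, resolved by the Jacobi identity
    have hN0 : N ≠ 0 := by rintro rfl; simp at hi
    obtain ⟨k, P, rfl, hkP, -⟩ := exists_min_cons hN0
    have hki : k < i := by
      by_contra h
      exact hi fun m hm => (not_lt.1 h).trans (by
        rcases Multiset.mem_cons.1 hm with rfl | hm
        exacts [le_rfl, hkP m hm])
    have hkj : k < j := by
      by_contra h
      exact hj fun m hm => (not_lt.1 h).trans (by
        rcases Multiset.mem_cons.1 hm with rfl | hm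
        exacts [le_rfl, hkP m hm])
    rw [Multiset.card_cons] at hN
    have hP := single_mem_multisetFil (M := P) le_rfl
    have IH := fun x y => ih P.card (by omega) x y
    have hz : Finsupp.single (k ::ₘ P) 1 = pbwRep e (e k) (Finsupp.single P 1) :=
      (pbwRep_of_min e hkP).symm
    have half : ∀ i j : I, k < i → k < j →
        pbwRep e (e i) (pbwRep e (e j) (Finsupp.single (k ::ₘ P) 1)) =
          pbwRep e (e k) (pbwRep e (e i) (pbwRep e (e j) (Finsupp.single P 1))) +
          pbwRep e ⁅e i, e k⁆ (pbwRep e (e j) (Finsupp.single P 1)) +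
          pbwRep e ⁅e j, e k⁆ (pbwRep e (e i) (Finsupp.single P 1)) +
          pbwRep e ⁅e i, ⁅e j, e k⁆⁆ (Finsupp.single P 1) := by
      intro i j hki hkj
      have h1 := IH (e j) (e k) _ hP
      have h2 := IH (e i) ⁅e j, e k⁆ _ hP
      have h3 := pbwRep_sub_mem e j P
      have h4 := IH (e i) (e k) _ h3
      have h5 := pbwRep_lie_of_min e (i := i) (j := k) (N := j ::ₘ P) (fun m hm => by
        rcases Multiset.mem_cons.1 hm with rfl | hm
        exacts [hkj.le, hkP m hm]) hki
      simp only [map_sub] at h4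
      rw [hz, ← h2, eq_add_of_sub_eq h1, map_add]
      have h6 : pbwRep e (e i) (pbwRep e (e k) (pbwRep e (e j) (Finsupp.single P 1))) =
          pbwRep e (e k) (pbwRep e (e i) (pbwRep e (e j) (Finsupp.single P 1))) +
          pbwRep e ⁅e i, e k⁆ (pbwRep e (e j) (Finsupp.single P 1)) := by
        rw [h5] at h4
        rw [← sub_eq_zero] at h4 ⊢
        rw [← h4]
        abel
      rw [h6]
      abel
    rw [half i j hki hkj, half j i hkj hki]
    have h7 := IH (e k) ⁅e i, e j⁆ _ hP
    have h8 := IH (e i) (e j) _ hP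
    rw [hz]
    have h9 : pbwRep e ⁅e i, e j⁆ (pbwRep e (e k) (Finsupp.single P 1)) =
        pbwRep e (e k) (pbwRep e ⁅e i, e j⁆ (Finsupp.single P 1)) -
        pbwRep e ⁅e k, ⁅e i, e j⁆⁆ (Finsupp.single P 1) := by rw [← h7]; abel
    have h10 : ⁅e k, ⁅e i, e j⁆⁆ = ⁅e j, ⁅e i, e k⁆⁆ - ⁅e i, ⁅e j, e k⁆⁆ := by
      rw [leibniz_lie (e k), ← lie_skew (e i) (e k), ← lie_skew (e j) (e k), lie_neg, lie_neg,
        lie_skew, sub_neg_eq_add]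
    rw [h9, h10, ← h8, map_sub, map_sub, LinearMap.sub_apply]
    abel

/-- The relations of the Lie algebra hold in the module on multisets. -/
theorem pbwRep_lie (x y : L) : pbwRep e ⁅x, y⁆ = ⁅pbwRep e x, pbwRep e y⁆ := by
  refine Finsupp.lhom_ext fun M c => ?_
  rw [← mul_one c, ← smul_eq_mul, ← Finsupp.smul_single, map_smul, map_smul,
    ← pbwRep_lie_aux e M.card x y _ (single_mem_multisetFil le_rfl)]
  rfl

/-- The action of the universal enveloping algebra on the free module on multisets. -/
def pbwRepU : U L →ₐ[ℂ] Module.End ℂ (Multiset I →₀ ℂ) :=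
  UniversalEnvelopingAlgebra.lift ℂ
    ({ pbwRep e with map_lie' := fun {x y} => pbwRep_lie e x y } : L →ₗ⁅ℂ⁆ _)

theorem pbwRepU_toU (x : L) : pbwRepU e (toU x) = pbwRep e x :=
  UniversalEnvelopingAlgebra.lift_ι_apply ℂ _ x

/-- The ordered monomial of a multiset of indices. -/
def multisetMonomial (e : I → L) (M : Multiset I) : U L :=
  ((M.sort (· ≤ ·)).map fun i => toU (e i)).prod

theorem multisetMonomial_cons (e : I → L) {i : I} {M : Multiset I} (h : ∀ j ∈ M, i ≤ j) :
    multisetMonomial e (i ::ₘ M) = toU (e i) * multisetMonomial e M := by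
  rw [multisetMonomial, Multiset.sort_cons _ _ _ h, List.map_cons, List.prod_cons]
  rfl

/-- An ordered monomial maps the empty multiset to the multiset of its indices; this gives the
linear independence of the ordered monomials. -/
theorem pbwRepU_multisetMonomial (M : Multiset I) :
    pbwRepU e (multisetMonomial e M) (Finsupp.single 0 1) = Finsupp.single M 1 := by
  induction hn : M.card generalizing M with
  | zero => rw [Multiset.card_eq_zero.1 hn]; simp [multisetMonomial]
  | succ n ih =>
    have hM0 : M ≠ 0 := by rintro rfl; simp at hn
    obtain ⟨j, N, rfl, hj, -⟩ := exists_min_cons hM0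
    rw [multisetMonomial_cons _ hj, map_mul, Module.End.mul_apply, ih N (by simpa using hn),
      pbwRepU_toU, pbwRep_of_min e hj]

theorem multisetMonomial_linearIndependent :
    LinearIndependent ℂ (multisetMonomial (e : I → L)) := by
  refine LinearIndependent.of_comp
    ((LinearMap.applyₗ (Finsupp.single 0 1)) ∘ₗ (pbwRepU e).toLinearMap) ?_
  have : (((LinearMap.applyₗ (Finsupp.single 0 1)) ∘ₗ (pbwRepU e).toLinearMap) ∘
      multisetMonomial (e : I → L)) = fun M : Multiset I => Finsupp.single M (1 : ℂ) :=
    funext fun M => pbwRepU_multisetMonomial e M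
  rw [this]
  exact Finsupp.linearIndependent_single_one ℂ _

theorem multisetMonomial_toMultiset (e : I → L) (n : I →₀ ℕ) :
    multisetMonomial e (Finsupp.toMultiset n) = pbwMonomial e n := by
  have h : (Finsupp.toMultiset n).sort (· ≤ ·) =
      (n.support.sort (· ≤ ·)).flatMap fun i => List.replicate (n i) i := by
    refine List.Perm.eq_of_pairwise' (r := (· ≤ ·)) ?_ ?_ ?_
    · exact Multiset.pairwise_sort _ _
    · have h1 := Finset.pairwise_sort n.support (· ≤ ·)
      generalize n.support.sort (· ≤ ·) = l at h1
      induction l with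
      | nil => simp
      | cons a l ih =>
        rw [List.flatMap_cons, List.pairwise_append]
        rw [List.pairwise_cons] at h1
        refine ⟨List.pairwise_replicate.2 (Or.inr le_rfl), ih h1.2, fun x hx y hy => ?_⟩
        obtain ⟨b, hb, hy⟩ := List.mem_flatMap.1 hy
        rw [List.eq_of_mem_replicate hx, List.eq_of_mem_replicate hy]
        exact h1.1 b hb
    · rw [← Multiset.coe_eq_coe, Multiset.sort_eq, Finsupp.toMultiset_apply, Finsupp.sum,
        Finset.sum, ← Finset.sort_eq n.support (· ≤ ·)]
      generalize n.support.sort (· ≤ ·) = l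
      induction l with
      | nil => simp
      | cons a l ih =>
        rw [List.flatMap_cons, ← Multiset.coe_add, ← ih, Multiset.coe_replicate]
        simp [Multiset.nsmul_singleton]
  rw [multisetMonomial, h, pbwMonomial]
  generalize n.support.sort (· ≤ ·) = l
  induction l with
  | nil => simp
  | cons a l ih => simp [ih]

section Graded

variable {Γ : Type*} [AddCommMonoid Γ] (deg : I → Γ)

/-- The span of the ordered monomials of degree `γ` with at most `n` factors. -/
def monomialFil (e : I → L) (deg : I → Γ) (γ : Γ) (n : ℕ) : Submodule ℂ (U L) :=
  Submodule.span ℂ {u | ∃ M : Multiset I, (M.map deg).sum = γ ∧ M.card ≤ n ∧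
    u = multisetMonomial e M}

theorem monomialFil_mono (e : I → L) (γ : Γ) {m n : ℕ} (h : m ≤ n) :
    monomialFil e deg γ m ≤ monomialFil e deg γ n :=
  Submodule.span_mono fun _ ⟨M, h1, h2, h3⟩ => ⟨M, h1, h2.trans h, h3⟩

theorem mem_monomialFil (e : I → L) {M : Multiset I} {n : ℕ} (h : M.card ≤ n) {γ : Γ}
    (hγ : (M.map deg).sum = γ) : multisetMonomial e M ∈ monomialFil e deg γ n :=
  Submodule.subset_span ⟨M, hγ, h, rfl⟩

theorem toU_mul_multisetMonomial
    (hdeg : ∀ i j, ⁅e i, e j⁆ ∈ Submodule.span ℂ (e '' {k | deg k = deg i + deg j}))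
    (n : ℕ) : ∀ (i : I) (M : Multiset I), M.card ≤ n →
    toU (e i) * multisetMonomial e M - multisetMonomial e (i ::ₘ M) ∈
      monomialFil e deg (deg i + (M.map deg).sum) M.card := by
  induction n with
  | zero =>
    intro i M hM
    have : M = 0 := Multiset.card_eq_zero.1 (by omega)
    rw [multisetMonomial_cons e (by simp [this]), sub_self]
    exact zero_mem _
  | succ n ih =>
    intro i M hM
    by_cases hi : ∀ j ∈ M, i ≤ j
    · rw [multisetMonomial_cons _ hi, sub_self]; exact zero_mem _
    have hM0 : M ≠ 0 := by rintro rfl; simp at hi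
    obtain ⟨j, N, rfl, hj, -⟩ := exists_min_cons hM0
    have hji : j < i := by
      by_contra h
      exact hi fun m hm => (not_lt.1 h).trans (by
        rcases Multiset.mem_cons.1 hm with rfl | hm
        exacts [le_rfl, hj m hm])
    rw [Multiset.card_cons] at hM
    have ih2 : ∀ (i : I) (γ : Γ) (m : ℕ), m ≤ n → ∀ v ∈ monomialFil e deg γ m,
        toU (e i) * v ∈ monomialFil e deg (deg i + γ) (m + 1) := by
      intro i γ m hm v hv
      induction hv using Submodule.span_induction with
      | zero => rw [mul_zero]; exact zero_mem _
      | add a b _ _ ha hb => rw [mul_add]; exact add_mem ha hb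
      | smul c a _ ha => rw [mul_smul_comm]; exact Submodule.smul_mem _ _ ha
      | mem v hv =>
        obtain ⟨M, rfl, hM, rfl⟩ := hv
        have := add_mem (monomialFil_mono deg e _ (show M.card ≤ m + 1 by omega)
          (ih i M (hM.trans hm)))
          (mem_monomialFil deg e (show (i ::ₘ M).card ≤ m + 1 by simpa using hM) (by simp))
        rwa [sub_add_cancel] at this
    have h1 : toU (e i) * multisetMonomial e (j ::ₘ N) =
        toU (e j) * (toU (e i) * multisetMonomial e N) + toU ⁅e i, e j⁆ * multisetMonomial e N := by
      have : toU ⁅e i, e j⁆ = toU (e i) * toU (e j) - toU (e j) * toU (e i) :=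
        LieHom.map_lie (UniversalEnvelopingAlgebra.ι ℂ) _ _
      rw [multisetMonomial_cons _ hj, this]
      noncomm_ring
    have h2 : multisetMonomial e (i ::ₘ j ::ₘ N) =
        toU (e j) * multisetMonomial e (i ::ₘ N) := by
      rw [Multiset.cons_swap, multisetMonomial_cons]
      intro k hk
      rcases Multiset.mem_cons.1 hk with rfl | hk
      exacts [hji.le, hj k hk]
    have h3 := ih2 j _ _ (by omega) _ (ih i N (by omega))
    have h4 : toU ⁅e i, e j⁆ * multisetMonomial e N ∈
        monomialFil e deg (deg i + deg j + (N.map deg).sum) (N.card + 1) := by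
      have := hdeg i j
      generalize ⁅e i, e j⁆ = z at this
      induction this using Submodule.span_induction with
      | zero => rw [map_zero, zero_mul]; exact zero_mem _
      | add a b _ _ ha hb => rw [map_add, add_mul]; exact add_mem ha hb
      | smul c a _ ha => rw [map_smul, smul_mul_assoc]; exact Submodule.smul_mem _ _ ha
      | mem v hv =>
        obtain ⟨k, hk, rfl⟩ := hv
        rw [← show deg k = _ from hk]
        exact ih2 k _ _ (by omega) _ (mem_monomialFil deg e le_rfl rfl)
    rw [h1, h2, Multiset.card_cons, Multiset.map_cons, Multiset.sum_cons]
    have := add_mem (show _ ∈ monomialFil e deg (deg i + deg j + (N.map deg).sum) (N.card + 1) by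
      convert h3 using 2; abel) h4
    rw [← add_assoc]
    convert this using 1
    noncomm_ring

/-- Straightening: a product of basis vectors is a combination of ordered monomials of the same
degree. -/
theorem list_prod_mem_span_pbwMonomial
    (hdeg : ∀ i j, ⁅e i, e j⁆ ∈ Submodule.span ℂ (e '' {k | deg k = deg i + deg j}))
    (l : List I) :
    (l.map fun i => toU (e i)).prod ∈ Submodule.span ℂ {u | ∃ n : I →₀ ℕ,
      (n.sum fun i k => k • deg i) = (l.map deg).sum ∧ u = pbwMonomial e n} := by
  have key : (l.map fun i => toU (e i)).prod ∈ monomialFil e deg (l.map deg).sum l.length := by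
    induction l with
    | nil =>
      have := mem_monomialFil (M := 0) deg e (n := 0) (γ := 0) (by simp) (by simp)
      simpa [multisetMonomial] using this
    | cons i l ih =>
      simp only [List.map_cons, List.prod_cons, List.sum_cons, List.length_cons]
      generalize (l.map deg).sum = γ at ih ⊢
      generalize (l.map fun i => toU (e i)).prod = w at ih ⊢
      induction ih using Submodule.span_induction with
      | zero => rw [mul_zero]; exact zero_mem _
      | add a b _ _ ha hb => rw [mul_add]; exact add_mem ha hb
      | smul c a _ ha => rw [mul_smul_comm]; exact Submodule.smul_mem _ _ ha
      | mem v hv =>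
        obtain ⟨M, rfl, hM, rfl⟩ := hv
        have := add_mem (monomialFil_mono deg e _ (show M.card ≤ l.length + 1 by omega)
          (toU_mul_multisetMonomial e deg hdeg _ i M le_rfl))
          (mem_monomialFil deg e (show (i ::ₘ M).card ≤ l.length + 1 by simpa using hM) (by simp))
        rwa [sub_add_cancel] at this
  refine Submodule.span_mono ?_ key
  rintro _ ⟨M, hM, -, rfl⟩
  refine ⟨Multiset.toFinsupp M, ?_, ?_⟩
  · rw [← hM]
    classical
    simp [Finsupp.sum, Finset.sum_multiset_map_count]
  · rw [← multisetMonomial_toMultiset, Multiset.toFinsupp_toMultiset]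

end Graded

theorem toU_lie (x y : L) : toU ⁅x, y⁆ = toU x * toU y - toU y * toU x :=
  LieHom.map_lie (UniversalEnvelopingAlgebra.ι ℂ) x y

/-- An induction principle: `U(L)` is spanned by products of elements of `L`. -/
theorem U_induction {p : U L → Prop} (u : U L) (h1 : p 1) (hadd : ∀ a b, p a → p b → p (a + b))
    (hsmul : ∀ (c : ℂ) a, p a → p (c • a)) (hmul : ∀ x a, p a → p (toU x * a)) : p u := by
  have h0 : p 0 := by simpa using hsmul 0 1 h1
  let S : Submodule ℂ (U L) :=
    { carrier := {u | p u}, zero_mem' := h0, add_mem' := fun {a b} => hadd a b,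
      smul_mem' := hsmul }
  -- the elements that preserve `S` by left multiplication are a subalgebra containing `L`
  let A : Subalgebra ℂ (U L) :=
    { carrier := {a | ∀ u ∈ S, a * u ∈ S}
      mul_mem' := fun {a b} ha hb u hu => by rw [mul_assoc]; exact ha _ (hb _ hu)
      one_mem' := fun u hu => by rwa [one_mul]
      add_mem' := fun {a b} ha hb u hu => by rw [add_mul]; exact add_mem (ha _ hu) (hb _ hu)
      zero_mem' := fun u hu => by rw [zero_mul]; exact zero_mem _
      algebraMap_mem' := fun r u hu => by
        rw [Algebra.algebraMap_eq_smul_one, smul_mul_assoc, one_mul]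
        exact Submodule.smul_mem _ _ hu }
  let f : L →ₗ⁅ℂ⁆ A :=
    { toFun := fun x => ⟨toU x, fun u hu => hmul x u hu⟩
      map_add' := fun x y => Subtype.ext (map_add _ _ _)
      map_smul' := fun c x => Subtype.ext (map_smul _ _ _)
      map_lie' := fun {x y} => Subtype.ext (toU_lie x y) }
  have : A.val.comp (UniversalEnvelopingAlgebra.lift ℂ f) = AlgHom.id ℂ _ := by
    ext x
    change ((UniversalEnvelopingAlgebra.lift ℂ f (UniversalEnvelopingAlgebra.ι ℂ x) : A) : U L) = _
    rw [UniversalEnvelopingAlgebra.lift_ι_apply]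
    rfl
  have hu := (UniversalEnvelopingAlgebra.lift ℂ f u).2 1 h1
  rw [show ((UniversalEnvelopingAlgebra.lift ℂ f u : A) : U L) = u from
    AlgHom.congr_fun this u, mul_one] at hu
  exact hu

theorem span_pbwMonomial : ⊤ ≤ Submodule.span ℂ (Set.range (pbwMonomial (e : I → L))) := by
  intro u hu
  clear hu
  -- straightening for the trivial grading
  have hdeg : ∀ i j, ⁅e i, e j⁆ ∈ Submodule.span ℂ (e '' {k | (fun _ : I => (0 : ℕ)) k =
      (fun _ : I => (0 : ℕ)) i + (fun _ : I => (0 : ℕ)) j}) := by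
    intro i j
    simp [e.span_eq]
  have hl : ∀ l : List I, (l.map fun i => toU (e i)).prod ∈
      Submodule.span ℂ (Set.range (pbwMonomial (e : I → L))) := fun l =>
    Submodule.span_mono (by rintro _ ⟨n, -, rfl⟩; exact ⟨n, rfl⟩)
      (list_prod_mem_span_pbwMonomial e _ hdeg l)
  have : u ∈ Submodule.span ℂ (Set.range fun l : List I => (l.map fun i => toU (e i)).prod) := by
    induction u using U_induction with
    | h1 => exact Submodule.subset_span ⟨[], by simp⟩
    | hadd a b ha hb => exact add_mem ha hb
    | hsmul c a ha => exact Submodule.smul_mem _ _ ha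
    | hmul x a ha =>
      induction ha using Submodule.span_induction with
      | zero => rw [mul_zero]; exact zero_mem _
      | add a b _ _ ha hb => rw [mul_add]; exact add_mem ha hb
      | smul c a _ ha => rw [mul_smul_comm]; exact Submodule.smul_mem _ _ ha
      | mem v hv =>
        obtain ⟨l, rfl⟩ := hv
        induction x using basis_induction e with
        | zero => rw [map_zero, zero_mul]; exact zero_mem _
        | add a b ha hb => rw [map_add, add_mul]; exact add_mem ha hb
        | smul c a ha => rw [map_smul, smul_mul_assoc]; exact Submodule.smul_mem _ _ ha
        | basis i => exact Submodule.subset_span ⟨i :: l, by simp⟩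
  exact Submodule.span_le.2 (by rintro _ ⟨l, rfl⟩; exact hl l) this

/-- The Poincaré-Birkhoff-Witt theorem: the ordered monomials in a basis of `L` are a basis of
`U(L)`. -/
def pbwBasis : Module.Basis (I →₀ ℕ) ℂ (U L) :=
  Module.Basis.mk (v := pbwMonomial (e : I → L)) (by
    have h := (multisetMonomial_linearIndependent e).comp Finsupp.toMultiset
      (Function.LeftInverse.injective Finsupp.toMultiset_toFinsupp)
    convert h using 1
    exact funext fun n => (multisetMonomial_toMultiset e n).symm) (span_pbwMonomial e)

theorem pbwBasis_apply (n : I →₀ ℕ) : pbwBasis e n = pbwMonomial e n :=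
  Module.Basis.mk_apply _ _ _

end PBW

end Wakimoto

end

/-! ### Functoriality and triangular decompositions of enveloping algebras -/

noncomputable section

namespace Wakimoto

section Functoriality

attribute [local instance 100] LieRing.ofAssociativeRing

variable {L : Type*} [LieRing L] [LieAlgebra ℂ L]

/-- The homomorphism of enveloping algebras induced by a homomorphism of Lie algebras. -/
def mapU {P : Type*} [LieRing P] [LieAlgebra ℂ P] (φ : P →ₗ⁅ℂ⁆ L) : U P →ₐ[ℂ] U L :=
  UniversalEnvelopingAlgebra.lift ℂ ((UniversalEnvelopingAlgebra.ι ℂ).comp φ)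

theorem mapU_toU {P : Type*} [LieRing P] [LieAlgebra ℂ P] (φ : P →ₗ⁅ℂ⁆ L) (x : P) :
    mapU φ (toU x) = toU (φ x) :=
  UniversalEnvelopingAlgebra.lift_ι_apply ℂ _ x

/-- The algebra homomorphism `U(L) → ℂ` given by a character of `L`. -/
def charU (χ : L →ₗ[ℂ] ℂ) (hχ : ∀ x y : L, χ ⁅x, y⁆ = 0) : U L →ₐ[ℂ] ℂ :=
  UniversalEnvelopingAlgebra.lift ℂ ({ χ with
    map_lie' := fun {x y} => by
      change χ ⁅x, y⁆ = χ x * χ y - χ y * χ x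
      rw [hχ, mul_comm, sub_self] } : L →ₗ⁅ℂ⁆ ℂ)

theorem charU_toU (χ : L →ₗ[ℂ] ℂ) (hχ : ∀ x y : L, χ ⁅x, y⁆ = 0) (x : L) :
    charU χ hχ (toU x) = χ x :=
  UniversalEnvelopingAlgebra.lift_ι_apply ℂ _ x

/-- The antihomomorphism `x ↦ χ(x) - x` from `L` to `U(L)`. -/
def twistedNeg (χ : L →ₗ[ℂ] ℂ) (hχ : ∀ x y : L, χ ⁅x, y⁆ = 0) : L →ₗ⁅ℂ⁆ (U L)ᵐᵒᵖ where
  toFun x := MulOpposite.op (χ x • (1 : U L) - toU x)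
  map_add' x y := by rw [← MulOpposite.op_add, map_add, map_add, add_smul]; congr 1; abel
  map_smul' c x := by
    rw [← MulOpposite.op_smul, map_smul, map_smul, smul_assoc, ← smul_sub]; rfl
  map_lie' {x y} := by
    rw [hχ, LieRing.of_associative_ring_bracket, ← MulOpposite.op_mul, ← MulOpposite.op_mul,
      ← MulOpposite.op_sub, toU_lie]
    congr 1
    simp only [mul_sub, sub_mul, mul_smul_comm, smul_mul_assoc, one_mul, mul_one, zero_smul]
    module

/-- The antipode of `U(L)` twisted by a character `χ`: the antihomomorphism with
`x ↦ χ(x) - x` for `x ∈ L`. -/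
def twistedAntipode (χ : L →ₗ[ℂ] ℂ) (hχ : ∀ x y : L, χ ⁅x, y⁆ = 0) : U L →ₗ[ℂ] U L :=
  (MulOpposite.opLinearEquiv ℂ).symm.toLinearMap ∘ₗ
    (UniversalEnvelopingAlgebra.lift ℂ (twistedNeg χ hχ)).toLinearMap

variable (χ : L →ₗ[ℂ] ℂ) (hχ : ∀ x y : L, χ ⁅x, y⁆ = 0)

theorem twistedAntipode_one : twistedAntipode χ hχ 1 = 1 := by
  simp [twistedAntipode]

theorem twistedAntipode_mul (a b : U L) :
    twistedAntipode χ hχ (a * b) = twistedAntipode χ hχ b * twistedAntipode χ hχ a := by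
  simp [twistedAntipode]

theorem twistedAntipode_toU (x : L) : twistedAntipode χ hχ (toU x) = χ x • 1 - toU x :=
  congrArg MulOpposite.unop (UniversalEnvelopingAlgebra.lift_ι_apply ℂ (twistedNeg χ hχ) x)

/-- The antipode of `U(L)`. -/
def antipode : U L →ₗ[ℂ] U L := twistedAntipode 0 (fun _ _ => rfl)

theorem antipode_one : antipode (1 : U L) = 1 := twistedAntipode_one _ _

theorem antipode_mul (a b : U L) : antipode (a * b) = antipode b * antipode a :=
  twistedAntipode_mul _ _ a b

theorem antipode_toU (x : L) : antipode (toU x) = -toU x := by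
  rw [antipode, twistedAntipode_toU]; simp

theorem antipode_mapU {P : Type*} [LieRing P] [LieAlgebra ℂ P] (φ : P →ₗ⁅ℂ⁆ L) (a : U P) :
    antipode (mapU φ a) = mapU φ (antipode a) := by
  induction a using U_induction with
  | h1 => simp [antipode_one]
  | hadd a b ha hb => simp [ha, hb]
  | hsmul c a ha => simp [ha]
  | hmul x a ha =>
    rw [map_mul, antipode_mul, antipode_mul, map_mul, ha, mapU_toU, antipode_toU, antipode_toU,
      map_neg, mapU_toU]

/-- The counit of `U(L)`. -/
def counit : U L →ₐ[ℂ] ℂ := charU 0 (fun _ _ => rfl)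

theorem counit_toU (x : L) : counit (toU x) = 0 := charU_toU _ _ x

end Functoriality

section Triangular

attribute [local instance 100] LieRing.ofAssociativeRing

variable {L P Q : Type*} [LieRing L] [LieAlgebra ℂ L] [LieRing P] [LieAlgebra ℂ P]
  [LieRing Q] [LieAlgebra ℂ Q] (p : P →ₗ⁅ℂ⁆ L) (q : Q →ₗ⁅ℂ⁆ L)

/-- The multiplication map `U(P) ⊗ U(Q) → U(L)`. -/
def mulMap : U P ⊗[ℂ] U Q →ₗ[ℂ] U L :=
  TensorProduct.lift ((LinearMap.mul ℂ (U L)).compl₁₂ (mapU p).toLinearMap (mapU q).toLinearMap)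

theorem mulMap_tmul (a : U P) (b : U Q) : mulMap p q (a ⊗ₜ b) = mapU p a * mapU q b := rfl

theorem pbwMonomial_sum {I J : Type*} [LinearOrder I] [LinearOrder J] (e : I → P) (f : J → Q)
    (m : I →₀ ℕ) (n : J →₀ ℕ) :
    pbwMonomial (fun k : I ⊕ₗ J => Sum.elim (fun i => p (e i)) (fun j => q (f j)) (ofLex k))
      ((Finsupp.sumFinsuppEquivProdFinsupp.symm (m, n)).equivMapDomain toLex) =
    mapU p (pbwMonomial e m) * mapU q (pbwMonomial f n) := by
  classical
  have hs : ((Finsupp.sumFinsuppEquivProdFinsupp.symm (m, n)).equivMapDomain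
      toLex).support.sort (· ≤ ·) = (m.support.sort (· ≤ ·)).map (fun i => toLex (Sum.inl i)) ++
        (n.support.sort (· ≤ ·)).map (fun j => toLex (Sum.inr j)) := by
    refine List.Perm.eq_of_pairwise' (r := (· ≤ ·)) (Finset.pairwise_sort _ _) ?_ ?_
    · rw [List.pairwise_append, List.pairwise_map, List.pairwise_map]
      refine ⟨(Finset.pairwise_sort m.support _).imp (fun h => Sum.Lex.inl_le_inl_iff.2 h),
        (Finset.pairwise_sort n.support _).imp (fun h => Sum.Lex.inr_le_inr_iff.2 h), ?_⟩
      intro a ha b hb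
      obtain ⟨i, -, rfl⟩ := List.mem_map.1 ha
      obtain ⟨j, -, rfl⟩ := List.mem_map.1 hb
      exact Sum.Lex.inl_le_inr i j
    · rw [List.perm_ext_iff_of_nodup]
      · intro k
        obtain ⟨k, rfl⟩ := toLex.surjective k
        rcases k with i | j <;> simp [Finsupp.sumFinsuppEquivProdFinsupp]
      · exact Finset.sort_nodup _ _
      · rw [List.nodup_append]
        refine ⟨(Finset.sort_nodup _ _).map (toLex.injective.comp Sum.inl_injective),
          (Finset.sort_nodup _ _).map (toLex.injective.comp Sum.inr_injective), ?_⟩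
        intro a ha b hb hab
        obtain ⟨i, -, rfl⟩ := List.mem_map.1 ha
        obtain ⟨j, -, rfl⟩ := List.mem_map.1 hb
        exact Sum.inl_ne_inr (toLex.injective hab)
  rw [pbwMonomial, hs, List.map_append, List.prod_append, pbwMonomial, pbwMonomial,
    map_list_prod, map_list_prod, List.map_map, List.map_map, List.map_map, List.map_map]
  congr 2 <;> refine List.map_congr_left fun i _ => ?_ <;>
    simp [Finsupp.sumFinsuppEquivProdFinsupp, mapU_toU]

/-- The multiplication map takes the tensor products of ordered monomials to the ordered monomials
in a basis of `L` whose indices from `P` precede those from `Q`. -/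
theorem mulMap_bijective (h : Function.Bijective fun z : P × Q => p z.1 + q z.2) :
    Function.Bijective (mulMap p q) := by
  classical
  let _ : LinearOrder (Module.Basis.ofVectorSpaceIndex ℂ P) := linearOrderOfSTO WellOrderingRel
  let _ : LinearOrder (Module.Basis.ofVectorSpaceIndex ℂ Q) := linearOrderOfSTO WellOrderingRel
  let e := Module.Basis.ofVectorSpace ℂ P
  let f := Module.Basis.ofVectorSpace ℂ Q
  let c : (P × Q) ≃ₗ[ℂ] L := LinearEquiv.ofBijective
    ((p : P →ₗ[ℂ] L).coprod (q : Q →ₗ[ℂ] L)) h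
  have hc (z : P × Q) : c z = p z.1 + q z.2 := rfl
  let g := ((e.prod f).map c).reindex toLex
  let B := (pbwBasis e).tensorProduct (pbwBasis f)
  let σ := Finsupp.sumFinsuppEquivProdFinsupp.symm.trans
    (Finsupp.equivCongrLeft (M := ℕ) (toLex : Module.Basis.ofVectorSpaceIndex ℂ P ⊕
      Module.Basis.ofVectorSpaceIndex ℂ Q ≃ _))
  have : mulMap p q = (B.equiv (pbwBasis g) σ).toLinearMap := by
    refine B.ext fun mn => ?_
    rw [LinearEquiv.coe_coe, Module.Basis.equiv_apply, pbwBasis_apply]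
    obtain ⟨m, n⟩ := mn
    rw [Module.Basis.tensorProduct_apply, mulMap_tmul, pbwBasis_apply, pbwBasis_apply,
      ← pbwMonomial_sum]
    congr 1
    ext k
    obtain ⟨k, rfl⟩ := toLex.surjective k
    rcases k with i | j <;> simp [g, hc]
  rw [this]
  exact (B.equiv (pbwBasis g) σ).bijective

/-- The isomorphism `U(P) ⊗ U(Q) ≅ U(L)` for complementary subalgebras `P` and `Q` of `L`. -/
def mulEquiv (h : Function.Bijective fun z : P × Q => p z.1 + q z.2) :
    U P ⊗[ℂ] U Q ≃ₗ[ℂ] U L :=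
  LinearEquiv.ofBijective (mulMap p q) (mulMap_bijective p q h)

theorem mulEquiv_tmul (h : Function.Bijective fun z : P × Q => p z.1 + q z.2) (a : U P) (b : U Q) :
    mulEquiv p q h (a ⊗ₜ b) = mapU p a * mapU q b := rfl

theorem mulEquiv_symm_mul (h : Function.Bijective fun z : P × Q => p z.1 + q z.2)
    (a : U P) (b : U Q) : (mulEquiv p q h).symm (mapU p a * mapU q b) = a ⊗ₜ b := by
  rw [LinearEquiv.symm_apply_eq, mulEquiv_tmul]

theorem mapU_injective_left (h : Function.Bijective fun z : P × Q => p z.1 + q z.2) :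
    Function.Injective (mapU p) := by
  intro a b hab
  have h1 : mulMap p q (a ⊗ₜ 1) = mulMap p q (b ⊗ₜ 1) := by
    rw [mulMap_tmul, mulMap_tmul, hab]
  have h2 := congrArg ((TensorProduct.rid ℂ (U P)) ∘ (counit : U Q →ₐ[ℂ] ℂ).toLinearMap.lTensor (U P))
    ((mulMap_bijective p q h).1 h1)
  simpa using h2

theorem mapU_injective_right (h : Function.Bijective fun z : P × Q => p z.1 + q z.2) :
    Function.Injective (mapU q) := by
  intro a b hab
  have h1 : mulMap p q (1 ⊗ₜ a) = mulMap p q (1 ⊗ₜ b) := by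
    rw [mulMap_tmul, mulMap_tmul, hab]
  have h2 := congrArg ((TensorProduct.lid ℂ (U Q)) ∘ (counit : U P →ₐ[ℂ] ℂ).toLinearMap.rTensor (U Q))
    ((mulMap_bijective p q h).1 h1)
  simpa using h2

end Triangular

end Wakimoto

end

/-! ### Partial traces and adjoint eigenvectors -/

noncomputable section

namespace Wakimoto

section PartialTrace

variable {E V W A : Type*} [AddCommGroup E] [Module ℂ E] [AddCommGroup V] [Module ℂ V]
  [AddCommGroup W] [Module ℂ W] (a : Module.Basis A ℂ E)

/-- The coefficient in `V` of the basis vector `a i` in an element of `E ⊗ V`. -/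
def tcoef (i : A) : E ⊗[ℂ] V →ₗ[ℂ] V := (TensorProduct.lid ℂ V).toLinearMap ∘ₗ (a.coord i).rTensor V

theorem tcoef_tmul (i : A) (x : E) (v : V) : tcoef a i (x ⊗ₜ[ℂ] v) = a.repr x i • v := by
  simp [tcoef]

theorem tcoef_finite (z : E ⊗[ℂ] V) : {i | tcoef a i z ≠ 0}.Finite := by
  induction z using TensorProduct.induction_on with
  | zero => simp
  | tmul x v =>
    refine (a.repr x).hasFiniteSupport.subset fun i hi => ?_
    rw [Set.mem_ofPred_eq, tcoef_tmul] at hi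
    exact fun h0 => hi (by rw [h0, zero_smul])
  | add x y hx hy =>
    refine (hx.union hy).subset fun i hi => ?_
    by_contra hc
    simp only [Set.mem_union, Set.mem_ofPred_eq, not_or, not_not] at hc
    exact hi (by rw [map_add, hc.1, hc.2, add_zero])

theorem sum_tcoef (z : E ⊗[ℂ] V) : ∑ᶠ i, a i ⊗ₜ[ℂ] tcoef a i z = z := by
  have hfin (w : E ⊗[ℂ] V) : (Function.support fun i => a i ⊗ₜ[ℂ] tcoef a i w).Finite := by
    refine (tcoef_finite a w).subset fun i hi h0 => hi ?_
    simp only [h0, TensorProduct.tmul_zero]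
  induction z using TensorProduct.induction_on with
  | zero => simp
  | tmul x v =>
    rw [finsum_eq_sum_of_support_subset (s := (a.repr x).support)]
    · conv_rhs => rw [← a.linearCombination_repr x, Finsupp.linearCombination_apply, Finsupp.sum,
        TensorProduct.sum_tmul]
      refine Finset.sum_congr rfl fun i _ => ?_
      rw [tcoef_tmul, TensorProduct.smul_tmul]
    · intro i hi
      rw [Finset.mem_coe, Finsupp.mem_support_iff]
      intro h0
      exact hi (by simp only [tcoef_tmul, h0, zero_smul, TensorProduct.tmul_zero])
  | add x y hx hy =>
    conv_rhs => rw [← hx, ← hy]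
    rw [← finsum_add_distrib (hfin x) (hfin y)]
    simp only [map_add, TensorProduct.tmul_add]

theorem tcoef_lTensor (φ : V →ₗ[ℂ] W) (i : A) (z : E ⊗[ℂ] V) :
    tcoef a i (φ.lTensor E z) = φ (tcoef a i z) := by
  induction z using TensorProduct.induction_on with
  | zero => simp
  | tmul x v => simp [tcoef_tmul]
  | add x y hx hy => simp [hx, hy]

theorem tcoef_rTensor (T : E →ₗ[ℂ] E) (j : A) (z : E ⊗[ℂ] V) :
    tcoef a j (T.rTensor V z) = ∑ᶠ i, a.repr (T (a i)) j • tcoef a i z := by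
  conv_lhs => rw [← sum_tcoef a z]
  have hfin : (Function.support fun i => a i ⊗ₜ[ℂ] tcoef a i z).Finite := by
    refine (tcoef_finite a z).subset fun i hi h0 => hi ?_
    simp only [h0, TensorProduct.tmul_zero]
  have h := ((tcoef a j ∘ₗ T.rTensor V : E ⊗[ℂ] V →ₗ[ℂ] V) : E ⊗[ℂ] V →+ V).map_finsum hfin
  refine h.trans (finsum_congr fun i => ?_)
  simp [tcoef_tmul]

/-- The maps `F : E → E ⊗ V` whose partial trace is a finite sum. -/
def Traceable (F : E →ₗ[ℂ] E ⊗[ℂ] V) : Prop := {i | tcoef a i (F (a i)) ≠ 0}.Finite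

/-- The linear maps vanishing on all but finitely many of the basis vectors `a i`. -/
def finHom (V : Type*) [AddCommGroup V] [Module ℂ V] : Submodule ℂ (E →ₗ[ℂ] V) where
  carrier := {F | {i | F (a i) ≠ 0}.Finite}
  zero_mem' := by simp
  add_mem' := by
    intro F G hF hG
    refine (hF.union hG).subset fun i hi => ?_
    by_contra hc
    simp only [Set.mem_union, Set.mem_ofPred_eq, not_or, not_not] at hc
    exact hi (by rw [LinearMap.add_apply, hc.1, hc.2, add_zero])
  smul_mem' := by
    intro c F hF
    refine Set.Finite.subset hF fun i hi h0 => hi ?_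
    rw [LinearMap.smul_apply, h0, smul_zero]

theorem comp_mem_finHom {F : E →ₗ[ℂ] V} (hF : F ∈ finHom a V) (φ : V →ₗ[ℂ] W) :
    φ ∘ₗ F ∈ finHom a W := by
  refine Set.Finite.subset hF fun i hi h0 => hi ?_
  rw [LinearMap.comp_apply, h0, map_zero]

theorem traceable_of_mem_finHom {F : E →ₗ[ℂ] E ⊗[ℂ] V} (hF : F ∈ finHom a (E ⊗[ℂ] V)) :
    Traceable a F :=
  Set.Finite.subset hF fun i hi h0 => hi (by rw [h0, map_zero])

/-- The partial trace of `F : E → E ⊗ V`, the sum of its diagonal coefficients in `V`. -/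
def ptr (F : E →ₗ[ℂ] E ⊗[ℂ] V) : V := ∑ᶠ i, tcoef a i (F (a i))

theorem Traceable.add {F G : E →ₗ[ℂ] E ⊗[ℂ] V} (hF : Traceable a F) (hG : Traceable a G) :
    Traceable a (F + G) := by
  refine (Set.Finite.union hF hG).subset fun i hi => ?_
  by_contra hc
  simp only [Set.mem_union, Set.mem_ofPred_eq, not_or, not_not] at hc
  exact hi (by rw [LinearMap.add_apply, map_add, hc.1, hc.2, add_zero])

theorem Traceable.smul {F : E →ₗ[ℂ] E ⊗[ℂ] V} (c : ℂ) (hF : Traceable a F) :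
    Traceable a (c • F) := by
  refine Set.Finite.subset hF fun i hi h0 => hi ?_
  rw [LinearMap.smul_apply, map_smul, h0, smul_zero]

theorem ptr_zero : ptr a (0 : E →ₗ[ℂ] E ⊗[ℂ] V) = 0 := by simp [ptr]

theorem ptr_add {F G : E →ₗ[ℂ] E ⊗[ℂ] V} (hF : Traceable a F) (hG : Traceable a G) :
    ptr a (F + G) = ptr a F + ptr a G := by
  rw [ptr, ptr, ptr, ← finsum_add_distrib hF hG]
  simp

theorem ptr_smul (c : ℂ) {F : E →ₗ[ℂ] E ⊗[ℂ] V} (hF : Traceable a F) :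
    ptr a (c • F) = c • ptr a F := by
  rw [ptr, ptr, smul_finsum' c hF]
  simp

theorem Traceable.neg {F : E →ₗ[ℂ] E ⊗[ℂ] V} (hF : Traceable a F) : Traceable a (-F) := by
  rw [← neg_one_smul ℂ]; exact hF.smul a _

theorem ptr_neg {F : E →ₗ[ℂ] E ⊗[ℂ] V} (hF : Traceable a F) : ptr a (-F) = -ptr a F := by
  rw [← neg_one_smul ℂ, ptr_smul a _ hF, neg_one_smul]

theorem Traceable.sub {F G : E →ₗ[ℂ] E ⊗[ℂ] V} (hF : Traceable a F) (hG : Traceable a G) :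
    Traceable a (F - G) := by
  rw [sub_eq_add_neg]; exact hF.add a (hG.neg a)

theorem ptr_sub {F G : E →ₗ[ℂ] E ⊗[ℂ] V} (hF : Traceable a F) (hG : Traceable a G) :
    ptr a (F - G) = ptr a F - ptr a G := by
  rw [sub_eq_add_neg, ptr_add a hF (hG.neg a), ptr_neg a hG, sub_eq_add_neg]

theorem Traceable.lTensor (φ : V →ₗ[ℂ] W) {F : E →ₗ[ℂ] E ⊗[ℂ] V} (hF : Traceable a F) :
    Traceable a (φ.lTensor E ∘ₗ F) := by
  refine Set.Finite.subset hF fun i hi h0 => hi ?_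
  rw [LinearMap.comp_apply, tcoef_lTensor, h0, map_zero]

theorem ptr_lTensor (φ : V →ₗ[ℂ] W) {F : E →ₗ[ℂ] E ⊗[ℂ] V} (hF : Traceable a F) :
    ptr a (φ.lTensor E ∘ₗ F) = φ (ptr a F) := by
  have := (φ : V →+ W).map_finsum (f := fun i => tcoef a i (F (a i))) hF
  refine Eq.trans (finsum_congr fun i => ?_) this.symm
  rw [LinearMap.comp_apply, tcoef_lTensor]
  rfl

theorem traceable_comp {F : E →ₗ[ℂ] E ⊗[ℂ] V} (hF : F ∈ finHom a (E ⊗[ℂ] V)) (T : E →ₗ[ℂ] E) :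
    Traceable a (F ∘ₗ T) := by
  have : (⋃ j ∈ {j | F (a j) ≠ 0}, {i | tcoef a i (F (a j)) ≠ 0}).Finite :=
    Set.Finite.biUnion hF fun j _ => tcoef_finite a _
  refine this.subset fun i hi => ?_
  by_contra hc
  simp only [Set.mem_iUnion, Set.mem_ofPred_eq, not_exists, not_not] at hc
  refine hi ?_
  rw [LinearMap.comp_apply, ← a.linearCombination_repr (T (a i)), Finsupp.linearCombination_apply,
    Finsupp.sum, map_sum, map_sum]
  refine Finset.sum_eq_zero fun j _ => ?_
  rw [map_smul, map_smul]
  by_cases hj : F (a j) = 0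
  · rw [hj, map_zero, smul_zero]
  · rw [hc j hj, smul_zero]

theorem traceable_rTensor {F : E →ₗ[ℂ] E ⊗[ℂ] V} (hF : F ∈ finHom a (E ⊗[ℂ] V)) (T : E →ₗ[ℂ] E) :
    Traceable a (T.rTensor V ∘ₗ F) :=
  traceable_of_mem_finHom a (comp_mem_finHom a hF _)

/-- The cyclicity of the partial trace. -/
theorem ptr_comm {F : E →ₗ[ℂ] E ⊗[ℂ] V} (hF : F ∈ finHom a (E ⊗[ℂ] V)) (T : E →ₗ[ℂ] E) :
    ptr a (F ∘ₗ T) = ptr a (T.rTensor V ∘ₗ F) := by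
  classical
  have hF' : {i | F (a i) ≠ 0}.Finite := hF
  set J := hF'.toFinset with hJ
  have hJ0 : ∀ j, j ∉ J → F (a j) = 0 := by
    intro j hj
    rw [hJ, Set.Finite.mem_toFinset, Set.mem_ofPred_eq, not_not] at hj
    exact hj
  set I := J.biUnion fun j => (tcoef_finite a (F (a j))).toFinset with hI
  have hI0 : ∀ i, i ∉ I → ∀ j, tcoef a i (F (a j)) = 0 := by
    intro i hi j
    by_cases hj : j ∈ J
    · by_contra hne
      exact hi (Finset.mem_biUnion.2 ⟨j, hj, by simpa using hne⟩)
    · rw [hJ0 j hj, map_zero]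
  have e1 : ∀ i, tcoef a i ((F ∘ₗ T) (a i)) = ∑ j ∈ J, a.repr (T (a i)) j • tcoef a i (F (a j)) := by
    intro i
    rw [LinearMap.comp_apply]
    conv_lhs => rw [← a.linearCombination_repr (T (a i)), Finsupp.linearCombination_apply,
      Finsupp.sum, map_sum, map_sum]
    simp only [map_smul]
    refine Finset.sum_congr_of_eq_on_inter ?_ ?_ ?_
    · intro j _ hj
      rw [hJ0 j hj, map_zero, smul_zero]
    · intro j _ hj
      rw [Finsupp.notMem_support_iff.1 hj, zero_smul]
    · intros; rfl
  have e2 : ∀ j, tcoef a j ((T.rTensor V ∘ₗ F) (a j)) =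
      ∑ i ∈ I, a.repr (T (a i)) j • tcoef a i (F (a j)) := by
    intro j
    rw [LinearMap.comp_apply, tcoef_rTensor, finsum_eq_sum_of_support_subset]
    intro i hi
    by_contra hc
    exact hi (by simp only [hI0 i hc j, smul_zero])
  rw [ptr, ptr, finsum_eq_sum_of_support_subset (s := I), finsum_eq_sum_of_support_subset (s := J)]
  · simp only [e1, e2]
    exact Finset.sum_comm
  · intro j hj
    by_contra hc
    exact hj (by simp only [LinearMap.comp_apply, hJ0 j hc, map_zero])
  · intro i hi
    by_contra hc
    refine hi ?_
    simp only [e1]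
    exact Finset.sum_eq_zero fun j _ => by rw [hI0 i hc j, smul_zero]

theorem ptr_tmul (x : E) (ζ : E →ₗ[ℂ] V) {F : E →ₗ[ℂ] E ⊗[ℂ] V}
    (hF : ∀ i, tcoef a i (F (a i)) = a.repr x i • ζ (a i)) : ptr a F = ζ x := by
  rw [ptr]
  simp only [hF]
  rw [finsum_eq_sum_of_support_subset (s := (a.repr x).support)]
  · conv_rhs => rw [← a.linearCombination_repr x, Finsupp.linearCombination_apply, Finsupp.sum,
      map_sum]
    simp only [map_smul]
  · intro i hi
    rw [Finset.mem_coe, Finsupp.mem_support_iff]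
    intro h0
    exact hi (by simp only [h0, zero_smul])

end PartialTrace

section Eigen

/-- In a basis of eigenvectors, the coefficients of an eigenvector are supported at the basis
vectors with the same eigenvalue. -/
theorem eigen_repr {V I : Type*} [AddCommGroup V] [Module ℂ V] (a : Module.Basis I ℂ V)
    (T : Module.End ℂ V) (c : I → ℂ) (h : ∀ i, T (a i) = c i • a i) {v : V} {d : ℂ}
    (hv : T v = d • v) {i : I} (hi : a.repr v i ≠ 0) : c i = d := by
  have key : ∀ w : V, a.repr (T w) i = c i * a.repr w i := by
    intro w
    induction w using basis_induction a with
    | zero => simp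
    | add x y hx hy => simp [hx, hy, mul_add]
    | smul c x hx => simp [hx]; ring
    | basis j =>
      rw [h, map_smul, Finsupp.smul_apply, a.repr_self, smul_eq_mul]
      by_cases hij : j = i
      · rw [hij]
      · rw [Finsupp.single_eq_of_ne (Ne.symm hij), mul_zero, mul_zero]
  have h1 := key v
  rw [hv, map_smul, Finsupp.smul_apply, smul_eq_mul] at h1
  exact (mul_right_cancel₀ hi h1).symm

/-- A family of submodules spanning `V` that is contained in an independent family is equal to
it. -/
theorem eq_of_iSupIndep {V I : Type*} [AddCommGroup V] [Module ℂ V] {E F : I → Submodule ℂ V}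
    (hF : iSupIndep F) (hle : ∀ i, E i ≤ F i) (h : ⨆ i, E i = ⊤) (i : I) : E i = F i := by
  refine le_antisymm (hle i) fun v hv => ?_
  have hv' : v ∈ E i ⊔ ⨆ j, ⨆ _ : j ≠ i, E j := by
    have : (⊤ : Submodule ℂ V) ≤ E i ⊔ ⨆ j, ⨆ _ : j ≠ i, E j := by
      rw [← h]
      refine iSup_le fun j => ?_
      by_cases hj : j = i
      · rw [hj]; exact le_sup_left
      · exact le_sup_of_le_right (le_iSup₂_of_le j hj le_rfl)
    exact this trivial
  obtain ⟨x, hx, y, hy, rfl⟩ := Submodule.mem_sup.1 hv'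
  have hy' : y ∈ ⨆ j, ⨆ _ : j ≠ i, F j := (iSup₂_mono fun j _ => hle j) hy
  have h0 : y = 0 := by
    have h1 := (Submodule.add_mem_iff_right _ (hle i hx)).1 hv
    exact (Submodule.disjoint_def.1 (hF i)) y h1 hy'
  rw [h0, add_zero]
  exact hx

theorem eigenspace_intCast_iSupIndep {V : Type*} [AddCommGroup V] [Module ℂ V]
    (T : Module.End ℂ V) : iSupIndep fun n : ℤ => T.eigenspace (n : ℂ) :=
  T.eigenspaces_iSupIndep.comp Int.cast_injective

/-- A linear map into `W` with values in the range of an injective map factors through that map. -/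
theorem exists_factor {V V' W : Type*} [AddCommGroup V] [Module ℂ V] [AddCommGroup V']
    [Module ℂ V'] [AddCommGroup W] [Module ℂ W] (T : V →ₗ[ℂ] W) (i : V' →ₗ[ℂ] W)
    (hi : Function.Injective i) (h : ∀ v, ∃ w, T v = i w) : ∃ s : V →ₗ[ℂ] V', ∀ v, T v = i (s v) := by
  refine ⟨(LinearEquiv.ofInjective i hi).symm.toLinearMap ∘ₗ
    T.codRestrict (LinearMap.range i) fun v => ?_, fun v => ?_⟩
  · obtain ⟨w, hw⟩ := h v
    exact ⟨w, hw.symm⟩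
  · have := (LinearEquiv.ofInjective i hi).apply_symm_apply (T.codRestrict (LinearMap.range i)
      (fun v => (h v).imp fun _ hw => hw.symm) v)
    exact (congrArg Subtype.val this).symm

end Eigen

section Degree

attribute [local instance 100] LieRing.ofAssociativeRing

variable {L : Type*} [LieRing L] [LieAlgebra ℂ L]

/-- The adjoint action of `L` on `U(L)`. -/
def adU (x : L) : Module.End ℂ (U L) := LinearMap.mulLeft ℂ (toU x) - LinearMap.mulRight ℂ (toU x)

theorem adU_apply (x : L) (u : U L) : adU x u = toU x * u - u * toU x := rfl

theorem adU_one (x : L) : adU x (1 : U L) = 0 := by simp [adU_apply]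

theorem adU_mul (x : L) (u v : U L) : adU x (u * v) = adU x u * v + u * adU x v := by
  simp only [adU_apply]; noncomm_ring

theorem adU_toU (x y : L) : adU x (toU y) = toU ⁅x, y⁆ := by
  rw [adU_apply, toU_lie]

theorem toU_mul_eq (x : L) (u : U L) : toU x * u = u * toU x + adU x u := by
  rw [adU_apply]; abel

/-- The elements of `U(L)` of weight `c` for the adjoint action of `x`. -/
def eigU (x : L) (c : ℂ) : Submodule ℂ (U L) := Module.End.eigenspace (adU x) c

theorem mem_eigU {x : L} {c : ℂ} {u : U L} : u ∈ eigU x c ↔ adU x u = c • u :=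
  Module.End.mem_eigenspace_iff

theorem one_mem_eigU (x : L) : (1 : U L) ∈ eigU x 0 := by
  rw [mem_eigU, adU_one, zero_smul]

theorem mul_mem_eigU {x : L} {c d : ℂ} {u v : U L} (hu : u ∈ eigU x c) (hv : v ∈ eigU x d) :
    u * v ∈ eigU x (c + d) := by
  rw [mem_eigU] at *
  rw [adU_mul, hu, hv, add_smul, smul_mul_assoc, mul_smul_comm]

theorem toU_mem_eigU {x y : L} {c : ℂ} (h : ⁅x, y⁆ = c • y) : toU y ∈ eigU x c := by
  rw [mem_eigU, adU_toU, h, map_smul]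

theorem pow_mem_eigU {x : L} {c : ℂ} {u : U L} (hu : u ∈ eigU x c) (n : ℕ) :
    u ^ n ∈ eigU x (n * c) := by
  induction n with
  | zero => simpa using one_mem_eigU x
  | succ n ih =>
    rw [pow_succ]
    have := mul_mem_eigU ih hu
    rwa [show (n : ℂ) * c + c = ((n + 1 : ℕ) : ℂ) * c by push_cast; ring] at this

/-- An ordered monomial in eigenvectors is an eigenvector. -/
theorem pbwMonomial_mem_eigU {H : Type*} [LieRing H] [LieAlgebra ℂ H] (φ : H →ₗ⁅ℂ⁆ L)
    {I : Type*} [LinearOrder I] (e : I → H) (x : L) (c : I → ℂ)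
    (h : ∀ i, ⁅x, φ (e i)⁆ = c i • φ (e i)) (n : I →₀ ℕ) :
    mapU φ (pbwMonomial e n) ∈ eigU x (n.sum fun i k => k * c i) := by
  have key : ∀ l : List I, mapU φ (l.map fun i => toU (e i) ^ n i).prod ∈
      eigU x (l.map fun i => (n i : ℂ) * c i).sum := by
    intro l
    induction l with
    | nil => simpa using one_mem_eigU x
    | cons i l ih =>
      simp only [List.map_cons, List.prod_cons, List.sum_cons, map_mul, map_pow, mapU_toU]
      exact mul_mem_eigU (pow_mem_eigU (toU_mem_eigU (h i)) _) ih
  have := key (n.support.sort (· ≤ ·))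
  rwa [← List.sum_toFinset _ (Finset.sort_nodup _ _), Finset.sort_toFinset] at this

theorem adU_antipode (x : L) (u : U L) : adU x (antipode u) = antipode (adU x u) := by
  rw [adU_apply, adU_apply, map_sub, antipode_mul, antipode_mul, antipode_toU]
  noncomm_ring

theorem antipode_mem_eigU {x : L} {c : ℂ} {u : U L} (hu : u ∈ eigU x c) :
    antipode u ∈ eigU x c := by
  rw [mem_eigU] at *
  rw [adU_antipode, hu, map_smul]

theorem adU_twistedAntipode (χ : L →ₗ[ℂ] ℂ) (hχ : ∀ x y : L, χ ⁅x, y⁆ = 0) (x : L) (u : U L) :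
    adU x (twistedAntipode χ hχ u) = twistedAntipode χ hχ (adU x u) := by
  rw [adU_apply, adU_apply, map_sub, twistedAntipode_mul, twistedAntipode_mul, twistedAntipode_toU]
  simp only [mul_sub, sub_mul, mul_smul_comm, smul_mul_assoc, one_mul, mul_one]
  abel

theorem mapU_adU {H : Type*} [LieRing H] [LieAlgebra ℂ H] (φ : H →ₗ⁅ℂ⁆ L) (x : H) (u : U H) :
    mapU φ (adU x u) = adU (φ x) (mapU φ u) := by
  simp [adU_apply, mapU_toU]

theorem toU_injective : Function.Injective (toU : L → U L) := by
  classical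
  let _ : LinearOrder (Module.Basis.ofVectorSpaceIndex ℂ L) := linearOrderOfSTO WellOrderingRel
  let e := Module.Basis.ofVectorSpace ℂ L
  have he : ∀ i, toU (e i) = pbwBasis e (Finsupp.single i 1) := by
    intro i
    rw [pbwBasis_apply, pbwMonomial, Finsupp.support_single _ one_ne_zero]
    simp
  have h : ∀ x : L, ∀ i, (pbwBasis e).repr (toU x) (Finsupp.single i 1) = e.repr x i := by
    intro x i
    induction x using basis_induction e with
    | zero => simp
    | add x y hx hy => simp [hx, hy]
    | smul c x hx => simp [hx]
    | basis j =>
      rw [he, Module.Basis.repr_self, Module.Basis.repr_self, Finsupp.single_apply,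
        Finsupp.single_apply]
      simp [Finsupp.single_left_inj]
  intro x y hxy
  refine e.ext_elem fun i => ?_
  rw [← h, ← h, hxy]

end Degree

end Wakimoto

end

/-! ### The partial trace on `Hom(U(L), U(L))` -/

noncomputable section

namespace Wakimoto

section Frame

attribute [local instance 100] LieRing.ofAssociativeRing

variable {L : Type*} [LieRing L] [LieAlgebra ℂ L]

/-- The homomorphism `U(H) → U(L)` for a subalgebra `H` of `L`. -/
abbrev incU (H : LieSubalgebra ℂ L) : U H →ₐ[ℂ] U L := mapU H.incl

theorem incU_toU (H : LieSubalgebra ℂ L) (x : H) : incU H (toU x) = toU (x : L) := mapU_toU _ x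

/-- The properties of a semi-infinite structure on which the description of `US` rests: the degree
is the eigenvalue of `ad δ`, the enveloping algebra of `P = L₊` has a homogeneous basis with finitely
many elements in each degree, `β` is concentrated in degree `0` and is a character of `M = L₋`, `P`
is generated by finitely many elements of degree `1`, and `M` is generated by its elements of degree
`0` together with elements `y` of degree `-1` that behave like Chevalley generators: `[y, L₁] ⊆ ℂ h`
with `[h, y] = -β(h) y`. -/
structure TriangularFrame (G : SemiInfinite L) (P M : LieSubalgebra ℂ L) (A B : Type*) where
  delta : L
  lie_delta : ∀ n x, x ∈ G.gr n → ⁅delta, x⁆ = (n : ℂ) • x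
  P_eq : P.toSubmodule = G.plus
  M_eq : M.toSubmodule = G.minus
  a : Module.Basis A ℂ (U P)
  degA : A → ℕ
  a_mem : ∀ i, incU P (a i) ∈ eigU delta (degA i)
  a_fin : ∀ n, {i | degA i = n}.Finite
  b : Module.Basis B ℂ (U M)
  degB : B → ℕ
  b_mem : ∀ j, incU M (b j) ∈ eigU delta (-(degB j : ℂ))
  beta_lie : ∀ x y : M, G.beta ⁅(x : L), (y : L)⁆ = 0
  beta_eq_zero : ∀ n ≠ 0, ∀ x ∈ G.gr n, G.beta x = 0
  rank : ℕ
  s : Fin rank → P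
  s_mem : ∀ j, (s j : L) ∈ G.gr 1
  s_gen : ∀ K : LieSubalgebra ℂ P, (∀ j, s j ∈ K) → ∀ x, x ∈ K
  M_gen : ∀ K : LieSubalgebra ℂ M, (∀ y : M, (y : L) ∈ G.gr 0 → y ∈ K) →
    (∀ y h : M, (y : L) ∈ G.gr (-1) → (h : L) ∈ G.gr 0 →
      (∀ x ∈ G.gr 1, ∃ c : ℂ, ⁅(y : L), x⁆ = c • (h : L)) →
      ⁅(h : L), (y : L)⁆ = -(G.beta h) • (y : L) → y ∈ K) → ∀ y, y ∈ K

variable {G : SemiInfinite L} {P M : LieSubalgebra ℂ L} {A B : Type*}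

namespace TriangularFrame

variable (F : TriangularFrame G P M A B)

theorem gr_eq (n : ℤ) : G.gr n = Module.End.eigenspace (LieAlgebra.ad ℂ L F.delta) (n : ℂ) := by
  refine eq_of_iSupIndep (eigenspace_intCast_iSupIndep _) (fun n x hx => ?_) G.iSup_gr n
  rw [Module.End.mem_eigenspace_iff]
  exact F.lie_delta n x hx

theorem mem_gr {n : ℤ} {x : L} : x ∈ G.gr n ↔ ⁅F.delta, x⁆ = (n : ℂ) • x := by
  rw [F.gr_eq, Module.End.mem_eigenspace_iff]; rfl

theorem lie_mem_gr (F : TriangularFrame G P M A B) {m n : ℤ} {x y : L} (hx : x ∈ G.gr m) (hy : y ∈ G.gr n) :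
    ⁅x, y⁆ ∈ G.gr (m + n) := by
  rw [F.mem_gr] at *
  rw [leibniz_lie, hx, hy, smul_lie, lie_smul, ← add_smul]
  push_cast; rfl

theorem mem_P (F : TriangularFrame G P M A B) {n : ℤ} (hn : 0 < n) {x : L} (hx : x ∈ G.gr n) : x ∈ P := by
  rw [← LieSubalgebra.mem_toSubmodule, F.P_eq]
  exact Submodule.mem_iSup_of_mem ⟨n, hn⟩ hx

theorem mem_M (F : TriangularFrame G P M A B) {n : ℤ} (hn : n ≤ 0) {x : L} (hx : x ∈ G.gr n) : x ∈ M := by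
  rw [← LieSubalgebra.mem_toSubmodule, F.M_eq]
  exact Submodule.mem_iSup_of_mem ⟨n, hn⟩ hx

theorem P_induction (F : TriangularFrame G P M A B)
    {p : L → Prop} {x : L} (hx : x ∈ P) (h0 : p 0)
    (hadd : ∀ x y, p x → p y → p (x + y))
    (h : ∀ n : ℤ, 0 < n → ∀ x ∈ G.gr n, p x) : p x := by
  rw [← LieSubalgebra.mem_toSubmodule, F.P_eq, SemiInfinite.plus] at hx
  induction hx using Submodule.iSup_induction' with
  | zero => exact h0
  | add x y _ _ hx hy => exact hadd x y hx hy
  | mem n x hx => exact h n n.2 x hx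

theorem bijective_add (F : TriangularFrame G P M A B) : Function.Bijective fun z : P × M => P.incl z.1 + M.incl z.2 := by
  have hd : Disjoint P.toSubmodule M.toSubmodule := by
    have h := (eigenspace_intCast_iSupIndep (LieAlgebra.ad ℂ L F.delta)).disjoint_biSup_biSup
      (s := {n : ℤ | 0 < n}) (t := {n : ℤ | n ≤ 0}) (by
        rw [Set.disjoint_left]; intro n h1 h2
        simp only [Set.mem_ofPred_eq] at h1 h2; omega)
    refine h.mono ?_ ?_
    · rw [F.P_eq, SemiInfinite.plus]
      exact iSup_le fun n => (F.gr_eq n).le.trans (le_iSup₂_of_le (n : ℤ) n.2 le_rfl)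
    · rw [F.M_eq, SemiInfinite.minus]
      exact iSup_le fun n => (F.gr_eq n).le.trans (le_iSup₂_of_le (n : ℤ) n.2 le_rfl)
  constructor
  · rintro ⟨x, y⟩ ⟨x', y'⟩ h
    simp only [LieSubalgebra.coe_incl] at h
    have h1 : (x : L) - x' = y' - y := by rw [sub_eq_sub_iff_add_eq_add, h, add_comm]
    have h2 := Submodule.disjoint_def.1 hd ((x : L) - x') (sub_mem x.2 x'.2)
      (h1 ▸ sub_mem y'.2 y.2)
    have h3 : (y' : L) - y = 0 := h1 ▸ h2
    exact Prod.ext (Subtype.ext (sub_eq_zero.1 h2)) (Subtype.ext (sub_eq_zero.1 h3).symm)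
  · intro x
    have hx : x ∈ ⨆ n, G.gr n := G.iSup_gr ▸ Submodule.mem_top
    induction hx using Submodule.iSup_induction' with
    | zero => exact ⟨0, by simp⟩
    | add x y _ _ hx hy =>
      obtain ⟨z, rfl⟩ := hx
      obtain ⟨w, rfl⟩ := hy
      exact ⟨z + w, by simp; abel⟩
    | mem n x hx =>
      rcases lt_or_ge 0 n with hn | hn
      · exact ⟨(⟨x, F.mem_P hn hx⟩, 0), by simp⟩
      · exact ⟨(0, ⟨x, F.mem_M hn hx⟩), by simp⟩

theorem incP_injective (F : TriangularFrame G P M A B) : Function.Injective (incU P) :=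
  mapU_injective_left P.incl M.incl F.bijective_add

theorem incM_injective (F : TriangularFrame G P M A B) : Function.Injective (incU M) :=
  mapU_injective_right P.incl M.incl F.bijective_add

/-- The isomorphism `U(L) ≅ U(P) ⊗ U(M)`. -/
def split : U L ≃ₗ[ℂ] U P ⊗[ℂ] U M := (mulEquiv P.incl M.incl F.bijective_add).symm

theorem split_mul (p : U P) (m : U M) : F.split (incU P p * incU M m) = p ⊗ₜ m :=
  mulEquiv_symm_mul _ _ _ p m

theorem split_symm (p : U P) (m : U M) : F.split.symm (p ⊗ₜ m) = incU P p * incU M m := by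
  rw [LinearEquiv.symm_apply_eq, split_mul]

theorem split_incP (p : U P) : F.split (incU P p) = p ⊗ₜ 1 := by
  rw [← split_mul, map_one, mul_one]

theorem split_incM (m : U M) : F.split (incU M m) = 1 ⊗ₜ m := by
  rw [← split_mul, map_one, one_mul]

theorem split_induction (F : TriangularFrame G P M A B) {p : U L → Prop} (v : U L)
    (hadd : ∀ a b, p a → p b → p (a + b))
    (h : ∀ (q : U P) (m : U M), p (incU P q * incU M m)) : p v := by
  rw [← F.split.symm_apply_apply v]
  induction F.split v using TensorProduct.induction_on with
  | zero => simpa using h 0 0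
  | tmul q m => rw [split_symm]; exact h q m
  | add x y hx hy => rw [map_add]; exact hadd _ _ hx hy

theorem split_left (q : U P) (v : U L) :
    F.split (incU P q * v) = (LinearMap.mulLeft ℂ q).rTensor (U M) (F.split v) := by
  induction v using F.split_induction with
  | hadd a b ha hb => rw [mul_add, map_add, ha, hb, map_add, map_add]
  | h p m => rw [← mul_assoc, ← map_mul, split_mul, split_mul]; simp

theorem split_right (m : U M) (v : U L) :
    F.split (v * incU M m) = (LinearMap.mulRight ℂ m).lTensor (U P) (F.split v) := by
  induction v using F.split_induction with
  | hadd a b ha hb => rw [add_mul, map_add, ha, hb, map_add, map_add]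
  | h p m => rw [mul_assoc, ← map_mul, split_mul, split_mul]; simp

/-- The basis of `U(L)` given by the products of basis vectors of `U(P)` and `U(M)`. -/
def basisU : Module.Basis (A × B) ℂ (U L) := (F.a.tensorProduct F.b).map F.split.symm

theorem basisU_apply (z : A × B) : F.basisU z = incU P (F.a z.1) * incU M (F.b z.2) := by
  rw [basisU, Module.Basis.map_apply, Module.Basis.tensorProduct_apply, split_symm]

theorem basisU_eig (z : A × B) :
    adU F.delta (F.basisU z) = ((F.degA z.1 : ℂ) - F.degB z.2) • F.basisU z := by
  rw [basisU_apply, ← mem_eigU, sub_eq_add_neg]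
  exact mul_mem_eigU (F.a_mem z.1) (F.b_mem z.2)

theorem iSup_grU (G : SemiInfinite L) : ⨆ n, G.grU n = ⊤ := by
  rw [eq_top_iff]
  intro u hu
  clear hu
  induction u using U_induction with
  | h1 => exact Submodule.mem_iSup_of_mem 0 (Submodule.subset_span ⟨[], by simp, by simp, by simp⟩)
  | hadd a b ha hb => exact add_mem ha hb
  | hsmul c a ha => exact Submodule.smul_mem _ c ha
  | hmul x u hu =>
    have hx : x ∈ ⨆ n, G.gr n := G.iSup_gr ▸ Submodule.mem_top
    induction hx using Submodule.iSup_induction' with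
    | zero => rw [map_zero, zero_mul]; exact zero_mem _
    | add x y _ _ hx hy => rw [map_add, add_mul]; exact add_mem hx hy
    | mem k x hx =>
      induction hu using Submodule.iSup_induction' with
      | zero => rw [mul_zero]; exact zero_mem _
      | add x y _ _ hx hy => rw [mul_add]; exact add_mem hx hy
      | mem n u hu => exact Submodule.mem_iSup_of_mem (n + k) (G.toU_mul_mem hx hu)

theorem grU_eq (n : ℤ) : G.grU n = eigU F.delta (n : ℂ) := by
  refine eq_of_iSupIndep (E := G.grU) (F := fun n : ℤ => eigU F.delta (n : ℂ))
    (eigenspace_intCast_iSupIndep (adU F.delta)) (fun n => ?_) (iSup_grU G) n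
  rw [SemiInfinite.grU, Submodule.span_le]
  rintro _ ⟨l, hl, rfl, rfl⟩
  induction l with
  | nil => simpa using one_mem_eigU F.delta
  | cons p l ih =>
    rw [List.map_cons, List.sum_cons, List.map_cons, List.prod_cons, Int.cast_add]
    exact mul_mem_eigU (toU_mem_eigU (F.lie_delta _ _ (hl p (List.mem_cons_self ..))))
      (ih fun q hq => hl q (List.mem_cons_of_mem _ hq))

theorem mem_grU {n : ℤ} {u : U L} : u ∈ G.grU n ↔ adU F.delta u = (n : ℂ) • u := by
  rw [F.grU_eq, mem_eigU]

theorem incP_a_mem (i : A) : incU P (F.a i) ∈ G.grU (F.degA i) := by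
  rw [F.grU_eq]; exact_mod_cast F.a_mem i

theorem antipode_mem (F : TriangularFrame G P M A B) {n : ℤ} {u : U L} (hu : u ∈ G.grU n) : antipode u ∈ G.grU n := by
  rw [F.grU_eq] at *; exact antipode_mem_eigU hu

theorem mul_mem (F : TriangularFrame G P M A B) {m n : ℤ} {u v : U L} (hu : u ∈ G.grU m) (hv : v ∈ G.grU n) :
    u * v ∈ G.grU (m + n) := by
  rw [F.grU_eq] at *; rw [Int.cast_add]; exact mul_mem_eigU hu hv

theorem finite_degA_lt (N : ℤ) : {i | (F.degA i : ℤ) < N}.Finite := by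
  refine ((Set.finite_lt_nat N.toNat).biUnion fun n _ => F.a_fin n).subset fun i hi => ?_
  simp only [Set.mem_ofPred_eq] at hi
  simp only [Set.mem_iUnion, Set.mem_ofPred_eq, exists_prop, exists_eq_right']
  omega

/-- A map in `finHom` vanishes in large degrees. The converse is `mem_finHom_of_bound`. -/
theorem finHom_bound {V : Type*} [AddCommGroup V] [Module ℂ V] {f : U P →ₗ[ℂ] V}
    (hf : f ∈ finHom F.a V) : ∃ N : ℕ, ∀ i, N ≤ F.degA i → f (F.a i) = 0 := by
  have hf' : {i | f (F.a i) ≠ 0}.Finite := hf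
  obtain ⟨N, hN⟩ := (hf'.image F.degA).bddAbove
  refine ⟨N + 1, fun i hi => ?_⟩
  by_contra hne
  have := hN ⟨i, hne, rfl⟩
  omega

theorem mem_finHom_of_bound {V : Type*} [AddCommGroup V] [Module ℂ V] {f : U P →ₗ[ℂ] V}
    (N : ℤ) (h : ∀ i, N ≤ F.degA i → f (F.a i) = 0) : f ∈ finHom F.a V :=
  (F.finite_degA_lt N).subset fun i hi => by
    by_contra hc
    exact hi (h i (not_lt.1 hc))

/-- The map `p ↦ f(u S(p))` on `U(P)`, where `S` is the antipode. -/
def tail {V : Type*} [AddCommGroup V] [Module ℂ V] (f : U L →ₗ[ℂ] V) (u : U L) : U P →ₗ[ℂ] V :=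
  f ∘ₗ LinearMap.mulLeft ℂ u ∘ₗ (incU P).toLinearMap ∘ₗ antipode

theorem tail_apply {V : Type*} [AddCommGroup V] [Module ℂ V] (f : U L →ₗ[ℂ] V) (u : U L) (p : U P) :
    tail f u p = f (u * incU P (antipode p)) := rfl

theorem tail_mem {V : Type*} [AddCommGroup V] [Module ℂ V] {f : U L →ₗ[ℂ] V} (hf : f ∈ G.homU V)
    (u : U L) : tail f u ∈ finHom F.a V := by
  obtain ⟨N, hN⟩ := hf
  have hu : u ∈ ⨆ n, G.grU n := iSup_grU G ▸ Submodule.mem_top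
  induction hu using Submodule.iSup_induction' with
  | zero =>
    have : tail f (0 : U L) = (0 : U P →ₗ[ℂ] V) := by ext; simp [tail_apply]
    rw [this]; exact zero_mem _
  | add u v _ _ hu hv =>
    have : tail f (u + v) = (tail f u + tail f v : U P →ₗ[ℂ] V) := by
      ext; simp [tail_apply, add_mul]
    rw [this]; exact add_mem hu hv
  | mem n u hu =>
    refine F.mem_finHom_of_bound (N - n) fun i hi => ?_
    rw [tail_apply, ← antipode_mapU]
    exact hN _ (by omega) _ (F.mul_mem hu (F.antipode_mem (F.incP_a_mem i)))

theorem split_tail_mem {f : U L →ₗ[ℂ] U L} (hf : f ∈ G.homU (U L)) (u : U L) :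
    F.split.toLinearMap ∘ₗ tail f u ∈ finHom F.a (U P ⊗[ℂ] U M) :=
  comp_mem_finHom F.a (F.tail_mem hf u) _

/-- The partial trace over `U(P)` of `p ↦ f(u S(p))`. On the invariants this is the projection of
`Hom(U(L), U(L))` to its coinvariants. -/
def Psi : G.HomUU →ₗ[ℂ] U L →ₗ[ℂ] U M :=
  LinearMap.mk₂ ℂ (fun f u => ptr F.a (F.split.toLinearMap ∘ₗ tail f.1 u))
    (fun f g u => by
      rw [← ptr_add _ (traceable_of_mem_finHom _ (F.split_tail_mem f.2 u))
        (traceable_of_mem_finHom _ (F.split_tail_mem g.2 u))]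
      congr 1; ext; simp [tail_apply])
    (fun c f u => by
      rw [← ptr_smul _ _ (traceable_of_mem_finHom _ (F.split_tail_mem f.2 u))]
      congr 1; ext; simp [tail_apply])
    (fun f u v => by
      rw [← ptr_add _ (traceable_of_mem_finHom _ (F.split_tail_mem f.2 u))
        (traceable_of_mem_finHom _ (F.split_tail_mem f.2 v))]
      congr 1; ext; simp [tail_apply, add_mul])
    (fun c f u => by
      rw [← ptr_smul _ _ (traceable_of_mem_finHom _ (F.split_tail_mem f.2 u))]
      congr 1; ext; simp [tail_apply])

theorem Psi_apply (f : G.HomUU) (u : U L) :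
    F.Psi f u = ptr F.a (F.split.toLinearMap ∘ₗ tail f.1 u) := rfl

/-- The map `p ↦ (x f)(u S(p))` is a commutator with the left multiplication by `x`, so its trace is
`0`. -/
theorem Psi_diagAct (x : P) (f : G.HomUU) : F.Psi (G.diagAct x f) = 0 := by
  ext u
  have h : F.split.toLinearMap ∘ₗ tail (G.diagAct x f).1 u =
      (LinearMap.mulLeft ℂ (toU x)).rTensor (U M) ∘ₗ (F.split.toLinearMap ∘ₗ tail f.1 u) -
        (F.split.toLinearMap ∘ₗ tail f.1 u) ∘ₗ LinearMap.mulLeft ℂ (toU x) := by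
    ext p
    have e1 : tail (G.diagAct x f).1 u p = toU (x : L) * tail f.1 u p +
        f.1 (u * incU P (antipode p) * toU (x : L)) := rfl
    have e2 : tail f.1 u (toU x * p) = - f.1 (u * incU P (antipode p) * toU (x : L)) := by
      rw [tail_apply, antipode_mul, antipode_toU, mul_neg, map_neg, map_mul (incU P), incU_toU, mul_neg,
        map_neg, mul_assoc]
    simp only [LinearMap.comp_apply, LinearMap.sub_apply, LinearEquiv.coe_coe,
      LinearMap.mulLeft_apply, e1, e2, ← split_left, incU_toU, map_add, map_neg]
    abel
  rw [Psi_apply, h, ptr_sub _ (traceable_rTensor _ (F.split_tail_mem f.2 u) _)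
    (traceable_comp _ (F.split_tail_mem f.2 u) _), ptr_comm _ (F.split_tail_mem f.2 u), sub_self]
  rfl

theorem Psi_boundaries {f : G.HomUU}
    (hf : f ∈ boundaries (V := G.HomUU) G.diagAct (fun x => -G.beta x) G.plus) : F.Psi f = 0 := by
  have : boundaries (V := G.HomUU) G.diagAct (fun x => -G.beta x) G.plus ≤ LinearMap.ker F.Psi := by
    refine iSup₂_le fun x hx => ?_
    rintro _ ⟨f, rfl⟩
    have hx' : x ∈ P := by
      rw [← LieSubalgebra.mem_toSubmodule, F.P_eq]; exact hx
    have hb : G.beta x = 0 := by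
      refine F.P_induction (p := fun x => G.beta x = 0) hx' (map_zero _) ?_ ?_
      · intro x y hx hy; rw [map_add, hx, hy, add_zero]
      · intro n hn x hx; exact F.beta_eq_zero n (by omega) x hx
    rw [LinearMap.mem_ker]
    simp only [hb, neg_zero, zero_smul, add_zero]
    exact F.Psi_diagAct ⟨x, hx'⟩ f
  exact this hf

theorem preUS_apply (F : TriangularFrame G P M A B) {f : G.HomUU} (hf : f ∈ G.preUS) (y : M) (v : U L) :
    f.1 (v * toU (y : L)) = G.beta y • f.1 v - toU (y : L) * f.1 v := by
  have hy : (y : L) ∈ G.minus := by rw [← F.M_eq]; exact y.2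
  have h1 := (Submodule.mem_iInf _).1 ((Submodule.mem_iInf _).1 hf (y : L)) hy
  have h2 := LinearMap.congr_fun (congrArg Subtype.val (LinearMap.mem_ker.1 h1)) v
  have h3 : toU (y : L) * f.1 v + f.1 (v * toU (y : L)) + (-G.beta (y : L)) • f.1 v = 0 := h2
  rw [neg_smul] at h3
  rw [eq_sub_iff_add_eq, add_comm]
  rwa [add_neg_eq_zero] at h3

theorem mem_preUS (F : TriangularFrame G P M A B) {f : G.HomUU}
    (h : ∀ (y : M) (v : U L), f.1 (v * toU (y : L)) = G.beta y • f.1 v - toU (y : L) * f.1 v) :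
    f ∈ G.preUS := by
  refine (Submodule.mem_iInf _).2 fun y => (Submodule.mem_iInf _).2 fun hy => ?_
  have hy' : y ∈ M := by rw [← LieSubalgebra.mem_toSubmodule, F.M_eq]; exact hy
  rw [LinearMap.mem_ker]
  refine Subtype.ext (LinearMap.ext fun v => ?_)
  change toU y * f.1 v + f.1 (v * toU y) + (-G.beta y) • f.1 v = 0
  rw [h ⟨y, hy'⟩ v, neg_smul]
  abel

/-- The condition that `Psi` turns the right action of `y` into the left action by `β(y) - y`. -/
def Equivariant (y : M) : Prop := ∀ f ∈ G.preUS, ∀ u : U L,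
  F.Psi f (u * toU (y : L)) = G.beta y • F.Psi f u - toU y * F.Psi f u

/-- The equivariance of `Psi` for an element `y` whose adjoint action on `U(P)` has the form
`p ↦ s(p) + h r(p)`, where `h` normalizes `U(P)` and `[h, y] = -β(h) y`. -/
theorem equivariant_of_decomposition (y h : M) (s r t : U P →ₗ[ℂ] U P)
    (hy : ∀ p, adU (y : L) (incU P p) = incU P (s p) + toU (h : L) * incU P (r p))
    (hh : ∀ p, adU (h : L) (incU P p) = incU P (t p))
    (hr : ∀ p, r (t p) = t (r p) + G.beta h • r p) : F.Equivariant y := by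
  intro f hf u
  set T := F.split.toLinearMap ∘ₗ tail f.1 u with hT
  have hTm : T ∈ finHom F.a (U P ⊗[ℂ] U M) := F.split_tail_mem f.2 u
  have tr := fun X : U P →ₗ[ℂ] U P => traceable_rTensor F.a hTm X
  have tc := fun X : U P →ₗ[ℂ] U P => traceable_comp F.a hTm X
  have tl : ∀ m : U M, ∀ {X : U P →ₗ[ℂ] U P ⊗[ℂ] U M}, Traceable F.a X →
      Traceable F.a ((LinearMap.mulLeft ℂ m).lTensor (U P) ∘ₗ X) :=
    fun m X hX => hX.lTensor F.a _
  have hm : ∀ (z : M) (q : U P) (m : U M), toU (z : L) * (incU P q * incU M m) =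
      incU P q * incU M (toU z * m) + adU (z : L) (incU P q) * incU M m := by
    intro z q m
    rw [map_mul, incU_toU, adU_apply]; noncomm_ring
  have L2 : ∀ v : U L, F.split (toU (h : L) * v) =
      (LinearMap.mulLeft ℂ (toU h)).lTensor (U P) (F.split v) + t.rTensor (U M) (F.split v) := by
    intro v
    induction v using F.split_induction with
    | hadd a b ha hb => simp only [mul_add, map_add, ha, hb]; abel
    | h q m => rw [hm, hh, map_add, split_mul, split_mul, split_mul]; simp
  have L1 : ∀ v : U L, F.split (toU (y : L) * v) =
      (LinearMap.mulLeft ℂ (toU y)).lTensor (U P) (F.split v) + s.rTensor (U M) (F.split v) +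
      (LinearMap.mulLeft ℂ (toU h)).lTensor (U P) (r.rTensor (U M) (F.split v)) +
      (t ∘ₗ r).rTensor (U M) (F.split v) := by
    intro v
    induction v using F.split_induction with
    | hadd a b ha hb => simp only [mul_add, map_add, ha, hb]; abel
    | h q m =>
      rw [hm, hy, add_mul, mul_assoc (toU (h : L)), hm h, hh]
      simp only [map_add, split_mul]
      simp
      abel
  have key : F.split.toLinearMap ∘ₗ tail f.1 (u * toU (y : L)) =
      G.beta y • T - ((LinearMap.mulLeft ℂ (toU y)).lTensor (U P) ∘ₗ T + s.rTensor (U M) ∘ₗ T +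
        (LinearMap.mulLeft ℂ (toU h)).lTensor (U P) ∘ₗ (r.rTensor (U M) ∘ₗ T) +
        (t ∘ₗ r).rTensor (U M) ∘ₗ T) + T ∘ₗ s - (G.beta h • (T ∘ₗ r) -
        ((LinearMap.mulLeft ℂ (toU h)).lTensor (U P) ∘ₗ (T ∘ₗ r) + (t.rTensor (U M) ∘ₗ T) ∘ₗ r)) := by
    ext p
    have e0 : toU (y : L) * incU P (antipode p) = incU P (antipode p) * toU (y : L) +
        (incU P (antipode (s p)) - incU P (antipode (r p)) * toU (h : L)) := by
      rw [toU_mul_eq, ← antipode_mapU, adU_antipode, hy, map_add, antipode_mul, antipode_toU,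
        antipode_mapU, antipode_mapU, antipode_mapU, mul_neg, ← sub_eq_add_neg]
    have e1 : tail f.1 (u * toU (y : L)) p = (G.beta y • tail f.1 u p - toU (y : L) * tail f.1 u p) +
        (tail f.1 u (s p) - (G.beta h • tail f.1 u (r p) - toU (h : L) * tail f.1 u (r p))) := by
      simp only [tail_apply]
      rw [mul_assoc, e0, mul_add, mul_sub, map_add, map_sub, ← mul_assoc, ← mul_assoc,
        F.preUS_apply hf, F.preUS_apply hf]
    simp only [LinearMap.comp_apply, LinearMap.sub_apply, LinearMap.add_apply, LinearMap.smul_apply,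
      LinearEquiv.coe_coe, e1, map_add, map_sub, map_smul, L1, L2, hT]
    abel
  have t0 := traceable_of_mem_finHom F.a hTm
  have hth : t.rTensor (U M) ∘ₗ T ∈ finHom F.a (U P ⊗[ℂ] U M) := comp_mem_finHom F.a hTm _
  have e3 : ptr F.a ((t.rTensor (U M) ∘ₗ T) ∘ₗ r) = ptr F.a (T ∘ₗ (r ∘ₗ t)) := by
    rw [ptr_comm _ hth, ptr_comm _ hTm, ← LinearMap.comp_assoc, ← LinearMap.rTensor_comp]
  have e4 : r ∘ₗ t = t ∘ₗ r + G.beta h • r := by ext p; simp [hr]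
  have e5 : ptr F.a (T ∘ₗ (r ∘ₗ t)) = ptr F.a (T ∘ₗ (t ∘ₗ r)) + G.beta h • ptr F.a (T ∘ₗ r) := by
    rw [e4, LinearMap.comp_add, LinearMap.comp_smul, ptr_add _ (tc _) ((tc _).smul _ _),
      ptr_smul _ _ (tc _)]
  rw [Psi_apply, key, Psi_apply, ← hT]
  rw [ptr_sub _ (((t0.smul _ _).sub _ ((((tl _ t0).add _ (tr s)).add _ (tl _ (tr r))).add _ (tr _))).add _
      (tc s)) (((tc r).smul _ _).sub _ ((tl _ (tc r)).add _ (traceable_comp _ hth r))),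
    ptr_add _ ((t0.smul _ _).sub _ ((((tl _ t0).add _ (tr s)).add _ (tl _ (tr r))).add _ (tr _))) (tc s),
    ptr_sub _ (t0.smul _ _) ((((tl _ t0).add _ (tr s)).add _ (tl _ (tr r))).add _ (tr _)),
    ptr_add _ (((tl _ t0).add _ (tr s)).add _ (tl _ (tr r))) (tr _),
    ptr_add _ ((tl _ t0).add _ (tr s)) (tl _ (tr r)), ptr_add _ (tl _ t0) (tr s),
    ptr_sub _ ((tc r).smul _ _) ((tl _ (tc r)).add _ (traceable_comp _ hth r)),
    ptr_add _ (tl _ (tc r)) (traceable_comp _ hth r), ptr_smul _ _ t0, ptr_smul _ _ (tc r),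
    ptr_lTensor _ _ t0, ptr_lTensor _ _ (tr r), ptr_lTensor _ _ (tc r), ← ptr_comm _ hTm s,
    ← ptr_comm _ hTm r, ← ptr_comm _ hTm (t ∘ₗ r), e3, e5]
  simp only [LinearMap.mulLeft_apply]
  abel

/-- The equivariance of `Psi` is inherited by brackets because `β` vanishes on them. -/
theorem Equivariant.lie {y z : M} (hy : F.Equivariant y) (hz : F.Equivariant z) :
    F.Equivariant ⁅y, z⁆ := by
  intro f hf u
  rw [LieSubalgebra.coe_bracket, toU_lie, mul_sub, map_sub, ← mul_assoc, ← mul_assoc, hz f hf,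
    hy f hf, hy f hf, hz f hf, F.beta_lie, toU_lie]
  simp only [mul_sub, sub_mul, mul_smul_comm, smul_sub, zero_smul, mul_assoc]
  rw [smul_comm (G.beta y)]
  abel

/-- An element whose adjoint action preserves `U(P)`. -/
theorem exists_adU_of_normalizes (F : TriangularFrame G P M A B) (y : M) (h : ∀ x : P, ⁅(y : L), (x : L)⁆ ∈ P) :
    ∃ s : U P →ₗ[ℂ] U P, ∀ p, adU (y : L) (incU P p) = incU P (s p) := by
  refine exists_factor (adU (y : L) ∘ₗ (incU P).toLinearMap) (incU P).toLinearMap F.incP_injective ?_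
  intro p
  simp only [LinearMap.comp_apply, AlgHom.toLinearMap_apply]
  induction p using U_induction with
  | h1 => exact ⟨0, by simp [adU_one]⟩
  | hadd a b ha hb =>
    obtain ⟨c, hc⟩ := ha
    obtain ⟨d, hd⟩ := hb
    exact ⟨c + d, by simp [hc, hd]⟩
  | hsmul c a ha =>
    obtain ⟨d, hd⟩ := ha
    exact ⟨c • d, by simp [hd]⟩
  | hmul x a ha =>
    obtain ⟨d, hd⟩ := ha
    refine ⟨toU (⟨_, h x⟩ : P) * a + toU x * d, ?_⟩
    rw [map_mul, adU_mul, hd, incU_toU, adU_toU, map_add, map_mul, map_mul, incU_toU, incU_toU]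

end TriangularFrame

end Frame

end Wakimoto

end

/-! ### Equivariance, and the description of `US` by maps `U(P) → U(M)` -/

noncomputable section

namespace Wakimoto

section Frame

attribute [local instance 100] LieRing.ofAssociativeRing

variable {L : Type*} [LieRing L] [LieAlgebra ℂ L]
variable {G : SemiInfinite L} {P M : LieSubalgebra ℂ L} {A B : Type*}

namespace TriangularFrame

variable (F : TriangularFrame G P M A B)

theorem Equivariant.smul_add {y z : M} (c : ℂ) (hy : F.Equivariant y) (hz : F.Equivariant z) :
    F.Equivariant (c • y + z) := by
  intro f hf u
  have h1 : ((c • y + z : M) : L) = c • (y : L) + z := rfl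
  rw [h1]
  simp only [map_add, map_smul, mul_add, mul_smul_comm, hy f hf, hz f hf, add_mul, smul_mul_assoc,
    add_smul, smul_sub, smul_assoc]
  abel

theorem lie_mem_P (F : TriangularFrame G P M A B) {y : L} (hy : y ∈ G.gr 0) (x : P) : ⁅y, (x : L)⁆ ∈ P := by
  refine F.P_induction (p := fun x => ⁅y, x⁆ ∈ P) x.2 (by simp) ?_ ?_
  · intro x x' hx hx'; rw [lie_add]; exact add_mem hx hx'
  · intro n hn x hx
    exact F.mem_P hn (by simpa using F.lie_mem_gr hy hx)

theorem equivariant_of_normalizes (y : M) (hy : ∀ x : P, ⁅(y : L), (x : L)⁆ ∈ P) :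
    F.Equivariant y := by
  obtain ⟨s, hs⟩ := F.exists_adU_of_normalizes y hy
  exact F.equivariant_of_decomposition y 0 s 0 0 (by simp [hs]) (by simp [adU_apply]) (by simp)

/-- The sum `U(P) + h U(P)` is direct for `0 ≠ h ∈ M` normalizing `U(P)`. -/
theorem incP_add_mul_injective (F : TriangularFrame G P M A B) {h : M} (hh : h ≠ 0)
    {t : U P →ₗ[ℂ] U P}
    (ht : ∀ p, adU (h : L) (incU P p) = incU P (t p)) {q q' : U P}
    (h0 : incU P q + toU (h : L) * incU P q' = 0) : q = 0 ∧ q' = 0 := by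
  have h1 : (q + t q') ⊗ₜ[ℂ] (1 : U M) + q' ⊗ₜ[ℂ] toU h = 0 := by
    apply F.split.symm.injective
    rw [map_add, split_symm, split_symm, map_zero, map_one, mul_one, map_add, ← ht, incU_toU,
      ← h0, toU_mul_eq]
    abel
  have h2 : q + t q' = 0 := by
    have := congrArg (TensorProduct.rid ℂ (U P) ∘
      (counit : U M →ₐ[ℂ] ℂ).toLinearMap.lTensor (U P)) h1
    simpa [counit_toU] using this
  have h3 : q' = 0 := by
    rw [h2, TensorProduct.zero_tmul, zero_add] at h1
    refine F.a.ext_elem fun i => ?_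
    have h4 := congrArg (tcoef F.a i) h1
    rw [tcoef_tmul, map_zero, smul_eq_zero] at h4
    rcases h4 with h4 | h4
    · rw [h4]; simp
    · exact absurd (toU_injective (h4.trans (map_zero _).symm)) hh
  rw [h3, map_zero, add_zero] at h2
  exact ⟨h2, h3⟩

/-- For a Chevalley generator `y` one has `[y, U(P)] ⊆ U(P) + h U(P)`. The sum is direct, so the
components of the bracket with `y` are linear maps, and `[h, y] = -β(h) y` determines how they
commute with `ad h`. -/
theorem equivariant_of_chevalley (y h : M) (hy : (y : L) ∈ G.gr (-1)) (hh : (h : L) ∈ G.gr 0)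
    (hyx : ∀ x ∈ G.gr 1, ∃ c : ℂ, ⁅(y : L), x⁆ = c • (h : L))
    (hb : ⁅(h : L), (y : L)⁆ = -(G.beta h) • (y : L)) : F.Equivariant y := by
  obtain ⟨t, ht⟩ := F.exists_adU_of_normalizes h (F.lie_mem_P hh)
  have hlie : ∀ x : P, ∃ (x' : P) (c : ℂ), ⁅(y : L), (x : L)⁆ = x' + c • (h : L) := by
    intro x
    refine F.P_induction (p := fun x => ∃ (x' : P) (c : ℂ), ⁅(y : L), x⁆ = x' + c • (h : L)) x.2 ?_ ?_ ?_
    · exact ⟨0, 0, by simp⟩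
    · rintro x x' ⟨z, c, hz⟩ ⟨z', c', hz'⟩
      refine ⟨z + z', c + c', ?_⟩
      rw [lie_add, hz, hz', add_smul, AddMemClass.coe_add]; abel
    · intro n hn x hx
      by_cases h1 : n = 1
      · obtain ⟨c, hc⟩ := hyx x (h1 ▸ hx)
        exact ⟨0, c, by simp [hc]⟩
      · have := F.lie_mem_gr hy hx
        exact ⟨⟨_, F.mem_P (by omega) this⟩, 0, by simp⟩
  by_cases h0 : h = 0
  · refine F.equivariant_of_normalizes y fun x => ?_
    obtain ⟨x', c, hx'⟩ := hlie x
    rw [hx', h0]; simp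
  have hex : ∀ p : U P, ∃ w : U P × U P,
      adU (y : L) (incU P p) = incU P w.1 + toU (h : L) * incU P w.2 := by
    intro p
    induction p using U_induction with
    | h1 => exact ⟨0, by simp [adU_one]⟩
    | hadd a b ha hb =>
      obtain ⟨c, hc⟩ := ha
      obtain ⟨d, hd⟩ := hb
      exact ⟨c + d, by simp [hc, hd, mul_add]; abel⟩
    | hsmul c a ha =>
      obtain ⟨d, hd⟩ := ha
      exact ⟨c • d, by simp [hd]⟩
    | hmul x a ha =>
      obtain ⟨d, hd⟩ := ha
      obtain ⟨x', c, hx'⟩ := hlie x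
      have e1 : toU (x : L) * (toU (h : L) * incU P d.2) = toU (h : L) * incU P (toU x * d.2) -
          incU P (t (toU x) * d.2) := by
        have := ht (toU x)
        rw [incU_toU] at this
        rw [map_mul (incU P), map_mul (incU P), ← this, incU_toU, adU_apply]
        noncomm_ring
      refine ⟨(toU x' * a + toU x * d.1 - t (toU x) * d.2, c • a + toU x * d.2), ?_⟩
      rw [map_mul, adU_mul, hd, incU_toU, adU_toU, hx', mul_add, e1]
      simp only [map_add, map_sub, map_mul, map_smul, incU_toU, add_mul, mul_add, smul_mul_assoc,
        mul_smul_comm]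
      abel
  let J : U P × U P →ₗ[ℂ] U L := (incU P).toLinearMap.coprod
    (LinearMap.mulLeft ℂ (toU (h : L)) ∘ₗ (incU P).toLinearMap)
  have hJ : Function.Injective J := by
    rw [injective_iff_map_eq_zero]
    intro w hw
    have := F.incP_add_mul_injective h0 ht (q := w.1) (q' := w.2) (by simpa [J] using hw)
    exact Prod.ext this.1 this.2
  obtain ⟨w, hw⟩ := exists_factor (adU (y : L) ∘ₗ (incU P).toLinearMap) J hJ
    (fun p => by simpa [J] using hex p)
  have hw' : ∀ p, adU (y : L) (incU P p) = incU P (w p).1 + toU (h : L) * incU P (w p).2 := by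
    intro p; simpa [J] using hw p
  refine F.equivariant_of_decomposition y h (LinearMap.fst ℂ _ _ ∘ₗ w) (LinearMap.snd ℂ _ _ ∘ₗ w) t
    hw' ht fun p => ?_
  have e1 : adU (h : L) (adU (y : L) (incU P p)) - adU (y : L) (adU (h : L) (incU P p)) =
      -(G.beta h) • adU (y : L) (incU P p) := by
    rw [show adU (h : L) (adU (y : L) (incU P p)) - adU (y : L) (adU (h : L) (incU P p)) =
      (toU (h : L) * toU (y : L) - toU (y : L) * toU (h : L)) * incU P p -
        incU P p * (toU (h : L) * toU (y : L) - toU (y : L) * toU (h : L)) by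
          simp only [adU_apply]; noncomm_ring, ← toU_lie, hb, map_smul, adU_apply, smul_mul_assoc,
          mul_smul_comm, smul_sub]
  rw [ht, hw', hw', map_add, adU_mul, adU_toU, lie_self, map_zero, zero_mul, zero_add, ht, ht] at e1
  have e2 : incU P (t (w p).1 - (w (t p)).1 + G.beta h • (w p).1) +
      toU (h : L) * incU P (t (w p).2 - (w (t p)).2 + G.beta h • (w p).2) = 0 := by
    rw [neg_smul, eq_neg_iff_add_eq_zero] at e1
    rw [← e1]
    simp only [map_add, map_sub, map_smul, mul_add, mul_sub, mul_smul_comm, smul_add]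
    abel
  have e3 := (F.incP_add_mul_injective h0 ht e2).2
  simp only [LinearMap.comp_apply, LinearMap.snd_apply]
  rw [← sub_eq_zero, ← neg_eq_zero, ← e3]
  abel

theorem equivariant (y : M) : F.Equivariant y := by
  let K : LieSubalgebra ℂ M :=
    { carrier := {y | F.Equivariant y}
      zero_mem' := by intro f hf u; simp
      add_mem' := by
        intro y z hy hz
        simpa using Equivariant.smul_add F 1 hy hz
      smul_mem' := by
        intro c y hy
        have := Equivariant.smul_add F c hy (z := 0) (by intro f hf u; simp)
        simpa using this
      lie_mem' := by
        intro y z hy hz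
        exact Equivariant.lie F hy hz }
  exact F.M_gen K (fun y hy => F.equivariant_of_normalizes y (F.lie_mem_P hy))
    (fun y h hy hh h1 h2 => F.equivariant_of_chevalley y h hy hh h1 h2) y

theorem beta_lie_M (F : TriangularFrame G P M A B) (x y : M) : (G.beta ∘ₗ M.toSubmodule.subtype) ⁅x, y⁆ = 0 := F.beta_lie x y

/-- The antipode of `U(M)` twisted by `β`. -/
def Sb : U M →ₗ[ℂ] U M := twistedAntipode (G.beta ∘ₗ M.toSubmodule.subtype) F.beta_lie_M

theorem Sb_one : F.Sb 1 = 1 := twistedAntipode_one _ _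

theorem Sb_mul (m n : U M) : F.Sb (m * n) = F.Sb n * F.Sb m := twistedAntipode_mul _ _ m n

theorem Sb_toU (y : M) : F.Sb (toU y) = G.beta y • 1 - toU y := twistedAntipode_toU _ _ y

/-- On invariants, `Psi f` is determined by its restriction to `U(P)`. -/
theorem Psi_mul {f : G.HomUU} (hf : f ∈ G.preUS) (u : U L) (m : U M) :
    F.Psi f (u * incU M m) = F.Sb m * F.Psi f u := by
  induction m using U_induction generalizing u with
  | h1 => simp [Sb_one]
  | hadd a b ha hb => simp [mul_add, ha, hb, add_mul]
  | hsmul c a ha => simp [ha]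
  | hmul y m hm =>
    rw [map_mul (incU M), incU_toU, ← mul_assoc, hm, F.equivariant y f hf, Sb_mul, Sb_toU, mul_sub, mul_sub,
      sub_mul, mul_smul_comm, mul_smul_comm, mul_one, smul_mul_assoc, mul_assoc]

/-- For maps with values in `U(M)` the partial trace only sees the value at `u`. -/
theorem Psi_of_range (f : G.HomUU) (f' : U L →ₗ[ℂ] U M) (h : ∀ v, f.1 v = incU M (f' v)) (u : U L) :
    F.Psi f u = f' u := by
  rw [Psi_apply]
  refine (ptr_tmul F.a 1 (f' ∘ₗ LinearMap.mulLeft ℂ u ∘ₗ (incU P).toLinearMap ∘ₗ antipode)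
    fun i => ?_).trans (by simp [antipode_one])
  simp only [LinearMap.comp_apply, LinearEquiv.coe_coe, tail_apply, h, split_incM, tcoef_tmul]
  rfl

/-- The extension of a map on `U(P)` to `U(L)` that is `U(M)`-equivariant on the right. -/
def extM (φ : U P →ₗ[ℂ] U M) : U L →ₗ[ℂ] U M :=
  TensorProduct.lift ((LinearMap.mul ℂ (U M)).flip.compl₁₂ φ F.Sb) ∘ₗ F.split.toLinearMap

theorem extM_mul (φ : U P →ₗ[ℂ] U M) (p : U P) (m : U M) :
    F.extM φ (incU P p * incU M m) = F.Sb m * φ p := by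
  rw [extM, LinearMap.comp_apply, LinearEquiv.coe_coe, split_mul]
  simp

theorem extM_incP (φ : U P →ₗ[ℂ] U M) (p : U P) : F.extM φ (incU P p) = φ p := by
  have := F.extM_mul φ p 1
  rwa [map_one, mul_one, Sb_one, one_mul] at this

theorem extM_mul_incM (φ : U P →ₗ[ℂ] U M) (u : U L) (m : U M) :
    F.extM φ (u * incU M m) = F.Sb m * F.extM φ u := by
  induction u using F.split_induction with
  | hadd a b ha hb => rw [add_mul, map_add, map_add, ha, hb, mul_add]
  | h p n => rw [mul_assoc, ← map_mul, extM_mul, extM_mul, Sb_mul, mul_assoc]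

theorem extM_mem {φ : U P →ₗ[ℂ] U M} (hφ : φ ∈ finHom F.a (U M)) :
    F.extM φ ∈ G.homU (U M) := by
  obtain ⟨N, hN⟩ := F.finHom_bound hφ
  refine ⟨N, fun n hn u hu => ?_⟩
  rw [← F.basisU.linearCombination_repr u, Finsupp.linearCombination_apply, Finsupp.sum, map_sum]
  refine Finset.sum_eq_zero fun z hz => ?_
  have h1 := eigen_repr F.basisU (adU F.delta) _ F.basisU_eig (F.mem_grU.1 hu)
    (Finsupp.mem_support_iff.1 hz)
  have h2 : (F.degA z.1 : ℤ) - F.degB z.2 = n := by exact_mod_cast h1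
  rw [map_smul, basisU_apply, extM_mul, hN _ (by omega), mul_zero, smul_zero]

/-- The invariant element of `Hom(U(L), U(L))` with given restriction to `U(P)` and values in
`U(M)`. -/
def lift {φ : U P →ₗ[ℂ] U M} (hφ : φ ∈ finHom F.a (U M)) : G.preUS :=
  ⟨⟨(incU M).toLinearMap ∘ₗ F.extM φ, G.comp_left_mem (F.extM_mem hφ) _⟩, F.mem_preUS <| by
    intro y v
    simp only [LinearMap.comp_apply, AlgHom.toLinearMap_apply]
    rw [← incU_toU, extM_mul_incM, Sb_toU, sub_mul, smul_mul_assoc, one_mul, map_sub, map_smul,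
      map_mul, incU_toU]⟩

theorem lift_apply {φ : U P →ₗ[ℂ] U M} (hφ : φ ∈ finHom F.a (U M)) (v : U L) :
    (F.lift hφ).1.1 v = incU M (F.extM φ v) := rfl

/-- The embedding of `US` into `Hom(U(P), U(M))`. -/
def Phi : G.US →ₗ[ℂ] U P →ₗ[ℂ] U M :=
  (boundaries (V := G.HomUU) G.diagAct (fun x => -G.beta x) G.plus).liftQ
    (LinearMap.lcomp ℂ (U M) (incU P).toLinearMap ∘ₗ F.Psi)
    (fun f hf => by
      rw [LinearMap.mem_ker, LinearMap.comp_apply, F.Psi_boundaries hf, map_zero]) ∘ₗ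
  Submodule.subtype (semiInvariants (V := G.HomUU) G.diagAct (fun x => -G.beta x) G.minus G.plus)

theorem Phi_mk (f : G.preUS) (p : U P) : F.Phi (G.mkUS f) p = F.Psi f.1 (incU P p) := rfl

theorem exists_mkUS (g : G.US) : ∃ f, G.mkUS f = g := by
  obtain ⟨_, f, hf, rfl⟩ := g
  exact ⟨⟨f, hf⟩, rfl⟩

theorem Phi_mem (g : G.US) : F.Phi g ∈ finHom F.a (U M) := by
  obtain ⟨f, rfl⟩ := exists_mkUS g
  obtain ⟨N, hN⟩ := f.1.2
  refine F.mem_finHom_of_bound N fun i hi => ?_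
  rw [Phi_mk, Psi_apply]
  have : ∀ j, tail f.1.1 (incU P (F.a i)) (F.a j) = 0 := by
    intro j
    rw [tail_apply, ← antipode_mapU]
    exact hN _ (by omega) _ (F.mul_mem (F.incP_a_mem i) (F.antipode_mem (F.incP_a_mem j)))
  have h0 : tail f.1.1 (incU P (F.a i)) = (0 : U P →ₗ[ℂ] U L) := F.a.ext fun j => by
    rw [this]; rfl
  rw [h0, LinearMap.comp_zero, ptr_zero]

theorem Phi_of_range (f : G.preUS) (f' : U L →ₗ[ℂ] U M) (h : ∀ v, f.1.1 v = incU M (f' v))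
    (p : U P) : F.Phi (G.mkUS f) p = f' (incU P p) := by
  rw [Phi_mk]
  exact F.Psi_of_range f.1 f' h _

theorem Phi_lift {φ : U P →ₗ[ℂ] U M} (hφ : φ ∈ finHom F.a (U M)) : F.Phi (G.mkUS (F.lift hφ)) = φ := by
  ext p
  rw [F.Phi_of_range _ _ (F.lift_apply hφ), extM_incP]

/-- The elements `s_j` generate the augmentation ideal of `U(P)` as a right ideal. -/
theorem exists_partial : ∃ D : Fin F.rank → (U P →ₗ[ℂ] U P),
    ∀ p, p = counit p • 1 + ∑ j, toU (F.s j) * D j p := by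
  have hK : ∀ x : P, ∀ u : U P, ∃ q : Fin F.rank → U P, toU x * u = ∑ j, toU (F.s j) * q j := by
    let K : LieSubalgebra ℂ P :=
      { carrier := {x | ∀ u : U P, ∃ q : Fin F.rank → U P, toU x * u = ∑ j, toU (F.s j) * q j}
        zero_mem' := fun u => ⟨0, by simp⟩
        add_mem' := by
          intro x y hx hy u
          obtain ⟨q, hq⟩ := hx u
          obtain ⟨r, hr⟩ := hy u
          exact ⟨q + r, by simp [add_mul, hq, hr, mul_add, Finset.sum_add_distrib]⟩
        smul_mem' := by
          intro c x hx u
          obtain ⟨q, hq⟩ := hx u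
          exact ⟨c • q, by simp [hq, Finset.smul_sum]⟩
        lie_mem' := by
          intro x y hx hy u
          obtain ⟨q, hq⟩ := hx (toU y * u)
          obtain ⟨r, hr⟩ := hy (toU x * u)
          exact ⟨q - r, by
            simp [toU_lie, sub_mul, mul_assoc, hq, hr, mul_sub, Finset.sum_sub_distrib]⟩ }
    refine fun x => F.s_gen K (fun j u => ?_) x
    refine ⟨Pi.single j u, ?_⟩
    rw [Finset.sum_eq_single j]
    · simp
    · intro i _ hij; simp [hij]
    · simp
  have hex : ∀ p : U P, ∃ q : Fin F.rank → U P, p = counit p • 1 + ∑ j, toU (F.s j) * q j := by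
    intro p
    induction p using U_induction with
    | h1 => exact ⟨0, by simp⟩
    | hadd a b ha hb =>
      obtain ⟨q, hq⟩ := ha
      obtain ⟨r, hr⟩ := hb
      refine ⟨q + r, ?_⟩
      conv_lhs => rw [hq, hr]
      simp only [map_add, add_smul, Pi.add_apply, mul_add, Finset.sum_add_distrib]
      abel
    | hsmul c a ha =>
      obtain ⟨q, hq⟩ := ha
      refine ⟨c • q, ?_⟩
      conv_lhs => rw [hq]
      simp [Finset.smul_sum, smul_smul]
    | hmul x a _ =>
      obtain ⟨q, hq⟩ := hK x a
      exact ⟨q, by rw [map_mul, counit_toU, zero_mul, zero_smul, zero_add, hq]⟩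
  choose q hq using fun i => hex (F.a i)
  refine ⟨fun j => F.a.constr ℂ fun i => q i j, fun p => ?_⟩
  have : (LinearMap.id : U P →ₗ[ℂ] U P) = (counit : U P →ₐ[ℂ] ℂ).toLinearMap.smulRight (1 : U P) +
      ∑ j, LinearMap.mulLeft ℂ (toU (F.s j)) ∘ₗ F.a.constr ℂ (fun i => q i j) := by
    refine F.a.ext fun i => ?_
    conv_lhs => rw [LinearMap.id_apply, hq i]
    simp [Module.Basis.constr_basis]
  have h := LinearMap.congr_fun this p
  simpa using h

/-- The decomposition of `exists_partial`, extended to `U(L) = U(P) ⊗ U(M)`. -/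
theorem exists_partialU (F : TriangularFrame G P M A B) : ∃ (D : Fin F.rank → (U L →ₗ[ℂ] U L)) (e : U L →ₗ[ℂ] U M),
    ∀ v, v = incU M (e v) + ∑ j, toU (F.s j : L) * D j v := by
  obtain ⟨D, hD⟩ := F.exists_partial
  refine ⟨fun j => F.split.symm.toLinearMap ∘ₗ (D j).rTensor (U M) ∘ₗ F.split.toLinearMap,
    (TensorProduct.lid ℂ (U M)).toLinearMap ∘ₗ (counit : U P →ₐ[ℂ] ℂ).toLinearMap.rTensor (U M) ∘ₗ
      F.split.toLinearMap, fun v => ?_⟩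
  induction v using F.split_induction with
  | hadd a b ha hb =>
    conv_lhs => rw [ha, hb]
    simp only [map_add, mul_add, Finset.sum_add_distrib]
    abel
  | h p m =>
    conv_lhs => rw [hD p]
    simp only [LinearMap.comp_apply, LinearEquiv.coe_coe, split_mul, LinearMap.rTensor_tmul,
      split_symm, TensorProduct.lid_tmul, AlgHom.toLinearMap_apply, map_add, map_smul, map_one,
      map_sum, map_mul, add_mul, Finset.sum_mul, incU_toU, smul_mul_assoc, one_mul, mul_assoc]

/-- An element of `Hom(U(L), U(L))` is congruent, modulo the boundaries, to a map with values in
`U(M)`. -/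
theorem exists_boundary (F : TriangularFrame G P M A B) (f : G.HomUU) : ∃ g : G.HomUU, ∃ g' : U L →ₗ[ℂ] U M,
    (∀ v, g.1 v = incU M (g' v)) ∧
    f - g ∈ boundaries (V := G.HomUU) G.diagAct (fun x => -G.beta x) G.plus := by
  obtain ⟨D, e, hD⟩ := F.exists_partialU
  let T : Module.End ℂ (U L →ₗ[ℂ] U L) :=
    -∑ j, LinearMap.llcomp ℂ (U L) (U L) (U L) (D j) ∘ₗ
      LinearMap.lcomp ℂ (U L) (LinearMap.mulRight ℂ (toU (F.s j : L)))
  have hT : ∀ (h : U L →ₗ[ℂ] U L) u, T h u = -∑ j, D j (h (u * toU (F.s j : L))) := by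
    intro h u
    simp [T, LinearMap.sum_apply]
  obtain ⟨N, hN⟩ := f.2
  have hk : ∀ k : ℕ, ∀ n : ℤ, N ≤ n + k → ∀ u ∈ G.grU n, (T ^ k) f.1 u = 0 := by
    intro k
    induction k with
    | zero => intro n hn u hu; exact hN n (by simpa using hn) u hu
    | succ k ih =>
      intro n hn u hu
      rw [pow_succ', Module.End.mul_apply, hT, Finset.sum_eq_zero, neg_zero]
      intro j _
      rw [ih (n + 1) (by push_cast at hn; omega) _ (G.mul_toU_mem (F.s_mem j) hu), map_zero]
  have hfin : ∀ u, ∃ K : ℕ, ∀ k ≥ K, (T ^ k) f.1 u = 0 := by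
    intro u
    have hu : u ∈ ⨆ n, G.grU n := iSup_grU G ▸ Submodule.mem_top
    induction hu using Submodule.iSup_induction' with
    | zero => exact ⟨0, fun k _ => map_zero _⟩
    | add u v _ _ hu hv =>
      obtain ⟨K, hK⟩ := hu
      obtain ⟨K', hK'⟩ := hv
      exact ⟨max K K', fun k hk => by
        rw [map_add, hK k (le_trans (le_max_left _ _) hk), hK' k (le_trans (le_max_right _ _) hk),
          add_zero]⟩
    | mem n u hu => exact ⟨(N - n).toNat, fun k hk' => hk k n (by omega) u hu⟩
  have hfin' : ∀ u, (Function.support fun k => (T ^ k) f.1 u).Finite := by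
    intro u
    obtain ⟨K, hK⟩ := hfin u
    refine (Set.finite_lt_nat K).subset fun k hk' => ?_
    by_contra hc
    exact hk' (hK k (not_lt.1 hc))
  let S : U L →ₗ[ℂ] U L :=
    { toFun := fun u => ∑ᶠ k, (T ^ k) f.1 u
      map_add' := fun u v => by
        rw [← finsum_add_distrib (hfin' u) (hfin' v)]
        simp only [map_add]
      map_smul' := fun c u => by
        rw [RingHom.id_apply, smul_finsum' c (hfin' u)]
        simp only [map_smul] }
  have hS : ∀ u, S u = ∑ᶠ k, (T ^ k) f.1 u := fun _ => rfl
  have hSmem : S ∈ G.homU (U L) := by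
    refine ⟨N, fun n hn u hu => ?_⟩
    rw [hS, finsum_eq_zero_of_forall_eq_zero]
    intro k
    exact hk k n (by omega) u hu
  have hSK : ∀ u K, (∀ k ≥ K, (T ^ k) f.1 u = 0) → S u = ∑ k ∈ Finset.range K, (T ^ k) f.1 u := by
    intro u K hK
    rw [hS, finsum_eq_sum_of_support_subset]
    intro k hk'
    rw [Finset.coe_range, Set.mem_Iio]
    by_contra hc
    exact hk' (hK k (not_lt.1 hc))
  have hST : ∀ u, S u = f.1 u + T S u := by
    intro u
    choose K hK using hfin
    set N' := K u + ∑ j, K (u * toU (F.s j : L)) with hN'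
    have h1 : ∀ j, K (u * toU (F.s j : L)) ≤ N' := fun j =>
      (Finset.single_le_sum (f := fun j => K (u * toU (F.s j : L))) (fun _ _ => Nat.zero_le _)
        (Finset.mem_univ j)).trans (Nat.le_add_left _ _)
    rw [hSK u (N' + 1) (fun k hk' => hK u k (by omega)), Finset.sum_range_succ', add_comm, hT]
    congr 1
    have h2 : ∀ j, S (u * toU (F.s j : L)) =
        ∑ k ∈ Finset.range N', (T ^ k) f.1 (u * toU (F.s j : L)) := fun j =>
      hSK _ _ fun k hk' => hK _ k ((h1 j).trans hk')
    simp only [h2, map_sum]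
    rw [Finset.sum_comm, ← Finset.sum_neg_distrib]
    refine Finset.sum_congr rfl fun k _ => ?_
    rw [pow_succ', Module.End.mul_apply, hT]
  refine ⟨⟨(incU M).toLinearMap ∘ₗ e ∘ₗ S, G.comp_left_mem (G.comp_left_mem hSmem _) _⟩, e ∘ₗ S,
    fun v => rfl, ?_⟩
  have hsum : f - ⟨(incU M).toLinearMap ∘ₗ e ∘ₗ S, G.comp_left_mem (G.comp_left_mem hSmem _) _⟩ =
      ∑ j, G.diagAct (F.s j : L) ⟨D j ∘ₗ S, G.comp_left_mem hSmem _⟩ := by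
    refine Subtype.ext (LinearMap.ext fun u => ?_)
    have e1 : (∑ j, G.diagAct (F.s j : L) ⟨D j ∘ₗ S, G.comp_left_mem hSmem _⟩ : G.HomUU).1 u =
        ∑ j, (toU (F.s j : L) * D j (S u) + D j (S (u * toU (F.s j : L)))) := by
      rw [AddSubmonoidClass.coe_finsetSum, LinearMap.sum_apply]
      rfl
    rw [e1, Finset.sum_add_distrib]
    change f.1 u - incU M (e (S u)) = _
    have h1 := hST u
    have h2 := hD (S u)
    rw [hT] at h1
    rw [sub_eq_iff_eq_add]
    have h3 : f.1 u = S u + ∑ j, D j (S (u * toU (F.s j : L))) := by rw [h1]; abel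
    rw [h3]
    conv_lhs => rw [h2]
    abel
  rw [hsum]
  refine Submodule.sum_mem _ fun j _ => ?_
  refine Submodule.mem_iSup_of_mem (F.s j : L) (Submodule.mem_iSup_of_mem
    (Submodule.mem_iSup_of_mem ⟨1, one_pos⟩ (F.s_mem j))
    ⟨⟨D j ∘ₗ S, G.comp_left_mem hSmem _⟩, ?_⟩)
  simp [F.beta_eq_zero 1 one_ne_zero _ (F.s_mem j)]

/-- The kernel of `Psi` is the space of boundaries. -/
theorem mem_boundaries {f : G.HomUU} (hf : F.Psi f = 0) :
    f ∈ boundaries (V := G.HomUU) G.diagAct (fun x => -G.beta x) G.plus := by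
  obtain ⟨g, g', hg, hb⟩ := F.exists_boundary f
  have h1 := F.Psi_boundaries hb
  rw [map_sub, hf, zero_sub, neg_eq_zero] at h1
  have h2 : g = 0 := by
    refine Subtype.ext (LinearMap.ext fun v => ?_)
    rw [hg, ← F.Psi_of_range g g' hg, h1]
    simp
  rwa [h2, sub_zero] at hb

theorem Phi_injective : Function.Injective F.Phi := by
  rw [injective_iff_map_eq_zero]
  intro g hg
  obtain ⟨f, rfl⟩ := exists_mkUS g
  have h1 : F.Psi f.1 = 0 := by
    ext v
    induction v using F.split_induction with
    | hadd a b ha hb => rw [map_add, ha, hb]; simp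
    | h p m =>
      rw [F.Psi_mul f.2, ← Phi_mk, hg]; simp
  exact Subtype.ext ((Submodule.Quotient.mk_eq_zero _).2 (F.mem_boundaries h1))

theorem mkUS_lift_Phi (g : G.US) : G.mkUS (F.lift (F.Phi_mem g)) = g :=
  F.Phi_injective (F.Phi_lift _)

theorem Phi_rightUS_M (g : G.US) (y : M) (p : U P) :
    F.Phi (G.rightUS (y : L) g) p = F.Phi g p * toU y := by
  obtain ⟨f, rfl⟩ := exists_mkUS g
  change F.Psi (G.rightAct (y : L) f.1) (incU P p) = F.Psi f.1 (incU P p) * toU y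
  rw [Psi_apply, Psi_apply, ← LinearMap.mulRight_apply (R := ℂ), ← ptr_lTensor _ _
    (traceable_of_mem_finHom _ (F.split_tail_mem f.1.2 _))]
  congr 1
  ext q
  simp only [LinearMap.comp_apply, LinearEquiv.coe_coe, ← F.split_right, incU_toU]
  rfl

/-- The right action of `L` on `US` in terms of the maps `Phi g`. -/
theorem Phi_rightUS (g : G.US) (x : L) (p : U P) :
    F.Phi (G.rightUS x g) p = ∑ᶠ i, tcoef F.a i
      (F.split (incU M (F.Phi g (p * antipode (F.a i))) * toU x)) := by
  conv_lhs => rw [← F.mkUS_lift_Phi g]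
  change F.Psi (G.rightAct x (F.lift (F.Phi_mem g)).1) (incU P p) = _
  rw [Psi_apply, ptr]
  refine finsum_congr fun i => ?_
  simp only [LinearMap.comp_apply, LinearEquiv.coe_coe, tail_apply]
  change tcoef F.a i (F.split ((F.lift (F.Phi_mem g)).1.1 _ * toU x)) = _
  rw [lift_apply, ← map_mul, extM_incP]

end TriangularFrame

end Frame

end Wakimoto

end

/-! ### The filtration of `U(L)` by the degree in `U(P)` -/

noncomputable section

namespace Wakimoto

section EigenSpan

/-- An eigenvector in the span of a set of eigenvectors is in the span of those with the same
eigenvalue. -/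
theorem mem_span_of_eigen {V : Type*} [AddCommGroup V] [Module ℂ V] (T : Module.End ℂ V)
    {S : Set V} (hS : ∀ v ∈ S, ∃ c : ℂ, T v = c • v) {v : V} (hv : v ∈ Submodule.span ℂ S) {c : ℂ}
    (h : T v = c • v) : v ∈ Submodule.span ℂ {w | w ∈ S ∧ T w = c • w} := by
  have key : ∀ w ∈ Submodule.span ℂ S, w ∈ Submodule.span ℂ {w | w ∈ S ∧ T w = c • w} ⊔
      ⨆ d, ⨆ _ : d ≠ c, T.eigenspace d := by
    intro w hw
    induction hw using Submodule.span_induction with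
    | zero => exact zero_mem _
    | add x y _ _ hx hy => exact add_mem hx hy
    | smul r x _ hx => exact Submodule.smul_mem _ r hx
    | mem w hw =>
      obtain ⟨d, hd⟩ := hS w hw
      by_cases hdc : d = c
      · exact Submodule.mem_sup_left (Submodule.subset_span ⟨hw, hdc ▸ hd⟩)
      · exact Submodule.mem_sup_right (Submodule.mem_iSup_of_mem d (Submodule.mem_iSup_of_mem hdc
          (Module.End.mem_eigenspace_iff.2 hd)))
  obtain ⟨x, hx, y, hy, rfl⟩ := Submodule.mem_sup.1 (key v hv)
  have hx' : x ∈ T.eigenspace c := by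
    have : Submodule.span ℂ {w | w ∈ S ∧ T w = c • w} ≤ T.eigenspace c := by
      rw [Submodule.span_le]
      rintro w ⟨-, hw⟩
      exact Module.End.mem_eigenspace_iff.2 hw
    exact this hx
  have hy' : y ∈ T.eigenspace c :=
    (Submodule.add_mem_iff_right _ hx').1 (Module.End.mem_eigenspace_iff.2 h)
  rw [Submodule.disjoint_def.1 (T.eigenspaces_iSupIndep c) y hy' hy, add_zero]
  exact hx

theorem finsum_repr {E V A : Type*} [AddCommGroup E] [Module ℂ E] [AddCommGroup V] [Module ℂ V]
    (a : Module.Basis A ℂ E) (ζ : E →ₗ[ℂ] V) (x : E) : ∑ᶠ i, a.repr x i • ζ (a i) = ζ x := by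
  rw [finsum_eq_sum_of_support_subset (s := (a.repr x).support)]
  · conv_rhs => rw [← a.linearCombination_repr x, Finsupp.linearCombination_apply, Finsupp.sum,
      map_sum]
    simp only [map_smul]
  · intro i hi
    rw [Finset.mem_coe, Finsupp.mem_support_iff]
    intro h0
    exact hi (by simp only [h0, zero_smul])

end EigenSpan

section Frame

attribute [local instance 100] LieRing.ofAssociativeRing

variable {L : Type*} [LieRing L] [LieAlgebra ℂ L]

theorem mapU_mapU {H K : Type*} [LieRing H] [LieAlgebra ℂ H] [LieRing K] [LieAlgebra ℂ K]
    (φ : K →ₗ⁅ℂ⁆ L) (ψ : H →ₗ⁅ℂ⁆ K) (χ : H →ₗ⁅ℂ⁆ L) (h : ∀ x, φ (ψ x) = χ x) (u : U H) :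
    mapU φ (mapU ψ u) = mapU χ u := by
  induction u using U_induction with
  | h1 => simp
  | hadd a b ha hb => simp [ha, hb]
  | hsmul c a ha => simp [ha]
  | hmul x a ha => simp [mapU_toU, ha, h]

/-- The enveloping algebra is spanned by the products of elements of a spanning set. -/
theorem span_list_prod {S : Set L} (hS : Submodule.span ℂ S = ⊤) :
    Submodule.span ℂ {u : U L | ∃ l : List L, (∀ x ∈ l, x ∈ S) ∧ u = (l.map toU).prod} = ⊤ := by
  rw [eq_top_iff]
  intro u hu
  clear hu
  induction u using U_induction with
  | h1 => exact Submodule.subset_span ⟨[], by simp, by simp⟩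
  | hadd a b ha hb => exact add_mem ha hb
  | hsmul c a ha => exact Submodule.smul_mem _ c ha
  | hmul x u hu =>
    have hx : x ∈ Submodule.span ℂ S := hS ▸ Submodule.mem_top
    induction hx using Submodule.span_induction with
    | zero => rw [map_zero, zero_mul]; exact zero_mem _
    | add x y _ _ hx hy => rw [map_add, add_mul]; exact add_mem hx hy
    | smul c x _ hx => rw [map_smul, smul_mul_assoc]; exact Submodule.smul_mem _ c hx
    | mem x hx =>
      induction hu using Submodule.span_induction with
      | zero => rw [mul_zero]; exact zero_mem _
      | add x y _ _ hx hy => rw [mul_add]; exact add_mem hx hy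
      | smul c x _ hx => rw [mul_smul_comm]; exact Submodule.smul_mem _ c hx
      | mem u hu =>
        obtain ⟨l, hl, rfl⟩ := hu
        exact Submodule.subset_span ⟨x :: l, by
          intro y hy
          rcases List.mem_cons.1 hy with rfl | hy
          · exact hx
          · exact hl y hy, by simp⟩

variable {G : SemiInfinite L} {P M : LieSubalgebra ℂ L} {A B : Type*}

namespace TriangularFrame

variable (F : TriangularFrame G P M A B)

theorem delta_mem_gr : F.delta ∈ G.gr 0 := by
  rw [F.mem_gr, lie_self, Int.cast_zero, zero_smul]

theorem delta_mem_M : F.delta ∈ M := F.mem_M le_rfl F.delta_mem_gr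

theorem repr_a_eq {p : U P} {c : ℂ} (hp : incU P p ∈ eigU F.delta c) {i : A}
    (hi : F.a.repr p i ≠ 0) : (F.degA i : ℂ) = c := by
  obtain ⟨t, ht⟩ := F.exists_adU_of_normalizes ⟨F.delta, F.delta_mem_M⟩ (F.lie_mem_P F.delta_mem_gr)
  have key : ∀ q : U P, ∀ d : ℂ, incU P q ∈ eigU F.delta d → t q = d • q := by
    intro q d hq
    apply F.incP_injective
    rw [← ht, map_smul]
    exact mem_eigU.1 hq
  exact eigen_repr F.a t _ (fun j => key _ _ (F.a_mem j)) (key p c hp) hi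

theorem apply_eq_zero_of_bound {V : Type*} [AddCommGroup V] [Module ℂ V] {f : U P →ₗ[ℂ] V} {N : ℕ}
    (hf : ∀ i, N ≤ F.degA i → f (F.a i) = 0) {p : U P} {n : ℕ} (hn : N ≤ n)
    (hp : incU P p ∈ eigU F.delta n) : f p = 0 := by
  rw [← finsum_repr F.a f p]
  refine finsum_eq_zero_of_forall_eq_zero fun i => ?_
  by_cases hi : F.a.repr p i = 0
  · rw [hi, zero_smul]
  · have h1 := F.repr_a_eq hp hi
    rw [hf i (by have : F.degA i = n := by exact_mod_cast h1
                 omega), smul_zero]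

theorem repr_basisU (v : U L) (i : A) (j : B) :
    F.basisU.repr v (i, j) = F.b.repr (tcoef F.a i (F.split v)) j := by
  induction v using F.split_induction with
  | hadd a b ha hb => simp [ha, hb]
  | h p m => simp [basisU, split_mul, tcoef_tmul]; ring

/-- The span of the products `p m`, with `p` in `U(P)` of degree less than `k` and `m` in `U(M)`. -/
def Fil (F : TriangularFrame G P M A B) (k : ℕ) : Submodule ℂ (U L) :=
  Submodule.span ℂ {u | ∃ (p : U P) (m : U M) (n : ℕ), n < k ∧ incU P p ∈ eigU F.delta n ∧
    u = incU P p * incU M m}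

theorem mem_Fil {k n : ℕ} {p : U P} (hp : incU P p ∈ eigU F.delta n) (hn : n < k) (m : U M) :
    incU P p * incU M m ∈ F.Fil k := Submodule.subset_span ⟨p, m, n, hn, hp, rfl⟩

theorem Fil_mono {j k : ℕ} (h : j ≤ k) : F.Fil j ≤ F.Fil k := by
  refine Submodule.span_mono ?_
  rintro _ ⟨p, m, n, hn, hp, rfl⟩
  exact ⟨p, m, n, hn.trans_le h, hp, rfl⟩

theorem Fil_mul {k : ℕ} {u : U L} (hu : u ∈ F.Fil k) (m : U M) : u * incU M m ∈ F.Fil k := by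
  induction hu using Submodule.span_induction with
  | zero => rw [zero_mul]; exact zero_mem _
  | add x y _ _ hx hy => rw [add_mul]; exact add_mem hx hy
  | smul c x _ hx => rw [smul_mul_assoc]; exact Submodule.smul_mem _ c hx
  | mem u hu =>
    obtain ⟨p, m', n, hn, hp, rfl⟩ := hu
    rw [mul_assoc, ← map_mul]
    exact F.mem_Fil hp hn _

theorem mul_Fil {k n : ℕ} {q : U P} (hq : incU P q ∈ eigU F.delta n) {u : U L} (hu : u ∈ F.Fil k) :
    incU P q * u ∈ F.Fil (n + k) := by
  induction hu using Submodule.span_induction with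
  | zero => rw [mul_zero]; exact zero_mem _
  | add x y _ _ hx hy => rw [mul_add]; exact add_mem hx hy
  | smul c x _ hx => rw [mul_smul_comm]; exact Submodule.smul_mem _ c hx
  | mem u hu =>
    obtain ⟨p, m, n', hn, hp, rfl⟩ := hu
    rw [← mul_assoc, ← map_mul]
    refine F.mem_Fil (n := n + n') ?_ (by omega) _
    rw [map_mul, Nat.cast_add]
    exact mul_mem_eigU hq hp

theorem tcoef_Fil {k : ℕ} {u : U L} (hu : u ∈ F.Fil k) {i : A} (hi : k ≤ F.degA i) :
    tcoef F.a i (F.split u) = 0 := by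
  induction hu using Submodule.span_induction with
  | zero => simp
  | add x y _ _ hx hy => rw [map_add, map_add, hx, hy, add_zero]
  | smul c x _ hx => rw [map_smul, map_smul, hx, smul_zero]
  | mem u hu =>
    obtain ⟨p, m, n, hn, hp, rfl⟩ := hu
    rw [split_mul, tcoef_tmul]
    by_cases h0 : F.a.repr p i = 0
    · rw [h0, zero_smul]
    · have h1 := F.repr_a_eq hp h0
      have : F.degA i = n := by exact_mod_cast h1
      omega

/-- The products of homogeneous elements of `P` of total degree `n`. -/
def homProd (G : SemiInfinite L) (P : LieSubalgebra ℂ L) (n : ℕ) : Set (U P) :=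
  {u | ∃ l : List (ℕ × P), (∀ z ∈ l, 0 < z.1 ∧ (z.2 : L) ∈ G.gr z.1) ∧
    (l.map Prod.fst).sum = n ∧ u = (l.map fun z => toU z.2).prod}

theorem homProd_mem {n : ℕ} {u : U P} (hu : u ∈ homProd G P n) : incU P u ∈ eigU F.delta n := by
  obtain ⟨l, hl, rfl, rfl⟩ := hu
  induction l with
  | nil => simpa using one_mem_eigU F.delta
  | cons z l ih =>
    simp only [List.map_cons, List.sum_cons, List.prod_cons, map_mul, incU_toU, Nat.cast_add]
    refine mul_mem_eigU (toU_mem_eigU ?_) (ih fun w hw => hl w (List.mem_cons_of_mem _ hw))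
    simpa using F.lie_delta _ _ (hl z (List.mem_cons_self ..)).2

theorem mem_span_homProd {n : ℕ} {p : U P} (hp : incU P p ∈ eigU F.delta n) :
    p ∈ Submodule.span ℂ (homProd G P n) := by
  have htop : (⊤ : Submodule ℂ (U P)) ≤ Submodule.span ℂ (⋃ n, homProd G P n) := by
    intro u hu
    clear hu
    induction u using U_induction with
    | h1 => exact Submodule.subset_span (Set.mem_iUnion.2 ⟨0, [], by simp, by simp, by simp⟩)
    | hadd a b ha hb => exact add_mem ha hb
    | hsmul c a ha => exact Submodule.smul_mem _ c ha
    | hmul x u hu =>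
      obtain ⟨x, hx⟩ := x
      have : ∃ hx' : x ∈ P, toU (⟨x, hx'⟩ : P) * u ∈ Submodule.span ℂ (⋃ n, homProd G P n) := by
        refine F.P_induction (p := fun x => ∃ hx' : x ∈ P, toU (⟨x, hx'⟩ : P) * u ∈
          Submodule.span ℂ (⋃ n, homProd G P n)) hx ⟨zero_mem _, ?_⟩ ?_ ?_
        · rw [show (⟨0, zero_mem _⟩ : P) = 0 from rfl, map_zero, zero_mul]; exact zero_mem _
        · rintro x y ⟨hx, h1⟩ ⟨hy, h2⟩
          refine ⟨add_mem hx hy, ?_⟩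
          rw [show (⟨x + y, add_mem hx hy⟩ : P) = ⟨x, hx⟩ + ⟨y, hy⟩ from rfl, map_add, add_mul]
          exact add_mem h1 h2
        · intro k hk x hx
          refine ⟨F.mem_P hk hx, ?_⟩
          induction hu using Submodule.span_induction with
          | zero => rw [mul_zero]; exact zero_mem _
          | add x y _ _ hx hy => rw [mul_add]; exact add_mem hx hy
          | smul c x _ hx => rw [mul_smul_comm]; exact Submodule.smul_mem _ c hx
          | mem u hu =>
            obtain ⟨n, l, hl, h1, rfl⟩ := Set.mem_iUnion.1 hu
            refine Submodule.subset_span (Set.mem_iUnion.2 ⟨k.toNat + n,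
              (k.toNat, ⟨x, F.mem_P hk hx⟩) :: l, ?_, by simp [h1], by simp⟩)
            intro z hz
            rcases List.mem_cons.1 hz with rfl | hz
            · refine ⟨by simpa using hk, ?_⟩
              simpa [Int.toNat_of_nonneg hk.le] using hx
            · exact hl z hz
      exact this.2
  obtain ⟨t, ht⟩ := F.exists_adU_of_normalizes ⟨F.delta, F.delta_mem_M⟩ (F.lie_mem_P F.delta_mem_gr)
  have key : ∀ q : U P, ∀ d : ℂ, incU P q ∈ eigU F.delta d → t q = d • q := by
    intro q d hq
    apply F.incP_injective
    rw [← ht, map_smul]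
    exact mem_eigU.1 hq
  have h := mem_span_of_eigen t (S := ⋃ n, homProd G P n) (fun v hv => by
    obtain ⟨k, hk⟩ := Set.mem_iUnion.1 hv
    exact ⟨k, key _ _ (F.homProd_mem hk)⟩) (htop trivial) (key p n hp)
  have hle : {w | w ∈ (⋃ n, homProd G P n) ∧ t w = (n : ℂ) • w} ⊆
      homProd G P n ∪ {0} := by
    rintro w ⟨hw, htw⟩
    obtain ⟨k, hk⟩ := Set.mem_iUnion.1 hw
    by_cases hkn : k = n
    · exact Or.inl (hkn ▸ hk)
    · right
      have h1 := key _ _ (F.homProd_mem hk)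
      rw [htw, ← sub_eq_zero, ← sub_smul, smul_eq_zero] at h1
      refine h1.resolve_left ?_
      rw [sub_eq_zero]
      exact_mod_cast Ne.symm hkn
  have h2 := Submodule.span_mono hle h
  rwa [Submodule.span_union, Submodule.span_singleton_eq_bot.2 rfl, sup_bot_eq] at h2

/-- Commuting an element of degree `-l ≤ 0` past `U(P)` does not raise the degree in `U(P)`, and
lowers it if `l > 0`. -/
theorem adU_mem_Fil {p : U P} {n : ℕ} (hp : incU P p ∈ eigU F.delta n) {y : L} {l : ℕ}
    (hy : y ∈ G.gr (-(l : ℤ))) :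
    adU y (incU P p) ∈ F.Fil (n + 1) ∧ (0 < l → adU y (incU P p) ∈ F.Fil n) := by
  have hp' := F.mem_span_homProd hp
  clear hp
  induction hp' using Submodule.span_induction with
  | zero => simp
  | add x z _ _ hx hz =>
    rw [map_add, map_add]
    exact ⟨add_mem hx.1 hz.1, fun h => add_mem (hx.2 h) (hz.2 h)⟩
  | smul c x _ hx =>
    rw [map_smul, map_smul]
    exact ⟨Submodule.smul_mem _ c hx.1, fun h => Submodule.smul_mem _ c (hx.2 h)⟩
  | mem p hp =>
    obtain ⟨w, hw, rfl, rfl⟩ := hp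
    induction w generalizing y l with
    | nil => simp [adU_one]
    | cons z w ih =>
      have hw' : ∀ v ∈ w, 0 < v.1 ∧ (v.2 : L) ∈ G.gr v.1 := fun v hv =>
        hw v (List.mem_cons_of_mem _ hv)
      obtain ⟨hz0, hz⟩ := hw z (List.mem_cons_self ..)
      set q := (w.map fun z => toU z.2).prod with hq
      set n := (w.map Prod.fst).sum with hn
      have hqe : incU P q ∈ eigU F.delta n := F.homProd_mem ⟨w, hw', hn.symm, hq⟩
      have hze : incU P (toU z.2) ∈ eigU F.delta z.1 := by
        rw [incU_toU]
        exact toU_mem_eigU (by simpa using F.lie_delta _ _ hz)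
      simp only [List.map_cons, List.sum_cons, List.prod_cons]
      rw [← hq, ← hn, map_mul, adU_mul, incU_toU, adU_toU]
      have h1 := ih hy hw'
      have hyz := F.lie_mem_gr hy hz
      have h2 : toU ⁅y, (z.2 : L)⁆ * incU P q ∈ F.Fil (z.1 + n + 1) ∧
          (0 < l → toU ⁅y, (z.2 : L)⁆ * incU P q ∈ F.Fil (z.1 + n)) := by
        by_cases hlt : l < z.1
        · have hm : ⁅y, (z.2 : L)⁆ ∈ P := F.mem_P (by omega) hyz
          have he : incU P (toU (⟨_, hm⟩ : P) * q) ∈ eigU F.delta ((z.1 - l + n : ℕ) : ℂ) := by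
            rw [map_mul, incU_toU, Nat.cast_add, Nat.cast_sub hlt.le]
            refine mul_mem_eigU (toU_mem_eigU ?_) hqe
            rw [F.lie_delta _ _ hyz]; push_cast; congr 1; ring
          have e : toU ⁅y, (z.2 : L)⁆ * incU P q =
              incU P (toU (⟨_, hm⟩ : P) * q) * incU M 1 := by
            rw [map_mul, incU_toU, map_one, mul_one]
          rw [e]
          exact ⟨F.mem_Fil he (by omega) _, fun h => F.mem_Fil he (by omega) _⟩
        · have hyz' : ⁅y, (z.2 : L)⁆ ∈ G.gr (-((l - z.1 : ℕ) : ℤ)) := by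
            convert hyz using 2; omega
          have hm : ⁅y, (z.2 : L)⁆ ∈ M := F.mem_M (by omega) hyz'
          have h3 := (ih hyz' hw').1
          have h4 : toU ⁅y, (z.2 : L)⁆ * incU P q ∈ F.Fil (n + 1) := by
            rw [toU_mul_eq]
            refine add_mem ?_ h3
            rw [show toU ⁅y, (z.2 : L)⁆ = incU M (toU (⟨_, hm⟩ : M)) from (incU_toU M ⟨_, hm⟩).symm]
            exact F.mem_Fil hqe (by omega) _
          exact ⟨F.Fil_mono (by omega) h4, fun _ => F.Fil_mono (by omega) h4⟩
      have h5 := F.mul_Fil hze h1.1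
      rw [incU_toU, ← add_assoc] at h5
      refine ⟨add_mem h2.1 h5, fun h => add_mem (h2.2 h) ?_⟩
      have h6 := F.mul_Fil hze (h1.2 h)
      rwa [incU_toU] at h6

theorem toU_mul_Fil {k l : ℕ} {y : L} (hy : y ∈ G.gr (-(l : ℤ))) {u : U L} (hu : u ∈ F.Fil k) :
    toU y * u ∈ F.Fil k := by
  induction hu using Submodule.span_induction with
  | zero => rw [mul_zero]; exact zero_mem _
  | add x y _ _ hx hy => rw [mul_add]; exact add_mem hx hy
  | smul c x _ hx => rw [mul_smul_comm]; exact Submodule.smul_mem _ c hx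
  | mem u hu =>
    obtain ⟨p, m, n, hn, hp, rfl⟩ := hu
    rw [← mul_assoc, toU_mul_eq, add_mul]
    refine add_mem ?_ (F.Fil_mono (by omega) (F.Fil_mul (F.adU_mem_Fil hp hy).1 m))
    have hm : y ∈ M := F.mem_M (by omega) hy
    rw [show toU y = incU M (toU (⟨y, hm⟩ : M)) from (incU_toU M ⟨y, hm⟩).symm, mul_assoc, ← map_mul]
    exact F.mem_Fil hp hn _

/-- Elements of the enveloping algebra of a subalgebra concentrated in negative degrees commute with
`U(P)` up to terms of lower degree in `U(P)`. -/
theorem commutator_mem_Fil {am : LieSubalgebra ℂ L}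
    (ham : ∀ y ∈ am, y ∈ ⨆ n : {n : ℤ // n < 0}, G.gr n) (w : U am) {p : U P} {n : ℕ}
    (hp : incU P p ∈ eigU F.delta n) :
    incU am w * incU P p - incU P p * incU am w ∈ F.Fil n := by
  have hle : am ≤ M := by
    intro y hy
    rw [← LieSubalgebra.mem_toSubmodule, F.M_eq]
    exact (iSup_le fun n : {n : ℤ // n < 0} =>
      le_iSup (fun n : {n : ℤ // n ≤ 0} => G.gr n) ⟨n, n.2.le⟩) (ham y hy)
  induction w using U_induction with
  | h1 => simp
  | hadd a b ha hb =>
    rw [map_add, add_mul, mul_add, add_sub_add_comm]; exact add_mem ha hb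
  | hsmul c a ha =>
    rw [map_smul, smul_mul_assoc, mul_smul_comm, ← smul_sub]; exact Submodule.smul_mem _ c ha
  | hmul y w hw =>
    have key : ∀ z ∈ ⨆ n : {n : ℤ // n < 0}, G.gr n,
        toU z * incU am w * incU P p - incU P p * (toU z * incU am w) ∈ F.Fil n := by
      intro z hz
      induction hz using Submodule.iSup_induction' with
      | zero => simp
      | add x y _ _ hx hy =>
        rw [map_add, add_mul, add_mul, mul_add, add_sub_add_comm]; exact add_mem hx hy
      | mem k z hz =>
        have hz' : z ∈ G.gr (-((-(k : ℤ)).toNat : ℤ)) := by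
          have := k.2
          convert hz using 2; omega
        have e : toU z * incU am w * incU P p - incU P p * (toU z * incU am w) =
            toU z * (incU am w * incU P p - incU P p * incU am w) +
              adU z (incU P p) * incU am w := by
          rw [adU_apply]; noncomm_ring
        rw [e, ← mapU_mapU M.incl (LieSubalgebra.inclusion hle) am.incl (fun _ => rfl) w]
        rw [← mapU_mapU M.incl (LieSubalgebra.inclusion hle) am.incl (fun _ => rfl) w] at hw
        exact add_mem (F.toU_mul_Fil hz' hw) (F.Fil_mul ((F.adU_mem_Fil hp hz').2
          (by have := k.2; omega)) _)
    have := key y (ham y y.2)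
    rwa [map_mul, incU_toU]

/-- The right action on `US` of an element of `P` annihilates all values at a given element of
`U(P)` if its degree is large. -/
theorem exists_Phi_rightUS_eq_zero (g : G.US) (p : U P) :
    ∃ K : ℕ, ∀ d : ℕ, K ≤ d → ∀ x ∈ G.gr d, F.Phi (G.rightUS x g) p = 0 := by
  set ψ : U P →ₗ[ℂ] U M := tail (F.extM (F.Phi g)) (incU P p) with hψ
  have hψ' : ∀ q, ψ q = F.Phi g (p * antipode q) := by
    intro q
    rw [hψ, tail_apply, ← map_mul, extM_incP]
  have hfin : {i | ψ (F.a i) ≠ 0}.Finite := F.tail_mem (F.extM_mem (F.Phi_mem g)) _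
  set K : ℕ := ∑ i ∈ hfin.toFinset, (F.degA i + 1 +
    ∑ j ∈ (F.b.repr (ψ (F.a i))).support, F.degB j) with hK
  refine ⟨K, fun d hd x hx => ?_⟩
  rw [Phi_rightUS]
  refine finsum_eq_zero_of_forall_eq_zero fun i => ?_
  rw [← hψ']
  by_cases hi : ψ (F.a i) = 0
  · rw [hi, map_zero, zero_mul, map_zero, map_zero]
  have hi1 : F.degA i + 1 + ∑ j ∈ (F.b.repr (ψ (F.a i))).support, F.degB j ≤ d :=
    (Finset.single_le_sum (f := fun i => F.degA i + 1 +
      ∑ j ∈ (F.b.repr (ψ (F.a i))).support, F.degB j) (fun _ _ => Nat.zero_le _)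
      (by simpa using hi)).trans hd
  rw [← F.b.linearCombination_repr (ψ (F.a i)), Finsupp.linearCombination_apply, Finsupp.sum, map_sum,
    Finset.sum_mul, map_sum, map_sum]
  refine Finset.sum_eq_zero fun j hj => ?_
  have hj1 : F.degB j ≤ ∑ j ∈ (F.b.repr (ψ (F.a i))).support, F.degB j :=
    Finset.single_le_sum (f := F.degB) (fun _ _ => Nat.zero_le _) hj
  rw [map_smul, smul_mul_assoc, map_smul, map_smul]
  have : tcoef F.a i (F.split (incU M (F.b j) * toU x)) = 0 := by
    refine F.b.ext_elem fun j' => ?_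
    rw [← repr_basisU, map_zero, Finsupp.zero_apply]
    by_contra hne
    have h1 : incU M (F.b j) * toU x ∈ eigU F.delta (-(F.degB j : ℂ) + d) :=
      mul_mem_eigU (F.b_mem j) (toU_mem_eigU (by simpa using F.lie_delta _ _ hx))
    have h2 := eigen_repr F.basisU (adU F.delta) _ F.basisU_eig (mem_eigU.1 h1) hne
    have h3 : (F.degA i : ℤ) - F.degB j' = -F.degB j + d := by exact_mod_cast h2
    omega
  rw [this, smul_zero]

/-- The right action of `x` of degree `d` on a map `φ` with values in the enveloping algebra of a
negatively graded subalgebra is, in the lowest degrees, given by `p ↦ -φ(p x)`. -/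
theorem Phi_rightUS_lift {am : LieSubalgebra ℂ L} (hle : am ≤ M)
    (ham : ∀ y ∈ am, y ∈ ⨆ n : {n : ℤ // n < 0}, G.gr n) {φ : U P →ₗ[ℂ] U am}
    (hφ : (mapU (LieSubalgebra.inclusion hle)).toLinearMap ∘ₗ φ ∈ finHom F.a (U M)) {k : ℕ}
    (hk : ∀ j < k, ∀ p, incU P p ∈ eigU F.delta (j : ℂ) → φ p = 0) {x : P} {d : ℕ}
    (hx : (x : L) ∈ G.gr d) {u : U P} {n : ℕ} (hu : incU P u ∈ eigU F.delta n)
    (hn : n + d ≤ k) :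
    F.Phi (G.rightUS (x : L) (G.mkUS (F.lift hφ))) u =
      -mapU (LieSubalgebra.inclusion hle) (φ (u * toU x)) := by
  have hxe : incU P (toU x) ∈ eigU F.delta d := by
    rw [incU_toU]; exact toU_mem_eigU (by simpa using F.lie_delta _ _ hx)
  rw [Phi_rightUS, F.Phi_lift]
  have h1 := finsum_repr F.a (((mapU (LieSubalgebra.inclusion hle)).toLinearMap ∘ₗ φ) ∘ₗ
    LinearMap.mulLeft ℂ u ∘ₗ antipode) (toU x)
  refine Eq.trans (finsum_congr fun i => ?_) (h1.trans ?_)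
  · simp only [LinearMap.comp_apply, LinearMap.mulLeft_apply, AlgHom.toLinearMap_apply]
    by_cases hi : φ (u * antipode (F.a i)) = 0
    · rw [hi]; simp
    · have hdi : d ≤ F.degA i := by
        by_contra hc
        refine hi (hk (n + F.degA i) (by omega) _ ?_)
        rw [map_mul, Nat.cast_add, ← antipode_mapU]
        exact mul_mem_eigU hu (antipode_mem_eigU (F.a_mem i))
      set w := φ (u * antipode (F.a i)) with hw
      have h2 := F.tcoef_Fil (F.commutator_mem_Fil ham w hxe) hdi
      rw [map_sub, map_sub, sub_eq_zero, incU_toU] at h2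
      have e : incU am w = incU M (mapU (LieSubalgebra.inclusion hle) w) :=
        (mapU_mapU M.incl (LieSubalgebra.inclusion hle) am.incl (fun _ => rfl) w).symm
      rw [e] at h2
      rw [h2, ← incU_toU, split_mul, tcoef_tmul]
  · simp [antipode_toU]

end TriangularFrame

end Frame

end Wakimoto

end

/-! ### Semi-induction: the projection to `U(am)` -/

noncomputable section

namespace Wakimoto

section Frame

attribute [local instance 100] LieRing.ofAssociativeRing

variable {L : Type*} [LieRing L] [LieAlgebra ℂ L]
variable {G : SemiInfinite L} {P M : LieSubalgebra ℂ L} {A B : Type*}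

/-- The data for the semi-induction of a character `lam` of a graded subalgebra `H = H₊ ⊕ H₋`:
complements `ap` and `am` of `H₊` in `P` and of `H₋` in `M`, with homogeneous bases. The condition
`height` makes a trace over `H₊` vanish, see `ptr_kappa_zeta_Bd`; it holds if `L` has a second
grading for which `H₊` is in positive degrees, `H₋` in degrees `≥ 0`. -/
structure SemiInductionFrame (F : TriangularFrame G P M A B) (H Hp Hm ap am : LieSubalgebra ℂ L)
    (lam : H →ₗ[ℂ] ℂ) (C D E : Type*) where
  ap_le : ap ≤ P
  am_le : am ≤ M
  Hp_le : Hp ≤ P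
  Hm_le : Hm ≤ M
  Hp_le_H : Hp ≤ H
  Hm_le_H : Hm ≤ H
  am_neg : ∀ y ∈ am, y ∈ ⨆ n : {n : ℤ // n < 0}, G.gr n
  bijP : Function.Bijective fun z : ap × Hp =>
    LieSubalgebra.inclusion ap_le z.1 + LieSubalgebra.inclusion Hp_le z.2
  bijM : Function.Bijective fun z : am × Hm =>
    LieSubalgebra.inclusion am_le z.1 + LieSubalgebra.inclusion Hm_le z.2
  H_split : ∀ h ∈ H, ∃ u ∈ Hp, ∃ v ∈ Hm, u + v = h
  lam_lie : ∀ x y : H, lam ⁅x, y⁆ = 0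
  lam_gr : ∀ n ≠ 0, ∀ h : H, (h : L) ∈ G.gr n → lam h = 0
  c : Module.Basis C ℂ (U ap)
  degC : C → ℕ
  c_mem : ∀ i, incU ap (c i) ∈ eigU F.delta (degC i)
  c_fin : ∀ n, {i | degC i = n}.Finite
  d : Module.Basis D ℂ (U am)
  degD : D → ℕ
  d_mem : ∀ i, incU am (d i) ∈ eigU F.delta (-(degD i : ℂ))
  e : Module.Basis E ℂ Hp
  degE : E → ℕ
  e_mem : ∀ i, (e i : L) ∈ G.gr (degE i)
  e_fin : ∀ n, {i | degE i = n}.Finite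
  Hm_span : Submodule.span ℂ {y : Hm | ∃ n, (y : L) ∈ G.gr n} = ⊤
  height : ∀ (i : E) (w v : Hm) (u : Hp), ⁅(e i : L), (w : L)⁆ = (u : L) + v →
    (lam ⟨v, Hm_le_H v.2⟩ + G.beta v = 0) ∧
    ∀ (x u' : Hp) (v' : Hm), ⁅(x : L), (v : L)⁆ = (u' : L) + v' → e.repr u' i = 0

namespace SemiInductionFrame

variable {F : TriangularFrame G P M A B} {H Hp Hm ap am : LieSubalgebra ℂ L} {lam : H →ₗ[ℂ] ℂ}
  {C D E : Type*} (W : SemiInductionFrame F H Hp Hm ap am lam C D E)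

theorem inter_eq_zero (F : TriangularFrame G P M A B) {x : L} (h1 : x ∈ P) (h2 : x ∈ M) : x = 0 := by
  have h := @F.bijective_add.1 (⟨x, h1⟩, 0) (0, ⟨x, h2⟩) (by simp)
  exact congrArg (fun z : P × M => (z.1 : L)) h

theorem sum_unique (W : SemiInductionFrame F H Hp Hm ap am lam C D E) {u u' : Hp} {v v' : Hm}
    (h : (u : L) + v = u' + v') : u = u' ∧ v = v' := by
  have h1 : (u : L) - u' = v' - v := by rw [sub_eq_sub_iff_add_eq_add, h, add_comm]
  have h2 : (u : L) - u' = 0 := inter_eq_zero F (sub_mem (W.Hp_le u.2) (W.Hp_le u'.2))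
    (h1 ▸ sub_mem (W.Hm_le v'.2) (W.Hm_le v.2))
  exact ⟨Subtype.ext (sub_eq_zero.1 h2), Subtype.ext (sub_eq_zero.1 (h1 ▸ h2)).symm⟩

/-- The decomposition `H = H₊ ⊕ H₋`. -/
def splitH : (Hp × Hm) ≃ₗ[ℂ] H :=
  LinearEquiv.ofBijective
    (((LieSubalgebra.inclusion W.Hp_le_H : Hp →ₗ⁅ℂ⁆ H) : Hp →ₗ[ℂ] H).coprod
      ((LieSubalgebra.inclusion W.Hm_le_H : Hm →ₗ⁅ℂ⁆ H) : Hm →ₗ[ℂ] H)) <| by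
    constructor
    · intro z w h
      have := W.sum_unique (u := z.1) (u' := w.1) (v := z.2) (v' := w.2) (congrArg Subtype.val h)
      exact Prod.ext this.1 this.2
    · intro h
      obtain ⟨u, hu, v, hv, huv⟩ := W.H_split h h.2
      exact ⟨(⟨u, hu⟩, ⟨v, hv⟩), Subtype.ext huv⟩

/-- The projection to `H₊`. -/
def prP : H →ₗ[ℂ] Hp := LinearMap.fst ℂ Hp Hm ∘ₗ W.splitH.symm.toLinearMap

/-- The projection to `H₋`. -/
def prM : H →ₗ[ℂ] Hm := LinearMap.snd ℂ Hp Hm ∘ₗ W.splitH.symm.toLinearMap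

theorem prP_add_prM (h : H) : (W.prP h : L) + W.prM h = h :=
  congrArg Subtype.val (W.splitH.apply_symm_apply h)

theorem prP_eq {h : H} {u : Hp} {v : Hm} (huv : (u : L) + v = h) : W.prP h = u :=
  (W.sum_unique ((W.prP_add_prM h).trans huv.symm)).1

/-- The bracket of `H₊` and `H₋` as an element of `H`. -/
abbrev brH (x : Hp) (y : Hm) : H :=
  ⁅(⟨x, W.Hp_le_H x.2⟩ : H), (⟨y, W.Hm_le_H y.2⟩ : H)⁆

/-- The character `lam + β` of `H₋`. -/
def chi : Hm →ₗ[ℂ] ℂ := lam ∘ₗ (LieSubalgebra.inclusion W.Hm_le_H : Hm →ₗ⁅ℂ⁆ H).toLinearMap +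
  G.beta ∘ₗ Hm.toSubmodule.subtype

theorem chi_apply (y : Hm) : W.chi y = lam ⟨y, W.Hm_le_H y.2⟩ + G.beta y := rfl

theorem chi_lie (x y : Hm) : W.chi ⁅x, y⁆ = 0 := by
  have h1 := W.lam_lie ⟨x, W.Hm_le_H x.2⟩ ⟨y, W.Hm_le_H y.2⟩
  have h2 := F.beta_lie ⟨x, W.Hm_le x.2⟩ ⟨y, W.Hm_le y.2⟩
  rw [chi_apply]
  exact (congrArg₂ (· + ·) h1 h2).trans (add_zero 0)

/-- The right action of `H₋` on `H₊ ≅ H / H₋`, twisted by the character `chi`. -/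
def ract : Hm →ₗ[ℂ] Module.End ℂ Hp :=
  LinearMap.mk₂ ℂ (fun y x => W.chi y • x + W.prP (W.brH x y))
    (fun y z x => by
      have : W.brH x (y + z) = W.brH x y + W.brH x z := Subtype.ext (lie_add (x : L) (y : L) z)
      rw [this, map_add, map_add, add_smul]; abel)
    (fun c y x => by
      have : W.brH x (c • y) = c • W.brH x y := Subtype.ext (lie_smul c (x : L) (y : L))
      rw [this, map_smul, map_smul, smul_add, smul_assoc])
    (fun y x z => by
      have : W.brH (x + z) y = W.brH x y + W.brH z y := Subtype.ext (add_lie (x : L) z (y : L))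
      rw [this, map_add, smul_add]; abel)
    (fun c y x => by
      have : W.brH (c • x) y = c • W.brH x y := Subtype.ext (smul_lie c (x : L) (y : L))
      rw [this, map_smul, smul_add, smul_comm])

theorem ract_apply (y : Hm) (x : Hp) : W.ract y x = W.chi y • x + W.prP (W.brH x y) := rfl

theorem ract_lie (y z : Hm) : W.ract ⁅y, z⁆ = W.ract z * W.ract y - W.ract y * W.ract z := by
  ext1 x
  have h1 := W.prP_add_prM (W.brH x y)
  have h2 := W.prP_add_prM (W.brH x z)
  have h3 := W.prP_add_prM (W.brH (W.prP (W.brH x y)) z)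
  have h4 := W.prP_add_prM (W.brH (W.prP (W.brH x z)) y)
  have h5 : W.prP (W.brH x ⁅y, z⁆) =
      W.prP (W.brH (W.prP (W.brH x y)) z) - W.prP (W.brH (W.prP (W.brH x z)) y) := by
    refine W.prP_eq (v := W.prM (W.brH (W.prP (W.brH x y)) z) - W.prM (W.brH (W.prP (W.brH x z)) y) +
      ⁅W.prM (W.brH x y), z⁆ - ⁅W.prM (W.brH x z), y⁆) ?_
    have e : ((W.brH x ⁅y, z⁆ : H) : L) = ⁅((W.brH x y : H) : L), (z : L)⁆ -
        ⁅((W.brH x z : H) : L), (y : L)⁆ := by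
      change ⁅(x : L), ⁅(y : L), (z : L)⁆⁆ = ⁅⁅(x : L), (y : L)⁆, (z : L)⁆ - ⁅⁅(x : L), (z : L)⁆, (y : L)⁆
      rw [leibniz_lie (x : L) (y : L) (z : L), ← lie_skew ⁅(x : L), (z : L)⁆ (y : L)]; abel
    rw [e, ← h1, ← h2, add_lie, add_lie]
    have e3 : ⁅(W.prP (W.brH x y) : L), (z : L)⁆ = W.prP (W.brH (W.prP (W.brH x y)) z) +
      W.prM (W.brH (W.prP (W.brH x y)) z) := h3.symm
    have e4 : ⁅(W.prP (W.brH x z) : L), (y : L)⁆ = W.prP (W.brH (W.prP (W.brH x z)) y) +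
      W.prM (W.brH (W.prP (W.brH x z)) y) := h4.symm
    rw [e3, e4]
    push_cast
    abel
  have h6 : ∀ (w : Hm) (c : ℂ) (u v : Hp), W.prP (W.brH (c • u + v) w) =
      c • W.prP (W.brH u w) + W.prP (W.brH v w) := by
    intro w c u v
    have : W.brH (c • u + v) w = c • W.brH u w + W.brH v w :=
      Subtype.ext (by
        change ⁅(c • (u : L) + (v : L)), (w : L)⁆ = c • ⁅(u : L), (w : L)⁆ + ⁅(v : L), (w : L)⁆
        rw [add_lie, smul_lie])
    rw [this, map_add, map_smul]
  simp only [LinearMap.sub_apply, Module.End.mul_apply, ract_apply, chi_lie, zero_smul, zero_add, h5, h6]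
  simp only [smul_add]
  rw [smul_comm (W.chi z)]
  abel

/-- The right action of `U(H₋)` on `H₊`. -/
def ractU : U Hm →ₐ[ℂ] (Module.End ℂ Hp)ᵐᵒᵖ :=
  UniversalEnvelopingAlgebra.lift ℂ
    ({ toFun := fun y => MulOpposite.op (W.ract y)
       map_add' := fun y z => by rw [map_add, MulOpposite.op_add]
       map_smul' := fun c y => by rw [map_smul, MulOpposite.op_smul]; rfl
       map_lie' := fun {y z} => by
        rw [LieRing.of_associative_ring_bracket, ract_lie, MulOpposite.op_sub, MulOpposite.op_mul,
          MulOpposite.op_mul] } : Hm →ₗ⁅ℂ⁆ (Module.End ℂ Hp)ᵐᵒᵖ)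

theorem ractU_toU (y : Hm) : W.ractU (toU y) = MulOpposite.op (W.ract y) :=
  UniversalEnvelopingAlgebra.lift_ι_apply ℂ _ y

/-- The isomorphism `U(M) ≅ U(am) ⊗ U(H₋)`. -/
def splitM : U M ≃ₗ[ℂ] U am ⊗[ℂ] U Hm := (mulEquiv _ _ W.bijM).symm

/-- The inclusion `U(am) → U(M)`. -/
abbrev inA : U am →ₐ[ℂ] U M := mapU (LieSubalgebra.inclusion W.am_le)

/-- The inclusion `U(H₋) → U(M)`. -/
abbrev inH : U Hm →ₐ[ℂ] U M := mapU (LieSubalgebra.inclusion W.Hm_le)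

theorem splitM_mul (a : U am) (w : U Hm) : W.splitM (W.inA a * W.inH w) = a ⊗ₜ w :=
  mulEquiv_symm_mul _ _ _ a w

theorem splitM_symm (a : U am) (w : U Hm) : W.splitM.symm (a ⊗ₜ w) = W.inA a * W.inH w := by
  rw [LinearEquiv.symm_apply_eq, splitM_mul]

theorem splitM_induction {p : U M → Prop} (W : SemiInductionFrame F H Hp Hm ap am lam C D E) (v : U M)
    (hadd : ∀ a b, p a → p b → p (a + b)) (h : ∀ a w, p (W.inA a * W.inH w)) : p v := by
  rw [← W.splitM.symm_apply_apply v]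
  induction W.splitM v using TensorProduct.induction_on with
  | zero => simpa using h 0 0
  | tmul q m => rw [splitM_symm]; exact h q m
  | add x y hx hy => rw [map_add]; exact hadd _ _ hx hy

theorem inA_injective : Function.Injective W.inA := mapU_injective_left _ _ W.bijM

/-- The character of `U(H₋)` given by `chi`. -/
def chiU : U Hm →ₐ[ℂ] ℂ := charU W.chi W.chi_lie

/-- The projection `U(M) = U(am) ⊗ U(H₋) → U(am)` given by the character `chi`. -/
def proj : U M →ₗ[ℂ] U am :=
  (TensorProduct.rid ℂ (U am)).toLinearMap ∘ₗ W.chiU.toLinearMap.lTensor (U am) ∘ₗ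
    W.splitM.toLinearMap

theorem proj_mul (a : U am) (w : U Hm) : W.proj (W.inA a * W.inH w) = W.chiU w • a := by
  simp [proj, splitM_mul]

theorem proj_inA (a : U am) : W.proj (W.inA a) = a := by
  have := W.proj_mul a 1
  rwa [map_one, mul_one, map_one, one_smul] at this

theorem inH_toU (y : Hm) : W.inH (toU y) = toU ⟨(y : L), W.Hm_le y.2⟩ := mapU_toU _ y

theorem proj_mul_toU (m : U M) (y : Hm) : W.proj (m * W.inH (toU y)) = W.chi y • W.proj m := by
  induction m using W.splitM_induction with
  | hadd a b ha hb => rw [add_mul, map_add, map_add, ha, hb, smul_add]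
  | h a w =>
    rw [mul_assoc, ← map_mul, proj_mul, proj_mul, map_mul, chiU, charU_toU, smul_smul, mul_comm]

/-- The linear map `a w ↦ (x w) ⊗ a` on `U(M) = U(am) U(H₋)`. -/
def kappa (x : Hp) : U M →ₗ[ℂ] Hp ⊗[ℂ] U am :=
  TensorProduct.map (LinearMap.applyₗ x ∘ₗ (MulOpposite.opLinearEquiv ℂ).symm.toLinearMap ∘ₗ
    W.ractU.toLinearMap) LinearMap.id ∘ₗ (TensorProduct.comm ℂ (U am) (U Hm)).toLinearMap ∘ₗ
    W.splitM.toLinearMap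

theorem kappa_mul (x : Hp) (a : U am) (w : U Hm) :
    W.kappa x (W.inA a * W.inH w) = (W.ractU w).unop x ⊗ₜ a := by
  simp [kappa, splitM_mul]

theorem kappa_inA (x : Hp) (a : U am) : W.kappa x (W.inA a) = x ⊗ₜ a := by
  have := W.kappa_mul x a 1
  rwa [map_one, mul_one, map_one] at this

theorem kappa_mul_toU (x : Hp) (m : U M) (y : Hm) :
    W.kappa x (m * W.inH (toU y)) = (W.ract y).rTensor (U am) (W.kappa x m) := by
  induction m using W.splitM_induction with
  | hadd a b ha hb => rw [add_mul, map_add, map_add, ha, hb, map_add]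
  | h a w =>
    rw [mul_assoc, ← map_mul, kappa_mul, kappa_mul, map_mul, ractU_toU]
    simp

theorem repr_e_eq {x : Hp} {n : ℤ} (hx : (x : L) ∈ G.gr n) {i : E} (hi : W.e.repr x i ≠ 0) :
    (W.degE i : ℤ) = n := by
  have hd : ∀ x : Hp, ⁅F.delta, (x : L)⁆ ∈ Hp := by
    intro x
    induction x using basis_induction W.e with
    | zero => simp
    | add x y hx hy => rw [AddMemClass.coe_add, lie_add]; exact add_mem hx hy
    | smul c x hx =>
      rw [show ((c • x : Hp) : L) = c • (x : L) from rfl, lie_smul]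
      exact Hp.smul_mem c hx
    | basis i => rw [F.mem_gr.1 (W.e_mem i)]; exact Hp.smul_mem _ (W.e i).2
  let T : Module.End ℂ Hp :=
    { toFun := fun x => ⟨⁅F.delta, (x : L)⁆, hd x⟩
      map_add' := fun x y => Subtype.ext (lie_add _ _ _)
      map_smul' := fun c x => Subtype.ext (lie_smul _ _ _) }
  have h := eigen_repr W.e T (fun i => (W.degE i : ℂ))
    (fun j => Subtype.ext (by
      have h := F.mem_gr.1 (W.e_mem j)
      rw [Int.cast_natCast] at h
      exact h))
    (v := x) (d := (n : ℂ)) (Subtype.ext (F.mem_gr.1 hx)) hi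
  exact_mod_cast h

/-- The elements of `H₊` of degree at most `k`. -/
def HpLe (k : ℕ) : Submodule ℂ Hp := Submodule.span ℂ (W.e '' {i | W.degE i ≤ k})

theorem repr_eq_zero_of_mem_HpLe {k : ℕ} {x : Hp} (hx : x ∈ W.HpLe k) {i : E} (hi : k < W.degE i) :
    W.e.repr x i = 0 := by
  have := (W.e.mem_span_image (s := {i | W.degE i ≤ k})).1 hx
  by_contra hne
  have h := this (Finsupp.mem_support_iff.2 hne)
  simp only [Set.mem_ofPred_eq] at h
  omega

theorem ract_mem_HpLe {k : ℕ} (y : Hm) {x : Hp} (hx : x ∈ W.HpLe k) : W.ract y x ∈ W.HpLe k := by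
  have hy : y ∈ Submodule.span ℂ {y : Hm | ∃ n, (y : L) ∈ G.gr n} := W.Hm_span ▸ Submodule.mem_top
  induction hx using Submodule.span_induction with
  | zero => rw [map_zero]; exact zero_mem _
  | add a b _ _ ha hb => rw [map_add]; exact add_mem ha hb
  | smul c a _ ha => rw [map_smul]; exact Submodule.smul_mem _ c ha
  | mem x hx =>
    obtain ⟨i, hi, rfl⟩ := hx
    induction hy using Submodule.span_induction with
    | zero => rw [map_zero]; exact zero_mem _
    | add a b _ _ ha hb => rw [map_add]; exact add_mem ha hb
    | smul c a _ ha => rw [map_smul]; exact Submodule.smul_mem _ c ha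
    | mem y hy =>
      obtain ⟨n, hn⟩ := hy
      rw [ract_apply]
      refine add_mem (Submodule.smul_mem _ _ (Submodule.subset_span ⟨i, hi, rfl⟩)) ?_
      by_cases hy0 : y = 0
      · have : W.brH (W.e i) y = 0 := by
          rw [hy0]; exact Subtype.ext (lie_zero (W.e i : L))
        rw [this, map_zero]; exact zero_mem _
      have hn0 : n ≤ 0 := by
        by_contra hc
        exact hy0 (Subtype.ext (inter_eq_zero F (F.mem_P (not_le.1 hc) hn) (W.Hm_le y.2)))
      have hb : ((W.brH (W.e i) y : H) : L) ∈ G.gr (W.degE i + n) := F.lie_mem_gr (W.e_mem i) hn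
      have hu : (W.prP (W.brH (W.e i) y) : L) ∈ G.gr (W.degE i + n) := by
        have h1 := W.prP_add_prM (W.brH (W.e i) y)
        by_cases hpos : 0 < (W.degE i : ℤ) + n
        · have h2 : (W.prM (W.brH (W.e i) y) : L) = 0 := by
            refine inter_eq_zero F ?_ (W.Hm_le (W.prM _).2)
            rw [← h1] at hb
            have h3 := F.mem_P hpos hb
            exact (add_mem_cancel_left (W.Hp_le (W.prP _).2)).1 h3
          rw [h2, add_zero] at h1
          rwa [h1]
        · have h2 : (W.prP (W.brH (W.e i) y) : L) = 0 := by
            refine inter_eq_zero F (W.Hp_le (W.prP _).2) ?_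
            rw [← h1] at hb
            have h3 := F.mem_M (not_lt.1 hpos) hb
            exact (add_mem_cancel_right (W.Hm_le (W.prM _).2)).1 h3
          rw [h2]; exact zero_mem _
      refine (W.e.mem_span_image (s := {i | W.degE i ≤ k})).2 fun j hj => ?_
      have h4 := W.repr_e_eq hu (Finsupp.mem_support_iff.1 hj)
      simp only [Set.mem_ofPred_eq] at hi ⊢
      omega

theorem ractU_mem_HpLe {k : ℕ} (w : U Hm) {x : Hp} (hx : x ∈ W.HpLe k) :
    (W.ractU w).unop x ∈ W.HpLe k := by
  induction w using U_induction generalizing x with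
  | h1 => simpa using hx
  | hadd a b ha hb => simpa using add_mem (ha hx) (hb hx)
  | hsmul c a ha => simpa using Submodule.smul_mem _ c (ha hx)
  | hmul y a ha =>
    rw [map_mul, ractU_toU]
    simpa using ha (W.ract_mem_HpLe y hx)

theorem tcoef_kappa {x : Hp} {k : ℕ} (hx : x ∈ W.HpLe k) (m : U M) {i : E} (hi : k < W.degE i) :
    tcoef W.e i (W.kappa x m) = 0 := by
  induction m using W.splitM_induction with
  | hadd a b ha hb => rw [map_add, map_add, ha, hb, add_zero]
  | h a w =>
    rw [kappa_mul, tcoef_tmul, W.repr_eq_zero_of_mem_HpLe (W.ractU_mem_HpLe w hx) hi, zero_smul]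

theorem tcoef_kappa_prM (x : Hp) (m : U M) (i : E) (y : Hm) :
    tcoef W.e i (W.kappa x (m * W.inH (toU (W.prM (W.brH (W.e i) y))))) = 0 := by
  obtain ⟨h1, h2⟩ := W.height i y (W.prM (W.brH (W.e i) y)) (W.prP (W.brH (W.e i) y))
    (W.prP_add_prM (W.brH (W.e i) y)).symm
  rw [kappa_mul_toU]
  induction W.kappa x m using TensorProduct.induction_on with
  | zero => simp
  | add z w hz hw => rw [map_add, map_add, hz, hw, add_zero]
  | tmul z a =>
    rw [LinearMap.rTensor_tmul, tcoef_tmul, ract_apply, chi_apply, h1, zero_smul, zero_add,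
      h2 z _ (W.prM (W.brH z (W.prM (W.brH (W.e i) y))))
        (W.prP_add_prM (W.brH z (W.prM (W.brH (W.e i) y)))).symm, zero_smul]

/-- The elements of `US` annihilated by the right action of `H₊`. -/
def Inv (_ : SemiInductionFrame F H Hp Hm ap am lam C D E) : Submodule ℂ G.US :=
  ⨅ x : Hp, LinearMap.ker (G.rightUS (x : L))

theorem mem_Inv {g : G.US} : g ∈ W.Inv ↔ ∀ x : Hp, G.rightUS (x : L) g = 0 := by
  simp [Inv]

/-- The span of all `g y - chi(y) g`, for `y ∈ H₋` and `g ∈ US`. -/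
def Bd : Submodule ℂ G.US :=
  Submodule.span ℂ {z | ∃ (y : Hm) (g : G.US), z = G.rightUS (y : L) g - W.chi y • g}

/-- The composition of `Phi g` with the projection to `U(am)`. -/
def q : G.US →ₗ[ℂ] U P →ₗ[ℂ] U am := LinearMap.llcomp ℂ (U P) (U M) (U am) W.proj ∘ₗ F.Phi

theorem q_apply (g : G.US) (p : U P) : W.q g p = W.proj (F.Phi g p) := rfl

theorem Phi_rightUS_Hm (g : G.US) (y : Hm) (p : U P) :
    F.Phi (G.rightUS (y : L) g) p = F.Phi g p * W.inH (toU y) := by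
  rw [inH_toU]
  exact F.Phi_rightUS_M g ⟨y, W.Hm_le y.2⟩ p

theorem q_mem (g : G.US) : W.q g ∈ finHom F.a (U am) := comp_mem_finHom F.a (F.Phi_mem g) W.proj

theorem q_Bd {z : G.US} (hz : z ∈ W.Bd) : W.q z = 0 := by
  have : W.Bd ≤ LinearMap.ker W.q := by
    refine Submodule.span_le.2 ?_
    rintro _ ⟨y, g, rfl⟩
    refine LinearMap.mem_ker.2 (LinearMap.ext fun p => ?_)
    rw [q_apply, map_sub, map_smul, LinearMap.sub_apply, LinearMap.smul_apply, map_sub, map_smul,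
      Phi_rightUS_Hm, proj_mul_toU, sub_self, LinearMap.zero_apply]
  exact this hz

theorem sub_proj_mem (m : U M) : m - W.inA (W.proj m) ∈
    Submodule.span ℂ {z | ∃ (n : U M) (y : Hm), z = n * W.inH (toU y) - W.chi y • n} := by
  induction m using W.splitM_induction with
  | hadd a b ha hb => rw [map_add, map_add, add_sub_add_comm]; exact add_mem ha hb
  | h a w =>
    rw [proj_mul, map_smul]
    induction w using U_induction generalizing a with
    | h1 => simp
    | hadd v w hv hw =>
      rw [map_add, map_add, mul_add, add_smul, add_sub_add_comm]; exact add_mem (hv a) (hw a)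
    | hsmul c w hw =>
      rw [map_smul, map_smul, mul_smul_comm, smul_assoc, ← smul_sub]
      exact Submodule.smul_mem _ c (hw a)
    | hmul y w hw =>
      have key : ∀ v : U Hm, ∀ b : U M, b * W.inH v - W.chiU v • b ∈ Submodule.span ℂ
          {z | ∃ (n : U M) (y : Hm), z = n * W.inH (toU y) - W.chi y • n} := by
        intro v
        induction v using U_induction with
        | h1 => simp
        | hadd v w hv hw =>
          intro b
          rw [map_add, map_add, mul_add, add_smul, add_sub_add_comm]; exact add_mem (hv b) (hw b)
        | hsmul c w hw =>
          intro b
          rw [map_smul, map_smul, mul_smul_comm, smul_assoc, ← smul_sub]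
          exact Submodule.smul_mem _ c (hw b)
        | hmul y w hw =>
          intro b
          have e : b * W.inH (toU y * w) - W.chiU (toU y * w) • b =
              (b * W.inH (toU y) * W.inH w - W.chiU w • (b * W.inH (toU y))) +
                W.chiU w • (b * W.inH (toU y) - W.chi y • b) := by
            rw [map_mul, map_mul, ← mul_assoc, chiU, charU_toU, mul_smul, smul_sub, smul_comm]
            abel
          rw [e]
          exact add_mem (hw _) (Submodule.smul_mem _ _ (Submodule.subset_span ⟨b, y, rfl⟩))
      exact key _ _

/-- The boundaries of the right action of `H₋` are the kernel of the projection to `U(am)`. -/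
theorem mem_Bd {z : G.US} (hz : W.q z = 0) : z ∈ W.Bd := by
  classical
  let Ph : G.US ≃ₗ[ℂ] finHom F.a (U M) := LinearEquiv.ofBijective
    (F.Phi.codRestrict (finHom F.a (U M)) F.Phi_mem) ⟨fun g g' h =>
      F.Phi_injective (congrArg Subtype.val h), fun φ => ⟨G.mkUS (F.lift φ.2), Subtype.ext
        (F.Phi_lift φ.2)⟩⟩
  have hPh : ∀ φ, F.Phi (Ph.symm φ) = φ.1 := fun φ => congrArg Subtype.val (Ph.apply_symm_apply φ)
  have hs : ∀ i : A, ∀ m : U M, (F.a.coord i).smulRight m ∈ finHom F.a (U M) := by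
    intro i m
    refine (Set.finite_singleton i).subset fun j hj => ?_
    by_contra hne
    refine hj ?_
    rw [LinearMap.smulRight_apply, Module.Basis.coord_apply, F.a.repr_self,
      Finsupp.single_eq_of_ne (Ne.symm hne), zero_smul]
  let T : A → U M →ₗ[ℂ] G.US := fun i => Ph.symm.toLinearMap ∘ₗ
    { toFun := fun m => ⟨(F.a.coord i).smulRight m, hs i m⟩
      map_add' := fun m n => Subtype.ext (by ext; simp)
      map_smul' := fun c m => Subtype.ext (by
        ext p
        exact smul_comm _ _ _) }
  have hT : ∀ i m, F.Phi (T i m) = (F.a.coord i).smulRight m := fun i m => hPh _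
  have hmem : ∀ i m, W.proj m = 0 → T i m ∈ W.Bd := by
    intro i m hm
    have h := W.sub_proj_mem m
    rw [hm, map_zero, sub_zero] at h
    clear hm
    induction h using Submodule.span_induction with
    | zero => rw [map_zero]; exact zero_mem _
    | add a b _ _ ha hb => rw [map_add]; exact add_mem ha hb
    | smul c a _ ha => rw [map_smul]; exact Submodule.smul_mem _ c ha
    | mem m hm =>
      obtain ⟨n, y, rfl⟩ := hm
      refine Submodule.subset_span ⟨y, T i n, F.Phi_injective (LinearMap.ext fun p => ?_)⟩
      rw [map_sub F.Phi, map_smul F.Phi, LinearMap.sub_apply, LinearMap.smul_apply, Phi_rightUS_Hm,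
        hT, hT, LinearMap.smulRight_apply, LinearMap.smulRight_apply, smul_sub, smul_mul_assoc,
        smul_comm]
  have hfin : {i | F.Phi z (F.a i) ≠ 0}.Finite := F.Phi_mem z
  have hz' : z = ∑ i ∈ hfin.toFinset, T i (F.Phi z (F.a i)) := by
    apply F.Phi_injective
    rw [map_sum]
    refine F.a.ext fun j => ?_
    simp only [hT, LinearMap.sum_apply, LinearMap.smulRight_apply, Module.Basis.coord_apply,
      F.a.repr_self]
    by_cases hj : F.Phi z (F.a j) = 0
    · rw [hj, Finset.sum_eq_zero]
      intro i hi
      rw [Finsupp.single_eq_of_ne, zero_smul]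
      rintro rfl
      simp [hj] at hi
    · rw [Finset.sum_eq_single j]
      · simp
      · intro i _ hij
        rw [Finsupp.single_eq_of_ne hij, zero_smul]
      · intro h; simp [hj] at h
  rw [hz']
  exact Submodule.sum_mem _ fun i _ => hmem i _ (LinearMap.congr_fun hz (F.a i))

end SemiInductionFrame

end Frame

end Wakimoto

end

/-! ### Semi-induction: injectivity of the restriction to `U(ap)` -/

noncomputable section

namespace Wakimoto

section Frame

attribute [local instance 100] LieRing.ofAssociativeRing

variable {L : Type*} [LieRing L] [LieAlgebra ℂ L]
variable {G : SemiInfinite L} {P M : LieSubalgebra ℂ L} {A B : Type*}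

theorem rightUS_add (x y : L) (g : G.US) : G.rightUS (x + y) g = G.rightUS x g + G.rightUS y g := by
  obtain ⟨f, rfl⟩ := TriangularFrame.exists_mkUS g
  refine Subtype.ext ?_
  change Submodule.mkQ _ _ = Submodule.mkQ _ _ + Submodule.mkQ _ _
  rw [← map_add]
  congr 1
  refine Subtype.ext (LinearMap.ext fun u => ?_)
  change f.1.1 u * toU (x + y) = f.1.1 u * toU x + f.1.1 u * toU y
  rw [map_add, mul_add]

theorem rightUS_smul (c : ℂ) (x : L) (g : G.US) : G.rightUS (c • x) g = c • G.rightUS x g := by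
  obtain ⟨f, rfl⟩ := TriangularFrame.exists_mkUS g
  refine Subtype.ext ?_
  change Submodule.mkQ _ _ = c • Submodule.mkQ _ _
  rw [← map_smul]
  congr 1
  refine Subtype.ext (LinearMap.ext fun u => ?_)
  change f.1.1 u * toU (c • x) = c • (f.1.1 u * toU x)
  rw [map_smul, mul_smul_comm]

theorem rightUS_lie (x y : L) (g : G.US) :
    G.rightUS ⁅x, y⁆ g = G.rightUS y (G.rightUS x g) - G.rightUS x (G.rightUS y g) := by
  obtain ⟨f, rfl⟩ := TriangularFrame.exists_mkUS g
  refine Subtype.ext ?_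
  change Submodule.mkQ _ _ = Submodule.mkQ _ _ - Submodule.mkQ _ _
  rw [← map_sub]
  congr 1
  refine Subtype.ext (LinearMap.ext fun u => ?_)
  change f.1.1 u * toU ⁅x, y⁆ = f.1.1 u * toU x * toU y - f.1.1 u * toU y * toU x
  rw [toU_lie, mul_sub, mul_assoc, mul_assoc]

namespace SemiInductionFrame

variable {F : TriangularFrame G P M A B} {H Hp Hm ap am : LieSubalgebra ℂ L} {lam : H →ₗ[ℂ] ℂ}
  {C D E : Type*} (W : SemiInductionFrame F H Hp Hm ap am lam C D E)

/-- The values at `p` of the maps `Phi (g x)`, as a function of `x` in `H₊`. -/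
def zeta (_ : SemiInductionFrame F H Hp Hm ap am lam C D E) (p : U P) :
    G.US →ₗ[ℂ] Hp →ₗ[ℂ] U M :=
  LinearMap.mk₂ ℂ (fun g x => F.Phi (G.rightUS (x : L) g) p)
    (fun g g' x => by rw [map_add, map_add, LinearMap.add_apply])
    (fun c g x => by rw [map_smul, map_smul, LinearMap.smul_apply])
    (fun g x y => by rw [AddMemClass.coe_add, rightUS_add, map_add, LinearMap.add_apply])
    (fun c g x => by
      rw [show ((c • x : Hp) : L) = c • (x : L) from rfl, rightUS_smul, map_smul,
        LinearMap.smul_apply])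

theorem zeta_apply (p : U P) (g : G.US) (x : Hp) :
    W.zeta p g x = F.Phi (G.rightUS (x : L) g) p := rfl

theorem zeta_mem (p : U P) (g : G.US) : W.zeta p g ∈ finHom W.e (U M) := by
  obtain ⟨K, hK⟩ := F.exists_Phi_rightUS_eq_zero g p
  refine ((Set.finite_lt_nat K).biUnion fun n _ => W.e_fin n).subset fun i hi => ?_
  simp only [Set.mem_iUnion, Set.mem_ofPred_eq, exists_prop, exists_eq_right']
  by_contra hc
  exact hi (hK _ (not_lt.1 hc) _ (W.e_mem i))

theorem kappa_zeta_mem (p : U P) (g : G.US) (x : Hp) :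
    W.kappa x ∘ₗ W.zeta p g ∈ finHom W.e (Hp ⊗[ℂ] U am) :=
  comp_mem_finHom W.e (W.zeta_mem p g) _

/-- On the boundaries of the right action of `H₋` the partial traces of `kappa ∘ zeta` vanish. Since
`zeta` vanishes on the invariants of `H₊`, this gives equations for the projections of invariants. -/
theorem ptr_kappa_zeta_Bd {z : G.US} (hz : z ∈ W.Bd) (p : U P) (x : Hp) :
    ptr W.e (W.kappa x ∘ₗ W.zeta p z) = 0 := by
  induction hz using Submodule.span_induction with
  | zero => rw [map_zero, LinearMap.comp_zero, ptr_zero]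
  | add y z _ _ hy hz =>
    rw [map_add, LinearMap.comp_add, ptr_add _ (traceable_of_mem_finHom _ (W.kappa_zeta_mem p y x))
      (traceable_of_mem_finHom _ (W.kappa_zeta_mem p z x)), hy, hz, add_zero]
  | smul c z _ hz =>
    rw [map_smul, LinearMap.comp_smul,
      ptr_smul _ _ (traceable_of_mem_finHom _ (W.kappa_zeta_mem p z x)), hz, smul_zero]
  | mem z hz =>
    obtain ⟨y, h, rfl⟩ := hz
    set X := W.kappa x ∘ₗ W.zeta p h with hX
    have hXm : X ∈ finHom W.e (Hp ⊗[ℂ] U am) := W.kappa_zeta_mem p h x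
    have key : ∀ x' : Hp, W.zeta p (G.rightUS (y : L) h - W.chi y • h) x' =
        W.zeta p h x' * W.inH (toU y) - W.zeta p h (W.ract y x') -
          F.Phi h p * W.inH (toU (W.prM (W.brH x' y))) := by
      intro x'
      have h1 : G.rightUS (x' : L) (G.rightUS (y : L) h) = G.rightUS (y : L) (G.rightUS (x' : L) h) -
          G.rightUS (W.prP (W.brH x' y) : L) h - G.rightUS (W.prM (W.brH x' y) : L) h := by
        rw [sub_sub, ← rightUS_add, W.prP_add_prM]
        change _ = _ - G.rightUS ⁅(x' : L), (y : L)⁆ h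
        rw [rightUS_lie]; abel
      have e1 : W.zeta p (G.rightUS (y : L) h - W.chi y • h) x' =
          F.Phi (G.rightUS (x' : L) (G.rightUS (y : L) h)) p - W.chi y • W.zeta p h x' := by
        rw [map_sub (W.zeta p), map_smul (W.zeta p)]
        rfl
      have e2 : W.zeta p h (W.ract y x') = W.chi y • W.zeta p h x' +
          F.Phi (G.rightUS (W.prP (W.brH x' y) : L) h) p := by
        rw [ract_apply, map_add (W.zeta p h), map_smul (W.zeta p h)]
        rfl
      have e3 : F.Phi (G.rightUS (x' : L) (G.rightUS (y : L) h)) p =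
          W.zeta p h x' * W.inH (toU y) - F.Phi (G.rightUS (W.prP (W.brH x' y) : L) h) p -
            F.Phi h p * W.inH (toU (W.prM (W.brH x' y))) := by
        rw [h1, map_sub F.Phi, map_sub F.Phi, LinearMap.sub_apply, LinearMap.sub_apply,
          W.Phi_rightUS_Hm _ y, W.Phi_rightUS_Hm h (W.prM _), zeta_apply]
      rw [e1, e2, e3]
      abel
    have hK : Traceable W.e ((W.ract y).rTensor (U am) ∘ₗ X - X ∘ₗ W.ract y) :=
      (traceable_rTensor W.e hXm _).sub W.e (traceable_comp W.e hXm _)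
    have h2 : ptr W.e (W.kappa x ∘ₗ W.zeta p (G.rightUS (y : L) h - W.chi y • h)) =
        ptr W.e ((W.ract y).rTensor (U am) ∘ₗ X - X ∘ₗ W.ract y) := by
      refine finsum_congr fun i => ?_
      rw [LinearMap.comp_apply, key, map_sub, map_sub, map_sub, tcoef_kappa_prM, sub_zero,
        kappa_mul_toU]
      rfl
    rw [h2, ptr_sub _ (traceable_rTensor W.e hXm _) (traceable_comp W.e hXm _), ptr_comm _ hXm,
      sub_self]

/-- The inclusion `U(ap) → U(P)`. -/
abbrev inAp (W : SemiInductionFrame F H Hp Hm ap am lam C D E) : U ap →ₐ[ℂ] U P :=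
  mapU (LieSubalgebra.inclusion W.ap_le)

/-- The inclusion of `U(H₊)` into `U(P)`. -/
abbrev inHp (W : SemiInductionFrame F H Hp Hm ap am lam C D E) : U Hp →ₐ[ℂ] U P :=
  mapU (LieSubalgebra.inclusion W.Hp_le)

theorem incU_inAp (u : U ap) : incU P (W.inAp u) = incU ap u := mapU_mapU _ _ _ (fun _ => rfl) u

theorem incU_inA (u : U am) : incU M (W.inA u) = incU am u := mapU_mapU _ _ _ (fun _ => rfl) u

theorem incU_inHp (u : U Hp) : incU P (W.inHp u) = incU Hp u := mapU_mapU _ _ _ (fun _ => rfl) u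

/-- The product of a basis element of `U(ap)` and of basis elements of `H₊`. -/
def mon (z : C × List E) : U P :=
  W.inAp (W.c z.1) * W.inHp ((z.2.map fun j => toU (W.e j)).prod)

theorem mon_append (i : C) (l : List E) (j : E) :
    W.mon (i, l ++ [j]) = W.mon (i, l) * toU (LieSubalgebra.inclusion W.Hp_le (W.e j)) := by
  simp [mon, mul_assoc, mapU_toU]

theorem mon_mem (z : C × List E) :
    incU P (W.mon z) ∈ eigU F.delta ((W.degC z.1 + (z.2.map W.degE).sum : ℕ) : ℂ) := by
  rw [mon, map_mul, incU_inAp, incU_inHp, Nat.cast_add]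
  refine mul_mem_eigU (W.c_mem _) ?_
  induction z.2 with
  | nil => simpa using one_mem_eigU F.delta
  | cons j l ih =>
    simp only [List.map_cons, List.sum_cons, List.prod_cons, map_mul, incU_toU, Nat.cast_add]
    exact mul_mem_eigU (toU_mem_eigU (by simpa using F.lie_delta _ _ (W.e_mem j))) ih

theorem span_mon : Submodule.span ℂ (Set.range W.mon) = ⊤ := by
  rw [eq_top_iff]
  intro u hu
  clear hu
  rw [← (mulEquiv _ _ W.bijP).apply_symm_apply u]
  induction (mulEquiv _ _ W.bijP).symm u using TensorProduct.induction_on with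
  | zero => rw [map_zero]; exact zero_mem _
  | add x y hx hy => rw [map_add]; exact add_mem hx hy
  | tmul x y =>
    rw [mulEquiv_tmul]
    have hy : y ∈ Submodule.span ℂ {u : U Hp | ∃ l : List Hp, (∀ x ∈ l, x ∈ Set.range W.e) ∧
        u = (l.map toU).prod} := span_list_prod W.e.span_eq ▸ Submodule.mem_top
    induction x using basis_induction W.c with
    | zero => rw [map_zero, zero_mul]; exact zero_mem _
    | add a b ha hb => rw [map_add, add_mul]; exact add_mem ha hb
    | smul c a ha => rw [map_smul, smul_mul_assoc]; exact Submodule.smul_mem _ c ha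
    | basis i =>
      induction hy using Submodule.span_induction with
      | zero => rw [map_zero, mul_zero]; exact zero_mem _
      | add a b _ _ ha hb => rw [map_add, mul_add]; exact add_mem ha hb
      | smul c a _ ha => rw [map_smul, mul_smul_comm]; exact Submodule.smul_mem _ c ha
      | mem u hu =>
        obtain ⟨l, hl, rfl⟩ := hu
        obtain ⟨l', rfl⟩ : ∃ l' : List E, l = l'.map W.e := by
          induction l with
          | nil => exact ⟨[], rfl⟩
          | cons x l ih =>
            obtain ⟨j, hj⟩ := hl x (List.mem_cons_self ..)
            obtain ⟨l', hl'⟩ := ih fun y hy => hl y (List.mem_cons_of_mem _ hy)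
            exact ⟨j :: l', by rw [List.map_cons, hj, hl']⟩
        refine Submodule.subset_span ⟨(i, l'), ?_⟩
        rw [mon, List.map_map]
        rfl

/-- An element of `U(P)` of degree `k` is a combination of products `mon z` of degree `k`. -/
theorem mem_span_mon {p : U P} {k : ℕ} (hp : incU P p ∈ eigU F.delta k) :
    p ∈ Submodule.span ℂ (W.mon '' {z | W.degC z.1 + (z.2.map W.degE).sum = k}) := by
  obtain ⟨t, ht⟩ := F.exists_adU_of_normalizes ⟨F.delta, F.delta_mem_M⟩ (F.lie_mem_P F.delta_mem_gr)
  have key : ∀ q : U P, ∀ d : ℂ, incU P q ∈ eigU F.delta d → t q = d • q := by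
    intro q d hq
    apply F.incP_injective
    rw [← ht, map_smul]
    exact mem_eigU.1 hq
  have h := mem_span_of_eigen t (S := Set.range W.mon) (fun v hv => by
    obtain ⟨z, rfl⟩ := hv
    exact ⟨_, key _ _ (W.mon_mem z)⟩) (W.span_mon ▸ Submodule.mem_top) (key p k hp)
  refine Submodule.span_le.2 ?_ h
  rintro _ ⟨⟨z, rfl⟩, hz⟩
  by_cases hk : W.degC z.1 + (z.2.map W.degE).sum = k
  · exact Submodule.subset_span ⟨z, hk, rfl⟩
  · rw [key _ _ (W.mon_mem z), ← sub_eq_zero, ← sub_smul, smul_eq_zero] at hz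
    rcases hz with hz | hz
    · rw [sub_eq_zero] at hz
      exact absurd (by exact_mod_cast hz) hk
    · rw [hz]; exact zero_mem _

theorem inA_comp_mem {n : U P →ₗ[ℂ] U am} (hn : n ∈ finHom F.a (U am)) :
    W.inA.toLinearMap ∘ₗ n ∈ finHom F.a (U M) := comp_mem_finHom F.a hn _

/-- An element of `US` is congruent modulo the boundaries to one with values in `U(am)`. -/
theorem sub_lift_mem_Bd (g : G.US) : g - G.mkUS (F.lift (W.inA_comp_mem (W.q_mem g))) ∈ W.Bd := by
  apply W.mem_Bd
  ext p
  rw [map_sub, LinearMap.sub_apply, W.q_apply (G.mkUS _), F.Phi_lift]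
  simp [proj_inA]

/-- An invariant of `H₊` whose projection vanishes on `U(ap)` is a boundary. -/
theorem q_eq_zero {g : G.US} (hg : g ∈ W.Inv) (h : ∀ u : U ap, W.q g (W.inAp u) = 0) :
    W.q g = 0 := by
  set n := W.q g with hn
  have hptr : ∀ p x, ptr W.e (W.kappa x ∘ₗ W.zeta p
      (G.mkUS (F.lift (W.inA_comp_mem (W.q_mem g))))) = 0 := by
    intro p x
    have h1 := W.ptr_kappa_zeta_Bd (W.sub_lift_mem_Bd g) p x
    rw [map_sub, LinearMap.comp_sub,
      ptr_sub _ (traceable_of_mem_finHom _ (W.kappa_zeta_mem p _ x))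
      (traceable_of_mem_finHom _ (W.kappa_zeta_mem p _ x))] at h1
    have h2 : W.zeta p g = 0 := by
      ext x'
      rw [zeta_apply, W.mem_Inv.1 hg, map_zero]; rfl
    rwa [h2, LinearMap.comp_zero, ptr_zero, zero_sub, neg_eq_zero] at h1
  have key : ∀ k : ℕ, ∀ p, incU P p ∈ eigU F.delta k → n p = 0 := by
    intro k
    induction k using Nat.strong_induction_on with
    | _ k ih =>
    intro p hp
    have hmon : ∀ z : C × List E, W.degC z.1 + (z.2.map W.degE).sum = k → n (W.mon z) = 0 := by
      rintro ⟨i, l⟩ hz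
      rcases List.eq_nil_or_concat l with rfl | ⟨l', j, rfl⟩
      · simpa [mon] using h (W.c i)
      · rw [List.concat_eq_append] at hz ⊢
        rw [mon_append]
        simp only [List.map_append, List.sum_append, List.map_cons, List.map_nil, List.sum_cons,
          List.sum_nil, add_zero] at hz
        have h1 := ptr_tmul W.e (W.e j) (-(n ∘ₗ LinearMap.mulLeft ℂ (W.mon (i, l')) ∘ₗ toU ∘ₗ
          (LieSubalgebra.inclusion W.Hp_le : Hp →ₗ⁅ℂ⁆ P).toLinearMap))
          (F := W.kappa (W.e j) ∘ₗ W.zeta (W.mon (i, l'))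
            (G.mkUS (F.lift (W.inA_comp_mem (W.q_mem g))))) ?_
        · rw [hptr] at h1
          have h2 : -(n (W.mon (i, l') * toU (LieSubalgebra.inclusion W.Hp_le (W.e j)))) = 0 := h1.symm
          rwa [neg_eq_zero] at h2
        · intro i'
          rw [LinearMap.comp_apply]
          by_cases hlt : W.degE j < W.degE i'
          · rw [W.tcoef_kappa (Submodule.subset_span ⟨j, le_refl (W.degE j), rfl⟩) _ hlt, W.e.repr_self,
              Finsupp.single_eq_of_ne (by rintro rfl; exact lt_irrefl _ hlt), zero_smul]
          · have h3 := F.Phi_rightUS_lift W.am_le W.am_neg (W.inA_comp_mem (W.q_mem g)) (k := k)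
              ih (x := LieSubalgebra.inclusion W.Hp_le (W.e i')) (W.e_mem i') (W.mon_mem (i, l'))
              (by simp only; omega)
            have h4 : W.zeta (W.mon (i, l')) (G.mkUS (F.lift (W.inA_comp_mem (W.q_mem g)))) (W.e i') =
              -W.inA (n (W.mon (i, l') * toU (LieSubalgebra.inclusion W.Hp_le (W.e i')))) := h3
            rw [h4, map_neg, kappa_inA, map_neg, tcoef_tmul, ← smul_neg]
            rfl
    have hp' := W.mem_span_mon hp
    clear hp
    induction hp' using Submodule.span_induction with
    | zero => rw [map_zero]
    | add x y _ _ hx hy => rw [map_add, hx, hy, add_zero]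
    | smul c x _ hx => rw [map_smul, hx, smul_zero]
    | mem x hx =>
      obtain ⟨z, hz, rfl⟩ := hx
      exact hmon z hz
  exact F.a.ext fun i => key _ _ (F.a_mem i)

end SemiInductionFrame

end Frame

end Wakimoto

end

/-! ### Semi-induction: surjectivity of the restriction to `U(ap)` -/

noncomputable section

namespace Wakimoto

section FinHom

variable {E V A D : Type*} [AddCommGroup E] [Module ℂ E] [AddCommGroup V] [Module ℂ V]
  (a : Module.Basis A ℂ E) (d : Module.Basis D ℂ V)

/-- The map `aᵢ^* ⊗ v`. -/
def dualTmul (i : A) (v : V) : E →ₗ[ℂ] V := (a.coord i).smulRight v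

theorem dualTmul_self (i : A) (v : V) : dualTmul a i v (a i) = v := by
  simp [dualTmul]

theorem dualTmul_ne {i j : A} (h : j ≠ i) (v : V) : dualTmul a i v (a j) = 0 := by
  simp [dualTmul, Finsupp.single_eq_of_ne (Ne.symm h)]

theorem dualTmul_mem (i : A) (v : V) : dualTmul a i v ∈ finHom a V := by
  refine (Set.finite_singleton i).subset fun j hj => ?_
  by_contra hne
  exact hj (dualTmul_ne a hne v)

theorem mem_span_dualTmul {φ : E →ₗ[ℂ] V} (hφ : φ ∈ finHom a V) {s : Set D}
    (h : ∀ i, φ (a i) ∈ Submodule.span ℂ (d '' s)) :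
    φ ∈ Submodule.span ℂ {ψ | ∃ i, ∃ j ∈ s, ψ = dualTmul a i (d j)} := by
  classical
  have hfin : {i | φ (a i) ≠ 0}.Finite := hφ
  have hs : φ = ∑ i ∈ hfin.toFinset, dualTmul a i (φ (a i)) := by
    refine a.ext fun j => ?_
    rw [LinearMap.sum_apply]
    by_cases hj : φ (a j) = 0
    · rw [hj, Finset.sum_eq_zero]
      intro i hi
      rw [dualTmul_ne]
      rintro rfl
      simp [hj] at hi
    · rw [Finset.sum_eq_single j]
      · rw [dualTmul_self]
      · intro i _ hij
        rw [dualTmul_ne _ (Ne.symm hij)]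
      · intro h; simp [hj] at h
  rw [hs]
  refine Submodule.sum_mem _ fun i _ => ?_
  have key : ∀ v ∈ Submodule.span ℂ (d '' s), dualTmul a i v ∈
      Submodule.span ℂ {ψ | ∃ i, ∃ j ∈ s, ψ = dualTmul a i (d j)} := by
    intro v hv
    induction hv using Submodule.span_induction with
    | zero =>
      rw [show dualTmul a i (0 : V) = 0 from LinearMap.smulRight_zero _]; exact zero_mem _
    | add x y _ _ hx hy =>
      have : dualTmul a i (x + y) = dualTmul a i x + dualTmul a i y := by
        ext; simp [dualTmul]
      rw [this]; exact add_mem hx hy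
    | smul c x _ hx =>
      have : dualTmul a i (c • x) = c • dualTmul a i x := by
        ext e; exact smul_comm _ _ _
      rw [this]; exact Submodule.smul_mem _ c hx
    | mem v hv =>
      obtain ⟨j, hj, rfl⟩ := hv
      exact Submodule.subset_span ⟨i, j, hj, rfl⟩
  exact key _ (h i)

/-- The basis `aᵢ^* ⊗ dⱼ` of the space of linear maps vanishing on almost all `aᵢ`. -/
def finHomBasis : Module.Basis (A × D) ℂ (finHom a V) :=
  Module.Basis.mk (v := fun z : A × D => (⟨dualTmul a z.1 (d z.2), dualTmul_mem a _ _⟩ : finHom a V))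
    (by
      classical
      rw [linearIndependent_iff]
      intro l hl
      ext ⟨i, j⟩
      have h1 : d.repr ((Finsupp.linearCombination ℂ (fun z : A × D =>
          (⟨dualTmul a z.1 (d z.2), dualTmul_mem a _ _⟩ : finHom a V)) l).1 (a i)) j = 0 := by
        rw [hl]; simp
      rw [Finsupp.linearCombination_apply, Finsupp.sum, AddSubmonoidClass.coe_finsetSum,
        LinearMap.sum_apply, map_sum, Finsupp.finsetSum_apply] at h1
      rw [Finset.sum_eq_single (i, j)] at h1
      · simpa [dualTmul_self] using h1
      · rintro ⟨i', j'⟩ _ hne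
        change d.repr (l (i', j') • dualTmul a i' (d j') (a i)) j = 0
        by_cases hi : i = i'
        · subst hi
          rw [dualTmul_self, map_smul, d.repr_self, Finsupp.smul_apply,
            Finsupp.single_eq_of_ne (by rintro rfl; exact hne rfl), smul_zero]
        · rw [dualTmul_ne _ hi, smul_zero, map_zero, Finsupp.zero_apply]
      · intro h
        rw [Finsupp.notMem_support_iff] at h
        simp [h])
    (by
      rintro ⟨φ, hφ⟩ -
      have h := mem_span_dualTmul a d hφ (s := Set.univ) (fun i => by
        rw [Set.image_univ, d.span_eq]; trivial)
      have key : ∀ ψ ∈ Submodule.span ℂ {ψ : E →ₗ[ℂ] V | ∃ i, ∃ j ∈ Set.univ,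
          ψ = dualTmul a i (d j)}, ∃ hψ : ψ ∈ finHom a V, (⟨ψ, hψ⟩ : finHom a V) ∈
            Submodule.span ℂ (Set.range fun z : A × D =>
              (⟨dualTmul a z.1 (d z.2), dualTmul_mem a _ _⟩ : finHom a V)) := by
        intro ψ hψ
        induction hψ using Submodule.span_induction with
        | zero => exact ⟨zero_mem _, zero_mem _⟩
        | add x y _ _ hx hy => exact ⟨add_mem hx.1 hy.1, add_mem hx.2 hy.2⟩
        | smul c x _ hx => exact ⟨Submodule.smul_mem _ c hx.1, Submodule.smul_mem _ c hx.2⟩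
        | mem x hx =>
          obtain ⟨i, j, -, rfl⟩ := hx
          exact ⟨dualTmul_mem a _ _, Submodule.subset_span ⟨(i, j), rfl⟩⟩
      exact (key φ h).2)

theorem finHomBasis_apply (z : A × D) :
    (finHomBasis a d z : E →ₗ[ℂ] V) = dualTmul a z.1 (d z.2) := by
  rw [finHomBasis, Module.Basis.mk_apply]

end FinHom

section Frame

attribute [local instance 100] LieRing.ofAssociativeRing

variable {L : Type*} [LieRing L] [LieAlgebra ℂ L]
variable {G : SemiInfinite L} {P M : LieSubalgebra ℂ L} {A B : Type*}

theorem leftUS_rightUS (x y : L) (g : G.US) :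
    G.rightUS y (G.leftUS x g) = G.leftUS x (G.rightUS y g) :=
  (LinearMap.congr_fun (semiInvariantsMap_commute _ _ _ _ (G.leftAct_rightAct_commute x y)) g).symm

namespace SemiInductionFrame

variable {F : TriangularFrame G P M A B} {H Hp Hm ap am : LieSubalgebra ℂ L} {lam : H →ₗ[ℂ] ℂ}
  {C D E : Type*} (W : SemiInductionFrame F H Hp Hm ap am lam C D E)

/-- The functional on `U(P) = U(ap) ⊗ U(H₊)` dual to `c i ⊗ 1`. -/
def dualC (i : C) : U P →ₗ[ℂ] ℂ :=
  LinearMap.mul' ℂ ℂ ∘ₗ TensorProduct.map (W.c.coord i) (counit : U Hp →ₐ[ℂ] ℂ).toLinearMap ∘ₗ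
    (mulEquiv _ _ W.bijP).symm.toLinearMap

theorem dualC_mul (i : C) (u : U ap) (w : U Hp) :
    W.dualC i (W.inAp u * W.inHp w) = W.c.repr u i * counit w := by
  simp only [dualC, LinearMap.comp_apply, LinearEquiv.coe_coe]
  rw [mulEquiv_symm_mul]
  simp

theorem dualC_mul_toU (i : C) (p : U P) (x : Hp) :
    W.dualC i (p * toU (LieSubalgebra.inclusion W.Hp_le x)) = 0 := by
  rw [← (mulEquiv _ _ W.bijP).apply_symm_apply p]
  induction (mulEquiv _ _ W.bijP).symm p using TensorProduct.induction_on with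
  | zero => simp
  | add x y hx hy => rw [map_add, add_mul, map_add, hx, hy, add_zero]
  | tmul u w =>
    rw [mulEquiv_tmul, mul_assoc, ← mapU_toU, ← map_mul]
    rw [dualC_mul, map_mul, counit_toU, mul_zero, mul_zero]

theorem dualC_eq_zero {i : C} {p : U P} {k : ℕ} (hp : incU P p ∈ eigU F.delta k)
    (hk : k ≠ W.degC i) : W.dualC i p = 0 := by
  have h := W.mem_span_mon hp
  clear hp
  induction h using Submodule.span_induction with
  | zero => rw [map_zero]
  | add x y _ _ hx hy => rw [map_add, hx, hy, add_zero]
  | smul c x _ hx => rw [map_smul, hx, smul_zero]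
  | mem x hx =>
    obtain ⟨⟨i', l⟩, hz, rfl⟩ := hx
    rw [mon, dualC_mul]
    rcases l with _ | ⟨j, l⟩
    · simp only [List.map_nil, List.sum_nil, add_zero, Set.mem_ofPred_eq] at hz
      rw [W.c.repr_self, Finsupp.single_eq_of_ne (by rintro rfl; exact hk hz.symm), zero_mul]
    · rw [List.map_cons, List.prod_cons, map_mul, counit_toU, zero_mul, mul_zero]

/-- The map `p ↦ dualC i p • 1`. -/
def phiC (i : C) : U P →ₗ[ℂ] U M := (W.dualC i).smulRight 1

theorem phiC_apply (i : C) (p : U P) : W.phiC i p = W.dualC i p • 1 := rfl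

theorem phiC_mem (i : C) : W.phiC i ∈ finHom F.a (U M) := by
  refine (F.a_fin (W.degC i)).subset fun j hj => ?_
  by_contra hne
  exact hj (by rw [phiC_apply, W.dualC_eq_zero (F.a_mem j) hne, zero_smul])

theorem mkUS_phiC_mem (i : C) : G.mkUS (F.lift (W.phiC_mem i)) ∈ W.Inv := by
  rw [mem_Inv]
  intro x
  apply F.Phi_injective
  ext p
  rw [F.Phi_rightUS, F.Phi_lift, map_zero, LinearMap.zero_apply]
  have h1 := finsum_repr F.a (W.phiC i ∘ₗ LinearMap.mulLeft ℂ p ∘ₗ antipode)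
    (toU (LieSubalgebra.inclusion W.Hp_le x))
  refine Eq.trans (finsum_congr fun j => ?_) (h1.trans ?_)
  · have e : incU M (W.phiC i (p * antipode (F.a j))) * toU (x : L) =
        W.dualC i (p * antipode (F.a j)) •
          incU P (toU (LieSubalgebra.inclusion W.Hp_le x)) := by
      rw [phiC_apply, map_smul, map_one, smul_mul_assoc, one_mul, incU_toU]; rfl
    rw [e, map_smul, F.split_incP, map_smul, tcoef_tmul]
    simp only [LinearMap.comp_apply, LinearMap.mulLeft_apply, phiC_apply]
    rw [smul_comm]
  · simp only [LinearMap.comp_apply, LinearMap.mulLeft_apply, antipode_toU, map_neg,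
      phiC_apply, dualC_mul_toU, zero_smul, neg_zero]

theorem leftUS_mem_Inv {g : G.US} (hg : g ∈ W.Inv) (x : L) : G.leftUS x g ∈ W.Inv := by
  rw [mem_Inv] at *
  intro y
  rw [leftUS_rightUS, hg, map_zero]

/-- The translates of the invariant given by `dualC i`. -/
theorem exists_translate (i : C) (u : U L) : ∃ f : G.preUS, G.mkUS f ∈ W.Inv ∧
    ∀ v, f.1.1 v = incU M (F.extM (W.phiC i) (antipode u * v)) := by
  induction u using U_induction with
  | h1 => exact ⟨_, W.mkUS_phiC_mem i, fun v => by rw [antipode_one, one_mul]; rfl⟩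
  | hadd a b ha hb =>
    obtain ⟨f, h1, h2⟩ := ha
    obtain ⟨f', h1', h2'⟩ := hb
    refine ⟨f + f', add_mem h1 h1', fun v => ?_⟩
    rw [map_add, add_mul, map_add, map_add, ← h2, ← h2']; rfl
  | hsmul c a ha =>
    obtain ⟨f, h1, h2⟩ := ha
    refine ⟨c • f, Submodule.smul_mem _ c h1, fun v => ?_⟩
    rw [map_smul, smul_mul_assoc, map_smul, map_smul, ← h2]; rfl
  | hmul x a ha =>
    obtain ⟨f, h1, h2⟩ := ha
    refine ⟨⟨G.leftAct x f.1, invariants_le_comap _ (G.leftAct_commute x) f.2⟩,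
      W.leftUS_mem_Inv h1 x, fun v => ?_⟩
    rw [antipode_mul, antipode_toU, mul_assoc, neg_mul, ← neg_mul, ← map_neg, ← h2]; rfl

theorem Sb_antipode (u : U am) : F.Sb (antipode (W.inA u)) = W.inA u := by
  have hb : ∀ y : am, G.beta (y : L) = 0 := by
    rintro ⟨y, hy⟩
    have := W.am_neg y hy
    change G.beta y = 0
    clear hy
    induction this using Submodule.iSup_induction' with
    | zero => exact map_zero _
    | add x y _ _ hx hy => rw [map_add, hx, hy, add_zero]
    | mem n x hx => exact F.beta_eq_zero n (by have := n.2; omega) x hx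
  induction u using U_induction with
  | h1 => rw [map_one, antipode_one, F.Sb_one]
  | hadd a b ha hb => rw [map_add, map_add, map_add, ha, hb]
  | hsmul c a ha => rw [map_smul, map_smul, map_smul, ha]
  | hmul y a ha =>
    rw [map_mul, antipode_mul, F.Sb_mul, ha, mapU_toU, antipode_toU, map_neg, F.Sb_toU]
    have : G.beta ((LieSubalgebra.inclusion W.am_le y : M) : L) = 0 := hb y
    rw [this, zero_smul, zero_sub, neg_neg]

theorem proj_mul_inH (m : U M) (w : U Hm) : W.proj (m * W.inH w) = W.chiU w • W.proj m := by
  induction m using W.splitM_induction with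
  | hadd a b ha hb => rw [add_mul, map_add, map_add, ha, hb, smul_add]
  | h a v => rw [mul_assoc, ← map_mul, proj_mul, proj_mul, map_mul, smul_smul, mul_comm]

theorem chi_eq_zero {n : ℤ} (hn : n ≠ 0) {y : Hm} (hy : (y : L) ∈ G.gr n) : W.chi y = 0 := by
  rw [chi_apply, W.lam_gr n hn _ hy, F.beta_eq_zero n hn _ hy, add_zero]

theorem proj_mul_adU (m : U M) (w : U Hm) :
    W.proj (m * adU (⟨F.delta, F.delta_mem_M⟩ : M) (W.inH w)) = 0 := by
  induction w using U_induction generalizing m with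
  | h1 => rw [map_one, adU_one, mul_zero, map_zero]
  | hadd a b ha hb => rw [map_add, map_add, mul_add, map_add, ha, hb, add_zero]
  | hsmul c a ha => rw [map_smul, map_smul, mul_smul_comm, map_smul, ha, smul_zero]
  | hmul y w hw =>
    rw [map_mul W.inH, adU_mul, mul_add, map_add, ← mul_assoc, ← mul_assoc, hw, add_zero, inH_toU,
      adU_toU]
    have hy : y ∈ Submodule.span ℂ {y : Hm | ∃ n, (y : L) ∈ G.gr n} := W.Hm_span ▸ Submodule.mem_top
    have key : ∀ y ∈ Submodule.span ℂ {y : Hm | ∃ n, (y : L) ∈ G.gr n},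
        W.proj (m * toU ⁅(⟨F.delta, F.delta_mem_M⟩ : M), (⟨(y : L), W.Hm_le y.2⟩ : M)⁆) = 0 := by
      intro y hy
      induction hy using Submodule.span_induction with
      | zero =>
        rw [show (⟨((0 : Hm) : L), W.Hm_le (0 : Hm).2⟩ : M) = 0 from rfl]; simp
      | add a b _ _ ha hb =>
        rw [show (⟨((a + b : Hm) : L), W.Hm_le (a + b).2⟩ : M) =
          ⟨(a : L), W.Hm_le a.2⟩ + ⟨(b : L), W.Hm_le b.2⟩ from rfl, lie_add, map_add, mul_add, map_add,
          ha, hb, add_zero]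
      | smul c a _ ha =>
        rw [show (⟨((c • a : Hm) : L), W.Hm_le (c • a).2⟩ : M) =
          c • ⟨(a : L), W.Hm_le a.2⟩ from rfl, lie_smul, map_smul, mul_smul_comm, map_smul,
          ha, smul_zero]
      | mem y hy =>
        obtain ⟨n, hn⟩ := hy
        have e : ⁅(⟨F.delta, F.delta_mem_M⟩ : M), (⟨(y : L), W.Hm_le y.2⟩ : M)⁆ =
            (n : ℂ) • (⟨(y : L), W.Hm_le y.2⟩ : M) := Subtype.ext (F.lie_delta n _ hn)
        rw [e, map_smul, mul_smul_comm, map_smul, ← inH_toU, proj_mul_toU]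
        by_cases h0 : n = 0
        · rw [h0, Int.cast_zero, zero_smul]
        · rw [W.chi_eq_zero h0 hn, zero_smul, smul_zero]
    rw [proj_mul_inH, key y hy, smul_zero]

/-- The projection to `U(am)` preserves degrees. -/
theorem proj_mem {m : U M} {k : ℕ} (hm : incU M m ∈ eigU F.delta (-(k : ℂ))) :
    W.proj m ∈ Submodule.span ℂ (W.d '' {j | W.degD j = k}) := by
  have hinj : Function.Injective (incU am) := by
    intro u v huv
    apply W.inA_injective
    apply F.incM_injective
    rw [incU_inA, incU_inA, huv]
  obtain ⟨t, ht⟩ := exists_factor (adU F.delta ∘ₗ (incU am).toLinearMap) (incU am).toLinearMap hinj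
    (fun u => by
      induction u using basis_induction W.d with
      | zero => exact ⟨0, by simp⟩
      | add a b ha hb =>
        obtain ⟨c, hc⟩ := ha
        obtain ⟨c', hc'⟩ := hb
        exact ⟨c + c', by rw [map_add, map_add, hc, hc']⟩
      | smul r a ha =>
        obtain ⟨c, hc⟩ := ha
        exact ⟨r • c, by rw [map_smul, map_smul, hc]⟩
      | basis i =>
        refine ⟨-(W.degD i : ℂ) • W.d i, ?_⟩
        rw [map_smul]
        exact mem_eigU.1 (W.d_mem i))
  simp only [LinearMap.comp_apply, AlgHom.toLinearMap_apply] at ht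
  have htd : ∀ i, t (W.d i) = -(W.degD i : ℂ) • W.d i := by
    intro i
    apply hinj
    rw [← ht, map_smul]
    exact mem_eigU.1 (W.d_mem i)
  have htA : ∀ a, adU (⟨F.delta, F.delta_mem_M⟩ : M) (W.inA a) = W.inA (t a) := by
    intro a
    apply F.incM_injective
    rw [mapU_adU, incU_inA, incU_inA, ← ht]; rfl
  have hproj : ∀ m, W.proj (adU (⟨F.delta, F.delta_mem_M⟩ : M) m) = t (W.proj m) := by
    intro m
    induction m using W.splitM_induction with
    | hadd a b ha hb => rw [map_add, map_add, map_add, map_add, ha, hb]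
    | h a w => rw [adU_mul, map_add, proj_mul_adU, add_zero, htA, proj_mul, proj_mul, map_smul]
  have hm' : adU (⟨F.delta, F.delta_mem_M⟩ : M) m = -(k : ℂ) • m := by
    apply F.incM_injective
    rw [mapU_adU, map_smul]
    exact mem_eigU.1 hm
  have h1 : t (W.proj m) = -(k : ℂ) • W.proj m := by rw [← hproj, hm', map_smul]
  refine (W.d.mem_span_image).2 fun j hj => ?_
  have h2 := eigen_repr W.d t _ htd h1 (Finsupp.mem_support_iff.1 hj)
  have h3 : (W.degD j : ℂ) = k := neg_injective h2
  exact_mod_cast h3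

/-- The restriction of `q g` to `U(ap)`. -/
def res : G.US →ₗ[ℂ] U ap →ₗ[ℂ] U am := LinearMap.lcomp ℂ (U am) W.inAp.toLinearMap ∘ₗ W.q

theorem res_apply (g : G.US) (u : U ap) : W.res g u = W.q g (W.inAp u) := rfl

theorem comp_inAp_mem {V : Type*} [AddCommGroup V] [Module ℂ V] {n : U P →ₗ[ℂ] V}
    (hn : n ∈ finHom F.a V) : n ∘ₗ W.inAp.toLinearMap ∈ finHom W.c V := by
  obtain ⟨N, hN⟩ := F.finHom_bound hn
  refine ((Set.finite_lt_nat N).biUnion fun n _ => W.c_fin n).subset fun i hi => ?_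
  simp only [Set.mem_iUnion, Set.mem_ofPred_eq, exists_prop, exists_eq_right']
  by_contra hc
  refine hi (F.apply_eq_zero_of_bound hN (not_lt.1 hc) ?_)
  rw [AlgHom.toLinearMap_apply, incU_inAp]
  exact W.c_mem i

theorem res_mem (g : G.US) : W.res g ∈ finHom W.c (U am) := W.comp_inAp_mem (W.q_mem g)

/-- The translate of the invariant given by `dualC i` by `d j` restricts to `cᵢ^* ⊗ dⱼ`, up to terms
with values of smaller degree, which come from commuting `d j` past `U(ap)`. -/
theorem exists_res_sub_mem (i : C) (j : D) : ∃ g ∈ W.Inv, ∀ i',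
    (W.res g - dualTmul W.c i (W.d j)) (W.c i') ∈
      Submodule.span ℂ (W.d '' {j' | W.degD j' < W.degD j}) := by
  obtain ⟨f, hf, hfv⟩ := W.exists_translate i (incU am (W.d j))
  refine ⟨G.mkUS f, hf, fun i' => ?_⟩
  set r := incU am (antipode (W.d j)) * incU P (W.inAp (W.c i')) -
    incU P (W.inAp (W.c i')) * incU am (antipode (W.d j)) with hr
  have hc := W.c_mem i'
  rw [← W.incU_inAp] at hc
  have hrF := F.commutator_mem_Fil W.am_neg (antipode (W.d j)) hc
  rw [← hr] at hrF
  have hs : incU am (antipode (W.d j)) ∈ eigU F.delta (-(W.degD j : ℂ)) := by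
    rw [← antipode_mapU]; exact antipode_mem_eigU (W.d_mem j)
  have hre : r ∈ eigU F.delta ((W.degC i' : ℂ) + -(W.degD j : ℂ)) := by
    refine sub_mem ?_ (mul_mem_eigU hc hs)
    rw [add_comm]
    exact mul_mem_eigU hs hc
  have h1 : W.res (G.mkUS f) (W.c i') = W.dualC i (W.inAp (W.c i')) • W.d j +
      W.proj (F.extM (W.phiC i) r) := by
    have e : antipode (incU am (W.d j)) * incU P (W.inAp (W.c i')) =
        incU P (W.inAp (W.c i')) * incU M (antipode (W.inA (W.d j))) + r := by
      rw [hr, antipode_mapU, antipode_mapU, W.incU_inA]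
      exact (add_sub_cancel _ _).symm
    rw [res_apply, q_apply, F.Phi_of_range f (F.extM (W.phiC i) ∘ₗ
      LinearMap.mulLeft ℂ (antipode (incU am (W.d j)))) hfv, LinearMap.comp_apply,
      LinearMap.mulLeft_apply, e, map_add, F.extM_mul, W.Sb_antipode, map_add,
      phiC_apply, mul_smul_comm, mul_one, map_smul, proj_inA]
  have h2 : W.dualC i (W.inAp (W.c i')) • W.d j = dualTmul W.c i (W.d j) (W.c i') := by
    have := W.dualC_mul i (W.c i') 1
    rw [map_one, mul_one, map_one, mul_one] at this
    rw [this]; rfl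
  rw [LinearMap.sub_apply, h1, h2, add_sub_cancel_left]
  rw [← F.basisU.linearCombination_repr r, Finsupp.linearCombination_apply, Finsupp.sum, map_sum,
    map_sum]
  refine Submodule.sum_mem _ fun z hz => ?_
  rw [map_smul, map_smul]
  refine Submodule.smul_mem _ _ ?_
  rw [Finsupp.mem_support_iff] at hz
  have h3 := eigen_repr F.basisU (adU F.delta) _ F.basisU_eig (mem_eigU.1 hre) hz
  have h3' : (F.degA z.1 : ℤ) - F.degB z.2 = W.degC i' + -W.degD j := by exact_mod_cast h3
  have h4 : F.degA z.1 < W.degC i' := by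
    by_contra hc
    refine hz ?_
    rw [show z = (z.1, z.2) from rfl, F.repr_basisU, F.tcoef_Fil hrF (not_lt.1 hc), map_zero,
      Finsupp.zero_apply]
  rw [F.basisU_apply, F.extM_mul, phiC_apply, mul_smul_comm, mul_one, map_smul]
  by_cases h5 : F.degA z.1 = W.degC i
  · refine Submodule.smul_mem _ _ ?_
    have h6 : incU M (F.Sb (F.b z.2)) ∈ eigU F.delta (-(F.degB z.2 : ℂ)) := by
      have h7 : adU (⟨F.delta, F.delta_mem_M⟩ : M) (F.b z.2) = -(F.degB z.2 : ℂ) • F.b z.2 := by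
        apply F.incM_injective
        rw [mapU_adU, map_smul]
        exact mem_eigU.1 (F.b_mem z.2)
      have h8 : adU (⟨F.delta, F.delta_mem_M⟩ : M) (F.Sb (F.b z.2)) =
          F.Sb (adU (⟨F.delta, F.delta_mem_M⟩ : M) (F.b z.2)) := adU_twistedAntipode _ _ _ _
      rw [h7, map_smul] at h8
      have h9 := congrArg (incU M) h8
      rw [mapU_adU, map_smul] at h9
      exact mem_eigU.2 h9
    refine Submodule.span_mono (Set.image_mono ?_) (W.proj_mem h6)
    intro j' hj'
    simp only [Set.mem_ofPred_eq] at hj' ⊢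
    omega
  · rw [W.dualC_eq_zero (F.a_mem z.1) h5, zero_smul]
    exact zero_mem _

/-- Every map in `finHom` is the restriction of an invariant of `H₊`. -/
theorem exists_res_eq {ψ : U ap →ₗ[ℂ] U am} (hψ : ψ ∈ finHom W.c (U am)) :
    ∃ g ∈ W.Inv, W.res g = ψ := by
  have key : ∀ k : ℕ, ∀ i j, W.degD j < k → dualTmul W.c i (W.d j) ∈ W.Inv.map W.res := by
    intro k
    induction k with
    | zero => intro i j h; omega
    | succ k ih =>
      intro i j hj
      obtain ⟨g, hg, hgi⟩ := W.exists_res_sub_mem i j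
      have h1 := mem_span_dualTmul W.c W.d (sub_mem (W.res_mem g) (dualTmul_mem _ _ _)) hgi
      have h2 : W.res g - dualTmul W.c i (W.d j) ∈ W.Inv.map W.res := by
        refine Submodule.span_le.2 ?_ h1
        rintro _ ⟨i', j', hj', rfl⟩
        simp only [Set.mem_ofPred_eq] at hj'
        exact ih i' j' (by omega)
      have h3 := sub_mem (Submodule.mem_map_of_mem (f := W.res) hg) h2
      rwa [sub_sub_cancel] at h3
  have h := mem_span_dualTmul W.c W.d hψ (s := Set.univ) fun i => by
    rw [Set.image_univ, W.d.span_eq]; trivial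
  have h' : ψ ∈ W.Inv.map W.res := by
    refine Submodule.span_le.2 ?_ h
    rintro _ ⟨i, j, -, rfl⟩
    exact key _ i j (Nat.lt_succ_self _)
  exact h'

end SemiInductionFrame

end Frame

end Wakimoto

end

/-! ### The semi-induced module -/

noncomputable section

namespace Wakimoto

section Frame

attribute [local instance 100] LieRing.ofAssociativeRing

variable {L : Type*} [LieRing L] [LieAlgebra ℂ L]
variable {G : SemiInfinite L} {P M : LieSubalgebra ℂ L} {A B : Type*}

theorem mem_subU_iff (S : LieSubalgebra ℂ L) {u : U L} :
    u ∈ subU S.toSubmodule ↔ ∃ v : U S, incU S v = u := by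
  constructor
  · intro h
    have hle : subU S.toSubmodule ≤ (incU S).range := by
      rw [subU, Algebra.adjoin_le_iff]
      rintro _ ⟨x, hx, rfl⟩
      exact ⟨toU (⟨x, hx⟩ : S), incU_toU S ⟨x, hx⟩⟩
    exact hle h
  · rintro ⟨v, rfl⟩
    induction v using U_induction with
    | h1 => rw [map_one]; exact one_mem _
    | hadd a b ha hb => rw [map_add]; exact add_mem ha hb
    | hsmul c a ha => rw [map_smul]; exact (subU S.toSubmodule).smul_mem ha c
    | hmul x a ha =>
      rw [map_mul, incU_toU]
      exact mul_mem (Algebra.subset_adjoin ⟨x, x.2, rfl⟩) ha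

namespace SemiInductionFrame

variable {F : TriangularFrame G P M A B} {H Hp Hm ap am : LieSubalgebra ℂ L} {lam : H →ₗ[ℂ] ℂ}
  {C D E : Type*} (W : SemiInductionFrame F H Hp Hm ap am lam C D E)

theorem mem_Hp_of_plus {h : L} (hH : h ∈ H) (hP : h ∈ G.plus) (W : SemiInductionFrame F H Hp Hm ap am lam C D E) :
    h ∈ Hp := by
  obtain ⟨u, hu, v, hv, rfl⟩ := W.H_split h hH
  rw [← F.P_eq] at hP
  have h1 : v ∈ P := (add_mem_cancel_left (W.Hp_le hu)).1 hP
  rwa [inter_eq_zero F h1 (W.Hm_le hv), add_zero]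

theorem mem_Hm_of_minus {h : L} (hH : h ∈ H) (hM : h ∈ G.minus) (W : SemiInductionFrame F H Hp Hm ap am lam C D E) :
    h ∈ Hm := by
  obtain ⟨u, hu, v, hv, rfl⟩ := W.H_split h hH
  rw [← F.M_eq] at hM
  have h1 : u ∈ M := (add_mem_cancel_right (W.Hm_le hv)).1 hM
  rwa [inter_eq_zero F (W.Hp_le hu) h1, zero_add]

theorem lam_add_beta_Hp (W : SemiInductionFrame F H Hp Hm ap am lam C D E) (x : Hp) :
    lam ⟨x, W.Hp_le_H x.2⟩ + G.beta (x : L) = 0 := by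
  have : lam ∘ₗ (LieSubalgebra.inclusion W.Hp_le_H : Hp →ₗ⁅ℂ⁆ H).toLinearMap +
      G.beta ∘ₗ Hp.toSubmodule.subtype = 0 := by
    refine W.e.ext fun i => ?_
    have h0 : W.degE i ≠ 0 := by
      intro h0
      have h1 := W.e_mem i
      rw [h0] at h1
      have h2 := inter_eq_zero F (W.Hp_le (W.e i).2) (F.mem_M le_rfl h1)
      exact W.e.ne_zero i (Subtype.ext h2)
    have h1 : lam ⟨W.e i, W.Hp_le_H (W.e i).2⟩ = 0 :=
      W.lam_gr _ (by exact_mod_cast h0) _ (W.e_mem i)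
    have h2 : G.beta (W.e i : L) = 0 := F.beta_eq_zero _ (by exact_mod_cast h0) _ (W.e_mem i)
    exact (congrArg₂ (· + ·) h1 h2).trans (add_zero 0)
  exact LinearMap.congr_fun this x

variable (σ : H →ₗ⁅ℂ⁆ Module.End ℂ ℂ)

/-- The restriction map on `US ⊗ ℂ`, modulo the boundaries of `H₋`. -/
def resQ (hσ : ∀ h z, σ h z = lam h * z) :
    (G.US ⊗[ℂ] ℂ ⧸ boundaries (G.tensorAct H σ) (fun h : H => G.beta (h : L))
      {h : H | (h : L) ∈ G.minus}) →ₗ[ℂ] U ap →ₗ[ℂ] U am :=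
  Submodule.liftQ _ (W.res ∘ₗ (TensorProduct.rid ℂ G.US).toLinearMap) <| by
    refine iSup₂_le fun h hh => ?_
    rintro _ ⟨v, rfl⟩
    have hm := mem_Hm_of_minus h.2 hh W
    obtain ⟨g, rfl⟩ := (TensorProduct.rid ℂ G.US).symm.surjective v
    have e : TensorProduct.rid ℂ G.US
        (G.tensorAct H σ h ((TensorProduct.rid ℂ G.US).symm g) +
          G.beta (h : L) • (TensorProduct.rid ℂ G.US).symm g) =
          -(G.rightUS (h : L) g - W.chi ⟨h, hm⟩ • g) := by
      rw [TensorProduct.rid_symm_apply]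
      simp only [SemiInfinite.tensorAct, LinearMap.add_apply, LinearMap.neg_apply,
        LinearMap.rTensor_tmul, LinearMap.lTensor_tmul, 
        map_add, map_neg, map_smul, TensorProduct.rid_tmul, hσ, mul_one, one_smul]
      rw [chi_apply, add_smul]
      change -G.rightUS (h : L) g + lam h • g + G.beta (h : L) • g =
        -(G.rightUS (h : L) g - (lam h • g + G.beta (h : L) • g))
      abel
    rw [LinearMap.mem_ker, LinearMap.comp_apply]
    change W.res (TensorProduct.rid ℂ G.US (G.tensorAct H σ h ((TensorProduct.rid ℂ G.US).symm g) +
      G.beta (h : L) • (TensorProduct.rid ℂ G.US).symm g)) = 0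
    rw [e, map_neg, neg_eq_zero]
    have := W.q_Bd (Submodule.subset_span ⟨⟨h, hm⟩, g, rfl⟩)
    rw [res, LinearMap.comp_apply, this, map_zero]

theorem resQ_mk (hσ : ∀ h z, σ h z = lam h * z) (g : G.US) :
    W.resQ σ hσ (Submodule.Quotient.mk (g ⊗ₜ[ℂ] (1 : ℂ))) = W.res g := by
  change W.res (TensorProduct.rid ℂ G.US (g ⊗ₜ[ℂ] (1 : ℂ))) = _
  rw [TensorProduct.rid_tmul, one_smul]

theorem mk_eq_mk (hσ : ∀ h z, σ h z = lam h * z) {g g' : G.US} (h : g - g' ∈ W.Bd) :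
    (Submodule.Quotient.mk (g ⊗ₜ[ℂ] (1 : ℂ)) : G.US ⊗[ℂ] ℂ ⧸ boundaries (G.tensorAct H σ)
      (fun h : H => G.beta (h : L)) {h : H | (h : L) ∈ G.minus}) =
      Submodule.Quotient.mk (g' ⊗ₜ[ℂ] (1 : ℂ)) := by
  rw [Submodule.Quotient.eq, ← TensorProduct.sub_tmul]
  generalize g - g' = z at h
  induction h using Submodule.span_induction with
  | zero => rw [TensorProduct.zero_tmul]; exact zero_mem _
  | add x y _ _ hx hy => rw [TensorProduct.add_tmul]; exact add_mem hx hy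
  | smul c x _ hx => rw [← TensorProduct.smul_tmul']; exact Submodule.smul_mem _ c hx
  | mem z hz =>
    obtain ⟨y, g, rfl⟩ := hz
    have hy : (y : L) ∈ G.minus := by rw [← F.M_eq]; exact W.Hm_le y.2
    rw [← neg_mem_iff]
    refine Submodule.mem_iSup_of_mem ⟨y, W.Hm_le_H y.2⟩ (Submodule.mem_iSup_of_mem hy
      ⟨g ⊗ₜ 1, ?_⟩)
    rw [TensorProduct.sub_tmul, chi_apply, add_smul, TensorProduct.add_tmul]
    simp only [SemiInfinite.tensorAct, LinearMap.add_apply, LinearMap.neg_apply,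
      LinearMap.rTensor_tmul, LinearMap.lTensor_tmul, LinearMap.smul_apply, LinearMap.id_apply, hσ,
      mul_one, ← TensorProduct.smul_tmul']
    rw [← TensorProduct.tmul_smul (lam ⟨y, W.Hm_le_H y.2⟩) g (1 : ℂ), smul_eq_mul, mul_one]
    abel

/-- Since `lam + β` vanishes on `H₊`, an element of the semi-induced module is represented by an
invariant of `H₊` in `US`. -/
theorem exists_rep (hσ : ∀ h z, σ h z = lam h * z) (v : G.SInd H σ) :
    ∃ g ∈ W.Inv, v.1 = Submodule.Quotient.mk (g ⊗ₜ[ℂ] (1 : ℂ)) := by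
  obtain ⟨_, w, hw, rfl⟩ := v
  obtain ⟨g, rfl⟩ := (TensorProduct.rid ℂ G.US).symm.surjective w
  refine ⟨g, W.mem_Inv.2 fun x => ?_, congrArg _ (TensorProduct.rid_symm_apply g)⟩
  have hx : (x : L) ∈ G.plus := by rw [← F.P_eq]; exact W.Hp_le x.2
  have h1 := (Submodule.mem_iInf _).1 ((Submodule.mem_iInf _).1 hw ⟨x, W.Hp_le_H x.2⟩) hx
  have h2 := congrArg (TensorProduct.rid ℂ G.US) (LinearMap.mem_ker.1 h1)
  simp only [SemiInfinite.tensorAct, LinearMap.add_apply, LinearMap.neg_apply,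
    LinearMap.rTensor_tmul, LinearMap.lTensor_tmul, LinearMap.smul_apply, LinearMap.id_apply,
    map_add, map_neg, map_smul, TensorProduct.rid_symm_apply, TensorProduct.rid_tmul, hσ, mul_one,
    one_smul, map_zero] at h2
  rw [add_assoc, ← add_smul, W.lam_add_beta_Hp x, zero_smul, add_zero, neg_eq_zero] at h2
  exact h2

theorem exists_SInd (hσ : ∀ h z, σ h z = lam h * z) {g : G.US} (hg : g ∈ W.Inv) :
    ∃ v : G.SInd H σ, v.1 = Submodule.Quotient.mk (g ⊗ₜ[ℂ] (1 : ℂ)) := by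
  refine ⟨⟨_, g ⊗ₜ 1, ?_, rfl⟩, rfl⟩
  refine (Submodule.mem_iInf _).2 fun h => (Submodule.mem_iInf _).2 fun hh => ?_
  have hp := mem_Hp_of_plus h.2 hh W
  have h1 := W.lam_add_beta_Hp ⟨h, hp⟩
  have h2 : G.rightUS (h : L) g = 0 := W.mem_Inv.1 hg ⟨h, hp⟩
  rw [LinearMap.mem_ker]
  simp only [SemiInfinite.tensorAct, LinearMap.add_apply, LinearMap.neg_apply,
    LinearMap.rTensor_tmul, LinearMap.lTensor_tmul, LinearMap.smul_apply, LinearMap.id_apply, hσ,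
    mul_one, h2, TensorProduct.zero_tmul, neg_zero, zero_add]
  have h3 : g ⊗ₜ[ℂ] lam h = lam h • (g ⊗ₜ[ℂ] (1 : ℂ)) := by
    rw [← TensorProduct.tmul_smul, smul_eq_mul, mul_one]
  rw [h3, ← add_smul]
  change (lam h + G.beta (h : L)) • _ = _
  rw [show lam h + G.beta (h : L) = 0 from h1, zero_smul]

/-- The semi-induced module is the space of linear maps `U(ap) → U(am)` that vanish in large
degrees. -/
def resEquiv (hσ : ∀ h z, σ h z = lam h * z) : G.SInd H σ ≃ₗ[ℂ] finHom W.c (U am) :=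
  LinearEquiv.ofBijective
    ((W.resQ σ hσ ∘ₗ Submodule.subtype _).codRestrict (finHom W.c (U am)) fun v => by
      obtain ⟨g, -, hv⟩ := W.exists_rep σ hσ v
      rw [LinearMap.comp_apply, Submodule.subtype_apply, hv, resQ_mk]
      exact W.res_mem g) <| by
    constructor
    · rw [injective_iff_map_eq_zero]
      intro v hv
      obtain ⟨g, hg, hv'⟩ := W.exists_rep σ hσ v
      have h1 : W.resQ σ hσ v.1 = 0 := congrArg Subtype.val hv
      rw [hv', resQ_mk] at h1
      have h2 := W.mem_Bd (W.q_eq_zero hg fun u => LinearMap.congr_fun h1 u)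
      have h3 := W.mk_eq_mk σ hσ (g := g) (g' := 0) (by rwa [sub_zero])
      refine Subtype.ext (hv'.trans (h3.trans ?_))
      rw [TensorProduct.zero_tmul]; rfl
    · rintro ⟨ψ, hψ⟩
      obtain ⟨g, hg, hgψ⟩ := W.exists_res_eq hψ
      obtain ⟨v, hv⟩ := W.exists_SInd σ hσ hg
      refine ⟨v, Subtype.ext ?_⟩
      change W.resQ σ hσ v.1 = ψ
      rw [hv, resQ_mk, hgψ]

theorem resEquiv_apply (hσ : ∀ h z, σ h z = lam h * z) (v : G.SInd H σ) :
    (W.resEquiv σ hσ v).1 = W.resQ σ hσ v.1 := rfl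

/-- The vector of the semi-induced module with restriction `ψ` is characterized by its
representatives that map `U(P)` to `U(am)`. -/
theorem exists_rep_iff (hσ : ∀ h z, σ h z = lam h * z) (v : G.SInd H σ) (ψ : finHom W.c (U am)) :
    (∃ f : G.preUS, (∀ u ∈ subU P.toSubmodule, f.1.1 u ∈ subU am.toSubmodule) ∧
      (∀ u : U ap, f.1.1 (incU ap u) = incU am (ψ.1 u)) ∧
      v.1 = Submodule.Quotient.mk (G.mkUS f ⊗ₜ[ℂ] (1 : ℂ))) ↔ W.resEquiv σ hσ v = ψ := by
  constructor
  · rintro ⟨f, hf, hfψ, hv⟩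
    refine Subtype.ext ?_
    rw [resEquiv_apply, hv, resQ_mk]
    have hinj : Function.Injective (incU am) := by
      intro u v huv
      apply W.inA_injective
      apply F.incM_injective
      rw [incU_inA, incU_inA, huv]
    obtain ⟨n, hn⟩ := exists_factor (f.1.1 ∘ₗ (incU P).toLinearMap) (incU am).toLinearMap hinj
      (fun u => by
        obtain ⟨w, hw⟩ := (mem_subU_iff am).1 (hf _ ((mem_subU_iff P).2 ⟨u, rfl⟩))
        exact ⟨w, hw.symm⟩)
    simp only [LinearMap.comp_apply, AlgHom.toLinearMap_apply] at hn
    have hf' : ∀ v, f.1.1 v = incU M (F.extM (W.inA.toLinearMap ∘ₗ n) v) := by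
      have hm : ∀ (m : U M) (u : U L), f.1.1 (u * incU M m) = incU M (F.Sb m) * f.1.1 u := by
        intro m
        induction m using U_induction with
        | h1 => intro u; rw [map_one, mul_one, F.Sb_one, map_one, one_mul]
        | hadd a b ha hb => intro u; rw [map_add, mul_add, map_add, ha, hb, map_add, map_add, add_mul]
        | hsmul c a ha =>
          intro u; rw [map_smul, mul_smul_comm, map_smul, ha, map_smul, map_smul, smul_mul_assoc]
        | hmul y a ha =>
          intro u
          rw [map_mul (incU M), incU_toU, ← mul_assoc, ha, F.preUS_apply f.2, F.Sb_mul, map_mul (incU M),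
            F.Sb_toU, map_sub, map_smul, map_one, incU_toU, mul_assoc, sub_mul, smul_mul_assoc, one_mul]
      intro v
      induction v using F.split_induction with
      | hadd a b ha hb => rw [map_add, map_add, map_add, ha, hb]
      | h p m =>
        rw [hm, F.extM_mul, map_mul (incU M), hn, LinearMap.comp_apply, AlgHom.toLinearMap_apply,
          incU_inA]
    ext u
    rw [res_apply, q_apply, F.Phi_of_range f _ hf', F.extM_incP, LinearMap.comp_apply,
      AlgHom.toLinearMap_apply, proj_inA]
    apply hinj
    rw [← hn, incU_inAp, hfψ]
  · intro h
    obtain ⟨g, hg, hv⟩ := W.exists_rep σ hσ v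
    have h1 := congrArg Subtype.val h
    rw [resEquiv_apply, hv, resQ_mk] at h1
    have hl : ∀ p, (F.lift (W.inA_comp_mem (W.q_mem g))).1.1 (incU P p) = incU am (W.q g p) := by
      intro p
      rw [F.lift_apply, F.extM_incP, LinearMap.comp_apply, AlgHom.toLinearMap_apply, incU_inA]
    refine ⟨F.lift (W.inA_comp_mem (W.q_mem g)), fun u hu => ?_, fun u => ?_, ?_⟩
    · obtain ⟨p, rfl⟩ := (mem_subU_iff P).1 hu
      rw [hl]
      exact (mem_subU_iff am).2 ⟨_, rfl⟩
    · rw [← incU_inAp W, hl, ← h1]; rfl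
    · rw [hv]
      exact W.mk_eq_mk σ hσ (W.sub_lift_mem_Bd g)

/-- The weights of the vectors `cᵢ^* ⊗ dⱼ` for an element `h` of degree `0`. -/
theorem act_eq_smul (hσ : ∀ h z, σ h z = lam h * z) (h : Hm) (γ : C → ℂ)
    (hγ : ∀ i, incU ap (W.c i) ∈ eigU (h : L) (γ i)) {ε : ℂ} (i : C) (j : D)
    (hε : incU am (W.d j) ∈ eigU (h : L) ε) (v : G.SInd H σ)
    (hv : (W.resEquiv σ hσ v).1 = dualTmul W.c i (W.d j)) :
    G.actSInd H σ (h : L) v = (lam ⟨h, W.Hm_le_H h.2⟩ + ε - γ i) • v := by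
  apply (W.resEquiv σ hσ).injective
  refine Subtype.ext (W.c.ext fun i' => ?_)
  have hsm : (W.resEquiv σ hσ ((lam ⟨h, W.Hm_le_H h.2⟩ + ε - γ i) • v)).1 =
      (lam ⟨h, W.Hm_le_H h.2⟩ + ε - γ i) • dualTmul W.c i (W.d j) := by
    rw [map_smul, ← hv]; rfl
  rw [hsm]
  obtain ⟨g, hg, hvg⟩ := W.exists_rep σ hσ v
  rw [resEquiv_apply, hvg, resQ_mk] at hv
  have hvg' := hvg.trans (W.mk_eq_mk σ hσ (W.sub_lift_mem_Bd g))
  set f := F.lift (W.inA_comp_mem (W.q_mem g)) with hf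
  have h1 : (G.actSInd H σ (h : L) v).1 =
      Submodule.Quotient.mk (G.leftUS (h : L) (G.mkUS f) ⊗ₜ[ℂ] (1 : ℂ)) := by
    change Submodule.mapQ _ _ ((G.leftUS (h : L)).rTensor ℂ)
      (boundaries_le_comap _ (G.leftUS_tensor_commute H σ (h : L))) v.1 = _
    rw [hvg']; rfl
  rw [resEquiv_apply, h1, resQ_mk]
  let hM : M := ⟨h, W.Hm_le h.2⟩
  have h2 : G.leftUS (h : L) (G.mkUS f) = G.mkUS ⟨G.leftAct (h : L) f.1,
      invariants_le_comap _ (G.leftAct_commute (h : L)) f.2⟩ := rfl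
  have hpc : ∀ p : U P, F.Phi (G.leftUS (h : L) (G.mkUS f)) p =
      F.extM (W.inA.toLinearMap ∘ₗ W.q g) (toU (-(h : L)) * incU P p) := by
    intro p
    rw [h2, F.Phi_of_range _ (F.extM (W.inA.toLinearMap ∘ₗ W.q g) ∘ₗ
      LinearMap.mulLeft ℂ (toU (-(h : L)))) (fun v => rfl)]
    rfl
  have hci : incU P (W.inAp (W.c i')) ∈ eigU (h : L) (γ i') := by rw [incU_inAp]; exact hγ i'
  have h3 : toU (-(h : L)) * incU P (W.inAp (W.c i')) =
      -(incU P (W.inAp (W.c i')) * incU M (toU hM)) - γ i' • incU P (W.inAp (W.c i')) := by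
    rw [map_neg, neg_mul, toU_mul_eq, mem_eigU.1 hci, incU_toU, neg_add, sub_eq_add_neg]
  rw [res_apply, q_apply, hpc, h3, map_sub, map_neg, map_smul, F.extM_mul, F.extM_incP, F.Sb_toU]
  simp only [LinearMap.comp_apply, AlgHom.toLinearMap_apply]
  rw [← res_apply, hv, LinearMap.smul_apply]
  by_cases hi : i' = i
  · subst hi
    rw [dualTmul_self]
    have h4 : toU hM * W.inA (W.d j) = W.inA (W.d j) * W.inH (toU h) + ε • W.inA (W.d j) := by
      apply F.incM_injective
      rw [inH_toU, map_mul (incU M), map_add, map_mul (incU M), map_smul, incU_toU, incU_inA]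
      rw [toU_mul_eq, mem_eigU.1 hε]
    rw [sub_mul, smul_mul_assoc, one_mul, h4, map_sub, map_neg, map_sub, map_smul, map_smul, map_add,
      proj_mul_toU, map_smul, proj_inA, chi_apply]
    simp only [add_smul, sub_smul]
    change -(G.beta (h : L) • _ - _) - _ = _
    abel
  · rw [dualTmul_ne _ hi]
    simp

end SemiInductionFrame

end Frame

end Wakimoto

end

/-! ### Bigraded Lie algebras -/

noncomputable section

namespace Wakimoto

section FiniteSums

/-- There are finitely many families of multiplicities of given total degree, if there are finitely
many indices of each degree and all degrees are positive. -/
theorem finite_sum_mul_eq {Q : Type*} (deg : Q → ℕ) (hpos : ∀ q, 0 < deg q)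
    (hfin : ∀ n, {q | deg q = n}.Finite) (k : ℕ) :
    {n : Q →₀ ℕ | (n.sum fun q j => j * deg q) = k}.Finite := by
  classical
  have hS : {q | deg q ≤ k}.Finite := by
    refine ((Set.finite_le_nat k).biUnion fun n _ => hfin n).subset fun q hq => ?_
    simp only [Set.mem_iUnion, Set.mem_ofPred_eq, exists_prop, exists_eq_right']
    exact hq
  refine (Set.finite_Iic (∑ q ∈ hS.toFinset, Finsupp.single q k)).subset fun n hn => ?_
  simp only [Set.mem_ofPred_eq] at hn
  rw [Set.mem_Iic, Finsupp.le_def]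
  intro q
  by_cases hq : n q = 0
  · rw [hq]; exact Nat.zero_le _
  have h1 : n q * deg q ≤ k := by
    rw [← hn]
    exact Finset.single_le_sum (f := fun q => n q * deg q) (fun _ _ => Nat.zero_le _)
      (Finsupp.mem_support_iff.2 hq)
  have h2 := hpos q
  have h3 : deg q ≤ k := by nlinarith [Nat.pos_of_ne_zero hq]
  rw [Finsupp.finsetSum_apply, Finset.sum_eq_single q]
  · rw [Finsupp.single_eq_same]; nlinarith
  · intro q' _ hne
    rw [Finsupp.single_eq_of_ne (Ne.symm hne)]
  · intro h; simp [h3] at h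

end FiniteSums

/-- A basis of a Lie algebra consisting of common eigenvectors of `ad ρ` and `ad D`, with integral
eigenvalues `hgt` and `mo`. -/
structure BigradedBasis (L : Type*) [LieRing L] [LieAlgebra ℂ L] (R : Type*) where
  v : Module.Basis R ℂ L
  hgt : R → ℤ
  mo : R → ℤ
  rho : L
  D : L
  lie_rho : ∀ r, ⁅rho, v r⁆ = (hgt r : ℂ) • v r
  lie_D : ∀ r, ⁅D, v r⁆ = (mo r : ℂ) • v r

namespace BigradedBasis

attribute [local instance 100] LieRing.ofAssociativeRing

variable {L : Type*} [LieRing L] [LieAlgebra ℂ L] {R : Type*} (Z : BigradedBasis L R)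

/-- The indices of bidegree satisfying `p`. -/
def idx (p : ℤ → ℤ → Prop) : Set R := {r | p (Z.hgt r) (Z.mo r)}

/-- The span of the basis vectors of bidegree satisfying `p`. -/
def Sp (p : ℤ → ℤ → Prop) : Submodule ℂ L := Submodule.span ℂ (Z.v '' Z.idx p)

theorem mem_Sp {p : ℤ → ℤ → Prop} {x : L} :
    x ∈ Z.Sp p ↔ ∀ r, Z.v.repr x r ≠ 0 → p (Z.hgt r) (Z.mo r) := by
  rw [Sp, Z.v.mem_span_image]
  exact ⟨fun h r hr => h (Finsupp.mem_support_iff.2 hr), fun h r hr =>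
    h r (Finsupp.mem_support_iff.1 hr)⟩

theorem v_mem {p : ℤ → ℤ → Prop} {r : R} (h : p (Z.hgt r) (Z.mo r)) : Z.v r ∈ Z.Sp p :=
  Submodule.subset_span ⟨r, h, rfl⟩

theorem Sp_mono {p q : ℤ → ℤ → Prop} (h : ∀ i j, p i j → q i j) : Z.Sp p ≤ Z.Sp q := fun x hx =>
  Z.mem_Sp.2 fun r hr => h _ _ (Z.mem_Sp.1 hx r hr)

theorem lie_mem_Sp {p q s : ℤ → ℤ → Prop}
    (h : ∀ i j k l, p i j → q k l → s (i + k) (j + l))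
    {x y : L} (hx : x ∈ Z.Sp p) (hy : y ∈ Z.Sp q) : ⁅x, y⁆ ∈ Z.Sp s := by
  induction hx using Submodule.span_induction with
  | zero => rw [zero_lie]; exact zero_mem _
  | add a b _ _ ha hb => rw [add_lie]; exact add_mem ha hb
  | smul c a _ ha => rw [smul_lie]; exact Submodule.smul_mem _ c ha
  | mem x hx =>
    obtain ⟨r, hr, rfl⟩ := hx
    induction hy using Submodule.span_induction with
    | zero => rw [lie_zero]; exact zero_mem _
    | add a b _ _ ha hb => rw [lie_add]; exact add_mem ha hb
    | smul c a _ ha => rw [lie_smul]; exact Submodule.smul_mem _ c ha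
    | mem y hy =>
      obtain ⟨t, ht, rfl⟩ := hy
      refine Z.mem_Sp.2 fun w hw => ?_
      have h1 := eigen_repr Z.v (LieAlgebra.ad ℂ L Z.rho) _ Z.lie_rho
        (v := ⁅Z.v r, Z.v t⁆) (d := (Z.hgt r : ℂ) + Z.hgt t) (by
          rw [LieAlgebra.ad_apply, leibniz_lie, Z.lie_rho, Z.lie_rho, smul_lie, lie_smul, add_smul]) hw
      have h2 := eigen_repr Z.v (LieAlgebra.ad ℂ L Z.D) _ Z.lie_D
        (v := ⁅Z.v r, Z.v t⁆) (d := (Z.mo r : ℂ) + Z.mo t) (by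
          rw [LieAlgebra.ad_apply, leibniz_lie, Z.lie_D, Z.lie_D, smul_lie, lie_smul, add_smul]) hw
      have h1' : Z.hgt w = Z.hgt r + Z.hgt t := by exact_mod_cast h1
      have h2' : Z.mo w = Z.mo r + Z.mo t := by exact_mod_cast h2
      rw [h1', h2']
      exact h _ _ _ _ hr ht

theorem Sp_inf (p q : ℤ → ℤ → Prop) : Z.Sp p ⊓ Z.Sp q = Z.Sp fun i j => p i j ∧ q i j := by
  ext x
  rw [Submodule.mem_inf, mem_Sp, mem_Sp, mem_Sp]
  exact ⟨fun h r hr => ⟨h.1 r hr, h.2 r hr⟩, fun h => ⟨fun r hr => (h r hr).1, fun r hr => (h r hr).2⟩⟩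

/-- The subalgebra spanned by the basis vectors of bidegree satisfying a condition closed under
addition. -/
def SpLie (p : ℤ → ℤ → Prop) (hp : ∀ i j k l, p i j → p k l → p (i + k) (j + l)) :
    LieSubalgebra ℂ L :=
  { Z.Sp p with lie_mem' := fun hx hy => Z.lie_mem_Sp hp hx hy }

/-- The basis of a subalgebra spanned by basis vectors. -/
def subBasis {S : LieSubalgebra ℂ L} {p : ℤ → ℤ → Prop} (hS : S.toSubmodule = Z.Sp p) :
    Module.Basis (Z.idx p) ℂ S :=
  Module.Basis.mk (v := fun r : Z.idx p => (⟨Z.v r, by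
      rw [← LieSubalgebra.mem_toSubmodule, hS]; exact Z.v_mem r.2⟩ : S))
    (by
      refine LinearIndependent.of_comp S.toSubmodule.subtype ?_
      exact Z.v.linearIndependent.comp _ Subtype.val_injective)
    (by
      rintro ⟨x, hx⟩ -
      have hx' : x ∈ Z.Sp p := hS ▸ hx
      have key : ∀ x ∈ Z.Sp p, ∃ h : x ∈ S, (⟨x, h⟩ : S) ∈ Submodule.span ℂ (Set.range
          fun r : Z.idx p => (⟨Z.v r, by
            rw [← LieSubalgebra.mem_toSubmodule, hS]; exact Z.v_mem r.2⟩ : S)) := by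
        intro x hx
        induction hx using Submodule.span_induction with
        | zero => exact ⟨zero_mem _, zero_mem _⟩
        | add a b _ _ ha hb => exact ⟨add_mem ha.1 hb.1, add_mem ha.2 hb.2⟩
        | smul c a _ ha => exact ⟨S.smul_mem c ha.1, Submodule.smul_mem _ c ha.2⟩
        | mem x hx =>
          obtain ⟨r, hr, rfl⟩ := hx
          exact ⟨by rw [← LieSubalgebra.mem_toSubmodule, hS]; exact Z.v_mem hr,
            Submodule.subset_span ⟨⟨r, hr⟩, rfl⟩⟩
      exact (key x hx').2)

theorem subBasis_apply {S : LieSubalgebra ℂ L} {p : ℤ → ℤ → Prop} (hS : S.toSubmodule = Z.Sp p)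
    (r : Z.idx p) : (Z.subBasis hS r : L) = Z.v r := by
  rw [subBasis, Module.Basis.mk_apply]

theorem repr_subBasis {S : LieSubalgebra ℂ L} {p : ℤ → ℤ → Prop} (hS : S.toSubmodule = Z.Sp p)
    (x : S) (r : Z.idx p) : (Z.subBasis hS).repr x r = Z.v.repr (x : L) r := by
  classical
  induction x using basis_induction (Z.subBasis hS) with
  | zero => simp
  | add x y hx hy => rw [map_add, Finsupp.add_apply, hx, hy, AddMemClass.coe_add, map_add, Finsupp.add_apply]
  | smul c x hx =>
    rw [map_smul, Finsupp.smul_apply, hx, show ((c • x : S) : L) = c • (x : L) from rfl, map_smul,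
      Finsupp.smul_apply]
  | basis i =>
    rw [Module.Basis.repr_self, subBasis_apply, Z.v.repr_self, Finsupp.single_apply,
      Finsupp.single_apply]
    simp only [Subtype.ext_iff]

theorem bijective_inclusion {S S₁ S₂ : LieSubalgebra ℂ L} {p p₁ p₂ : ℤ → ℤ → Prop}
    (h1 : S₁.toSubmodule = Z.Sp p₁) (h2 : S₂.toSubmodule = Z.Sp p₂) (hS : S.toSubmodule = Z.Sp p)
    (hle1 : S₁ ≤ S) (hle2 : S₂ ≤ S) (hp : ∀ i j, p i j → p₁ i j ∨ p₂ i j)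
    (hd : ∀ i j, p₁ i j → p₂ i j → False) :
    Function.Bijective fun z : S₁ × S₂ =>
      LieSubalgebra.inclusion hle1 z.1 + LieSubalgebra.inclusion hle2 z.2 := by
  have m1 : ∀ x : L, x ∈ S₁ ↔ x ∈ Z.Sp p₁ := fun x => by rw [← h1]; rfl
  have m2 : ∀ x : L, x ∈ S₂ ↔ x ∈ Z.Sp p₂ := fun x => by rw [← h2]; rfl
  constructor
  · rintro ⟨x, y⟩ ⟨x', y'⟩ h
    have h' : (x : L) + y = x' + y' := congrArg Subtype.val h
    have e1 : (x : L) - x' = y' - y := by rw [sub_eq_sub_iff_add_eq_add, h', add_comm]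
    have hz : (x : L) - x' = 0 := by
      refine Z.v.ext_elem fun r => ?_
      rw [map_zero, Finsupp.zero_apply]
      by_contra hne
      refine hd _ _ (Z.mem_Sp.1 ((m1 _).1 (sub_mem x.2 x'.2)) r hne) ?_
      rw [e1] at hne
      exact Z.mem_Sp.1 ((m2 _).1 (sub_mem y'.2 y.2)) r hne
    have hz' := hz
    rw [e1] at hz'
    exact Prod.ext (Subtype.ext (sub_eq_zero.1 hz)) (Subtype.ext (sub_eq_zero.1 hz').symm)
  · rintro ⟨x, hx⟩
    have hx' : x ∈ Z.Sp p := hS ▸ hx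
    have key : ∀ x ∈ Z.Sp p, ∃ a ∈ S₁, ∃ b ∈ S₂, a + b = x := by
      intro x hx
      induction hx using Submodule.span_induction with
      | zero => exact ⟨0, zero_mem _, 0, zero_mem _, add_zero 0⟩
      | add x y _ _ hx hy =>
        obtain ⟨a, ha, b, hb, rfl⟩ := hx
        obtain ⟨a', ha', b', hb', rfl⟩ := hy
        exact ⟨a + a', add_mem ha ha', b + b', add_mem hb hb', add_add_add_comm _ _ _ _⟩
      | smul c x _ hx =>
        obtain ⟨a, ha, b, hb, rfl⟩ := hx
        exact ⟨c • a, S₁.smul_mem c ha, c • b, S₂.smul_mem c hb, (smul_add _ _ _).symm⟩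
      | mem x hx =>
        obtain ⟨r, hr, rfl⟩ := hx
        rcases hp _ _ hr with h | h
        · exact ⟨_, (m1 _).2 (Z.v_mem h), 0, zero_mem _, add_zero _⟩
        · exact ⟨0, zero_mem _, _, (m2 _).2 (Z.v_mem h), zero_add _⟩
    obtain ⟨a, ha, b, hb, hab⟩ := key x hx'
    exact ⟨(⟨a, ha⟩, ⟨b, hb⟩), Subtype.ext hab⟩

end BigradedBasis

/-- A bigraded basis with the properties required for semi-induction from `H`: the total degree
`hgt + I mo` is the degree of a semi-infinite structure, `P` and `M` are its positive and nonpositive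
parts, and `H` is the part of nonnegative height, without the vectors of height `0` and positive
`mo`. -/
structure BigradedFrame {L : Type*} [LieRing L] [LieAlgebra ℂ L] {R : Type*} (Z : BigradedBasis L R)
    (G : SemiInfinite L) (P M H ap am : LieSubalgebra ℂ L) (lam : H →ₗ[ℂ] ℂ) where
  I : ℤ
  I_pos : 0 < I
  gr_eq : ∀ n, G.gr n = Z.Sp fun i j => i + I * j = n
  P_eq : P.toSubmodule = Z.Sp fun i j => 0 < i + I * j
  M_eq : M.toSubmodule = Z.Sp fun i j => i + I * j ≤ 0
  H_eq : H.toSubmodule = Z.Sp fun i j => 0 < i ∨ i = 0 ∧ j ≤ 0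
  ap_eq : ap.toSubmodule = Z.Sp fun i j => (i < 0 ∨ i = 0 ∧ 0 < j) ∧ 0 < i + I * j
  am_eq : am.toSubmodule = Z.Sp fun i j => (i < 0 ∨ i = 0 ∧ 0 < j) ∧ i + I * j ≤ 0
  not_deg_zero : ∀ r, Z.hgt r + I * Z.mo r = 0 → Z.hgt r = 0
  deg_fin : ∀ n, {r | Z.hgt r + I * Z.mo r = n}.Finite
  beta_v : ∀ r, Z.hgt r ≠ 0 ∨ Z.mo r ≠ 0 → G.beta (Z.v r) = 0
  beta_lie : ∀ x y : M, G.beta ⁅(x : L), (y : L)⁆ = 0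
  lam_v : ∀ x : H, (∀ r, Z.v.repr (x : L) r ≠ 0 → Z.hgt r ≠ 0 ∨ Z.mo r ≠ 0) → lam x = 0
  lam_lie : ∀ x y : H, lam ⁅x, y⁆ = 0
  gen_pos : ∀ n : ℕ, 0 < n → ∀ x ∈ G.gr (n + 1),
    x ∈ Submodule.span ℂ {z | ∃ x ∈ G.gr 1, ∃ y ∈ G.gr n, z = ⁅x, y⁆}
  gen_neg : ∀ n : ℕ, 0 < n → ∀ x ∈ G.gr (-(n + 1 : ℤ)),
    x ∈ Submodule.span ℂ {z | ∃ x ∈ G.gr (-1), ∃ y ∈ G.gr (-(n : ℤ)), z = ⁅x, y⁆}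
  chevalley : ∀ x ∈ G.gr (-1), x ∈ Submodule.span ℂ {y | y ∈ G.gr (-1) ∧ ∃ h ∈ G.gr 0,
    (∀ x ∈ G.gr 1, ∃ c : ℂ, ⁅y, x⁆ = c • h) ∧ ⁅h, y⁆ = -(G.beta h) • y}

namespace BigradedFrame

attribute [local instance 100] LieRing.ofAssociativeRing

variable {L : Type*} [LieRing L] [LieAlgebra ℂ L] {R : Type*} {Z : BigradedBasis L R}
    {G : SemiInfinite L} {P M H ap am : LieSubalgebra ℂ L} {lam : H →ₗ[ℂ] ℂ}
    (Y : BigradedFrame Z G P M H ap am lam)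

/-- The element whose adjoint action is the total degree. -/
def delta : L := Z.rho + (Y.I : ℂ) • Z.D

/-- The total degree. -/
def deg (r : R) : ℤ := Z.hgt r + Y.I * Z.mo r

theorem lie_delta_v (r : R) : ⁅Y.delta, Z.v r⁆ = (Y.deg r : ℂ) • Z.v r := by
  rw [delta, add_lie, smul_lie, Z.lie_rho, Z.lie_D, smul_smul, ← add_smul, deg]
  push_cast; rfl

theorem lie_delta {n : ℤ} {x : L} (hx : x ∈ G.gr n) : ⁅Y.delta, x⁆ = (n : ℂ) • x := by
  rw [Y.gr_eq] at hx
  induction hx using Submodule.span_induction with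
  | zero => simp
  | add a b _ _ ha hb => rw [lie_add, ha, hb, smul_add]
  | smul c a _ ha => rw [lie_smul, ha, smul_comm]
  | mem x hx =>
    obtain ⟨r, hr, rfl⟩ := hx
    rw [Y.lie_delta_v]
    congr 2

theorem mem_gr_of_P {n : ℤ} (Y : BigradedFrame Z G P M H ap am lam) (hn : 0 < n) {x : L}
    (hx : x ∈ G.gr n) : x ∈ P := by
  rw [← LieSubalgebra.mem_toSubmodule, Y.P_eq]
  rw [Y.gr_eq] at hx
  exact Z.Sp_mono (fun i j h => by omega) hx

theorem mem_gr_of_M {n : ℤ} (Y : BigradedFrame Z G P M H ap am lam) (hn : n ≤ 0) {x : L}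
    (hx : x ∈ G.gr n) : x ∈ M := by
  rw [← LieSubalgebra.mem_toSubmodule, Y.M_eq]
  rw [Y.gr_eq] at hx
  exact Z.Sp_mono (fun i j h => by omega) hx

theorem P_induction (Y : BigradedFrame Z G P M H ap am lam) (K : LieSubalgebra ℂ P)
    (hK : ∀ x : P, (x : L) ∈ G.gr 1 → x ∈ K) (x : P) : x ∈ K := by
  have h1 : ∀ n : ℕ, ∀ x : P, (x : L) ∈ G.gr (n + 1) → x ∈ K := by
    intro n
    induction n with
    | zero => intro x hx; exact hK x (by simpa using hx)
    | succ n ih =>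
      rintro ⟨x, hP⟩ hx
      have h2 := Y.gen_pos (n + 1) (Nat.succ_pos n) x (by exact_mod_cast hx)
      have key : ∀ x ∈ Submodule.span ℂ {z | ∃ x ∈ G.gr 1, ∃ y ∈ G.gr (n + 1 : ℕ), z = ⁅x, y⁆},
          ∃ h : x ∈ P, (⟨x, h⟩ : P) ∈ K := by
        intro x hx
        induction hx using Submodule.span_induction with
        | zero => exact ⟨zero_mem _, zero_mem _⟩
        | add a b _ _ ha hb => exact ⟨add_mem ha.1 hb.1, add_mem ha.2 hb.2⟩
        | smul c a _ ha => exact ⟨P.smul_mem c ha.1, K.smul_mem c ha.2⟩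
        | mem x hx =>
          obtain ⟨a, ha, b, hb, rfl⟩ := hx
          have haP := Y.mem_gr_of_P one_pos ha
          have hbP := Y.mem_gr_of_P (by positivity) hb
          exact ⟨P.lie_mem haP hbP, K.lie_mem (hK ⟨a, haP⟩ ha) (ih ⟨b, hbP⟩ (by exact_mod_cast hb))⟩
      exact (key x h2).2
  induction x using basis_induction (Z.subBasis Y.P_eq) with
  | zero => exact zero_mem _
  | add x y hx hy => exact add_mem hx hy
  | smul c x hx => exact K.smul_mem c hx
  | basis r =>
    obtain ⟨r, hr⟩ := r
    have hr' : 0 < Z.hgt r + Y.I * Z.mo r := hr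
    refine h1 (Z.hgt r + Y.I * Z.mo r - 1).toNat _ ?_
    rw [Z.subBasis_apply, Y.gr_eq]
    exact Z.v_mem (by simp only; omega)

theorem M_induction (Y : BigradedFrame Z G P M H ap am lam) (K : LieSubalgebra ℂ M)
    (h0 : ∀ x : M, (x : L) ∈ G.gr 0 → x ∈ K) (hK : ∀ x : M, (x : L) ∈ G.gr (-1) → x ∈ K) (x : M) :
    x ∈ K := by
  have h1 : ∀ n : ℕ, ∀ x : M, (x : L) ∈ G.gr (-(n + 1 : ℤ)) → x ∈ K := by
    intro n
    induction n with
    | zero => intro x hx; exact hK x (by simpa using hx)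
    | succ n ih =>
      rintro ⟨x, hP⟩ hx
      have h2 := Y.gen_neg (n + 1) (Nat.succ_pos n) x (by exact_mod_cast hx)
      have key : ∀ x ∈ Submodule.span ℂ {z | ∃ x ∈ G.gr (-1), ∃ y ∈ G.gr (-((n + 1 : ℕ) : ℤ)),
          z = ⁅x, y⁆}, ∃ h : x ∈ M, (⟨x, h⟩ : M) ∈ K := by
        intro x hx
        induction hx using Submodule.span_induction with
        | zero => exact ⟨zero_mem _, zero_mem _⟩
        | add a b _ _ ha hb => exact ⟨add_mem ha.1 hb.1, add_mem ha.2 hb.2⟩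
        | smul c a _ ha => exact ⟨M.smul_mem c ha.1, K.smul_mem c ha.2⟩
        | mem x hx =>
          obtain ⟨a, ha, b, hb, rfl⟩ := hx
          have haP := Y.mem_gr_of_M (by omega) ha
          have hbP := Y.mem_gr_of_M (by omega) hb
          exact ⟨M.lie_mem haP hbP, K.lie_mem (hK ⟨a, haP⟩ ha) (ih ⟨b, hbP⟩ (by exact_mod_cast hb))⟩
      exact (key x h2).2
  induction x using basis_induction (Z.subBasis Y.M_eq) with
  | zero => exact zero_mem _
  | add x y hx hy => exact add_mem hx hy
  | smul c x hx => exact K.smul_mem c hx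
  | basis r =>
    obtain ⟨r, hr⟩ := r
    have hr' : Z.hgt r + Y.I * Z.mo r ≤ 0 := hr
    by_cases h0' : Z.hgt r + Y.I * Z.mo r = 0
    · refine h0 _ ?_
      rw [Z.subBasis_apply, Y.gr_eq]
      exact Z.v_mem h0'
    · refine h1 (-(Z.hgt r + Y.I * Z.mo r) - 1).toNat _ ?_
      rw [Z.subBasis_apply, Y.gr_eq]
      exact Z.v_mem (by simp only; omega)

theorem beta_eq_zero (Y : BigradedFrame Z G P M H ap am lam) {p : ℤ → ℤ → Prop}
    (hp : ∀ i j, p i j → i ≠ 0 ∨ j ≠ 0) {x : L} (hx : x ∈ Z.Sp p) : G.beta x = 0 := by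
  induction hx using Submodule.span_induction with
  | zero => exact map_zero _
  | add a b _ _ ha hb => rw [map_add, ha, hb, add_zero]
  | smul c a _ ha => rw [map_smul, ha, smul_zero]
  | mem x hx =>
    obtain ⟨r, hr, rfl⟩ := hx
    exact Y.beta_v r (hp _ _ hr)

theorem lam_eq_zero (Y : BigradedFrame Z G P M H ap am lam) {p : ℤ → ℤ → Prop}
    (hp : ∀ i j, p i j → i ≠ 0 ∨ j ≠ 0) {x : H} (hx : (x : L) ∈ Z.Sp p) : lam x = 0 :=
  Y.lam_v x fun r hr => hp _ _ (Z.mem_Sp.1 hx r hr)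

/-- A monomial in eigenvectors is an eigenvector. -/
theorem pbw_mem {S : LieSubalgebra ℂ L} {J : Type*} [LinearOrder J] (x : Module.Basis J ℂ S) (h : L)
    (c : J → ℂ) (hc : ∀ i, ⁅h, (x i : L)⁆ = c i • (x i : L)) (n : J →₀ ℕ) :
    incU S (pbwBasis x n) ∈ eigU h (n.sum fun i k => k * c i) := by
  rw [pbwBasis_apply]
  exact pbwMonomial_mem_eigU S.incl (fun i => x i) h c hc n

/-- The degree of a basis vector of `P`. -/
def degP (r : Z.idx fun i j => 0 < i + Y.I * j) : ℕ := (Y.deg r).toNat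

theorem degP_cast (r : Z.idx fun i j => 0 < i + Y.I * j) : (Y.degP r : ℤ) = Y.deg r :=
  Int.toNat_of_nonneg (le_of_lt r.2)

theorem degP_pos (r : Z.idx fun i j => 0 < i + Y.I * j) : 0 < Y.degP r := by
  have h := Y.degP_cast r
  have h2 : 0 < Y.deg r := r.2
  omega

theorem degP_fin (n : ℕ) : {r | Y.degP r = n}.Finite := by
  refine Set.Finite.of_finite_image ((Y.deg_fin n).subset ?_) Subtype.val_injective.injOn
  rintro _ ⟨r, hr, rfl⟩
  have h := Y.degP_cast r
  simp only [Set.mem_ofPred_eq] at hr ⊢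
  rw [hr] at h
  exact h.symm

/-- The degree of a basis vector of `M`, with the opposite sign. -/
def degM (r : Z.idx fun i j => i + Y.I * j ≤ 0) : ℕ := (-Y.deg r).toNat

theorem degM_cast (r : Z.idx fun i j => i + Y.I * j ≤ 0) : (Y.degM r : ℤ) = -Y.deg r :=
  Int.toNat_of_nonneg (by have : Y.deg r ≤ 0 := r.2; omega)

theorem v_mem_gr_one (k : Fin (Y.deg_fin 1).toFinset.card) :
    Z.v ((Y.deg_fin 1).toFinset.equivFin.symm k) ∈ G.gr 1 := by
  have h := ((Y.deg_fin 1).toFinset.equivFin.symm k).2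
  rw [Set.Finite.mem_toFinset] at h
  have h2 := Z.v_mem (p := fun i j => i + Y.I * j = 1) h
  rwa [← Y.gr_eq] at h2

/-- The triangular frame of a bigraded frame. -/
def toFrame [LinearOrder (Z.idx fun i j => 0 < i + Y.I * j)]
    [LinearOrder (Z.idx fun i j => i + Y.I * j ≤ 0)] :
    TriangularFrame G P M ((Z.idx fun i j => 0 < i + Y.I * j) →₀ ℕ)
      ((Z.idx fun i j => i + Y.I * j ≤ 0) →₀ ℕ) where
  delta := Y.delta
  lie_delta _ _ hx := Y.lie_delta hx
  P_eq := by
    rw [SemiInfinite.plus, Y.P_eq]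
    refine le_antisymm (Submodule.span_le.2 ?_) (iSup_le fun n => ?_)
    · rintro _ ⟨r, hr, rfl⟩
      refine Submodule.mem_iSup_of_mem ⟨_, hr⟩ ?_
      rw [Y.gr_eq]
      exact Z.v_mem rfl
    · rw [Y.gr_eq]
      exact Z.Sp_mono fun i j h => by have := n.2; omega
  M_eq := by
    rw [SemiInfinite.minus, Y.M_eq]
    refine le_antisymm (Submodule.span_le.2 ?_) (iSup_le fun n => ?_)
    · rintro _ ⟨r, hr, rfl⟩
      refine Submodule.mem_iSup_of_mem ⟨_, hr⟩ ?_
      rw [Y.gr_eq]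
      exact Z.v_mem rfl
    · rw [Y.gr_eq]
      exact Z.Sp_mono fun i j h => by have := n.2; omega
  a := pbwBasis (Z.subBasis Y.P_eq)
  degA n := n.sum fun r k => k * Y.degP r
  a_mem n := by
    have h := pbw_mem (Z.subBasis Y.P_eq) Y.delta (fun r => (Y.degP r : ℂ)) (fun r => by
      rw [Z.subBasis_apply, Y.lie_delta_v, ← Y.degP_cast, Int.cast_natCast]) n
    simpa [Finsupp.sum] using h
  a_fin n := finite_sum_mul_eq _ Y.degP_pos Y.degP_fin n
  b := pbwBasis (Z.subBasis Y.M_eq)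
  degB n := n.sum fun r k => k * Y.degM r
  b_mem n := by
    have h := pbw_mem (Z.subBasis Y.M_eq) Y.delta (fun r => -(Y.degM r : ℂ)) (fun r => by
      have h1 : Y.deg r = -(Y.degM r : ℤ) := by rw [Y.degM_cast, neg_neg]
      rw [Z.subBasis_apply, Y.lie_delta_v, h1, Int.cast_neg, Int.cast_natCast]) n
    simpa [Finsupp.sum] using h
  beta_lie := Y.beta_lie
  beta_eq_zero n hn x hx := by
    rw [Y.gr_eq] at hx
    refine Y.beta_eq_zero (fun i j h => ?_) hx
    by_contra hc
    simp only [not_or, not_not] at hc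
    rw [hc.1, hc.2, mul_zero, add_zero] at h
    exact hn h.symm
  rank := (Y.deg_fin 1).toFinset.card
  s k := ⟨Z.v ((Y.deg_fin 1).toFinset.equivFin.symm k),
    Y.mem_gr_of_P one_pos (Y.v_mem_gr_one k)⟩
  s_mem := Y.v_mem_gr_one
  s_gen K hK := by
    refine Y.P_induction K ?_
    rintro ⟨x, hP⟩ hx
    have key : ∀ x ∈ G.gr 1, ∃ h : x ∈ P, (⟨x, h⟩ : P) ∈ K := by
      intro x hx
      rw [Y.gr_eq] at hx
      induction hx using Submodule.span_induction with
      | zero => exact ⟨zero_mem _, zero_mem _⟩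
      | add a b _ _ ha hb => exact ⟨add_mem ha.1 hb.1, add_mem ha.2 hb.2⟩
      | smul c a _ ha => exact ⟨P.smul_mem c ha.1, K.smul_mem c ha.2⟩
      | mem x hx =>
        obtain ⟨r, hr, rfl⟩ := hx
        have h1 := hK ((Y.deg_fin 1).toFinset.equivFin ⟨r, by
          rw [Set.Finite.mem_toFinset]; exact hr⟩)
        simp only [Equiv.symm_apply_apply] at h1
        exact ⟨_, h1⟩
    exact (key x hx).2
  M_gen K h0 hK := by
    refine Y.M_induction K h0 ?_
    rintro ⟨x, hP⟩ hx
    have key : ∀ x ∈ Submodule.span ℂ {y | y ∈ G.gr (-1) ∧ ∃ h ∈ G.gr 0,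
        (∀ x ∈ G.gr 1, ∃ c : ℂ, ⁅y, x⁆ = c • h) ∧ ⁅h, y⁆ = -(G.beta h) • y},
        ∃ h : x ∈ M, (⟨x, h⟩ : M) ∈ K := by
      intro x hx
      induction hx using Submodule.span_induction with
      | zero => exact ⟨zero_mem _, zero_mem _⟩
      | add a b _ _ ha hb => exact ⟨add_mem ha.1 hb.1, add_mem ha.2 hb.2⟩
      | smul c a _ ha => exact ⟨M.smul_mem c ha.1, K.smul_mem c ha.2⟩
      | mem y hy =>
        obtain ⟨hy, h, hh, h1, h2⟩ := hy
        exact ⟨Y.mem_gr_of_M (by omega) hy, hK ⟨y, Y.mem_gr_of_M (by omega) hy⟩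
          ⟨h, Y.mem_gr_of_M le_rfl hh⟩ hy hh h1 h2⟩
    exact (key x (Y.chevalley x hx)).2

end BigradedFrame

end Wakimoto

end

/-! ### Semi-induction for bigraded Lie algebras -/

noncomputable section

namespace Wakimoto

namespace BigradedFrame

attribute [local instance 100] LieRing.ofAssociativeRing

variable {L : Type*} [LieRing L] [LieAlgebra ℂ L] {R : Type*} {Z : BigradedBasis L R}
    {G : SemiInfinite L} {P M H ap am : LieSubalgebra ℂ L} {lam : H →ₗ[ℂ] ℂ}
    (Y : BigradedFrame Z G P M H ap am lam)

theorem mul_pos_iff' (Y : BigradedFrame Z G P M H ap am lam) (j : ℤ) : 0 < Y.I * j ↔ 0 < j :=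
  mul_pos_iff_of_pos_left Y.I_pos

/-- The part of `H` of positive degree. -/
def Hp : LieSubalgebra ℂ L := Z.SpLie (fun i j => 0 < i ∧ 0 < i + Y.I * j) fun i j k l h1 h2 => by
  rw [mul_add]; omega

/-- The part of `H` of nonpositive degree. -/
def Hm : LieSubalgebra ℂ L :=
  Z.SpLie (fun i j => (0 < i ∨ i = 0 ∧ j ≤ 0) ∧ i + Y.I * j ≤ 0) fun i j k l h1 h2 => by
    rw [mul_add]; omega

theorem Hp_eq : Y.Hp.toSubmodule = Z.Sp fun i j => 0 < i ∧ 0 < i + Y.I * j := rfl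

theorem Hm_eq : Y.Hm.toSubmodule = Z.Sp fun i j => (0 < i ∨ i = 0 ∧ j ≤ 0) ∧ i + Y.I * j ≤ 0 := rfl

theorem le_of_Sp {S S' : LieSubalgebra ℂ L} {p p' : ℤ → ℤ → Prop} (h : S.toSubmodule = Z.Sp p)
    (h' : S'.toSubmodule = Z.Sp p') (hp : ∀ i j, p i j → p' i j) : S ≤ S' := by
  intro x hx
  rw [← LieSubalgebra.mem_toSubmodule, h']
  rw [← LieSubalgebra.mem_toSubmodule, h] at hx
  exact Z.Sp_mono hp hx

theorem split_of_sum (Z : BigradedBasis L R) {p₁ p₂ q : ℤ → ℤ → Prop} {u v : L}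
    (hu : u ∈ Z.Sp p₁) (hv : v ∈ Z.Sp p₂)
    (hd : ∀ i j, p₁ i j → p₂ i j → False) (h : u + v ∈ Z.Sp q) : u ∈ Z.Sp q ∧ v ∈ Z.Sp q := by
  rw [Z.mem_Sp] at hu hv h
  rw [Z.mem_Sp, Z.mem_Sp]
  constructor
  · intro r hr
    refine h r ?_
    rw [map_add, Finsupp.add_apply]
    by_cases h0 : Z.v.repr v r = 0
    · rwa [h0, add_zero]
    · exact (hd _ _ (hu r hr) (hv r h0)).elim
  · intro r hr
    refine h r ?_
    rw [map_add, Finsupp.add_apply]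
    by_cases h0 : Z.v.repr u r = 0
    · rwa [h0, zero_add]
    · exact (hd _ _ (hu r h0) (hv r hr)).elim

variable [LinearOrder (Z.idx fun i j => 0 < i + Y.I * j)]
    [LinearOrder (Z.idx fun i j => i + Y.I * j ≤ 0)]

/-- The data for semi-induction from `H` given by a bigraded frame and homogeneous bases of the
complements `ap` and `am`. -/
def toSemiInductionFrame {ι κ : Type*} [LinearOrder ι] [LinearOrder κ] (x : Module.Basis ι ℂ ap)
    (y : Module.Basis κ ℂ am) (dx : ι → ℕ) (dy : κ → ℕ)
    (hx : ∀ i, ⁅Y.delta, (x i : L)⁆ = (dx i : ℂ) • (x i : L))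
    (hy : ∀ j, ⁅Y.delta, (y j : L)⁆ = -(dy j : ℂ) • (y j : L)) (hpos : ∀ i, 0 < dx i)
    (hfin : ∀ n, {i | dx i = n}.Finite) :
    SemiInductionFrame Y.toFrame H Y.Hp Y.Hm ap am lam (ι →₀ ℕ) (κ →₀ ℕ)
      (Z.idx fun i j => 0 < i ∧ 0 < i + Y.I * j) where
  ap_le := le_of_Sp Y.ap_eq Y.P_eq fun i j h => h.2
  am_le := le_of_Sp Y.am_eq Y.M_eq fun i j h => h.2
  Hp_le := le_of_Sp Y.Hp_eq Y.P_eq fun i j h => h.2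
  Hm_le := le_of_Sp Y.Hm_eq Y.M_eq fun i j h => h.2
  Hp_le_H := le_of_Sp Y.Hp_eq Y.H_eq fun i j h => Or.inl h.1
  Hm_le_H := le_of_Sp Y.Hm_eq Y.H_eq fun i j h => h.1
  am_neg z hz := by
    rw [← LieSubalgebra.mem_toSubmodule, Y.am_eq] at hz
    refine Submodule.span_le.2 ?_ hz
    rintro _ ⟨r, ⟨hr1, hr2⟩, rfl⟩
    refine Submodule.mem_iSup_of_mem ⟨Z.hgt r + Y.I * Z.mo r, ?_⟩ ?_
    · have h0 := Y.not_deg_zero r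
      have h1 := Y.mul_pos_iff' (Z.mo r)
      omega
    · rw [Y.gr_eq]
      exact Z.v_mem rfl
  bijP := Z.bijective_inclusion Y.ap_eq Y.Hp_eq Y.P_eq _ _
    (fun i j h => by have h1 := Y.mul_pos_iff' j; omega) (fun i j h1 h2 => by omega)
  bijM := Z.bijective_inclusion Y.am_eq Y.Hm_eq Y.M_eq _ _
    (fun i j h => by have h1 := Y.mul_pos_iff' j; omega) (fun i j h1 h2 => by omega)
  H_split z hz := by
    have h := (Z.bijective_inclusion Y.Hp_eq Y.Hm_eq Y.H_eq
      (le_of_Sp Y.Hp_eq Y.H_eq fun i j h => Or.inl h.1)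
      (le_of_Sp Y.Hm_eq Y.H_eq fun i j h => h.1)
      (fun i j h => by have h1 := Y.mul_pos_iff' j; omega) (fun i j h1 h2 => by omega)).2 ⟨z, hz⟩
    obtain ⟨w, hw⟩ := h
    exact ⟨w.1, w.1.2, w.2, w.2.2, congrArg Subtype.val hw⟩
  lam_lie := Y.lam_lie
  lam_gr n hn h hh := by
    rw [Y.gr_eq] at hh
    refine Y.lam_eq_zero (fun i j h => ?_) hh
    by_contra hc
    simp only [not_or, not_not] at hc
    rw [hc.1, hc.2, mul_zero, add_zero] at h
    exact hn h.symm
  c := pbwBasis x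
  degC n := n.sum fun i k => k * dx i
  c_mem n := by
    have h := pbw_mem x Y.delta (fun i => (dx i : ℂ)) hx n
    simpa [Finsupp.sum, toFrame] using h
  c_fin n := finite_sum_mul_eq _ hpos hfin n
  d := pbwBasis y
  degD n := n.sum fun i k => k * dy i
  d_mem n := by
    have h := pbw_mem y Y.delta (fun i => -(dy i : ℂ)) hy n
    simpa [Finsupp.sum, toFrame] using h
  e := Z.subBasis Y.Hp_eq
  degE r := (Y.deg r).toNat
  e_mem r := by
    have h : 0 < Y.deg r := r.2.2
    rw [Z.subBasis_apply, Y.gr_eq, Int.toNat_of_nonneg h.le]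
    exact Z.v_mem rfl
  e_fin n := by
    refine Set.Finite.of_finite_image ((Y.deg_fin n).subset ?_) Subtype.val_injective.injOn
    rintro _ ⟨r, hr, rfl⟩
    have h : 0 < Y.deg r := r.2.2
    have h2 := Int.toNat_of_nonneg h.le
    simp only [Set.mem_ofPred_eq] at hr ⊢
    rw [hr] at h2
    exact h2.symm
  Hm_span := by
    rw [eq_top_iff, ← (Z.subBasis Y.Hm_eq).span_eq, Submodule.span_le]
    rintro _ ⟨r, rfl⟩
    refine Submodule.subset_span ⟨Y.deg r, ?_⟩
    rw [Z.subBasis_apply, Y.gr_eq]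
    exact Z.v_mem rfl
  height r w v u huv := by
    have hr : 0 < Z.hgt r := r.2.1
    have he : ((Z.subBasis Y.Hp_eq r : Y.Hp) : L) ∈ Z.Sp fun i _ => Z.hgt r ≤ i := by
      rw [Z.subBasis_apply]; exact Z.v_mem le_rfl
    have hw : (w : L) ∈ Z.Sp fun i _ => 0 ≤ i :=
      Z.Sp_mono (fun i j h => by omega) (show (w : L) ∈ Z.Sp _ from w.2)
    have h1 : (u : L) + v ∈ Z.Sp fun i _ => Z.hgt r ≤ i := by
      rw [← huv]
      exact Z.lie_mem_Sp (fun i j k l h h' => by omega) he hw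
    have h2 := (split_of_sum Z u.2 v.2 (fun i j h h' => by omega) h1).2
    refine ⟨?_, fun x u' v' hx' => ?_⟩
    · have h3 := Y.lam_eq_zero (x := ⟨v, le_of_Sp Y.Hm_eq Y.H_eq (fun i j h => h.1) v.2⟩)
        (fun i j h => Or.inl (show i ≠ 0 by omega)) h2
      have h4 := Y.beta_eq_zero (fun i j h => Or.inl (show i ≠ 0 by omega)) h2
      rw [h3, h4, add_zero]
    · have hx : (x : L) ∈ Z.Sp fun i _ => 0 < i :=
        Z.Sp_mono (fun i j h => h.1) (show (x : L) ∈ Z.Sp _ from x.2)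
      have h3 : (u' : L) + v' ∈ Z.Sp fun i _ => Z.hgt r < i := by
        rw [← hx']
        exact Z.lie_mem_Sp (fun i j k l h h' => by omega) hx h2
      have h4 := (split_of_sum Z u'.2 v'.2 (fun i j h h' => by omega) h3).1
      rw [Z.repr_subBasis]
      by_contra hne
      have h5 := Z.mem_Sp.1 h4 _ hne
      omega

end BigradedFrame

end Wakimoto

end

/-! ### The bigrading of the affine Lie algebra -/

noncomputable section

namespace Wakimoto

open LieAlgebra LieAlgebra.IsKilling LieModule

section Affine

attribute [local instance 100] LieRing.ofAssociativeRing

variable {𝔤 : Type*} [LieRing 𝔤] [LieAlgebra ℂ 𝔤] [FiniteDimensional ℂ 𝔤] [LieAlgebra.IsSimple ℂ 𝔤]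
  (T : LieSubalgebra ℂ 𝔤) [T.IsCartanSubalgebra] (b : (rootSystem T).Base) (θ : T.root)

/-- The index set of a basis of `𝔤` that is adapted to the root space decomposition. -/
abbrev RootIndex : Type _ := Σ α : Weight ℂ T 𝔤, Fin (Module.finrank ℂ (rootSpace T α))

open Classical in
theorem isInternal_rootSpace :
    DirectSum.IsInternal fun α : Weight ℂ T 𝔤 => (rootSpace T α).toSubmodule := by
  refine DirectSum.isInternal_submodule_of_iSupIndep_of_iSup_eq_top
    (LieSubmodule.iSupIndep_toSubmodule.mpr <| iSupIndep_genWeightSpace' ℂ T 𝔤) ?_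
  rw [← LieSubmodule.iSup_toSubmodule, iSup_genWeightSpace_eq_top' ℂ T 𝔤]
  rfl

open Classical in
/-- A basis of `𝔤` that is adapted to the root space decomposition. -/
def rootBasis : Module.Basis (RootIndex T) ℂ 𝔤 :=
  (isInternal_rootSpace T).collectedBasis fun α => Module.finBasis ℂ (rootSpace T α).toSubmodule

theorem rootBasis_mem (r : RootIndex T) : rootBasis T r ∈ rootSpace T r.1 :=
  by classical exact (isInternal_rootSpace T).collectedBasis_mem _ r

theorem rootSpace_le_span (α : Weight ℂ T 𝔤) :
    (rootSpace T α).toSubmodule ≤ Submodule.span ℂ (Set.range fun i => rootBasis T ⟨α, i⟩) := by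
  intro x hx
  have h := (Module.finBasis ℂ (rootSpace T α).toSubmodule).sum_repr ⟨x, hx⟩
  have h2 : _ = x := congrArg Subtype.val h
  rw [← h2, AddSubmonoidClass.coe_finsetSum]
  refine Submodule.sum_mem _ fun i _ => Submodule.smul_mem _ _ (Submodule.subset_span ⟨i, ?_⟩)
  simp [rootBasis]

/-- The index set of a basis of `𝔤̂`: the vectors `zᵐ ⊗ x` for `x` in a basis of `𝔤`, and `K`, `d`. -/
abbrev AffineIndex : Type _ := (ℤ × RootIndex T) ⊕ Fin 2

/-- A basis of `𝔤̂` consisting of vectors `zᵐ ⊗ x` with `x` in a weight space of `𝔤`, and of `K` and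
`d`. -/
def affineBasis : Module.Basis (AffineIndex T) ℂ (AffineLie T θ) :=
  (((AddMonoidAlgebra.basis ℤ ℂ).tensorProduct (rootBasis T)).prod (Module.Basis.finTwoProd ℂ) :
    Module.Basis (AffineIndex T) ℂ ((AddMonoidAlgebra ℂ ℤ ⊗[ℂ] 𝔤) × ℂ × ℂ))

theorem affineBasis_inl (m : ℤ) (r : RootIndex T) :
    affineBasis T θ (Sum.inl (m, r)) = ofLoop T θ (loop m (rootBasis T r)) := by
  have h : (((AddMonoidAlgebra.basis ℤ ℂ).tensorProduct (rootBasis T)).prod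
      (Module.Basis.finTwoProd ℂ)) (Sum.inl (m, r)) =
      (AddMonoidAlgebra.single m (1 : ℂ) ⊗ₜ[ℂ] rootBasis T r, 0) := by
    ext1 <;> simp
  exact h

theorem affineBasis_inr_zero : affineBasis T θ (Sum.inr 0) = elK T θ := by
  have h : (((AddMonoidAlgebra.basis ℤ ℂ).tensorProduct (rootBasis T)).prod
      (Module.Basis.finTwoProd ℂ)) (Sum.inr 0) =
      ((0 : AddMonoidAlgebra ℂ ℤ ⊗[ℂ] 𝔤), ((1 : ℂ), (0 : ℂ))) := by
    ext1 <;> simp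
  exact h

theorem affineBasis_inr_one : affineBasis T θ (Sum.inr 1) = elD T θ := by
  have h : (((AddMonoidAlgebra.basis ℤ ℂ).tensorProduct (rootBasis T)).prod
      (Module.Basis.finTwoProd ℂ)) (Sum.inr 1) =
      ((0 : AddMonoidAlgebra ℂ ℤ ⊗[ℂ] 𝔤), ((0 : ℂ), (1 : ℂ))) := by
    ext1 <;> simp
  exact h

/-- The weight of a basis vector of `𝔤̂`. -/
def affineWt : AffineIndex T → Module.Dual ℂ (T × ℂ × ℂ)
  | Sum.inl (m, r) => (r.1 : Weight ℂ T 𝔤).toLinear ∘ₗ LinearMap.fst ℂ T (ℂ × ℂ) +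
      (m : ℂ) • (LinearMap.snd ℂ ℂ ℂ ∘ₗ LinearMap.snd ℂ T (ℂ × ℂ))
  | Sum.inr _ => 0

theorem cartan_eq (h : T × ℂ × ℂ) : cartan T θ h =
    ofLoop T θ (loop 0 (h.1 : 𝔤)) + h.2.1 • elK T θ + h.2.2 • elD T θ :=
  affine_eq T θ (cartan T θ h)

theorem cartan_lie_loop (h : T × ℂ × ℂ) (α : Weight ℂ T 𝔤) (m : ℤ) {x : 𝔤}
    (hx : x ∈ rootSpace T α) : ⁅cartan T θ h, ofLoop T θ (loop m x)⁆ =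
      (α h.1 + h.2.2 * m) • ofLoop T θ (loop m x) := by
  rw [cartan_eq, add_lie, add_lie, smul_lie, smul_lie, elK_lie, smul_zero, add_zero, elD_lie_ofLoop,
    lie_ofLoop, cocycle_loop, Int.cast_zero, zero_mul, ite_self, zero_smul, add_zero, zero_add,
    smul_smul, add_smul]
  congr 1
  rw [← map_smul, ← map_smul]
  congr 2
  exact lie_eq_smul_of_mem_rootSpace hx h.1

theorem cartan_lie_elK (h : T × ℂ × ℂ) : ⁅cartan T θ h, elK T θ⁆ = 0 := by
  rw [← lie_skew, elK_lie, neg_zero]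

theorem cartan_lie_elD (h : T × ℂ × ℂ) : ⁅cartan T θ h, elD T θ⁆ = 0 := by
  rw [← lie_skew, neg_eq_zero, cartan_eq, lie_add, lie_add, lie_smul, lie_smul, elD_lie_ofLoop,
    lie_self, Int.cast_zero, zero_smul, smul_zero, add_zero, zero_add, ← lie_skew, elK_lie, neg_zero,
    smul_zero]

theorem cartan_lie_affineBasis (h : T × ℂ × ℂ) (r : AffineIndex T) :
    ⁅cartan T θ h, affineBasis T θ r⁆ = affineWt T r h • affineBasis T θ r := by
  rcases r with ⟨m, r⟩ | i
  · rw [affineBasis_inl, cartan_lie_loop T θ h r.1 m (rootBasis_mem T r)]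
    simp [affineWt, mul_comm]
  · rw [affineWt, LinearMap.zero_apply, zero_smul]
    fin_cases i
    · exact (congrArg _ (affineBasis_inr_zero T θ)).trans (cartan_lie_elK T θ h)
    · exact (congrArg _ (affineBasis_inr_one T θ)).trans (cartan_lie_elD T θ h)

/-- An element of the Cartan subalgebra is determined by arbitrary values of the simple roots. -/
theorem exists_apply_simple_eq (c : b.support → ℂ) :
    ∃ t : T, ∀ i : b.support, (i.1 : Weight ℂ T 𝔤) t = c i := by
  refine ⟨(Module.evalEquiv ℂ T).symm (b.toWeightBasis.constr ℂ c), fun i => ?_⟩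
  have h := Module.apply_evalEquiv_symm_apply ℂ T ((i.1 : Weight ℂ T 𝔤).toLinear)
    (b.toWeightBasis.constr ℂ c)
  refine h.trans ?_
  rw [← b.toWeightBasis.constr_basis ℂ c i, b.toWeightBasis_apply]
  rfl

theorem wtHeight_root (α : T.root) : wtHeight T b α = b.height α := by
  classical
  simp only [wtHeight]
  rw [dif_pos α.2]

theorem wtHeight_zero {α : Weight ℂ T 𝔤} (h : α.IsZero) : wtHeight T b α = 0 :=
  (wtHeight_eq_zero T b).2 h

set_option linter.unusedSectionVars false in
theorem weight_cases (α : Weight ℂ T 𝔤) : α.IsZero ∨ α ∈ T.root := by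
  by_cases h : α.IsZero
  · exact Or.inl h
  · right; simpa using h

/-- The element of the Cartan subalgebra on which all simple roots take the value `1`. -/
def rhoCheck : T := (exists_apply_simple_eq T b fun _ => 1).choose

theorem apply_rhoCheck (α : Weight ℂ T 𝔤) : α (rhoCheck T b) = wtHeight T b α := by
  have h1 : ∀ i : b.support, (i.1 : Weight ℂ T 𝔤) (rhoCheck T b) = 1 :=
    (exists_apply_simple_eq T b fun _ => 1).choose_spec
  rcases weight_cases T α with h | h
  · rw [wtHeight_zero T b h, show (α : T → ℂ) = 0 from h]; simp
  · obtain ⟨f, -, -, hf⟩ := b.exists_root_eq_sum_int ⟨α, h⟩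
    rw [wtHeight_root T b ⟨α, h⟩, RootPairing.Base.height_eq_sum hf]
    have h2 := LinearMap.congr_fun hf (rhoCheck T b)
    refine h2.trans ?_
    rw [LinearMap.sum_apply, Int.cast_sum]
    refine Finset.sum_congr rfl fun j hj => ?_
    rw [LinearMap.smul_apply]
    have h3 : (rootSystem T).root j (rhoCheck T b) = 1 := h1 ⟨j, hj⟩
    rw [h3]; simp

/-- The height of a basis vector. -/
def affineHgt : AffineIndex T → ℤ
  | Sum.inl (_, r) => wtHeight T b r.1
  | Sum.inr _ => 0

/-- The power of `z` of a basis vector. -/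
def affineMo : AffineIndex T → ℤ
  | Sum.inl (m, _) => m
  | Sum.inr _ => 0

/-- The bigrading of `𝔤̂` by the height and the power of `z`. -/
def affineBigraded : BigradedBasis (AffineLie T θ) (AffineIndex T) where
  v := affineBasis T θ
  hgt := affineHgt T b
  mo := affineMo T
  rho := cartan T θ (rhoCheck T b, 0, 0)
  D := cartan T θ (0, 0, 1)
  lie_rho r := by
    rw [cartan_lie_affineBasis]
    congr 1
    rcases r with ⟨m, r⟩ | i
    · simp [affineWt, affineHgt, apply_rhoCheck]
    · simp [affineWt, affineHgt]
  lie_D r := by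
    rw [cartan_lie_affineBasis]
    congr 1
    rcases r with ⟨m, r⟩ | i
    · simp [affineWt, affineMo]
    · simp [affineWt, affineMo]

/-- The subspaces of `𝔤̂` spanned by full weight spaces `zᵐ ⊗ 𝔤_α`, and possibly `K` and `d`, in
terms of the bigrading. -/
theorem span_sectorSet_union (p : ℤ → ℤ → Prop) {S : Set (AffineLie T θ)}
    (hS : ∀ X, X ∈ S ↔ p 0 0 ∧ (X = elK T θ ∨ X = elD T θ)) :
    Submodule.span ℂ (sectorSet T θ (fun α m => p (wtHeight T b α) m) ∪ S) =
      (affineBigraded T b θ).Sp p := by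
  refine le_antisymm (Submodule.span_le.2 ?_) (Submodule.span_le.2 ?_)
  · rintro X (⟨α, m, x, hp, hx, rfl⟩ | hX)
    · have h := rootSpace_le_span T α hx
      have h2 : ∀ y ∈ Submodule.span ℂ (Set.range fun i => rootBasis T ⟨α, i⟩),
          ofLoop T θ (loop m y) ∈ (affineBigraded T b θ).Sp p := by
        intro y hy
        induction hy using Submodule.span_induction with
        | zero => rw [map_zero, map_zero]; exact zero_mem _
        | add a c _ _ ha hc => rw [map_add, map_add]; exact add_mem ha hc
        | smul c a _ ha => rw [map_smul, map_smul]; exact Submodule.smul_mem _ c ha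
        | mem y hy =>
          obtain ⟨i, rfl⟩ := hy
          rw [← affineBasis_inl]
          exact (affineBigraded T b θ).v_mem (r := Sum.inl (m, ⟨α, i⟩)) hp
      exact h2 x h
    · obtain ⟨h0, rfl | rfl⟩ := (hS X).1 hX
      · rw [← affineBasis_inr_zero]
        exact (affineBigraded T b θ).v_mem (r := Sum.inr 0) h0
      · rw [← affineBasis_inr_one]
        exact (affineBigraded T b θ).v_mem (r := Sum.inr 1) h0
  · rintro _ ⟨r, hr, rfl⟩
    refine Submodule.subset_span ?_
    rcases r with ⟨m, r⟩ | i
    · exact Or.inl ⟨r.1, m, _, hr, rootBasis_mem T r, affineBasis_inl T θ m r⟩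
    · refine Or.inr ((hS _).2 ⟨hr, ?_⟩)
      fin_cases i
      · exact Or.inl (affineBasis_inr_zero T θ)
      · exact Or.inr (affineBasis_inr_one T θ)

theorem affine_gr_eq (n : ℤ) : (affineSemiInfinite T b θ).gr n =
    (affineBigraded T b θ).Sp fun i j => i + coxeter T b θ * j = n := by
  rw [← span_sectorSet_union T b θ]
  · rfl
  · intro X
    simp only [Set.mem_ofPred_eq, mul_zero, add_zero, eq_comm (a := (0 : ℤ))]

theorem affineMinus_eq : (affineMinus T b θ).toSubmodule =
    (affineBigraded T b θ).Sp fun i j => i + coxeter T b θ * j ≤ 0 := by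
  rw [← span_sectorSet_union T b θ _ (S := {elK T θ, elD T θ})]
  · rfl
  · intro X; simp

theorem affineBorel_eq : (affineBorel T b θ).toSubmodule =
    (affineBigraded T b θ).Sp fun i j => 0 ≤ i + coxeter T b θ * j := by
  rw [← span_sectorSet_union T b θ _ (S := {elK T θ, elD T θ})]
  · rfl
  · intro X; simp

theorem aBar_eq : (aBar T b θ).toSubmodule =
    (affineBigraded T b θ).Sp fun i j => 0 < i ∨ i = 0 ∧ j ≤ 0 := by
  rw [← span_sectorSet_union T b θ _ (S := {elK T θ, elD T θ})]
  · rfl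
  · intro X; simp

theorem aSpace_eq : aSpace T b θ =
    (affineBigraded T b θ).Sp fun i j => i < 0 ∨ i = 0 ∧ 0 < j := by
  rw [← span_sectorSet_union T b θ _ (S := ∅)]
  · rw [Set.union_empty]; rfl
  · intro X; simp

theorem affine_plus_eq : (affineSemiInfinite T b θ).plus =
    (affineBigraded T b θ).Sp fun i j => 0 < i + coxeter T b θ * j := by
  rw [SemiInfinite.plus]
  refine le_antisymm (iSup_le fun n => ?_) (Submodule.span_le.2 ?_)
  · rw [affine_gr_eq]
    exact (affineBigraded T b θ).Sp_mono fun i j h => by have := n.2; omega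
  · rintro _ ⟨r, hr, rfl⟩
    refine Submodule.mem_iSup_of_mem ⟨_, hr⟩ ?_
    rw [affine_gr_eq]
    exact (affineBigraded T b θ).v_mem rfl

theorem affine_minus_eq : (affineSemiInfinite T b θ).minus =
    (affineBigraded T b θ).Sp fun i j => i + coxeter T b θ * j ≤ 0 := by
  rw [SemiInfinite.minus]
  refine le_antisymm (iSup_le fun n => ?_) (Submodule.span_le.2 ?_)
  · rw [affine_gr_eq]
    exact (affineBigraded T b θ).Sp_mono fun i j h => by have := n.2; omega
  · rintro _ ⟨r, hr, rfl⟩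
    refine Submodule.mem_iSup_of_mem ⟨_, hr⟩ ?_
    rw [affine_gr_eq]
    exact (affineBigraded T b θ).v_mem rfl

theorem aPlus_eq : aPlus T b θ = (affineBigraded T b θ).Sp fun i j =>
    (i < 0 ∨ i = 0 ∧ 0 < j) ∧ 0 < i + coxeter T b θ * j := by
  rw [aPlus, aSpace_eq, affine_plus_eq, BigradedBasis.Sp_inf]

theorem aMinus_eq : aMinus T b θ = (affineBigraded T b θ).Sp fun i j =>
    (i < 0 ∨ i = 0 ∧ 0 < j) ∧ i + coxeter T b θ * j ≤ 0 := by
  rw [aMinus, aSpace_eq, affine_minus_eq, BigradedBasis.Sp_inf]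

/-- `𝔤̂₊` as a subalgebra. -/
def affinePlus : LieSubalgebra ℂ (AffineLie T θ) :=
  (affineBigraded T b θ).SpLie (fun i j => 0 < i + coxeter T b θ * j) fun i j k l h1 h2 => by
    rw [mul_add]; omega

/-- `𝔞₊` as a subalgebra. -/
def aPlusLie : LieSubalgebra ℂ (AffineLie T θ) :=
  (affineBigraded T b θ).SpLie
    (fun i j => (i < 0 ∨ i = 0 ∧ 0 < j) ∧ 0 < i + coxeter T b θ * j) fun i j k l h1 h2 => by
      rw [mul_add]; omega

/-- `𝔞₋` as a subalgebra. -/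
def aMinusLie : LieSubalgebra ℂ (AffineLie T θ) :=
  (affineBigraded T b θ).SpLie
    (fun i j => (i < 0 ∨ i = 0 ∧ 0 < j) ∧ i + coxeter T b θ * j ≤ 0) fun i j k l h1 h2 => by
      rw [mul_add]; omega

theorem aPlusLie_toSubmodule : (aPlusLie T b θ).toSubmodule = aPlus T b θ := (aPlus_eq T b θ).symm

theorem aMinusLie_toSubmodule : (aMinusLie T b θ).toSubmodule = aMinus T b θ :=
  (aMinus_eq T b θ).symm

theorem affinePlus_toSubmodule :
    (affinePlus T b θ).toSubmodule = (affineSemiInfinite T b θ).plus := (affine_plus_eq T b θ).symm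

theorem projCartan_affineBasis {r : AffineIndex T} (h : affineHgt T b r ≠ 0 ∨ affineMo T r ≠ 0) :
    projCartan T θ (affineBasis T θ r) = 0 := by
  rcases r with ⟨m, r⟩ | i
  · rw [affineBasis_inl]
    refine Prod.ext ?_ rfl
    change projT T (coeff 0 (loop m (rootBasis T r))) = 0
    rw [coeff_loop]
    split_ifs with hm
    · subst hm
      have hα : wtHeight T b r.1 ≠ 0 := h.resolve_right (fun h => h rfl)
      refine projT_rootSpace T (α := r.1) ?_ (rootBasis_mem T r)
      intro h0
      exact hα (wtHeight_zero T b h0)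
    · exact map_zero _
  · exact (h.elim (fun h => h rfl) fun h => h rfl).elim

variable {T b θ}

theorem IsHighest.height_nonneg (hθ : IsHighest T b θ) : 0 ≤ b.height θ := by
  have h1 := b.height_reflectionPerm_self θ
  change b.height ((rootSystem T).reflectionPerm θ θ) = _ at h1
  have := hθ ((rootSystem T).reflectionPerm θ θ)
  omega

theorem IsHighest.coxeter_pos (hθ : IsHighest T b θ) : 0 < coxeter T b θ := by
  have := hθ.height_nonneg
  unfold coxeter; omega

theorem wtHeight_neg (α : Weight ℂ T 𝔤) : wtHeight T b (-α) = -wtHeight T b α := by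
  have := wtHeight_add_eq_zero T b (α := α) (β := -α) (by simp)
  omega

theorem IsHighest.neg_le_wtHeight (hθ : IsHighest T b θ) (α : Weight ℂ T 𝔤) :
    -b.height θ ≤ wtHeight T b α := by
  have := hθ.wtHeight_le (-α)
  rw [wtHeight_neg] at this
  omega

/-- The Coxeter number exceeds all heights, so a vector of degree `0` has height `0`. -/
theorem IsHighest.hgt_eq_zero (hθ : IsHighest T b θ) (r : AffineIndex T)
    (h : affineHgt T b r + coxeter T b θ * affineMo T r = 0) : affineHgt T b r = 0 := by
  rcases r with ⟨m, r⟩ | i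
  · have h1 := hθ.wtHeight_le r.1
    have h2 := hθ.neg_le_wtHeight r.1
    change wtHeight T b r.1 + coxeter T b θ * m = 0 at h
    change wtHeight T b r.1 = 0
    have hm : m = 0 := by
      unfold coxeter at h
      by_contra hm
      rcases lt_or_gt_of_ne hm with h | h <;> nlinarith
    rw [hm] at h
    omega
  · rfl

theorem IsHighest.deg_fin (hθ : IsHighest T b θ) (n : ℤ) :
    {r : AffineIndex T | affineHgt T b r + coxeter T b θ * affineMo T r = n}.Finite := by
  let f : AffineIndex T → RootIndex T ⊕ Fin 2 := Sum.map Prod.snd id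
  refine Set.Finite.of_finite_image (f := f) (Set.toFinite _) ?_
  rintro (⟨m, r⟩ | i) hr (⟨m', r'⟩ | i') hr' h
  · have h1 : r = r' := Sum.inl_injective h
    subst h1
    change wtHeight T b r.1 + coxeter T b θ * m = n at hr
    change wtHeight T b r.1 + coxeter T b θ * m' = n at hr'
    have h3 : coxeter T b θ * m = coxeter T b θ * m' := by omega
    rw [mul_left_cancel₀ hθ.coxeter_pos.ne' h3]
  · cases h
  · cases h
  · exact congrArg Sum.inr (Sum.inr_injective h)

end Affine

end Wakimoto

end

/-! ### Generation of a simple Lie algebra -/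

noncomputable section

namespace Wakimoto

open LieAlgebra LieAlgebra.IsKilling LieModule

section Generation

attribute [local instance 100] LieRing.ofAssociativeRing

variable {𝔤 : Type*} [LieRing 𝔤] [LieAlgebra ℂ 𝔤] [FiniteDimensional ℂ 𝔤] [LieAlgebra.IsSimple ℂ 𝔤]
  (T : LieSubalgebra ℂ 𝔤) [T.IsCartanSubalgebra]

/-- The properties of the height with respect to a base that are used to generate `𝔤`. They are
shared by the height and by its negative. -/
structure HeightFunction where
  ht : Weight ℂ T 𝔤 → ℤ
  add : ∀ {α β γ : Weight ℂ T 𝔤}, (γ : T → ℂ) = α + β → ht γ = ht α + ht β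
  ht_neg : ∀ α : Weight ℂ T 𝔤, ht (-α) = -ht α
  eq_zero : ∀ {α : Weight ℂ T 𝔤}, ht α = 0 ↔ α.IsZero
  exists_pos : ∀ α, 0 < ht α → ∃ σ, ht σ = 1 ∧ ∃ n : ℕ, 0 < n ∧ α (coroot σ) = n
  separating : ∀ t : T, (∀ σ, ht σ = 1 → σ t = 0) → t = 0

variable {T}

theorem mem_T_of_mem_rootSpace {χ : T → ℂ} (hχ : χ = 0) {x : 𝔤} (hx : x ∈ rootSpace T χ) : x ∈ T := by
  subst hχ
  have h : x ∈ zeroRootSubalgebra ℂ 𝔤 T := hx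
  rwa [zeroRootSubalgebra_eq_of_is_cartan] at h

theorem killing_nondeg {χ : T → ℂ} {x : 𝔤} (hx : x ∈ rootSpace T χ)
    (h : ∀ y ∈ rootSpace T (-χ), killingForm ℂ 𝔤 x y = 0) : x = 0 := by
  have := mem_ker_killingForm_of_mem_rootSpace_of_forall_rootSpace_neg ℂ 𝔤 T hx h
  simpa using this

theorem killing_lie (x y z : 𝔤) : killingForm ℂ 𝔤 ⁅x, y⁆ z = -killingForm ℂ 𝔤 y ⁅x, z⁆ :=
  LieModule.traceForm_lieInvariant ℂ 𝔤 𝔤 x y z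

theorem sub_induction {p : 𝔤 → Prop} (h0 : p 0) (hadd : ∀ x y, p x → p y → p (x + y))
    (hw : ∀ (α : Weight ℂ T 𝔤) x, x ∈ rootSpace T α → p x) (x : 𝔤) : p x := by
  have hx : x ∈ ⨆ α : Weight ℂ T 𝔤, (rootSpace T α).toSubmodule := by
    rw [← LieSubmodule.iSup_toSubmodule, iSup_genWeightSpace_eq_top' ℂ T 𝔤]
    trivial
  induction hx using Submodule.iSup_induction' with
  | zero => exact h0
  | add x y _ _ hx hy => exact hadd x y hx hy
  | mem α x hx => exact hw α x hx

namespace HeightFunction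

variable (F : HeightFunction T)

theorem lie_mem {α β : Weight ℂ T 𝔤} {x y : 𝔤} (hx : x ∈ rootSpace T α) (hy : y ∈ rootSpace T β)
    (h : ⁅x, y⁆ ≠ 0) : ∃ γ : Weight ℂ T 𝔤, (γ : T → ℂ) = α + β ∧ ⁅x, y⁆ ∈ rootSpace T γ := by
  have hxy := lie_mem_genWeightSpace_of_mem_genWeightSpace hx hy
  refine ⟨⟨(α : T → ℂ) + β, fun h0 => h ?_⟩, rfl, hxy⟩
  rwa [h0, LieSubmodule.mem_bot] at hxy

/-- A nonzero vector of nonpositive height is not killed by all vectors of height one: otherwise it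
would be a primitive vector of negative weight for some `𝔰𝔩₂`. -/
theorem exists_lie_ne_zero {α : Weight ℂ T 𝔤} (hα : F.ht α ≤ 0) {y : 𝔤} (hy : y ∈ rootSpace T α)
    (h0 : y ≠ 0) : ∃ σ, F.ht σ = 1 ∧ ∃ x ∈ rootSpace T σ, ⁅x, y⁆ ≠ 0 := by
  by_cases hz : α.IsZero
  · have hyT := mem_T_of_mem_rootSpace hz hy
    have h1 : ∃ σ, F.ht σ = 1 ∧ σ ⟨y, hyT⟩ ≠ 0 := by
      by_contra! hc
      exact h0 (congrArg Subtype.val (F.separating ⟨y, hyT⟩ hc))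
    obtain ⟨σ, hσ, h2⟩ := h1
    obtain ⟨x, hx, hx0⟩ := σ.exists_ne_zero
    refine ⟨σ, hσ, x, hx, ?_⟩
    have h3 : ⁅y, x⁆ = σ ⟨y, hyT⟩ • x := lie_eq_smul_of_mem_rootSpace hx ⟨y, hyT⟩
    rw [← lie_skew, h3, neg_ne_zero]
    exact smul_ne_zero h2 hx0
  · have h1 : F.ht (-α) = -F.ht α := F.ht_neg α
    have h2 : F.ht α ≠ 0 := fun h => hz (F.eq_zero.1 h)
    obtain ⟨σ, hσ, n, hn, h3⟩ := F.exists_pos (-α) (by omega)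
    have hσ0 : σ.IsNonZero := fun h => by
      rw [F.eq_zero.2 h] at hσ
      omega
    obtain ⟨h, e, f, t, he, hf⟩ := exists_isSl2Triple_of_weight_isNonZero hσ0
    refine ⟨σ, hσ, e, he, fun hey => ?_⟩
    have hh := t.h_eq_coroot hσ0 he hf
    have hhy : ⁅h, y⁆ = (-(n : ℂ)) • y := by
      rw [hh]
      have h4 : ⁅(coroot σ : 𝔤), y⁆ = α (coroot σ) • y := lie_eq_smul_of_mem_rootSpace hy (coroot σ)
      rw [h4, ← h3]
      simp
    have P : t.HasPrimitiveVectorWith y (-(n : ℂ)) := ⟨h0, hhy, hey⟩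
    obtain ⟨k, hk⟩ := P.exists_nat
    have : (-(n : ℤ)) = k := by exact_mod_cast hk
    omega

/-- The negative of a height function. -/
def neg : HeightFunction T where
  ht α := -F.ht α
  add h := by rw [F.add h]; ring
  ht_neg α := by rw [F.ht_neg]
  eq_zero := by intro α; rw [neg_eq_zero, F.eq_zero]
  exists_pos α hα := by
    obtain ⟨σ, hσ, n, hn, h⟩ := F.exists_pos (-α) (by rw [F.ht_neg]; exact hα)
    refine ⟨-σ, by rw [F.ht_neg, hσ, neg_neg], n, hn, ?_⟩
    rw [← h, coroot_neg]
    have h2 : α (-coroot σ) = -α (coroot σ) := map_neg α.toLinear _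
    rw [h2]; simp
  separating t h := F.separating t fun σ hσ => by
    have := h (-σ) (by rw [F.ht_neg, hσ, neg_neg])
    simpa using this

/-- A root vector of height at least two is a combination of brackets with vectors of height one. -/
theorem rootSpace_le_of_pos (S : LieSubalgebra ℂ 𝔤)
    (hS : ∀ σ, F.ht σ = 1 → (rootSpace T σ).toSubmodule ≤ S.toSubmodule) :
    ∀ (n : ℕ) (α : Weight ℂ T 𝔤), F.ht α = n + 1 → (rootSpace T α).toSubmodule ≤ S.toSubmodule := by
  intro n
  induction n with
  | zero => intro α hα; exact hS α (by simpa using hα)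
  | succ n ih =>
    intro α hα x hx
    have hnz : α.IsNonZero := fun h => by rw [F.eq_zero.2 h] at hα; push_cast at hα; omega
    by_cases hx0 : x = 0
    · rw [hx0]; exact zero_mem _
    obtain ⟨y, hy, hxy⟩ : ∃ y ∈ rootSpace T (-α : T → ℂ), killingForm ℂ 𝔤 x y ≠ 0 := by
      by_contra! hc
      exact hx0 (killing_nondeg hx hc)
    have hy0 : y ≠ 0 := by rintro rfl; simp at hxy
    replace hy : y ∈ rootSpace T ((-α : Weight ℂ T 𝔤) : T → ℂ) := hy
    obtain ⟨σ, hσ, e, he, hey⟩ := F.exists_lie_ne_zero (α := -α) (by rw [F.ht_neg, hα]; omega) hy hy0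
    obtain ⟨γ, hγ, hmem⟩ := lie_mem he hy hey
    obtain ⟨w, hw, hw2⟩ : ∃ w ∈ rootSpace T (-γ : T → ℂ), killingForm ℂ 𝔤 ⁅e, y⁆ w ≠ 0 := by
      by_contra! hc
      exact hey (killing_nondeg hmem hc)
    have hw' : w ∈ rootSpace T ((-γ : Weight ℂ T 𝔤) : T → ℂ) := hw
    have h1 : ⁅e, w⁆ ≠ 0 := by
      intro h
      rw [killing_lie, h] at hw2
      simp at hw2
    have h2 : F.ht (-γ) = n + 1 := by
      rw [F.ht_neg, F.add hγ, F.ht_neg, hα, hσ]; push_cast; ring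
    have h3 : ⁅e, w⁆ ∈ rootSpace T α := by
      have := lie_mem_genWeightSpace_of_mem_genWeightSpace he hw'
      rwa [Weight.coe_neg, hγ, Weight.coe_neg, show (σ : T → ℂ) + -(σ + -α) = α by abel] at this
    have h4 := finrank_rootSpace_eq_one α hnz
    obtain ⟨c, hc⟩ := (finrank_eq_one_iff_of_nonzero' (⟨⁅e, w⁆, h3⟩ : rootSpace T α)
      (fun h => h1 (congrArg Subtype.val h))).1 h4 ⟨x, hx⟩
    have hc' : c • ⁅e, w⁆ = x := congrArg Subtype.val hc
    rw [← hc']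
    exact S.smul_mem c (S.lie_mem (hS σ hσ he) (ih (-γ) h2 hw'))

/-- A Lie algebra is generated by the root spaces of height `1`, `-1` and the Cartan subalgebra. -/
theorem eq_top_of_le (S : LieSubalgebra ℂ 𝔤) (hT : T ≤ S)
    (h1 : ∀ σ, F.ht σ = 1 → (rootSpace T σ).toSubmodule ≤ S.toSubmodule)
    (h2 : ∀ σ, F.ht σ = -1 → (rootSpace T σ).toSubmodule ≤ S.toSubmodule) (x : 𝔤) : x ∈ S := by
  refine sub_induction (T := T) (zero_mem _) (fun _ _ => add_mem) (fun α x hx => ?_) x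
  rcases lt_trichotomy (F.ht α) 0 with h | h | h
  · refine F.neg.rootSpace_le_of_pos S (fun σ hσ => h2 σ ?_) (-F.ht α - 1).toNat α ?_ hx
    · have : -F.ht σ = 1 := hσ
      omega
    · change -F.ht α = _
      omega
  · exact hT (mem_T_of_mem_rootSpace (F.eq_zero.1 h) hx)
  · exact F.rootSpace_le_of_pos S h1 (F.ht α - 1).toNat α (by omega) hx

/-- The iterated brackets of vectors of height one with a given vector, with their weights. -/
inductive Word (χ₀ : T → ℂ) (x₀ : 𝔤) : (T → ℂ) → ℕ → 𝔤 → Prop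
  | base : Word χ₀ x₀ χ₀ 0 x₀
  | step {χ : T → ℂ} {k : ℕ} {w : 𝔤} (hw : Word χ₀ x₀ χ k w) {σ : Weight ℂ T 𝔤} (hσ : F.ht σ = 1)
      {e : 𝔤} (he : e ∈ rootSpace T σ) : Word χ₀ x₀ (σ + χ) (k + 1) ⁅e, w⁆

/-- The span of the iterated brackets. -/
def words (χ₀ : T → ℂ) (x₀ : 𝔤) : Submodule ℂ 𝔤 :=
  Submodule.span ℂ {w | ∃ χ k, F.Word χ₀ x₀ χ k w}

variable {F}

theorem Word.mem {χ₀ : T → ℂ} {x₀ : 𝔤} (h0 : x₀ ∈ rootSpace T χ₀) {χ : T → ℂ} {k : ℕ} {w : 𝔤}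
    (h : F.Word χ₀ x₀ χ k w) : w ∈ rootSpace T χ := by
  induction h with
  | base => exact h0
  | step hw hσ he ih => exact lie_mem_genWeightSpace_of_mem_genWeightSpace he ih

theorem Word.ht_eq {α₀ : Weight ℂ T 𝔤} {x₀ : 𝔤} (h0 : x₀ ∈ rootSpace T α₀) {χ : T → ℂ} {k : ℕ}
    {w : 𝔤} (h : F.Word α₀ x₀ χ k w) (hne : w ≠ 0) (γ : Weight ℂ T 𝔤) (hγ : (γ : T → ℂ) = χ) :
    F.ht γ = F.ht α₀ + k := by
  induction h generalizing γ with
  | base =>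
    rw [DFunLike.coe_injective hγ]; simp
  | step hw hσ he ih =>
    rename_i χ k w σ e
    have hw0 : w ≠ 0 := by rintro rfl; simp at hne
    have hw1 := hw.mem h0
    let β : Weight ℂ T 𝔤 := ⟨χ, fun h => hw0 (by
      change w ∈ genWeightSpace 𝔤 χ at hw1
      rwa [h, LieSubmodule.mem_bot] at hw1)⟩
    rw [F.add (α := σ) (β := β) hγ, ih hw0 β rfl, hσ]
    push_cast; ring

variable (F)

theorem lie_words_mem {χ₀ : T → ℂ} {x₀ : 𝔤} {σ : Weight ℂ T 𝔤} (hσ : F.ht σ = 1)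
    {e : 𝔤} (he : e ∈ rootSpace T σ) {w : 𝔤} (hw : w ∈ F.words χ₀ x₀) : ⁅e, w⁆ ∈ F.words χ₀ x₀ := by
  induction hw using Submodule.span_induction with
  | zero => rw [lie_zero]; exact zero_mem _
  | add a b _ _ ha hb => rw [lie_add]; exact add_mem ha hb
  | smul c a _ ha => rw [lie_smul]; exact Submodule.smul_mem _ c ha
  | mem w hw =>
    obtain ⟨χ, k, hw⟩ := hw
    exact Submodule.subset_span ⟨_, _, hw.step hσ he⟩

theorem T_lie_words_mem {χ₀ : T → ℂ} {x₀ : 𝔤} (h0 : x₀ ∈ rootSpace T χ₀) {t : 𝔤} (ht : t ∈ T) {w : 𝔤}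
    (hw : w ∈ F.words χ₀ x₀) : ⁅t, w⁆ ∈ F.words χ₀ x₀ := by
  induction hw using Submodule.span_induction with
  | zero => rw [lie_zero]; exact zero_mem _
  | add a b _ _ ha hb => rw [lie_add]; exact add_mem ha hb
  | smul c a _ ha => rw [lie_smul]; exact Submodule.smul_mem _ c ha
  | mem w hw =>
    obtain ⟨χ, k, hw⟩ := hw
    have h1 : ⁅t, w⁆ = χ ⟨t, ht⟩ • w := lie_eq_smul_of_mem_rootSpace (hw.mem h0) ⟨t, ht⟩
    rw [h1]
    exact Submodule.smul_mem _ _ (Submodule.subset_span ⟨_, _, hw⟩)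

/-- The module generated by a lowest weight vector is everything. -/
theorem words_eq_top {α₀ : Weight ℂ T 𝔤} (hmin : ∀ α, F.ht α₀ ≤ F.ht α) {x₀ : 𝔤}
    (h0 : x₀ ∈ rootSpace T α₀) (hne : x₀ ≠ 0) (x : 𝔤) : x ∈ F.words α₀ x₀ := by
  have hneg : ∀ σ : Weight ℂ T 𝔤, F.ht σ = -1 → ∀ f ∈ rootSpace T σ, ∀ χ k w,
      F.Word (α₀ : T → ℂ) x₀ χ k w → ⁅f, w⁆ ∈ F.words (α₀ : T → ℂ) x₀ := by
    intro σ hσ f hf χ k w hw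
    induction hw with
    | base =>
      by_cases hz : ⁅f, x₀⁆ = 0
      · rw [hz]; exact zero_mem _
      obtain ⟨γ, hγ, -⟩ := lie_mem hf h0 hz
      have := F.add hγ
      have := hmin γ
      omega
    | step hw hτ he ih =>
      rename_i χ k w τ e
      rw [leibniz_lie]
      refine add_mem ?_ (F.lie_words_mem hτ he ih)
      by_cases hz : ⁅f, e⁆ = 0
      · rw [hz, zero_lie]; exact zero_mem _
      obtain ⟨γ, hγ, hm⟩ := lie_mem hf he hz
      have h1 : F.ht γ = 0 := by rw [F.add hγ]; omega
      exact F.T_lie_words_mem h0 (mem_T_of_mem_rootSpace (F.eq_zero.1 h1) hm)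
        (Submodule.subset_span ⟨_, _, hw⟩)
  let S : LieSubalgebra ℂ 𝔤 :=
    { carrier := {x | ∀ w ∈ F.words (α₀ : T → ℂ) x₀, ⁅x, w⁆ ∈ F.words (α₀ : T → ℂ) x₀}
      add_mem' := fun ha hb w hw => by rw [add_lie]; exact add_mem (ha w hw) (hb w hw)
      zero_mem' := fun w _ => by rw [zero_lie]; exact zero_mem _
      smul_mem' := fun c a ha w hw => by rw [smul_lie]; exact Submodule.smul_mem _ c (ha w hw)
      lie_mem' := fun {a b} ha hb w hw => by
        rw [lie_lie]; exact sub_mem (ha _ (hb w hw)) (hb _ (ha w hw)) }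
  have hS : ∀ x, x ∈ S := F.eq_top_of_le S (fun t ht w hw => F.T_lie_words_mem h0 ht hw)
    (fun σ hσ e he w hw => F.lie_words_mem hσ he hw) (by
      intro σ hσ f hf w hw
      induction hw using Submodule.span_induction with
      | zero => rw [lie_zero]; exact zero_mem _
      | add a b _ _ ha hb => rw [lie_add]; exact add_mem ha hb
      | smul c a _ ha => rw [lie_smul]; exact Submodule.smul_mem _ c ha
      | mem w hw =>
        obtain ⟨χ, k, hw⟩ := hw
        exact hneg σ hσ f hf χ k w hw)
  let I : LieIdeal ℂ 𝔤 := { F.words (α₀ : T → ℂ) x₀ with lie_mem := fun {x m} hm => hS x m hm }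
  rcases LieAlgebra.IsSimple.eq_bot_or_eq_top (R := ℂ) I with h | h
  · refine (hne ?_).elim
    have : x₀ ∈ I := Submodule.subset_span ⟨_, _, Word.base⟩
    rwa [h, LieSubmodule.mem_bot] at this
  · have : x ∈ I := by rw [h]; trivial
    exact this

/-- Only `0` commutes with a lowest weight vector and with all vectors of height one. -/
theorem eq_zero_of_lie_eq_zero {α₀ : Weight ℂ T 𝔤} (hmin : ∀ α, F.ht α₀ ≤ F.ht α) {y : 𝔤}
    (h1 : ∀ σ, F.ht σ = 1 → ∀ e ∈ rootSpace T σ, ⁅y, e⁆ = 0)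
    (h2 : ∀ e ∈ rootSpace T α₀, ⁅y, e⁆ = 0) : y = 0 := by
  obtain ⟨x₀, h0, hne⟩ := α₀.exists_ne_zero
  have hall : ∀ x : 𝔤, ⁅y, x⁆ = 0 := by
    intro x
    have hx := F.words_eq_top hmin h0 hne x
    induction hx using Submodule.span_induction with
    | zero => rw [lie_zero]
    | add a b _ _ ha hb => rw [lie_add, ha, hb, add_zero]
    | smul c a _ ha => rw [lie_smul, ha, smul_zero]
    | mem w hw =>
      obtain ⟨χ, k, hw⟩ := hw
      induction hw with
      | base => exact h2 _ h0
      | step hw hτ he ih => rw [leibniz_lie, h1 _ hτ _ he, ih, zero_lie, lie_zero, add_zero]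
  have hc : y ∈ LieAlgebra.center ℂ 𝔤 := by
    rw [LieModule.mem_maxTrivSubmodule]
    intro x
    rw [← lie_skew, hall, neg_zero]
  rwa [LieAlgebra.center_eq_bot, LieSubmodule.mem_bot] at hc

/-- The lowest weight is unique. -/
theorem eq_of_ht_eq {α₀ α : Weight ℂ T 𝔤} (hmin : ∀ α, F.ht α₀ ≤ F.ht α) (h : F.ht α = F.ht α₀) :
    α = α₀ := by
  by_contra hne
  obtain ⟨x₀, h0, hx0⟩ := α₀.exists_ne_zero
  obtain ⟨z, hz, hz0⟩ := α.exists_ne_zero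
  refine hz0 (killing_nondeg hz fun y hy => ?_)
  have hall : ∀ x, killingForm ℂ 𝔤 x y = 0 := by
    intro x
    have hx := F.words_eq_top hmin h0 hx0 x
    induction hx using Submodule.span_induction with
    | zero => simp
    | add a b _ _ ha hb => rw [map_add, LinearMap.add_apply, ha, hb, add_zero]
    | smul c a _ ha => rw [map_smul, LinearMap.smul_apply, ha, smul_zero]
    | mem w hw =>
      obtain ⟨χ, k, hw⟩ := hw
      by_cases hw0 : w = 0
      · simp [hw0]
      refine killingForm_apply_eq_zero_of_mem_rootSpace_of_add_ne_zero ℂ 𝔤 T (hw.mem h0) hy ?_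
      intro he
      have he' : (α : T → ℂ) = χ := by rw [← sub_eq_zero, ← neg_eq_zero, ← he]; abel
      have h3 := hw.ht_eq h0 hw0 α he'
      have hk : k = 0 := by omega
      subst hk
      cases hw
      exact hne (DFunLike.coe_injective he')
  exact hall z

/-- A simple Lie algebra is spanned by the brackets with the vectors of height one and with a lowest
weight vector. -/
theorem mem_span_lie {α₀ : Weight ℂ T 𝔤} (hmin : ∀ α, F.ht α₀ ≤ F.ht α) (x : 𝔤) :
    x ∈ Submodule.span ℂ {z | ∃ σ β : Weight ℂ T 𝔤, (F.ht σ = 1 ∨ σ = α₀) ∧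
      ∃ e ∈ rootSpace T σ, ∃ w ∈ rootSpace T β, z = ⁅e, w⁆} := by
  set A := Submodule.span ℂ {z | ∃ σ β : Weight ℂ T 𝔤, (F.ht σ = 1 ∨ σ = α₀) ∧
      ∃ e ∈ rootSpace T σ, ∃ w ∈ rootSpace T β, z = ⁅e, w⁆} with hA
  have hmem : ∀ σ : Weight ℂ T 𝔤, (F.ht σ = 1 ∨ σ = α₀) → ∀ e ∈ rootSpace T σ, ∀ w, ⁅e, w⁆ ∈ A := by
    intro σ hσ e he w
    refine sub_induction (T := T) (p := fun w => ⁅e, w⁆ ∈ A) ?_ ?_ ?_ w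
    · simp only [lie_zero]; exact zero_mem _
    · intro a b ha hb; simp only [lie_add]; exact add_mem ha hb
    · intro β w hw; exact Submodule.subset_span ⟨σ, β, hσ, e, he, w, hw, rfl⟩
  by_contra hx
  obtain ⟨φ, hφ, hφA⟩ := Submodule.exists_dual_map_eq_bot_of_notMem hx inferInstance
  have hker : LinearMap.ker (killingForm ℂ 𝔤) = ⊥ := by simp
  have hinj : Function.Injective (killingForm ℂ 𝔤) := LinearMap.ker_eq_bot.1 hker
  have hsurj : Function.Surjective (killingForm ℂ 𝔤) :=
    (LinearMap.injective_iff_surjective_of_finrank_eq_finrank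
      (Subspace.dual_finrank_eq (K := ℂ) (V := 𝔤)).symm).1 hinj
  obtain ⟨y, rfl⟩ := hsurj φ
  have hy : ∀ a ∈ A, killingForm ℂ 𝔤 y a = 0 := by
    intro a ha
    have : killingForm ℂ 𝔤 y a ∈ A.map (killingForm ℂ 𝔤 y) := ⟨a, ha, rfl⟩
    rwa [hφA, Submodule.mem_bot] at this
  have hz : ∀ σ : Weight ℂ T 𝔤, (F.ht σ = 1 ∨ σ = α₀) → ∀ e ∈ rootSpace T σ, ⁅y, e⁆ = 0 := by
    intro σ hσ e he
    apply hinj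
    rw [map_zero]
    ext w
    rw [← lie_skew, map_neg, LinearMap.neg_apply, killing_lie, neg_neg, hy _ (hmem σ hσ e he w)]
    rfl
  have : y = 0 := F.eq_zero_of_lie_eq_zero hmin (fun σ hσ => hz σ (Or.inl hσ)) (hz α₀ (Or.inr rfl))
  rw [this] at hφ
  simp at hφ

end HeightFunction

end Generation

end Wakimoto

end

/-! ### Generation and Chevalley generators of the affine Lie algebra -/

noncomputable section

namespace Wakimoto

open LieAlgebra LieAlgebra.IsKilling LieModule

section Affine

attribute [local instance 100] LieRing.ofAssociativeRing

variable {𝔤 : Type*} [LieRing 𝔤] [LieAlgebra ℂ 𝔤] [FiniteDimensional ℂ 𝔤] [LieAlgebra.IsSimple ℂ 𝔤]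
  (T : LieSubalgebra ℂ 𝔤) [T.IsCartanSubalgebra] (b : (rootSystem T).Base) (θ : T.root)

/-- The height with respect to a base as a height function. -/
def baseHeight : HeightFunction T where
  ht := wtHeight T b
  add := wtHeight_add T b
  ht_neg := wtHeight_neg
  eq_zero := wtHeight_eq_zero T b
  exists_pos α hα := by
    rcases weight_cases T α with h | h
    · rw [wtHeight_zero T b h] at hα; exact (lt_irrefl _ hα).elim
    rw [wtHeight_root T b ⟨α, h⟩] at hα
    obtain ⟨j, hj, hpos⟩ := RootPairing.Base.IsPos.exists_mem_support_pos_pairingIn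
      (b := b) (i := ⟨α, h⟩) hα
    rw [RootPairing.zero_lt_pairingIn_iff'] at hpos
    refine ⟨j, ?_, ((rootSystem T).pairingIn ℤ ⟨α, h⟩ j).toNat, by omega, ?_⟩
    · rw [wtHeight_root T b j, b.height_one_of_mem_support hj]
    · have h1 := (rootSystem T).algebraMap_pairingIn ℤ ⟨α, h⟩ j
      rw [rootSystem_pairing_apply] at h1
      rw [← h1]
      have h2 := Int.toNat_of_nonneg hpos.le
      rw [← Int.cast_natCast, h2]
      rfl
  separating t ht := by
    have h : Module.Dual.eval ℂ T t = 0 := b.toWeightBasis.ext fun i => by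
      rw [b.toWeightBasis_apply]
      exact ht i.1 (by rw [wtHeight_root T b i.1, b.height_one_of_mem_support i.2])
    exact (Module.forall_dual_apply_eq_zero_iff ℂ t).1 fun f => LinearMap.congr_fun h f

/-- The roots of height one are simple. -/
theorem mem_support_of_height_one {i : T.root} (h : b.height i = 1) : i ∈ b.support := by
  classical
  obtain ⟨f, -, hf | hf⟩ := b.exists_root_eq_sum_nat_or_neg i
  · have h1 : (rootSystem T).root i = ∑ j ∈ b.support, (f j : ℤ) • (rootSystem T).root j := by
      rw [hf]; simp
    have h2 := RootPairing.Base.height_eq_sum h1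
    rw [h] at h2
    have h3 : ∑ j ∈ b.support, f j = 1 := by exact_mod_cast h2.symm
    obtain ⟨j, hj, hj0⟩ : ∃ j ∈ b.support, f j ≠ 0 := by
      by_contra! hc
      rw [Finset.sum_eq_zero hc] at h3
      omega
    have h4 := Finset.add_sum_erase b.support f hj
    have h5 : ∑ k ∈ b.support.erase j, f k = 0 := by omega
    rw [Finset.sum_eq_zero_iff] at h5
    have h6 : (rootSystem T).root i = (rootSystem T).root j := by
      rw [hf, ← Finset.add_sum_erase b.support _ hj, Finset.sum_eq_zero (s := b.support.erase j)
        (fun k hk => by rw [h5 k hk, zero_smul]), show f j = 1 by omega, one_smul, add_zero]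
    rwa [(rootSystem T).root.injective h6]
  · have h1 : (rootSystem T).root i = ∑ j ∈ b.support, (-(f j : ℤ)) • (rootSystem T).root j := by
      rw [hf]; simp
    have h2 := RootPairing.Base.height_eq_sum h1
    rw [h, Finset.sum_neg_distrib] at h2
    have h3 : 0 ≤ ∑ j ∈ b.support, (f j : ℤ) := Finset.sum_nonneg fun _ _ => by positivity
    omega

variable {T b θ}

theorem loop_mem_gr {α : Weight ℂ T 𝔤} {m n : ℤ} (h : wtHeight T b α + coxeter T b θ * m = n) {x : 𝔤}
    (hx : x ∈ rootSpace T α) : ofLoop T θ (loop m x) ∈ (affineSemiInfinite T b θ).gr n :=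
  Submodule.subset_span (Or.inl ⟨α, m, x, h, hx, rfl⟩)

variable (T b θ) in
/-- The element of `𝔤̂₀` whose adjoint action is the degree. -/
def affineDelta : AffineLie T θ :=
  (affineBigraded T b θ).rho + (coxeter T b θ : ℂ) • (affineBigraded T b θ).D

theorem lie_affineDelta {n : ℤ} {x : AffineLie T θ} (hx : x ∈ (affineSemiInfinite T b θ).gr n) :
    ⁅affineDelta T b θ, x⁆ = (n : ℂ) • x := by
  rw [affine_gr_eq] at hx
  induction hx using Submodule.span_induction with
  | zero => simp
  | add a b _ _ ha hb => rw [lie_add, ha, hb, smul_add]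
  | smul c a _ ha => rw [lie_smul, ha, smul_comm]
  | mem x hx =>
    obtain ⟨r, hr, rfl⟩ := hx
    rw [affineDelta, add_lie, smul_lie, BigradedBasis.lie_rho, BigradedBasis.lie_D, smul_smul,
      ← add_smul]
    congr 1
    have h : (affineBigraded T b θ).hgt r + coxeter T b θ * (affineBigraded T b θ).mo r = n := hr
    rw [← h]
    push_cast; rfl

/-- The components of nonzero degree of `𝔤̂` are generated by brackets with a component of degree `s`
that contains all vectors of height one and a lowest weight vector. -/
theorem mem_span_lie_gr (F : HeightFunction T) {α₀ : Weight ℂ T 𝔤} (hmin : ∀ α, F.ht α₀ ≤ F.ht α)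
    (s : ℤ) (hs : ∀ σ, (F.ht σ = 1 ∨ σ = α₀) → ∃ q : ℤ, wtHeight T b σ + coxeter T b θ * q = s)
    {n : ℤ} (hn : n ≠ 0) {x : AffineLie T θ} (hx : x ∈ (affineSemiInfinite T b θ).gr n) :
    x ∈ Submodule.span ℂ {z | ∃ a ∈ (affineSemiInfinite T b θ).gr s,
      ∃ y ∈ (affineSemiInfinite T b θ).gr (n - s), z = ⁅a, y⁆} := by
  set S' : Set (AffineLie T θ) := {z | ∃ k, ∃ a ∈ (affineSemiInfinite T b θ).gr s,
    ∃ y ∈ (affineSemiInfinite T b θ).gr k, z = ⁅a, y⁆} ∪ {elK T θ} with hS'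
  have h1 : ∀ (m : ℤ) (x : 𝔤), ofLoop T θ (loop m x) ∈ Submodule.span ℂ S' := by
    intro m x
    have hx := F.mem_span_lie hmin x
    induction hx using Submodule.span_induction with
    | zero => rw [map_zero, map_zero]; exact zero_mem _
    | add a b _ _ ha hb => rw [map_add, map_add]; exact add_mem ha hb
    | smul c a _ ha => rw [map_smul, map_smul]; exact Submodule.smul_mem _ c ha
    | mem z hz =>
      obtain ⟨σ, β, hσ, e, he, w, hw, rfl⟩ := hz
      obtain ⟨q, hq⟩ := hs σ hσ
      have h2 := lie_ofLoop T θ q (m - q) e w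
      rw [show q + (m - q) = m by ring] at h2
      rw [← sub_eq_iff_eq_add.2 h2]
      refine sub_mem (Submodule.subset_span (Or.inl ⟨_, _, loop_mem_gr hq he, _,
        loop_mem_gr rfl hw, rfl⟩)) (Submodule.smul_mem _ _ (Submodule.subset_span (Or.inr rfl)))
  have h2 : x ∈ Submodule.span ℂ S' := by
    refine Submodule.span_le.2 ?_ hx
    rintro X (⟨α, m, x, -, -, rfl⟩ | ⟨h, -⟩)
    · exact h1 m x
    · exact (hn h).elim
  have h3 : ∀ v ∈ S', ∃ c : ℂ, LieAlgebra.ad ℂ _ (affineDelta T b θ) v = c • v := by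
    rintro v (⟨k, a, ha, y, hy, rfl⟩ | rfl)
    · refine ⟨(s : ℂ) + k, ?_⟩
      rw [LieAlgebra.ad_apply, leibniz_lie, lie_affineDelta ha, lie_affineDelta hy, smul_lie, lie_smul,
        add_smul]
    · refine ⟨0, ?_⟩
      rw [LieAlgebra.ad_apply, ← lie_skew, elK_lie, neg_zero, zero_smul]
  refine Submodule.span_le.2 ?_ (mem_span_of_eigen _ h3 h2 (lie_affineDelta hx))
  rintro v ⟨⟨k, a, ha, y, hy, rfl⟩ | rfl, hv⟩
  · by_cases h0 : ⁅a, y⁆ = 0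
    · rw [h0]; exact zero_mem _
    rw [LieAlgebra.ad_apply, leibniz_lie, lie_affineDelta ha, lie_affineDelta hy, smul_lie, lie_smul,
      ← add_smul] at hv
    have h4 := smul_left_injective ℂ h0 hv
    have h5 : s + k = n := by exact_mod_cast h4
    refine Submodule.subset_span ⟨a, ha, y, ?_, rfl⟩
    rwa [← h5, add_sub_cancel_left]
  · rw [LieAlgebra.ad_apply, ← lie_skew, elK_lie, neg_zero] at hv
    have h4 : elK T θ = 0 := (smul_eq_zero.1 hv.symm).resolve_left (by exact_mod_cast hn)
    rw [h4]; exact zero_mem _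

/-- The highest root is the only root of its height. -/
theorem IsHighest.eq_of_wtHeight_eq (hθ : IsHighest T b θ) {α : Weight ℂ T 𝔤}
    (h : wtHeight T b α = b.height θ) : α = θ := by
  refine (baseHeight T b).neg.eq_of_ht_eq (α₀ := θ) (fun β => ?_) ?_
  · change -wtHeight T b θ ≤ -wtHeight T b β
    rw [wtHeight_root T b θ]
    exact neg_le_neg (hθ.wtHeight_le β)
  · change -wtHeight T b α = -wtHeight T b θ
    rw [h, wtHeight_root T b θ]

/-- `𝔤̂₊` is generated in degree `1`; the component of degree `1` contains the simple root vectors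
and `z ⊗ 𝔤_{-θ}`. -/
theorem IsHighest.gen_pos (hθ : IsHighest T b θ) {n : ℤ} (hn : n ≠ 0) {x : AffineLie T θ}
    (hx : x ∈ (affineSemiInfinite T b θ).gr n) :
    x ∈ Submodule.span ℂ {z | ∃ a ∈ (affineSemiInfinite T b θ).gr 1,
      ∃ y ∈ (affineSemiInfinite T b θ).gr (n - 1), z = ⁅a, y⁆} := by
  refine mem_span_lie_gr (baseHeight T b) (α₀ := -(θ : Weight ℂ T 𝔤)) (fun α => ?_) 1 ?_ hn hx
  · change wtHeight T b (-(θ : Weight ℂ T 𝔤)) ≤ wtHeight T b α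
    rw [wtHeight_neg, wtHeight_root T b θ]
    exact hθ.neg_le_wtHeight α
  · rintro σ (hσ | rfl)
    · exact ⟨0, by rw [mul_zero, add_zero]; exact hσ⟩
    · exact ⟨1, by rw [wtHeight_neg, wtHeight_root T b θ, coxeter]; ring⟩

/-- `𝔤̂₋` is generated in degree `-1` over its component of degree `0`. -/
theorem IsHighest.gen_neg (hθ : IsHighest T b θ) {n : ℤ} (hn : n ≠ 0) {x : AffineLie T θ}
    (hx : x ∈ (affineSemiInfinite T b θ).gr n) :
    x ∈ Submodule.span ℂ {z | ∃ a ∈ (affineSemiInfinite T b θ).gr (-1),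
      ∃ y ∈ (affineSemiInfinite T b θ).gr (n - -1), z = ⁅a, y⁆} := by
  refine mem_span_lie_gr (baseHeight T b).neg (α₀ := θ) (fun α => ?_) (-1) ?_ hn hx
  · change -wtHeight T b θ ≤ -wtHeight T b α
    rw [wtHeight_root T b θ]
    exact neg_le_neg (hθ.wtHeight_le α)
  · rintro σ (hσ | rfl)
    · change -wtHeight T b σ = 1 at hσ
      exact ⟨0, by omega⟩
    · exact ⟨-1, by rw [wtHeight_root T b θ, coxeter]; ring⟩

/-- The sum of the positive roots takes the value `2` on simple coroots: the simple reflection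
permutes the other positive roots. -/
theorem twoRho_coroot {j : T.root} (hj : j ∈ b.support) :
    twoRho T b (coroot (j : Weight ℂ T 𝔤)) = 2 := by
  classical
  have h1 : twoRho T b (coroot (j : Weight ℂ T 𝔤)) =
      ∑ α : T.root, if b.IsPos α then (rootSystem T).pairing α j else 0 := by
    rw [twoRho, LinearMap.sum_apply]
    refine Finset.sum_congr (by congr!) fun α _ => ?_
    by_cases hα : b.IsPos α
    · rw [if_pos hα, if_pos hα]; rfl
    · rw [if_neg hα, if_neg hα]; rfl
  have hjpos : b.IsPos j := b.isPos_of_mem_support hj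
  rw [h1, ← Finset.sum_filter, ← Finset.add_sum_erase _ _
    (Finset.mem_filter.2 ⟨Finset.mem_univ j, hjpos⟩), RootPairing.pairing_same]
  have hp : ∀ α, (rootSystem T).pairing ((rootSystem T).reflectionPerm j α) j =
      -(rootSystem T).pairing α j := fun α => by
    rw [← RootPairing.pairing_reflectionPerm, RootPairing.pairing_reflectionPerm_self_right]
  have h2 : ∑ α ∈ (Finset.univ.filter fun α => b.IsPos α).erase j, (rootSystem T).pairing α j = 0 := by
    refine Finset.sum_involution (fun α _ => (rootSystem T).reflectionPerm j α) ?_ ?_ ?_ ?_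
    · intro α _
      rw [hp, add_neg_cancel]
    · intro α _ hne heq
      apply hne
      have h3 := congrArg (fun α => (rootSystem T).pairing α j) heq
      exact self_eq_neg.1 (h3.symm.trans (hp α))
    · intro α hα
      rw [Finset.mem_erase, Finset.mem_filter] at hα ⊢
      refine ⟨fun h => ?_, Finset.mem_univ _, hα.2.2.reflectionPerm hj hα.1⟩
      have h5 := hα.2.2.reflectionPerm hj hα.1
      have h6 : α = (rootSystem T).reflectionPerm j j := by
        exact ((rootSystem T).reflectionPerm_self j α).symm.trans (congrArg _ h)
      have h7 := b.height_reflectionPerm_self j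
      change b.height ((rootSystem T).reflectionPerm j j) = _ at h7
      rw [← h6] at h7
      have h8 : 0 < b.height α := hα.2.2
      have h9 : 0 < b.height j := hjpos
      omega
    · intro α _; exact RootPairing.reflectionPerm_self _ _ _
  rw [h2, add_zero]

/-- The vector of the Cartan subalgebra of `𝔤̂` spanned by the brackets of `zᵐ ⊗ 𝔤_α` with the
opposite root space. -/
def affineCoroot (θ : T.root) (α : Weight ℂ T 𝔤) (m : ℤ) : T × ℂ × ℂ :=
  ((cartanEquivDual T).symm α, (m : ℂ) * (2 / killingForm ℂ 𝔤 (coroot (θ : Weight ℂ T 𝔤) : T)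
    (coroot (θ : Weight ℂ T 𝔤) : T)), 0)

theorem cartan_mem_gr (h : T × ℂ × ℂ) : cartan T θ h ∈ (affineSemiInfinite T b θ).gr 0 := by
  rw [cartan_eq]
  refine add_mem (add_mem ?_ (Submodule.smul_mem _ _ (Submodule.subset_span (Or.inr ⟨rfl, Or.inl rfl⟩))))
    (Submodule.smul_mem _ _ (Submodule.subset_span (Or.inr ⟨rfl, Or.inr rfl⟩)))
  have h0 : ((h.1 : T) : 𝔤) ∈ rootSpace T (0 : T → ℂ) := by
    have h1 : ((h.1 : T) : 𝔤) ∈ zeroRootSubalgebra ℂ 𝔤 T := by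
      rw [zeroRootSubalgebra_eq_of_is_cartan]; exact h.1.2
    exact h1
  by_cases hz : h.1 = 0
  · rw [hz]; simp
  let ζ : Weight ℂ T 𝔤 := ⟨0, fun hc => hz (Subtype.ext (by
    change _ ∈ genWeightSpace 𝔤 (0 : T → ℂ) at h0
    rwa [hc, LieSubmodule.mem_bot] at h0))⟩
  refine loop_mem_gr (α := ζ) ?_ h0
  rw [wtHeight_zero T b (show ζ.IsZero from rfl), mul_zero, add_zero]

theorem lie_opposite {α : Weight ℂ T 𝔤} {m : ℤ} {x y : 𝔤} (hx : x ∈ rootSpace T α)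
    (hy : y ∈ rootSpace T (-α : T → ℂ)) :
    ⁅ofLoop T θ (loop m x), ofLoop T θ (loop (-m) y)⁆ =
      killingForm ℂ 𝔤 x y • cartan T θ (affineCoroot θ α m) := by
  rw [lie_ofLoop, cocycle_loop, add_neg_cancel, if_pos rfl, cartan_eq,
    lie_eq_killingForm_smul_of_mem_rootSpace_of_mem_rootSpace_neg hx hy, map_smul, map_smul]
  simp only [affineCoroot, normForm, zero_smul, add_zero, smul_add, smul_smul, LinearMap.smul_apply,
    smul_eq_mul]
  congr 2
  ring

/-- The bracket of a vector of `zᵐ ⊗ 𝔤_α` of degree `-1` with a vector of degree `1` is a multiple of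
the coroot, since `0` is the only weight of degree `0`. -/
theorem IsHighest.exists_lie_eq_smul (hθ : IsHighest T b θ) {α : Weight ℂ T 𝔤} {m : ℤ}
    (hm : wtHeight T b α + coxeter T b θ * m = -1) {x : 𝔤} (hx : x ∈ rootSpace T α)
    {u : AffineLie T θ} (hu : u ∈ (affineSemiInfinite T b θ).gr 1) :
    ∃ c : ℂ, ⁅ofLoop T θ (loop m x), u⁆ = c • cartan T θ (affineCoroot θ α m) := by
  induction hu using Submodule.span_induction with
  | zero => exact ⟨0, by rw [lie_zero, zero_smul]⟩
  | add a c _ _ ha hc =>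
    obtain ⟨p, hp⟩ := ha
    obtain ⟨q, hq⟩ := hc
    exact ⟨p + q, by rw [lie_add, hp, hq, add_smul]⟩
  | smul c a _ ha =>
    obtain ⟨p, hp⟩ := ha
    exact ⟨c * p, by rw [lie_smul, hp, smul_smul]⟩
  | mem u hu =>
    rcases hu with ⟨β, n, y, hn, hy, rfl⟩ | ⟨h, -⟩
    · by_cases hab : (α : T → ℂ) + β = 0
      · have h1 := wtHeight_add_eq_zero T b hab
        have h2 : coxeter T b θ * (m + n) = 0 := by rw [mul_add]; omega
        have h3 : n = -m := by
          rcases mul_eq_zero.1 h2 with h | h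
          · exact (hθ.coxeter_pos.ne' h).elim
          · omega
        have hy' : y ∈ rootSpace T (-α : T → ℂ) := by
          rwa [neg_eq_of_add_eq_zero_right hab]
        subst h3
        exact ⟨_, lie_opposite hx hy'⟩
      · refine ⟨0, ?_⟩
        have h1 : normForm T θ x y = 0 := by
          simp only [normForm, LinearMap.smul_apply]
          rw [killingForm_apply_eq_zero_of_mem_rootSpace_of_add_ne_zero ℂ 𝔤 T hx hy hab, smul_zero]
        have h2 : ⁅x, y⁆ = 0 := by
          by_contra hne
          obtain ⟨γ, hγ, -⟩ := HeightFunction.lie_mem hx hy hne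
          have h3 := wtHeight_add T b hγ
          have h4 : wtHeight T b γ + coxeter T b θ * (m + n) = 0 := by rw [mul_add]; omega
          have h5 := hθ.isolated (α := γ) (β := -γ) (by simp) h4
          exact hab (by rw [← hγ]; exact h5.1)
        rw [lie_ofLoop, cocycle_loop, h1, h2, mul_zero, ite_self, zero_smul, zero_smul, map_zero,
          map_zero, add_zero]
    · omega

/-- The condition `[h, y] = -β(h) y` for a vector `y` of weight `-α_j`, equivalent to `2ρ(α_j^∨) =
2`. -/
theorem twoRho_affineCoroot_simple {j : T.root} (hj : j ∈ b.support) {α : Weight ℂ T 𝔤}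
    (hα : α = -(j : Weight ℂ T 𝔤)) :
    α (affineCoroot θ α 0).1 = -betaCartan T b θ (affineCoroot θ α 0) := by
  subst hα
  have h1 := twoRho_coroot (b := b) hj
  have hne := root_apply_cartanEquivDual_symm_ne_zero (LieSubalgebra.isNonZero_coe_root j)
  rw [coroot, map_nsmul, map_smul] at h1
  simp only [affineCoroot, betaCartan, LinearMap.coprod_apply, Int.cast_zero, zero_mul, map_zero,
    add_zero, Weight.toLinear_neg, map_neg, neg_neg]
  have h2 : twoRho T b ((cartanEquivDual T).symm (j : Weight ℂ T 𝔤).toLinear) =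
      (j : Weight ℂ T 𝔤) ((cartanEquivDual T).symm (j : Weight ℂ T 𝔤).toLinear) := by
    simp only [smul_eq_mul, nsmul_eq_mul] at h1
    field_simp at h1
    push_cast at h1
    linear_combination h1 / 2
  rw [h2, Weight.coe_neg, Pi.neg_apply]
  exact neg_neg _

theorem killing_coroot (α : Weight ℂ T 𝔤) (hα : α.IsNonZero) :
    2 / killingForm ℂ 𝔤 (coroot α : T) (coroot α : T) = α ((cartanEquivDual T).symm α) / 2 := by
  have h1 : killingForm ℂ 𝔤 (coroot α : T) (coroot α : T) =
      2 • (α ((cartanEquivDual T).symm α))⁻¹ • α (coroot α) := traceForm_coroot α (coroot α)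
  have hne := root_apply_cartanEquivDual_symm_ne_zero hα
  rw [h1, root_apply_coroot hα]
  simp only [smul_eq_mul, nsmul_eq_mul]
  field_simp
  norm_num

/-- The condition `[h, y] = -β(h) y` for `y` in `z⁻¹ ⊗ 𝔤_θ`. It holds by the definition of `h^∨` as
`1 + ρ(θ^∨)`. -/
theorem twoRho_affineCoroot_theta :
    (θ : Weight ℂ T 𝔤) (affineCoroot θ θ (-1)).1 = -betaCartan T b θ (affineCoroot θ θ (-1)) := by
  have hne := root_apply_cartanEquivDual_symm_ne_zero (LieSubalgebra.isNonZero_coe_root θ)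
  simp only [affineCoroot, betaCartan, LinearMap.coprod_apply, Int.cast_neg, Int.cast_one,
    killing_coroot _ (LieSubalgebra.isNonZero_coe_root θ), dualCoxeter, map_zero, add_zero,
    LinearMap.smul_apply, LinearMap.id_apply, smul_eq_mul]
  rw [show coroot (θ : Weight ℂ T 𝔤) = 2 • ((θ : Weight ℂ T 𝔤) ((cartanEquivDual T).symm
    (θ : Weight ℂ T 𝔤)))⁻¹ • (cartanEquivDual T).symm (θ : Weight ℂ T 𝔤) from rfl, map_nsmul,
    map_smul, smul_eq_mul, nsmul_eq_mul]
  field_simp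
  push_cast
  ring

/-- The component of degree `-1` is spanned by vectors with the properties of Chevalley generators:
its weights are the negatives of the simple roots `α₀, …, α_r`. -/
theorem IsHighest.chevalley (hθ : IsHighest T b θ) {u : AffineLie T θ}
    (hu : u ∈ (affineSemiInfinite T b θ).gr (-1)) :
    u ∈ Submodule.span ℂ {y | y ∈ (affineSemiInfinite T b θ).gr (-1) ∧
      ∃ h ∈ (affineSemiInfinite T b θ).gr 0,
      (∀ x ∈ (affineSemiInfinite T b θ).gr 1, ∃ c : ℂ, ⁅y, x⁆ = c • h) ∧
      ⁅h, y⁆ = -((affineSemiInfinite T b θ).beta h) • y} := by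
  refine Submodule.span_mono ?_ hu
  rintro X (⟨α, m, x, hm, hx, rfl⟩ | ⟨h, -⟩)
  swap
  · omega
  refine ⟨loop_mem_gr hm hx, cartan T θ (affineCoroot θ α m), cartan_mem_gr _,
    fun u hu => hθ.exists_lie_eq_smul hm hx hu, ?_⟩
  rw [cartan_lie_loop T θ _ α m hx]
  congr 1
  change _ = -(betaCartan T b θ (projCartan T θ (cartan T θ (affineCoroot θ α m))))
  rw [projCartan_cartan, show (affineCoroot θ α m).2.2 = 0 from rfl, zero_mul, add_zero]
  have h1 := hθ.wtHeight_le α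
  have h2 := hθ.neg_le_wtHeight α
  have h3 : m = 0 ∨ m = -1 := by
    unfold coxeter at hm
    have h4 := hθ.height_nonneg
    have h5 : -2 < m := by by_contra hc; nlinarith
    have h6 : m < 1 := by by_contra hc; nlinarith
    omega
  rcases h3 with rfl | rfl
  · have h4 : wtHeight T b (-α) = 1 := by rw [wtHeight_neg]; omega
    have h5 : -α ∈ T.root := (weight_cases T (-α)).resolve_left fun h => by
      rw [wtHeight_zero T b h] at h4; omega
    rw [wtHeight_root T b ⟨-α, h5⟩] at h4
    exact twoRho_affineCoroot_simple (mem_support_of_height_one T b h4) (neg_neg α).symm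
  · have h4 := hθ.eq_of_wtHeight_eq (α := α) (by unfold coxeter at hm; omega)
    subst h4
    exact twoRho_affineCoroot_theta

end Affine

end Wakimoto

end

/-! ### The basis of the Wakimoto module -/

noncomputable section

namespace Wakimoto

open LieAlgebra LieAlgebra.IsKilling LieModule

section Monomials

attribute [local instance 100] LieRing.ofAssociativeRing

variable {L : Type*} [LieRing L] [LieAlgebra ℂ L]

theorem mapU_pbwMonomial {S I : Type*} [LieRing S] [LieAlgebra ℂ S] [LinearOrder I] (φ : S →ₗ⁅ℂ⁆ L)
    (e : I → S) (n : I →₀ ℕ) : mapU φ (pbwMonomial e n) = pbwMonomial (fun i => φ (e i)) n := by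
  rw [pbwMonomial, pbwMonomial, map_list_prod, List.map_map]
  congr 1
  refine List.map_congr_left fun i _ => ?_
  rw [Function.comp_apply, map_pow, mapU_toU]

theorem incU_pbwBasis {S : LieSubalgebra ℂ L} {I : Type*} [LinearOrder I] (x : Module.Basis I ℂ S)
    (n : I →₀ ℕ) : incU S (pbwBasis x n) = pbwMonomial (fun i => (x i : L)) n := by
  rw [pbwBasis_apply]
  exact mapU_pbwMonomial S.incl x n

end Monomials

section Affine

attribute [local instance 100] LieRing.ofAssociativeRing

variable {𝔤 : Type*} [LieRing 𝔤] [LieAlgebra ℂ 𝔤] [FiniteDimensional ℂ 𝔤] [LieAlgebra.IsSimple ℂ 𝔤]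
  {T : LieSubalgebra ℂ 𝔤} [T.IsCartanSubalgebra] {b : (rootSystem T).Base} {θ : T.root}

theorem charRep_lie {P : Weight ℂ T 𝔤 → ℤ → Prop}
    (hP : ∀ (α β γ : Weight ℂ T 𝔤) (m n : ℤ), P α m → P β n →
      (γ : T → ℂ) = α + β → P γ (m + n))
    (hP' : ∀ (α β : Weight ℂ T 𝔤) (m n : ℤ), P α m → P β n → (α : T → ℂ) + β = 0 → m + n = 0 →
      α.IsZero ∧ m = 0)
    (lam : Module.Dual ℂ (T × ℂ × ℂ)) (x y : sectorAlg θ hP) :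
    lam (projCartan T θ ⁅(x : AffineLie T θ), (y : AffineLie T θ)⁆) = 0 := by
  have h := LinearMap.congr_fun ((charRep θ hP hP' lam).map_lie x y) 1
  have h1 : (charRep θ hP hP' lam ⁅x, y⁆) 1 =
      lam (projCartan T θ ⁅(x : AffineLie T θ), (y : AffineLie T θ)⁆) * 1 := rfl
  rw [LieRing.of_associative_ring_bracket, h1, LinearMap.sub_apply] at h
  have h2 : ∀ u v, (charRep θ hP hP' lam u * charRep θ hP hP' lam v) 1 =
      lam (projCartan T θ u) * (lam (projCartan T θ v) * 1) := fun u v => rfl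
  rw [h2, h2] at h
  rw [mul_one] at h
  rw [h]; ring

theorem projCartan_eq_zero {x : AffineLie T θ}
    (hx : ∀ r, (affineBasis T θ).repr x r ≠ 0 → affineHgt T b r ≠ 0 ∨ affineMo T r ≠ 0) :
    projCartan T θ x = 0 := by
  rw [← (affineBasis T θ).linearCombination_repr x, Finsupp.linearCombination_apply, map_finsuppSum]
  refine Finset.sum_eq_zero fun r hr => ?_
  change projCartan T θ (_ • affineBasis T θ r) = 0
  rw [map_smul, projCartan_affineBasis T b θ (hx r (Finsupp.mem_support_iff.1 hr)), smul_zero]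

variable (b) in
/-- The character `λ` of `𝔞̄`. -/
def aBarChar (lam : Module.Dual ℂ (T × ℂ × ℂ)) : aBar T b θ →ₗ[ℂ] ℂ :=
  lam ∘ₗ projCartan T θ ∘ₗ (aBar T b θ).toSubmodule.subtype

/-- The bigraded frame of `𝔤̂`. -/
def affineFrame (hθ : IsHighest T b θ) (lam : Module.Dual ℂ (T × ℂ × ℂ)) :
    BigradedFrame (affineBigraded T b θ) (affineSemiInfinite T b θ) (affinePlus T b θ)
      (affineMinus T b θ) (aBar T b θ) (aPlusLie T b θ) (aMinusLie T b θ) (aBarChar b lam) where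
  I := coxeter T b θ
  I_pos := hθ.coxeter_pos
  gr_eq := affine_gr_eq T b θ
  P_eq := rfl
  M_eq := affineMinus_eq T b θ
  H_eq := aBar_eq T b θ
  ap_eq := rfl
  am_eq := rfl
  not_deg_zero := hθ.hgt_eq_zero
  deg_fin := hθ.deg_fin
  beta_v r hr := by
    change betaCartan T b θ (projCartan T θ (affineBasis T θ r)) = 0
    rw [projCartan_affineBasis T b θ hr, map_zero]
  beta_lie x y := charRep_lie _ (fun α β m n h1 h2 h hmn => by
    have h3 := wtHeight_add_eq_zero T b h
    refine hθ.isolated h ?_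
    have h4 : coxeter T b θ * m + coxeter T b θ * n = 0 := by rw [← mul_add, hmn, mul_zero]
    omega) (betaCartan T b θ) x y
  lam_v x hx := by
    change lam (projCartan T θ (x : AffineLie T θ)) = 0
    rw [projCartan_eq_zero (b := b) hx, map_zero]
  lam_lie x y := charRep_lie (P := fun α m => 0 < wtHeight T b α ∨ wtHeight T b α = 0 ∧ m ≤ 0) _
    (fun α β m n h1 h2 h hmn => by
      have := wtHeight_add_eq_zero T b h
      rw [← wtHeight_eq_zero T b]
      omega) lam x y
  gen_pos n hn x hx := by
    have h := hθ.gen_pos (n := n + 1) (by omega) hx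
    rwa [add_sub_cancel_right] at h
  gen_neg n hn x hx := by
    have h := hθ.gen_neg (n := -(n + 1)) (by omega) hx
    rwa [show (-((n : ℤ) + 1) - -1) = -(n : ℤ) by ring] at h
  chevalley x hx := hθ.chevalley hx

theorem aBarRep_apply (lam : Module.Dual ℂ (T × ℂ × ℂ)) (h : aBar T b θ) (z : ℂ) :
    aBarRep T b θ lam h z = aBarChar b lam h * z := rfl

theorem mem_affineRootSpace {γ : Module.Dual ℂ (T × ℂ × ℂ)} {x : AffineLie T θ} :
    x ∈ affineRootSpace T θ γ ↔ ∀ h, ⁅cartan T θ h, x⁆ = γ h • x := by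
  rw [affineRootSpace, wtSpace, Submodule.mem_iInf]
  refine forall_congr' fun h => ?_
  rw [LinearMap.mem_ker, LinearMap.sub_apply, sub_eq_zero]
  rfl

variable (b θ) in
/-- The total degree as an element of `𝔱 ⊕ ℂ K ⊕ ℂ d`. -/
def cartanDelta : T × ℂ × ℂ := (rhoCheck T b, 0, (coxeter T b θ : ℂ))

theorem cartan_cartanDelta (hθ : IsHighest T b θ) (lam : Module.Dual ℂ (T × ℂ × ℂ)) :
    cartan T θ (cartanDelta b θ) = (affineFrame hθ lam).delta := by
  change _ = cartan T θ (rhoCheck T b, 0, 0) + (coxeter T b θ : ℂ) • cartan T θ (0, 0, 1)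
  rw [← map_smul, ← map_add]
  congr 1
  simp [cartanDelta]

end Affine

section RootVectors

variable {L : Type*} [LieRing L] [LieAlgebra ℂ L] {R : Type*} {Z : BigradedBasis L R}
    {G : SemiInfinite L} {P M H ap am : LieSubalgebra ℂ L} {lam : H →ₗ[ℂ] ℂ}
    (Y : BigradedFrame Z G P M H ap am lam)

/-- The degree of an eigenvector is the degree of a basis vector. -/
theorem BigradedFrame.exists_deg_eq {p : ℤ → ℤ → Prop} {x : L} (hx : x ∈ Z.Sp p) (h0 : x ≠ 0) {c : ℂ}
    (hc : ⁅Y.delta, x⁆ = c • x) : ∃ n : ℤ, c = n ∧ (∃ r, p (Z.hgt r) (Z.mo r) ∧ Y.deg r = n) ∧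
      x ∈ G.gr n := by
  have h1 : ∀ r, Z.v.repr x r ≠ 0 → (Y.deg r : ℂ) = c := fun r hr =>
    eigen_repr Z.v (LieAlgebra.ad ℂ L Y.delta) _ Y.lie_delta_v hc hr
  obtain ⟨r, hr⟩ : ∃ r, Z.v.repr x r ≠ 0 := by
    by_contra! hcon
    exact h0 (Z.v.ext_elem fun r => by rw [hcon, map_zero]; rfl)
  refine ⟨Y.deg r, (h1 r hr).symm, ⟨r, Z.mem_Sp.1 hx r hr, rfl⟩, ?_⟩
  rw [Y.gr_eq, Z.mem_Sp]
  intro s hs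
  have h2 := (h1 s hs).trans (h1 r hr).symm
  exact_mod_cast h2

theorem BigradedFrame.finiteDimensional_gr (Y : BigradedFrame Z G P M H ap am lam) (n : ℤ) : FiniteDimensional ℂ (G.gr n) := by
  rw [Y.gr_eq]
  exact FiniteDimensional.span_of_finite ℂ ((Y.deg_fin n).image _)

theorem BigradedFrame.finite_of_linearIndependent (Y : BigradedFrame Z G P M H ap am lam) {ι : Type*} {x : ι → L}
    (hx : LinearIndependent ℂ x) (n : ℤ) : {i | x i ∈ G.gr n}.Finite := by
  have := Y.finiteDimensional_gr n
  have h1 : LinearIndependent ℂ fun i : {i | x i ∈ G.gr n} => (⟨x i, i.2⟩ : G.gr n) := by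
    refine LinearIndependent.of_comp (G.gr n).subtype ?_
    exact hx.comp _ Subtype.val_injective
  exact h1.finite

end RootVectors

section PartOne

attribute [local instance 100] LieRing.ofAssociativeRing

variable {𝔤 : Type*} [LieRing 𝔤] [LieAlgebra ℂ 𝔤] [FiniteDimensional ℂ 𝔤] [LieAlgebra.IsSimple ℂ 𝔤]
  {T : LieSubalgebra ℂ 𝔤} [T.IsCartanSubalgebra] {b : (rootSystem T).Base} {θ : T.root}

/-- For given bases of root vectors, the vectors `(∏ x_i^{n_i})^* ⊗ ∏ y_j^{l_j} ⊗ w_λ` form a basis of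
the Wakimoto module. -/
theorem exists_basis_wakimoto (hθ : IsHighest T b θ) (lam : Module.Dual ℂ (T × ℂ × ℂ))
    {ι κ : Type*} [LinearOrder ι] [LinearOrder κ]
    (x : Module.Basis ι ℂ (aPlus T b θ)) (y : Module.Basis κ ℂ (aMinus T b θ))
    (hx : ∀ i, ∃ γ, (x i : AffineLie T θ) ∈ affineRootSpace T θ γ)
    (hy : ∀ j, ∃ γ, (y j : AffineLie T θ) ∈ affineRootSpace T θ γ) :
    ∃ B : Module.Basis ((ι →₀ ℕ) × (κ →₀ ℕ)) ℂ (WakimotoModule T b θ lam),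
      ∀ n l v, IsBasisVector T b θ lam (fun i => (x i : AffineLie T θ))
        (fun j => (y j : AffineLie T θ)) n l v ↔ v = B (n, l) := by
  classical
  let Y := affineFrame hθ lam
  let _ : LinearOrder ((affineBigraded T b θ).idx fun i j => 0 < i + Y.I * j) :=
    linearOrderOfSTO WellOrderingRel
  let _ : LinearOrder ((affineBigraded T b θ).idx fun i j => i + Y.I * j ≤ 0) :=
    linearOrderOfSTO WellOrderingRel
  let x' : Module.Basis ι ℂ (aPlusLie T b θ) :=
    x.map (LinearEquiv.ofEq _ _ (aPlusLie_toSubmodule T b θ).symm)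
  let y' : Module.Basis κ ℂ (aMinusLie T b θ) :=
    y.map (LinearEquiv.ofEq _ _ (aMinusLie_toSubmodule T b θ).symm)
  have hx' : ∀ i, (x' i : AffineLie T θ) = x i := fun i => rfl
  have hy' : ∀ j, (y' j : AffineLie T θ) = y j := fun j => rfl
  have hdx : ∀ i, ∃ n : ℕ, 0 < n ∧ ⁅Y.delta, (x' i : AffineLie T θ)⁆ = (n : ℂ) • (x' i : AffineLie T θ) ∧
      (x i : AffineLie T θ) ∈ (affineSemiInfinite T b θ).gr n := by
    intro i
    obtain ⟨γ, hγ⟩ := hx i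
    have h1 := mem_affineRootSpace.1 hγ (cartanDelta b θ)
    rw [cartan_cartanDelta hθ lam] at h1
    obtain ⟨n, hn, ⟨r, hr, hrn⟩, hmem⟩ := Y.exists_deg_eq (p := fun i j =>
      (i < 0 ∨ i = 0 ∧ 0 < j) ∧ 0 < i + coxeter T b θ * j) (x' i).2 (fun h0 => x.ne_zero i
        (Subtype.ext h0)) h1
    have hpos : 0 < n := by rw [← hrn]; exact hr.2
    refine ⟨n.toNat, by omega, ?_, ?_⟩
    · rw [hx', h1, hn, ← Int.cast_natCast, Int.toNat_of_nonneg hpos.le]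
    · rwa [Int.toNat_of_nonneg hpos.le]
  have hdy : ∀ j, ∃ n : ℕ, ⁅Y.delta, (y' j : AffineLie T θ)⁆ = -(n : ℂ) • (y' j : AffineLie T θ) := by
    intro j
    obtain ⟨γ, hγ⟩ := hy j
    have h1 := mem_affineRootSpace.1 hγ (cartanDelta b θ)
    rw [cartan_cartanDelta hθ lam] at h1
    obtain ⟨n, hn, ⟨r, hr, hrn⟩, -⟩ := Y.exists_deg_eq (p := fun i j =>
      (i < 0 ∨ i = 0 ∧ 0 < j) ∧ i + coxeter T b θ * j ≤ 0) (y' j).2 (fun h0 => y.ne_zero j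
        (Subtype.ext h0)) h1
    have hneg : n ≤ 0 := by rw [← hrn]; exact hr.2
    refine ⟨(-n).toNat, ?_⟩
    rw [hy', h1, hn, ← Int.cast_natCast, Int.toNat_of_nonneg (by omega : 0 ≤ -n), Int.cast_neg, neg_neg]
  choose dx hdx0 hdx1 hdx2 using hdx
  choose dy hdy1 using hdy
  have hfin : ∀ n, {i | dx i = n}.Finite := by
    intro n
    have hli : LinearIndependent ℂ fun i => (x i : AffineLie T θ) :=
      x.linearIndependent.map' (aPlus T b θ).subtype (Submodule.ker_subtype _)
    refine (Y.finite_of_linearIndependent hli n).subset fun i hi => ?_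
    rw [Set.mem_ofPred_eq] at hi ⊢
    rw [← hi]
    exact hdx2 i
  let W := Y.toSemiInductionFrame x' y' dx dy hdx1 hdy1 hdx0 hfin
  refine ⟨(finHomBasis W.c W.d).map
    (W.resEquiv (aBarRep T b θ lam) (aBarRep_apply lam)).symm, fun n l v => ?_⟩
  rw [Module.Basis.map_apply, LinearEquiv.eq_symm_apply,
    ← W.exists_rep_iff (aBarRep T b θ lam) (aBarRep_apply lam), IsBasisVector,
    affinePlus_toSubmodule, aMinusLie_toSubmodule]
  refine exists_congr fun f => and_congr_right fun _ => ?_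
  rw [← and_assoc]
  refine and_congr_left fun _ => ?_
  have hc : ∀ n, incU _ (W.c n) = pbwMonomial (fun i => (x i : AffineLie T θ)) n := fun n =>
    incU_pbwBasis x' n
  have hd : ∀ l, incU _ (W.d l) = pbwMonomial (fun j => (y j : AffineLie T θ)) l := fun l =>
    incU_pbwBasis y' l
  rw [finHomBasis_apply]
  constructor
  · rintro ⟨h1, h2⟩ u
    have key : f.1.1 ∘ₗ (incU (aPlusLie T b θ)).toLinearMap =
        (incU (aMinusLie T b θ)).toLinearMap ∘ₗ dualTmul W.c n (W.d l) := by
      refine W.c.ext fun n' => ?_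
      rw [LinearMap.comp_apply, LinearMap.comp_apply, AlgHom.toLinearMap_apply,
        AlgHom.toLinearMap_apply, hc]
      by_cases hn : n' = n
      · rw [hn, dualTmul_self, hd, h1]
      · rw [dualTmul_ne _ hn, h2 n' hn, map_zero]
    exact LinearMap.congr_fun key u
  · intro h
    refine ⟨?_, fun n' hn => ?_⟩
    · rw [← hc, h, dualTmul_self, hd]
    · rw [← hc, h, dualTmul_ne _ hn, map_zero]

end PartOne

end Wakimoto

end

/-! ### Generating functions of partitions, and weight spaces -/

noncomputable section

namespace Wakimoto

section PartitionSeries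

open MvPowerSeries

variable {σ Q : Type*} (N : Q → σ →₀ ℕ)

/-- The families of multiplicities, supported in `S`, whose weighted sum is `d`. -/
def partitionsOn (S : Set Q) (d : σ →₀ ℕ) : Set (Q →₀ ℕ) :=
  {f | Finsupp.linearCombination ℕ N f = d ∧ ↑f.support ⊆ S}

/-- The generating function `∏_{q ∈ S} (1 - X^{N q})⁻¹` of the partitions with parts in `S`, defined
by its coefficients. -/
def partitionSeries (S : Set Q) : MvPowerSeries σ ℤ := fun d => ((partitionsOn N S d).ncard : ℤ)

theorem coeff_partitionSeries (S : Set Q) (d : σ →₀ ℕ) :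
    MvPowerSeries.coeff d (partitionSeries N S) = ((partitionsOn N S d).ncard : ℤ) := rfl

variable {N}

theorem finite_partitionsOn (hN : ∀ q, N q ≠ 0) (hfin : ∀ n, {q | (N q).degree = n}.Finite)
    (S : Set Q) (d : σ →₀ ℕ) : (partitionsOn N S d).Finite := by
  refine (finite_sum_mul_eq (fun q => (N q).degree) (fun q => Nat.pos_of_ne_zero fun h =>
    hN q ((Finsupp.degree_eq_zero_iff _).1 h)) hfin d.degree).subset fun f hf => ?_
  rw [Set.mem_ofPred_eq, ← hf.1, Finsupp.linearCombination_apply, map_finsuppSum]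
  exact Finset.sum_congr rfl fun q _ => ((map_nsmul Finsupp.degree _ _).trans (smul_eq_mul _ _)).symm

theorem partitionSeries_empty : partitionSeries N ∅ = 1 := by
  classical
  ext d
  rw [coeff_partitionSeries, coeff_one]
  split_ifs with h
  · subst h
    have : partitionsOn N ∅ 0 = {0} := by
      ext f
      simp only [partitionsOn, Set.subset_empty_iff, Finset.coe_eq_empty, Finsupp.support_eq_empty,
        Set.mem_singleton_iff, Set.mem_ofPred_eq]
      exact ⟨fun h => h.2, fun h => by rw [h]; simp⟩
    rw [this, Set.ncard_singleton, Nat.cast_one]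
  · have : partitionsOn N ∅ d = ∅ := by
      rw [Set.eq_empty_iff_forall_notMem]
      rintro f ⟨h1, h2⟩
      rw [Set.subset_empty_iff, Finset.coe_eq_empty, Finsupp.support_eq_empty] at h2
      rw [h2, map_zero] at h1
      exact h h1.symm
    rw [this, Set.ncard_empty, Nat.cast_zero]

theorem partitionSeries_insert (hN : ∀ q, N q ≠ 0) (hfin : ∀ n, {q | (N q).degree = n}.Finite)
    {S : Set Q} {q : Q} (hq : q ∉ S) :
    partitionSeries N (insert q S) * (1 - monomial (N q) 1) = partitionSeries N S := by
  classical
  ext d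
  rw [mul_sub, mul_one, map_sub, coeff_mul_monomial, mul_one]
  simp only [coeff_partitionSeries]
  set A : Set (Q →₀ ℕ) := {g | Finsupp.linearCombination ℕ N g + N q = d ∧ ↑g.support ⊆ insert q S}
    with hA
  have h1 : (if N q ≤ d then ((partitionsOn N (insert q S) (d - N q)).ncard : ℤ) else 0) =
      A.ncard := by
    split_ifs with h
    · congr 2
      ext g
      refine and_congr_left fun _ => ⟨fun h1 => ?_, fun h1 => ?_⟩
      · rw [h1, tsub_add_cancel_of_le h]
      · rw [← h1, add_tsub_cancel_right]
    · have : A = ∅ := by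
        rw [Set.eq_empty_iff_forall_notMem]
        rintro g ⟨h1, -⟩
        exact h (h1 ▸ le_add_self)
      rw [this, Set.ncard_empty, Nat.cast_zero]
  -- A partition with parts in `insert q S` either has no part `q`, or arises by adding one.
  have h2 : partitionsOn N (insert q S) d =
      partitionsOn N S d ∪ (fun g => g + Finsupp.single q 1) '' A := by
    ext f
    constructor
    · rintro ⟨h1, h2⟩
      by_cases h0 : f q = 0
      · refine Or.inl ⟨h1, fun p hp => (h2 hp).resolve_left ?_⟩
        rintro rfl
        exact Finsupp.mem_support_iff.1 hp h0
      · have h3 : f - Finsupp.single q 1 + Finsupp.single q 1 = f :=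
          tsub_add_cancel_of_le (Finsupp.single_le_iff.2 (Nat.one_le_iff_ne_zero.2 h0))
        refine Or.inr ⟨f - Finsupp.single q 1, ⟨?_, fun p hp => h2 ?_⟩, h3⟩
        · rw [← h1]
          nth_rewrite 2 [← h3]
          rw [map_add, Finsupp.linearCombination_single, one_smul]
        · refine Finsupp.mem_support_iff.2 fun h4 => Finsupp.mem_support_iff.1 hp ?_
          rw [Finsupp.tsub_apply, h4, zero_tsub]
    · rintro (⟨h1, h2⟩ | ⟨g, ⟨h1, h2⟩, rfl⟩)
      · exact ⟨h1, h2.trans (Set.subset_insert q S)⟩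
      · refine ⟨?_, fun p hp => ?_⟩
        · rw [map_add, Finsupp.linearCombination_single, one_smul, h1]
        · by_cases hpq : p = q
          · exact Or.inl hpq
          · refine h2 (Finsupp.mem_support_iff.2 fun h4 => Finsupp.mem_support_iff.1 hp ?_)
            rw [Finsupp.add_apply, h4, Finsupp.single_eq_of_ne hpq, add_zero]
  have h3 : Disjoint (partitionsOn N S d) ((fun g => g + Finsupp.single q 1) '' A) := by
    rw [Set.disjoint_left]
    rintro _ ⟨-, h1⟩ ⟨g, -, rfl⟩
    refine hq (h1 (Finsupp.mem_support_iff.2 ?_))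
    simp
  have h4 := finite_partitionsOn hN hfin (insert q S) d
  rw [h2, Set.finite_union] at h4
  rw [h1, h2, Set.ncard_union_eq h3 h4.1 h4.2, Set.ncard_image_of_injective _ (add_left_injective _)]
  push_cast
  ring

theorem partitionSeries_mul_prod (hN : ∀ q, N q ≠ 0) (hfin : ∀ n, {q | (N q).degree = n}.Finite)
    (S : Finset Q) : partitionSeries N (S : Set Q) * ∏ q ∈ S, (1 - monomial (N q) 1) = 1 := by
  classical
  induction S using Finset.induction_on with
  | empty => rw [Finset.coe_empty, partitionSeries_empty, Finset.prod_empty, mul_one]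
  | insert q S hq ih =>
    rw [Finset.prod_insert hq, ← mul_assoc, Finset.coe_insert,
      partitionSeries_insert hN hfin (by exact_mod_cast hq), ih]

open scoped MvPowerSeries.WithPiTopology in
/-- The generating function of partitions as a product over the values of the parts, a value of
multiplicity `m` contributing the `m`-th power of a geometric series. -/
theorem hasProd_partitionSeries (hN : ∀ q, N q ≠ 0) (hfin : ∀ n, {q | (N q).degree = n}.Finite)
    {Ρ : Type*} {a : Ρ → σ →₀ ℕ} (ha : Function.Injective a) (r : Q → Ρ) (hr : ∀ q, a (r q) = N q)
    (mult : Ρ → ℕ) (hmult : ∀ α, {q | N q = a α}.ncard = mult α)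
    (h0 : ∀ α, a α ≠ 0) :
    HasProd (fun α => invOfUnit (1 - monomial (a α) (1 : ℤ)) 1 ^ mult α)
      (partitionSeries N Set.univ) := by
  classical
  have hfib : ∀ α, {q | r q = α}.Finite := fun α => (hfin (a α).degree).subset fun q hq => by
    rw [Set.mem_ofPred_eq] at hq ⊢
    rw [← hr, hq]
  have hS : ∀ s : Finset Ρ, {q | r q ∈ s}.Finite := fun s => by
    refine (s.finite_toSet.biUnion fun α _ => hfib α).subset fun q hq => ?_
    simp only [Set.mem_iUnion, exists_prop]
    exact ⟨r q, hq, rfl⟩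
  have hinv : ∀ α, invOfUnit (1 - monomial (a α) (1 : ℤ)) 1 * (1 - monomial (a α) 1) = 1 := by
    intro α
    rw [mul_comm]
    refine mul_invOfUnit _ _ ?_
    rw [map_sub, map_one, ← coeff_zero_eq_constantCoeff_apply, coeff_monomial, if_neg (h0 α).symm, sub_zero,
      Units.val_one]
  have hprod : ∀ s : Finset Ρ, ∏ α ∈ s, invOfUnit (1 - monomial (a α) (1 : ℤ)) 1 ^ mult α =
      partitionSeries N {q | r q ∈ s} := by
    intro s
    have h1 := partitionSeries_mul_prod hN hfin (hS s).toFinset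
    have h2 : ∏ q ∈ (hS s).toFinset, (1 - monomial (N q) (1 : ℤ)) =
        ∏ α ∈ s, (1 - monomial (a α) 1) ^ mult α := by
      rw [← Finset.prod_fiberwise_of_maps_to (g := r) (t := s) fun q hq => by
        rw [Set.Finite.mem_toFinset] at hq; exact hq]
      refine Finset.prod_congr rfl fun α hα => ?_
      rw [Finset.prod_congr rfl (g := fun _ => 1 - monomial (a α) (1 : ℤ)), Finset.prod_const]
      · congr 1
        rw [← hmult α, ← Set.ncard_coe_finset]
        congr 1
        ext q
        rw [Finset.coe_filter, Set.mem_ofPred_eq, Set.mem_ofPred_eq, Set.Finite.mem_toFinset,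
          Set.mem_ofPred_eq, ← hr, ha.eq_iff]
        exact ⟨fun h => h.2, fun h => ⟨h ▸ hα, h⟩⟩
      · intro q hq
        rw [Finset.mem_filter] at hq
        rw [← hr, hq.2]
    rw [h2, Set.Finite.coe_toFinset] at h1
    have h3 : (∏ α ∈ s, invOfUnit (1 - monomial (a α) (1 : ℤ)) 1 ^ mult α) *
        ∏ α ∈ s, (1 - monomial (a α) 1) ^ mult α = 1 := by
      rw [← Finset.prod_mul_distrib]
      exact Finset.prod_eq_one fun α _ => by rw [← mul_pow, hinv, one_pow]
    exact left_inv_eq_right_inv h3 (by rw [mul_comm, h1])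
  rw [HasProd, WithPiTopology.tendsto_iff_coeff_tendsto]
  intro d
  -- The coefficient at `d` involves only the parts that are at most `d`.
  have hfd : (a ⁻¹' Set.Iic d).Finite := Set.Finite.preimage ha.injOn (Set.finite_Iic d)
  refine tendsto_const_nhds.congr' ?_
  rw [SummationFilter.unconditional_filter]
  filter_upwards [Filter.eventually_ge_atTop hfd.toFinset] with s hs
  rw [hprod, coeff_partitionSeries, coeff_partitionSeries]
  congr 2
  ext f
  refine and_congr_right fun hf => ⟨fun _ q hq => hs ?_, fun _ => Set.subset_univ _⟩
  rw [Set.Finite.mem_toFinset, Set.mem_preimage, hr, Set.mem_Iic, ← hf,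
    Finsupp.linearCombination_apply]
  have h1 : N q ≤ f q • N q := by
    have := Nat.pos_of_ne_zero (Finsupp.mem_support_iff.1 hq)
    exact le_self_nsmul zero_le this.ne'
  exact h1.trans (Finset.single_le_sum (f := fun q => f q • N q) (fun _ _ => zero_le) hq)

end PartitionSeries

section WeightBasis

/-- The eigenvectors, with given eigenvalues for a family of operators, in a basis of simultaneous
eigenvectors. -/
theorem iInf_ker_eq_span {V K I : Type*} [AddCommGroup V] [Module ℂ V] (B : Module.Basis K ℂ V)
    (ρ : I → Module.End ℂ V) (wt : K → I → ℂ) (hB : ∀ k i, ρ i (B k) = wt k i • B k) (μ : I → ℂ) :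
    ⨅ i, LinearMap.ker (ρ i - μ i • LinearMap.id) = Submodule.span ℂ (B '' {k | wt k = μ}) := by
  ext v
  simp only [Submodule.mem_iInf, LinearMap.mem_ker, LinearMap.sub_apply, LinearMap.smul_apply,
    LinearMap.id_apply, sub_eq_zero]
  constructor
  · intro h
    rw [B.mem_span_image]
    intro k hk
    funext i
    exact eigen_repr B (ρ i) (fun k => wt k i) (fun k => hB k i) (h i) (Finsupp.mem_support_iff.1 hk)
  · intro hv i
    induction hv using Submodule.span_induction with
    | zero => simp
    | add x y _ _ hx hy => rw [map_add, hx, hy, smul_add]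
    | smul c x _ hx => rw [map_smul, hx, smul_comm]
    | mem x hx =>
      obtain ⟨k, hk, rfl⟩ := hx
      rw [Set.mem_ofPred_eq] at hk
      rw [hB, hk]

theorem finrank_span_image {V K : Type*} [AddCommGroup V] [Module ℂ V] (B : Module.Basis K ℂ V)
    (S : Set K) : Module.finrank ℂ (Submodule.span ℂ (B '' S)) = S.ncard := by
  have h : LinearIndependent ℂ (fun k : S => B k) := B.linearIndependent.comp _ Subtype.val_injective
  have h2 := (Module.Basis.span h).reindex (Equiv.refl S)
  rw [← Set.image_eq_range] at h2
  rw [Module.finrank_eq_nat_card_basis h2, Nat.card_coe_set_eq]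

end WeightBasis

end Wakimoto

end

/-! ### The positive roots and the character formula -/

noncomputable section

namespace Wakimoto

open LieAlgebra LieAlgebra.IsKilling LieModule

section Lattice

attribute [local instance 100] LieRing.ofAssociativeRing

variable {𝔤 : Type*} [LieRing 𝔤] [LieAlgebra ℂ 𝔤] [FiniteDimensional ℂ 𝔤] [LieAlgebra.IsSimple ℂ 𝔤]
  {T : LieSubalgebra ℂ 𝔤} [T.IsCartanSubalgebra] {b : (rootSystem T).Base} {θ : T.root}

variable (T b θ) in
theorem latticePt_eq (m : Option b.support →₀ ℕ) :
    latticePt T b θ m = Finsupp.linearCombination ℕ (simpleRoot T b θ) m := rfl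

variable (b θ) in
/-- The simple roots have a dual system in the Cartan subalgebra of `𝔤̂`. -/
theorem exists_dual_simpleRoot (i : Option b.support) :
    ∃ h : T × ℂ × ℂ, ∀ m : Option b.support →₀ ℕ, latticePt T b θ m h = m i := by
  classical
  suffices h : ∃ h : T × ℂ × ℂ, ∀ j, simpleRoot T b θ j h = if j = i then 1 else 0 by
    obtain ⟨h, hh⟩ := h
    refine ⟨h, fun m => ?_⟩
    rw [latticePt, Finsupp.sum, LinearMap.sum_apply, Finset.sum_eq_single i]
    · rw [LinearMap.smul_apply, hh, if_pos rfl, nsmul_eq_mul, mul_one]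
    · intro j _ hj
      rw [LinearMap.smul_apply, hh, if_neg hj, smul_zero]
    · intro hi
      rw [Finsupp.notMem_support_iff.1 hi, zero_smul, LinearMap.zero_apply]
  rcases i with _ | i
  · refine ⟨(0, 0, 1), fun j => ?_⟩
    rcases j with _ | j
    · simp [simpleRoot]
    · simp [simpleRoot]
  · obtain ⟨t, ht⟩ := exists_apply_simple_eq T b fun j => if j = i then 1 else 0
    refine ⟨(t, 0, (θ : Weight ℂ T 𝔤) t), fun j => ?_⟩
    rcases j with _ | j
    · simp [simpleRoot]
    · simpa [simpleRoot] using ht j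

theorem latticePt_injective : Function.Injective (latticePt T b θ) := by
  intro m m' h
  ext i
  obtain ⟨t, ht⟩ := exists_dual_simpleRoot b θ i
  have := LinearMap.congr_fun h t
  rw [ht, ht] at this
  exact_mod_cast this

theorem latticePt_cartanDelta (m : Option b.support →₀ ℕ) :
    latticePt T b θ m (cartanDelta b θ) = m.degree := by
  have h : ∀ i, simpleRoot T b θ i (cartanDelta b θ) = 1 := by
    rintro (_ | i)
    · change (coxeter T b θ : ℂ) - (θ : Weight ℂ T 𝔤) (rhoCheck T b) = 1
      rw [apply_rhoCheck, wtHeight_root T b θ, coxeter]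
      push_cast; ring
    · change (i.1 : Weight ℂ T 𝔤) (rhoCheck T b) = 1
      rw [apply_rhoCheck, wtHeight_root T b i.1, RootPairing.Base.height_one_of_mem_support i.2,
        Int.cast_one]
  rw [latticePt, Finsupp.sum, LinearMap.sum_apply, Finsupp.degree_apply, Nat.cast_sum]
  exact Finset.sum_congr rfl fun i _ => by rw [LinearMap.smul_apply, h, nsmul_eq_mul, mul_one]

theorem affineWt_cartanDelta (r : AffineIndex T) : affineWt T r (cartanDelta b θ) =
    ((affineHgt T b r + coxeter T b θ * affineMo T r : ℤ) : ℂ) := by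
  rcases r with ⟨m, r⟩ | i
  · change r.1 (rhoCheck T b) + (m : ℂ) * (coxeter T b θ : ℂ) = _
    rw [apply_rhoCheck]
    simp only [affineHgt, affineMo]
    push_cast; ring
  · simp [affineWt, affineHgt, affineMo]

/-- The roots of degree one are the simple roots. -/
theorem IsHighest.exists_affineWt_eq_simpleRoot (hθ : IsHighest T b θ) {r : AffineIndex T}
    (hr : affineHgt T b r + coxeter T b θ * affineMo T r = 1) :
    ∃ i, affineWt T r = simpleRoot T b θ i := by
  rcases r with ⟨m, α, k⟩ | i
  swap
  · simp [affineHgt, affineMo] at hr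
  change wtHeight T b α + coxeter T b θ * m = 1 at hr
  have h1 := hθ.wtHeight_le α
  have h2 := hθ.neg_le_wtHeight α
  have h3 : m = 0 ∨ m = 1 := by
    unfold coxeter at hr
    have h4 := hθ.height_nonneg
    have h5 : m < 2 := by by_contra hc; nlinarith
    have h6 : -1 < m := by by_contra hc; nlinarith
    omega
  rcases h3 with rfl | rfl
  · have h4 : α ∈ T.root := (weight_cases T α).resolve_left fun h => by
      rw [wtHeight_zero T b h] at hr; omega
    have h5 : b.height ⟨α, h4⟩ = 1 := by
      rw [← wtHeight_root T b ⟨α, h4⟩]; simpa using hr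
    refine ⟨some ⟨⟨α, h4⟩, mem_support_of_height_one T b h5⟩, ?_⟩
    simp [affineWt, simpleRoot]
  · have h4 := hθ.eq_of_wtHeight_eq (α := -α) (by rw [wtHeight_neg]; unfold coxeter at hr; omega)
    refine ⟨none, ?_⟩
    have h5 : α = -(θ : Weight ℂ T 𝔤) := by rw [← h4, neg_neg]
    ext h <;> simp [affineWt, simpleRoot, h5]

/-- A root of degree `n + 1` is the sum of a simple root and a root of degree `n`, as `𝔤̂₊` is generated
in degree one. -/
theorem IsHighest.exists_affineWt_eq_add (hθ : IsHighest T b θ) {n : ℤ} (hn : 0 < n)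
    {r : AffineIndex T} (hr : affineHgt T b r + coxeter T b θ * affineMo T r = n + 1) :
    ∃ s t, affineHgt T b s + coxeter T b θ * affineMo T s = 1 ∧
      affineHgt T b t + coxeter T b θ * affineMo T t = n ∧
      affineWt T r = affineWt T s + affineWt T t := by
  by_contra! hc
  have h1 : affineBasis T θ r ∈ (affineSemiInfinite T b θ).gr (n + 1) := by
    rw [affine_gr_eq]
    exact (affineBigraded T b θ).v_mem hr
  have h2 := hθ.gen_pos (by omega) h1
  rw [add_sub_cancel_right] at h2
  have key : ∀ z ∈ Submodule.span ℂ {z | ∃ a ∈ (affineSemiInfinite T b θ).gr 1,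
      ∃ y ∈ (affineSemiInfinite T b θ).gr n, z = ⁅a, y⁆},
      (affineBasis T θ).coord r z = 0 := by
    intro z hz
    induction hz using Submodule.span_induction with
    | zero => exact map_zero _
    | add a c _ _ ha hc => rw [map_add, ha, hc, add_zero]
    | smul c a _ ha => rw [map_smul, ha, smul_zero]
    | mem z hz =>
      obtain ⟨a, ha, y, hy, rfl⟩ := hz
      rw [affine_gr_eq] at ha hy
      induction ha using Submodule.span_induction with
      | zero => rw [zero_lie, map_zero]
      | add a c _ _ ha hc => rw [add_lie, map_add, ha, hc, add_zero]
      | smul c a _ ha => rw [smul_lie, map_smul, ha, smul_zero]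
      | mem a ha =>
        obtain ⟨s, hs, rfl⟩ := ha
        induction hy using Submodule.span_induction with
        | zero => rw [lie_zero, map_zero]
        | add a c _ _ ha hc => rw [lie_add, map_add, ha, hc, add_zero]
        | smul c a _ ha => rw [lie_smul, map_smul, ha, smul_zero]
        | mem y hy =>
          obtain ⟨t, ht, rfl⟩ := hy
          by_contra hne
          refine hc s t hs ht (LinearMap.ext fun h => ?_)
          exact eigen_repr (affineBasis T θ) (LieAlgebra.ad ℂ _ (cartan T θ h)) _
            (fun r => cartan_lie_affineBasis T θ h r)
            (v := ⁅affineBasis T θ s, affineBasis T θ t⁆) (d := (affineWt T s + affineWt T t) h) (by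
              rw [LieAlgebra.ad_apply, leibniz_lie, cartan_lie_affineBasis, cartan_lie_affineBasis,
                smul_lie, lie_smul, LinearMap.add_apply, add_smul]) hne
  have h3 := key _ h2
  rw [Module.Basis.coord_apply, Module.Basis.repr_self, Finsupp.single_eq_same] at h3
  exact one_ne_zero h3

variable (T b θ) in
/-- The index set of the part of the basis of `𝔤̂` in `𝔤̂₊`. -/
abbrev PosIndex : Type _ := (affineBigraded T b θ).idx fun i j => 0 < i + coxeter T b θ * j

/-- The roots of `𝔤̂₊` are combinations of the simple roots with nonnegative coefficients. -/
theorem IsHighest.exists_affineWt_eq_latticePt (hθ : IsHighest T b θ) (q : PosIndex T b θ) :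
    ∃ m, latticePt T b θ m = affineWt T q.1 := by
  have key : ∀ (n : ℕ) (r : AffineIndex T),
      affineHgt T b r + coxeter T b θ * affineMo T r = (n : ℤ) + 1 →
      ∃ m, latticePt T b θ m = affineWt T r := by
    intro n
    induction n with
    | zero =>
      intro r hr
      obtain ⟨i, hi⟩ := hθ.exists_affineWt_eq_simpleRoot (by simpa using hr)
      exact ⟨Finsupp.single i 1, by rw [latticePt_eq, Finsupp.linearCombination_single, one_smul, hi]⟩
    | succ n ih =>
      intro r hr
      obtain ⟨s, t, hs, ht, hst⟩ := hθ.exists_affineWt_eq_add (n := n + 1) (by omega) (by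
        push_cast at hr; exact hr)
      obtain ⟨i, hi⟩ := hθ.exists_affineWt_eq_simpleRoot hs
      obtain ⟨m, hm⟩ := ih t ht
      refine ⟨Finsupp.single i 1 + m, ?_⟩
      rw [latticePt_eq, map_add, Finsupp.linearCombination_single, one_smul, ← latticePt_eq, hm, hst, hi]
  have hq : 0 < affineHgt T b q.1 + coxeter T b θ * affineMo T q.1 := q.2
  exact key (affineHgt T b q.1 + coxeter T b θ * affineMo T q.1 - 1).toNat q.1 (by omega)

/-- The coordinates, with respect to the simple roots, of the weight of a basis vector of `𝔤̂₊`. -/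
def rootCoord (hθ : IsHighest T b θ) (q : PosIndex T b θ) : Option b.support →₀ ℕ :=
  (hθ.exists_affineWt_eq_latticePt q).choose

theorem latticePt_rootCoord (hθ : IsHighest T b θ) (q : PosIndex T b θ) :
    latticePt T b θ (rootCoord hθ q) = affineWt T q.1 :=
  (hθ.exists_affineWt_eq_latticePt q).choose_spec

theorem degree_rootCoord (hθ : IsHighest T b θ) (q : PosIndex T b θ) :
    ((rootCoord hθ q).degree : ℤ) = affineHgt T b q.1 + coxeter T b θ * affineMo T q.1 := by
  have h1 := latticePt_cartanDelta (T := T) (b := b) (θ := θ) (rootCoord hθ q)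
  rw [latticePt_rootCoord, affineWt_cartanDelta] at h1
  exact_mod_cast h1.symm

theorem rootCoord_ne_zero (hθ : IsHighest T b θ) (q : PosIndex T b θ) : rootCoord hθ q ≠ 0 := by
  intro h
  have h1 := degree_rootCoord hθ q
  have hq : 0 < affineHgt T b q.1 + coxeter T b θ * affineMo T q.1 := q.2
  rw [h, map_zero] at h1
  omega

theorem finite_degree_rootCoord (hθ : IsHighest T b θ) (n : ℕ) :
    {q | (rootCoord hθ q).degree = n}.Finite := by
  refine Set.Finite.of_finite_image ((hθ.deg_fin n).subset ?_) Subtype.val_injective.injOn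
  rintro _ ⟨q, hq, rfl⟩
  rw [Set.mem_ofPred_eq] at hq ⊢
  rw [← degree_rootCoord hθ q, hq]

theorem affineRootSpace_eq_span (γ : Module.Dual ℂ (T × ℂ × ℂ)) :
    affineRootSpace T θ γ = Submodule.span ℂ (affineBasis T θ '' {r | affineWt T r = γ}) := by
  rw [affineRootSpace, wtSpace, iInf_ker_eq_span (affineBasis T θ)
    (fun h => LieAlgebra.ad ℂ (AffineLie T θ) (cartan T θ h)) (fun r h => affineWt T r h)
    (fun r h => cartan_lie_affineBasis T θ h r)]
  simp only [← DFunLike.ext'_iff]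

/-- The multiplicity of a positive root, in terms of the basis of `𝔤̂₊`. -/
theorem ncard_rootCoord_eq (hθ : IsHighest T b θ) {m : Option b.support →₀ ℕ} (hm : m ≠ 0) :
    {q | rootCoord hθ q = m}.ncard =
      Module.finrank ℂ (affineRootSpace T θ (latticePt T b θ m)) := by
  rw [affineRootSpace_eq_span, finrank_span_image,
    ← Set.ncard_image_of_injective _ (Subtype.val_injective (p := fun r =>
      r ∈ (affineBigraded T b θ).idx fun i j => 0 < i + coxeter T b θ * j))]
  congr 1
  ext r
  constructor
  · rintro ⟨q, hq, rfl⟩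
    rw [Set.mem_ofPred_eq] at hq ⊢
    rw [← latticePt_rootCoord hθ, hq]
  · intro hr
    rw [Set.mem_ofPred_eq] at hr
    have h1 := affineWt_cartanDelta (b := b) (θ := θ) r
    rw [hr, latticePt_cartanDelta] at h1
    have h2 : (m.degree : ℤ) = affineHgt T b r + coxeter T b θ * affineMo T r := by exact_mod_cast h1
    have h3 : m.degree ≠ 0 := fun h => hm ((Finsupp.degree_eq_zero_iff _).1 h)
    have h4 : 0 < affineHgt T b r + coxeter T b θ * affineMo T r := by omega
    refine ⟨⟨r, h4⟩, ?_, rfl⟩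
    refine latticePt_injective (θ := θ) ?_
    rw [latticePt_rootCoord, hr]

/-- The denominator of the character formula counts the families of multiplicities of basis vectors
of `𝔤̂₊`. -/
theorem isRootProduct_partitionSeries (hθ : IsHighest T b θ) :
    IsRootProduct T b θ (partitionSeries (rootCoord hθ) Set.univ) := by
  refine hasProd_partitionSeries (rootCoord_ne_zero hθ) (finite_degree_rootCoord hθ)
    (a := fun α : PosRoot T b θ => α.1) Subtype.val_injective
    (fun q => ⟨rootCoord hθ q, rootCoord_ne_zero hθ q, ?_⟩) (fun q => rfl) _
    (fun α => ncard_rootCoord_eq hθ α.2.1) fun α => α.2.1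
  rw [latticePt_rootCoord, affineRootSpace_eq_span]
  intro h
  rw [Submodule.span_eq_bot] at h
  exact (affineBasis T θ).ne_zero q.1 (h _ ⟨q.1, rfl, rfl⟩)

/-- A module with a basis of weight vectors indexed by the partitions has the expected character. -/
theorem characterEq_of_basis (hθ : IsHighest T b θ) (lam : Module.Dual ℂ (T × ℂ × ℂ)) {V K : Type*}
    [AddCommGroup V] [Module ℂ V] (act : AffineLie T θ → Module.End ℂ V) (B : Module.Basis K ℂ V)
    (e : K ≃ (PosIndex T b θ →₀ ℕ))
    (hB : ∀ k h, act (cartan T θ h) (B k) =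
      (lam h - (e k).sum fun q j => j * affineWt T q.1 h) • B k) :
    CharacterEq T b θ lam act (partitionSeries (rootCoord hθ) Set.univ) := by
  have hwt : ∀ (f : PosIndex T b θ →₀ ℕ) (h : T × ℂ × ℂ), (f.sum fun q j => j * affineWt T q.1 h) =
      latticePt T b θ (Finsupp.linearCombination ℕ (rootCoord hθ) f) h := by
    intro f h
    rw [latticePt_eq, Finsupp.linearCombination_apply ℕ f, map_finsuppSum, Finsupp.sum, Finsupp.sum,
      LinearMap.sum_apply]
    refine Finset.sum_congr rfl fun q _ => ?_
    rw [map_nsmul, LinearMap.smul_apply, ← latticePt_eq, latticePt_rootCoord, nsmul_eq_mul]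
  have hsp : ∀ μ, wtSpace T θ act μ = Submodule.span ℂ (B '' {k | lam -
      latticePt T b θ (Finsupp.linearCombination ℕ (rootCoord hθ) (e k)) = μ}) := by
    intro μ
    rw [wtSpace, iInf_ker_eq_span B (fun h => act (cartan T θ h)) _ hB]
    congr 2
    ext k
    rw [Set.mem_ofPred_eq, Set.mem_ofPred_eq, LinearMap.ext_iff, funext_iff]
    refine forall_congr' fun h => ?_
    rw [hwt, LinearMap.sub_apply]
  have hset : ∀ m, {k | lam - latticePt T b θ (Finsupp.linearCombination ℕ (rootCoord hθ) (e k)) =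
      lam - latticePt T b θ m} = e ⁻¹' partitionsOn (rootCoord hθ) Set.univ m := by
    intro m
    ext k
    rw [Set.mem_ofPred_eq, sub_right_inj, latticePt_injective.eq_iff]
    exact ⟨fun h => ⟨h, Set.subset_univ _⟩, fun h => h.1⟩
  have hempty : ∀ μ, (∀ m, μ ≠ lam - latticePt T b θ m) → {k | lam -
      latticePt T b θ (Finsupp.linearCombination ℕ (rootCoord hθ) (e k)) = μ} = ∅ := fun μ hμ =>
    Set.eq_empty_iff_forall_notMem.2 fun k hk => hμ _ (Eq.symm hk)
  refine ⟨fun μ => ?_, fun m => ?_, fun μ hμ => ?_⟩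
  · rw [hsp]
    by_cases hμ : ∃ m, μ = lam - latticePt T b θ m
    · obtain ⟨m, rfl⟩ := hμ
      rw [hset]
      exact FiniteDimensional.span_of_finite ℂ (((finite_partitionsOn (rootCoord_ne_zero hθ)
        (finite_degree_rootCoord hθ) _ _).preimage e.injective.injOn).image _)
    · push Not at hμ
      rw [hempty μ hμ, Set.image_empty]
      exact FiniteDimensional.span_of_finite ℂ Set.finite_empty
  · rw [formalCharacter, hsp, finrank_span_image, hset, coeff_partitionSeries,
      Set.ncard_preimage_of_injective_subset_range e.injective (by simp [e.surjective.range_eq])]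
  · rw [formalCharacter, hsp, hempty μ hμ, Set.image_empty, Submodule.span_empty, finrank_bot]

/-- The formal character is determined by the character formula. -/
theorem CharacterEq.formalCharacter_eq {lam : Module.Dual ℂ (T × ℂ × ℂ)} {V W : Type*}
    [AddCommGroup V] [Module ℂ V] [AddCommGroup W] [Module ℂ W]
    {act : AffineLie T θ → Module.End ℂ V} {act' : AffineLie T θ → Module.End ℂ W}
    {F : MvPowerSeries (Option b.support) ℤ} (h : CharacterEq T b θ lam act F)
    (h' : CharacterEq T b θ lam act' F) : formalCharacter T θ act = formalCharacter T θ act' := by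
  funext μ
  by_cases hμ : ∃ m, μ = lam - latticePt T b θ m
  · obtain ⟨m, rfl⟩ := hμ
    exact_mod_cast (h.coeff_eq m).trans (h'.coeff_eq m).symm
  · push Not at hμ
    rw [h.eq_zero μ hμ, h'.eq_zero μ hμ]

end Lattice

end Wakimoto

end

/-! ### Induction and coinduction of characters -/

noncomputable section

namespace Wakimoto

section Induced

attribute [local instance 100] LieRing.ofAssociativeRing

variable {L : Type*} [LieRing L] [LieAlgebra ℂ L] {N H : LieSubalgebra ℂ L}

theorem mulEquiv_induction (hb : Function.Bijective fun z : N × H => N.incl z.1 + H.incl z.2)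
    {p : U L → Prop} (u : U L) (hadd : ∀ a b, p a → p b → p (a + b))
    (h : ∀ n m, p (incU N n * incU H m)) : p u := by
  rw [← (mulEquiv N.incl H.incl hb).apply_symm_apply u]
  induction (mulEquiv N.incl H.incl hb).symm u using TensorProduct.induction_on with
  | zero => simpa using h 0 0
  | tmul n m => exact h n m
  | add x y hx hy => rw [map_add]; exact hadd _ _ hx hy

variable (σ : H →ₗ⁅ℂ⁆ Module.End ℂ ℂ) (χ : H →ₗ[ℂ] ℂ) (hχ : ∀ x y : H, χ ⁅x, y⁆ = 0)

variable (N) in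
/-- The map `n ↦ n ⊗ 1` from `U(N)` to a module induced from a character of a complement of `N`. -/
def uToInd : U N →ₗ[ℂ] Ind H σ :=
  (SemiInfinite.indRel H σ).mkQ ∘ₗ (TensorProduct.mk ℂ (U L) ℂ).flip 1 ∘ₗ (incU N).toLinearMap

theorem uToInd_apply (n : U N) :
    uToInd N σ n = (SemiInfinite.indRel H σ).mkQ (incU N n ⊗ₜ[ℂ] (1 : ℂ)) := rfl

theorem mkQ_mul_tmul (hσ : ∀ h z, σ h z = χ h * z) (u : U L) (h : H) (z : ℂ) :
    (SemiInfinite.indRel H σ).mkQ ((u * toU (h : L)) ⊗ₜ[ℂ] z) =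
      (SemiInfinite.indRel H σ).mkQ (u ⊗ₜ[ℂ] (χ h * z)) := by
  rw [← sub_eq_zero, ← map_sub, Submodule.mkQ_apply, Submodule.Quotient.mk_eq_zero, ← hσ]
  exact Submodule.subset_span ⟨u, h, z, rfl⟩

theorem mkQ_mul_incU_tmul (hσ : ∀ h z, σ h z = χ h * z) (u : U L) (m : U H) (z : ℂ) :
    (SemiInfinite.indRel H σ).mkQ ((u * incU H m) ⊗ₜ[ℂ] z) =
      (SemiInfinite.indRel H σ).mkQ (u ⊗ₜ[ℂ] (charU χ hχ m * z)) := by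
  induction m using U_induction generalizing u z with
  | h1 => simp
  | hadd a b ha hb => rw [map_add, mul_add, TensorProduct.add_tmul, map_add, ha, hb, map_add, add_mul,
      TensorProduct.tmul_add, map_add]
  | hsmul c a ha => rw [map_smul, mul_smul_comm, ← TensorProduct.smul_tmul', map_smul, ha, map_smul,
      smul_mul_assoc, TensorProduct.tmul_smul, map_smul]
  | hmul x a ha => rw [map_mul, incU_toU, ← mul_assoc, ha, mkQ_mul_tmul σ χ hσ, map_mul, charU_toU,
      mul_assoc]

/-- The projection of `U(L) = U(N) ⊗ U(H)` to `U(N)` given by the character of `U(H)`. -/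
def projU (hb : Function.Bijective fun z : N × H => N.incl z.1 + H.incl z.2) : U L →ₗ[ℂ] U N :=
  (TensorProduct.rid ℂ (U N)).toLinearMap ∘ₗ (charU χ hχ).toLinearMap.lTensor (U N) ∘ₗ
    (mulEquiv N.incl H.incl hb).symm.toLinearMap

theorem projU_mul (hb : Function.Bijective fun z : N × H => N.incl z.1 + H.incl z.2) (n : U N)
    (m : U H) : projU χ hχ hb (incU N n * incU H m) = charU χ hχ m • n := by
  rw [projU, LinearMap.comp_apply, LinearMap.comp_apply, LinearEquiv.coe_coe, LinearEquiv.coe_coe,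
    mulEquiv_symm_mul]
  rfl

theorem projU_mul_toU (hb : Function.Bijective fun z : N × H => N.incl z.1 + H.incl z.2) (u : U L)
    (h : H) : projU χ hχ hb (u * toU (h : L)) = χ h • projU χ hχ hb u := by
  induction u using mulEquiv_induction hb with
  | hadd a b ha hb => rw [add_mul, map_add, ha, hb, map_add, smul_add]
  | h n m => rw [mul_assoc, ← incU_toU, ← map_mul, projU_mul, projU_mul, map_mul, charU_toU, smul_smul,
      mul_comm]

/-- The inverse is induced by the projection `projU`. -/
theorem uToInd_bijective (hχ : ∀ x y : H, χ ⁅x, y⁆ = 0) (hσ : ∀ h z, σ h z = χ h * z) (hb : Function.Bijective fun z : N × H => N.incl z.1 + H.incl z.2) :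
    Function.Bijective (uToInd N σ) := by
  constructor
  · let r : U L ⊗[ℂ] ℂ →ₗ[ℂ] U N :=
      (TensorProduct.rid ℂ (U N)).toLinearMap ∘ₗ (projU χ hχ hb).rTensor ℂ
    have hr : ∀ u z, r (u ⊗ₜ z) = z • projU χ hχ hb u := fun u z => rfl
    have hle : SemiInfinite.indRel H σ ≤ LinearMap.ker r := by
      rw [SemiInfinite.indRel, Submodule.span_le]
      rintro _ ⟨u, h, z, rfl⟩
      change r _ = 0
      rw [map_sub, hr, hr, projU_mul_toU, hσ, smul_smul, mul_comm, sub_self]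
    have hleft : ∀ n, (SemiInfinite.indRel H σ).liftQ r hle (uToInd N σ n) = n := by
      intro n
      rw [uToInd_apply, Submodule.mkQ_apply, Submodule.liftQ_apply, hr, one_smul]
      have := projU_mul χ hχ hb n 1
      rwa [map_one, map_one, mul_one, one_smul] at this
    exact Function.LeftInverse.injective hleft
  · intro w
    obtain ⟨w, rfl⟩ := Submodule.mkQ_surjective _ w
    change w ∈ (LinearMap.range (uToInd N σ)).comap (SemiInfinite.indRel H σ).mkQ
    induction w using TensorProduct.induction_on with
    | zero => exact zero_mem _
    | add x y hx hy => exact add_mem hx hy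
    | tmul u z =>
      induction u using mulEquiv_induction hb with
      | hadd a b ha hb => rw [TensorProduct.add_tmul]; exact add_mem ha hb
      | h n m =>
        refine ⟨(charU χ hχ m * z) • n, ?_⟩
        rw [mkQ_mul_incU_tmul σ χ hχ hσ, map_smul, uToInd_apply, ← map_smul, ← TensorProduct.tmul_smul,
          smul_eq_mul, mul_one]

/-- The weights of the vectors `n ⊗ 1` of the induced module. -/
theorem actInd_uToInd (hσ : ∀ h z, σ h z = χ h * z) {h : H} {n : U N} {c : ℂ} (hn : incU N n ∈ eigU (h : L) c) :
    actInd H σ (h : L) (uToInd N σ n) = (χ h + c) • uToInd N σ n := by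
  have h1 : actInd H σ (h : L) (uToInd N σ n) =
      (SemiInfinite.indRel H σ).mkQ ((toU (h : L) * incU N n) ⊗ₜ[ℂ] (1 : ℂ)) := rfl
  rw [h1, toU_mul_eq, mem_eigU.1 hn, TensorProduct.add_tmul, map_add, mkQ_mul_tmul σ χ hσ, mul_one,
    ← TensorProduct.smul_tmul', map_smul, ← uToInd_apply, add_smul]
  congr 1
  rw [uToInd_apply, ← map_smul, ← TensorProduct.tmul_smul, smul_eq_mul, mul_one]

end Induced

section Coinduced

attribute [local instance 100] LieRing.ofAssociativeRing

variable {L : Type*} [LieRing L] [LieAlgebra ℂ L] {G : SemiInfinite L} {P M : LieSubalgebra ℂ L}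
  {A B : Type*} (F : TriangularFrame G P M A B) (σ : M →ₗ⁅ℂ⁆ Module.End ℂ ℂ) (χ : M →ₗ[ℂ] ℂ)
  (hχ : ∀ x y : M, χ ⁅x, y⁆ = 0)

namespace TriangularFrame

theorem bijective_add_swap (F : TriangularFrame G P M A B) :
    Function.Bijective fun z : M × P => M.incl z.1 + P.incl z.2 := by
  have h := F.bijective_add.comp (Equiv.prodComm M P).bijective
  refine (iff_of_eq (congrArg Function.Bijective (funext fun z => ?_))).1 h
  exact add_comm _ _

/-- The basis of `U(L)` given by the products of basis vectors of `U(M)` and `U(P)`. -/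
def basisMP : Module.Basis (B × A) ℂ (U L) :=
  (F.b.tensorProduct F.a).map (mulEquiv M.incl P.incl F.bijective_add_swap)

theorem basisMP_apply (z : B × A) : F.basisMP z = incU M (F.b z.1) * incU P (F.a z.2) := by
  rw [basisMP, Module.Basis.map_apply, Module.Basis.tensorProduct_apply, mulEquiv_tmul]

theorem basisMP_eig (z : B × A) :
    adU F.delta (F.basisMP z) = (-(F.degB z.1 : ℂ) + F.degA z.2) • F.basisMP z := by
  rw [basisMP_apply, ← mem_eigU]
  exact mul_mem_eigU (F.b_mem z.1) (F.a_mem z.2)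

/-- The extension of a functional on `U(P)` to `U(L) = U(M) ⊗ U(P)` by the character of `U(M)`. -/
def extChar (φ : U P →ₗ[ℂ] ℂ) : U L →ₗ[ℂ] ℂ :=
  LinearMap.mul' ℂ ℂ ∘ₗ TensorProduct.map (charU χ hχ).toLinearMap φ ∘ₗ
    (mulEquiv M.incl P.incl F.bijective_add_swap).symm.toLinearMap

theorem extChar_mul (φ : U P →ₗ[ℂ] ℂ) (m : U M) (p : U P) :
    F.extChar χ hχ φ (incU M m * incU P p) = charU χ hχ m * φ p := by
  rw [extChar, LinearMap.comp_apply, LinearMap.comp_apply, LinearEquiv.coe_coe, mulEquiv_symm_mul]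
  rfl

theorem extChar_incU (φ : U P →ₗ[ℂ] ℂ) (p : U P) : F.extChar χ hχ φ (incU P p) = φ p := by
  have := F.extChar_mul χ hχ φ 1 p
  rwa [map_one, map_one, one_mul, one_mul] at this

theorem extChar_toU_mul (φ : U P →ₗ[ℂ] ℂ) (h : M) (u : U L) :
    F.extChar χ hχ φ (toU (h : L) * u) = χ h * F.extChar χ hχ φ u := by
  induction u using mulEquiv_induction F.bijective_add_swap with
  | hadd a b ha hb => rw [mul_add, map_add, ha, hb, map_add, mul_add]
  | h m p => rw [← mul_assoc, ← incU_toU, ← map_mul, extChar_mul, extChar_mul, map_mul, charU_toU,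
      mul_assoc]

theorem extChar_mem {φ : U P →ₗ[ℂ] ℂ} (hφ : φ ∈ finHom F.a ℂ) : F.extChar χ hχ φ ∈ G.homU ℂ := by
  obtain ⟨N, hN⟩ := F.finHom_bound hφ
  refine ⟨N, fun n hn u hu => ?_⟩
  rw [F.mem_grU] at hu
  rw [← F.basisMP.linearCombination_repr u, Finsupp.linearCombination_apply, map_finsuppSum]
  refine Finset.sum_eq_zero fun z hz => ?_
  change F.extChar χ hχ φ (_ • F.basisMP z) = 0
  have h1 := eigen_repr F.basisMP (adU F.delta) _ F.basisMP_eig hu (Finsupp.mem_support_iff.1 hz)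
  have h2 : -(F.degB z.1 : ℤ) + F.degA z.2 = n := by exact_mod_cast h1
  rw [map_smul, basisMP_apply, extChar_mul, hN z.2 (by omega), mul_zero, smul_zero]

theorem comp_incU_mem {f : U L →ₗ[ℂ] ℂ} (hf : f ∈ G.homU ℂ) :
    f ∘ₗ (incU P).toLinearMap ∈ finHom F.a ℂ := by
  obtain ⟨N, hN⟩ := hf
  exact F.mem_finHom_of_bound N fun i hi => hN _ hi _ (F.incP_a_mem i)

theorem coind_apply_incU_mul (hσ : ∀ h z, σ h z = χ h * z) (f : Coind M σ G) (m : U M) (u : U L) :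
    f.1.1 (incU M m * u) = charU χ hχ m * f.1.1 u := by
  induction m using U_induction generalizing u with
  | h1 => simp
  | hadd a b ha hb => rw [map_add, add_mul, map_add, ha, hb, map_add, add_mul]
  | hsmul c a ha => rw [map_smul, smul_mul_assoc, map_smul, ha, map_smul, smul_mul_assoc]
  | hmul x a ha => rw [map_mul (incU M), incU_toU, mul_assoc, f.2 x, hσ, ha, map_mul (charU χ hχ),
      charU_toU, mul_assoc]

/-- A coinduced module is identified with the functionals on `U(P)` by restriction. -/
def coindEquiv (hσ : ∀ h z, σ h z = χ h * z) : finHom F.a ℂ ≃ₗ[ℂ] Coind M σ G where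
  toFun φ := ⟨⟨F.extChar χ hχ φ.1, F.extChar_mem χ hχ φ.2⟩, fun h u => by
    rw [hσ]; exact F.extChar_toU_mul χ hχ φ.1 h u⟩
  map_add' φ ψ := by
    refine Subtype.ext (Subtype.ext (F.basisMP.ext fun z => ?_))
    change F.extChar χ hχ (φ.1 + ψ.1) _ = F.extChar χ hχ φ.1 _ + F.extChar χ hχ ψ.1 _
    rw [basisMP_apply, extChar_mul, extChar_mul, extChar_mul, LinearMap.add_apply, mul_add]
  map_smul' c φ := by
    refine Subtype.ext (Subtype.ext (F.basisMP.ext fun z => ?_))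
    change F.extChar χ hχ (c • φ.1) _ = c • F.extChar χ hχ φ.1 _
    rw [basisMP_apply, extChar_mul, extChar_mul, LinearMap.smul_apply, mul_smul_comm]
  invFun f := ⟨f.1.1 ∘ₗ (incU P).toLinearMap, F.comp_incU_mem f.1.2⟩
  left_inv φ := Subtype.ext (LinearMap.ext fun p => F.extChar_incU χ hχ φ.1 p)
  right_inv f := by
    refine Subtype.ext (Subtype.ext (F.basisMP.ext fun z => ?_))
    change F.extChar χ hχ _ _ = _
    rw [basisMP_apply, extChar_mul, coind_apply_incU_mul σ χ hχ hσ]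
    rfl

/-- The weights of the vectors of the coinduced module that are dual to the basis of `U(P)`. -/
theorem actCoind_coindEquiv (hσ : ∀ h z, σ h z = χ h * z) {h : M} (γ : A → ℂ) (hγ : ∀ i, incU P (F.a i) ∈ eigU (h : L) (γ i)) {i : A}
    {φ : finHom F.a ℂ} (hφ : φ.1 = dualTmul F.a i 1) :
    actCoind M σ G (h : L) (F.coindEquiv σ χ hχ hσ φ) =
      (χ h - γ i) • F.coindEquiv σ χ hχ hσ φ := by
  refine (F.coindEquiv σ χ hχ hσ).symm.injective (Subtype.ext (F.a.ext fun j => ?_))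
  rw [map_smul, LinearEquiv.symm_apply_apply]
  change F.extChar χ hχ φ.1 (incU P (F.a j) * toU (h : L)) = (χ h - γ i) * φ.1 (F.a j)
  have h1 : incU P (F.a j) * toU (h : L) = toU (h : L) * incU P (F.a j) - γ j • incU P (F.a j) := by
    rw [← mem_eigU.1 (hγ j), adU_apply, sub_sub_cancel]
  rw [h1, map_sub, extChar_toU_mul, map_smul, extChar_incU, smul_eq_mul, ← sub_mul, hφ]
  by_cases hj : j = i
  · rw [hj]
  · rw [dualTmul_ne _ hj, mul_zero, mul_zero]

end TriangularFrame

end Coinduced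

end Wakimoto

end

/-! ### The characters of the three modules -/

noncomputable section

namespace Wakimoto

open LieAlgebra LieAlgebra.IsKilling LieModule

section Characters

attribute [local instance 100] LieRing.ofAssociativeRing

variable {𝔤 : Type*} [LieRing 𝔤] [LieAlgebra ℂ 𝔤] [FiniteDimensional ℂ 𝔤] [LieAlgebra.IsSimple ℂ 𝔤]
  {T : LieSubalgebra ℂ 𝔤} [T.IsCartanSubalgebra] {b : (rootSystem T).Base} {θ : T.root}

theorem finrank_rootSpace_neg (α : Weight ℂ T 𝔤) :
    Module.finrank ℂ (rootSpace T α) = Module.finrank ℂ (rootSpace T (-α : Weight ℂ T 𝔤)) := by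
  by_cases h : α.IsZero
  · have h1 : -α = α := by
      apply DFunLike.coe_injective
      rw [Weight.coe_neg, show (α : T → ℂ) = 0 from h, neg_zero]
    rw [h1]
  · rw [finrank_rootSpace_eq_one α h, finrank_rootSpace_eq_one (-α) (by simpa using h)]

variable (T b) in
/-- The basis of `𝔤̂` can be matched with itself so that weights change sign. -/
theorem exists_neg_index : ∃ e : AffineIndex T ≃ AffineIndex T, ∀ r, affineWt T (e r) = -affineWt T r ∧
    affineHgt T b (e r) = -affineHgt T b r ∧ affineMo T (e r) = -affineMo T r := by
  refine ⟨Equiv.sumCongr (Equiv.prodCongr (Equiv.neg ℤ) (Equiv.sigmaCongr (Equiv.neg (Weight ℂ T 𝔤))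
    fun α => finCongr (finrank_rootSpace_neg α))) (Equiv.refl _), ?_⟩
  rintro (⟨m, α, i⟩ | i)
  · refine ⟨?_, wtHeight_neg α, rfl⟩
    refine LinearMap.ext fun h => ?_
    change (-α : Weight ℂ T 𝔤) h.1 + ((-m : ℤ) : ℂ) * h.2.2 = -(α h.1 + m * h.2.2)
    rw [Weight.coe_neg, Pi.neg_apply]
    push_cast
    ring
  · refine ⟨?_, ?_, ?_⟩ <;> simp [affineWt, affineHgt, affineMo]

theorem IsHighest.cartan_mem_Sp (hθ : IsHighest T b θ) (h : T × ℂ × ℂ) :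
    cartan T θ h ∈ (affineBigraded T b θ).Sp fun i j => i = 0 ∧ j = 0 := by
  have h1 := cartan_mem_gr (b := b) (θ := θ) h
  rw [affine_gr_eq, BigradedBasis.mem_Sp] at h1
  rw [BigradedBasis.mem_Sp]
  intro r hr
  have h2 : affineHgt T b r + coxeter T b θ * affineMo T r = 0 := h1 r hr
  have h3 := hθ.hgt_eq_zero r h2
  rw [h3, zero_add] at h2
  exact ⟨h3, (mul_eq_zero.1 h2).resolve_left hθ.coxeter_pos.ne'⟩

theorem IsHighest.cartan_mem (hθ : IsHighest T b θ) {S : LieSubalgebra ℂ (AffineLie T θ)}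
    {p : ℤ → ℤ → Prop} (hS : S.toSubmodule = (affineBigraded T b θ).Sp p) (hp : p 0 0)
    (h : T × ℂ × ℂ) : cartan T θ h ∈ S := by
  rw [← LieSubalgebra.mem_toSubmodule, hS]
  exact (affineBigraded T b θ).Sp_mono (by rintro i j ⟨rfl, rfl⟩; exact hp) (hθ.cartan_mem_Sp h)

/-- The weight of a monomial in basis vectors. -/
theorem pbwBasis_mem_eigU {S : LieSubalgebra ℂ (AffineLie T θ)}
    {p : ℤ → ℤ → Prop} [LinearOrder ((affineBigraded T b θ).idx p)]
    (hS : S.toSubmodule = (affineBigraded T b θ).Sp p) (h : T × ℂ × ℂ)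
    (n : (affineBigraded T b θ).idx p →₀ ℕ) :
    incU S (pbwBasis ((affineBigraded T b θ).subBasis hS) n) ∈
      eigU (cartan T θ h) (n.sum fun r k => k * affineWt T r.1 h) := by
  have hc : ∀ r : (affineBigraded T b θ).idx p, ⁅cartan T θ h,
      (((affineBigraded T b θ).subBasis hS r : S) : AffineLie T θ)⁆ =
        affineWt T r.1 h • (((affineBigraded T b θ).subBasis hS r : S) : AffineLie T θ) := fun r => by
    rw [BigradedBasis.subBasis_apply]
    exact cartan_lie_affineBasis T θ h r.1
  exact BigradedFrame.pbw_mem ((affineBigraded T b θ).subBasis hS) (cartan T θ h)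
    (fun r => affineWt T r.1 h) hc n

theorem sum_domCongr_mul {I J : Type*} (e : I ≃ J) (n : I →₀ ℕ) (g : J → ℂ) :
    ((Finsupp.domCongr e n).sum fun j k => k * g j) = n.sum fun i k => k * g (e i) := by
  rw [Finsupp.domCongr_apply, Finsupp.equivMapDomain_eq_mapDomain]
  exact Finsupp.sum_mapDomain_index (fun _ => by simp) fun _ _ _ => by push_cast; ring

theorem neg_sum_domCongr_sumElim {I J K : Type*} (e : I ⊕ J ≃ K) (g : K → ℂ) (n : I →₀ ℕ) (l : J →₀ ℕ)
    {u : I → ℂ} {v : J → ℂ} (hu : ∀ i, g (e (Sum.inl i)) = u i) (hv : ∀ j, g (e (Sum.inr j)) = -v j) :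
    -((Finsupp.domCongr e (Finsupp.sumElim n l)).sum fun q k => k * g q) =
      (l.sum fun j k => k * v j) - n.sum fun i k => k * u i := by
  rw [sum_domCongr_mul, Finsupp.sum_sumElim]
  simp only [Function.comp_def, hu, hv, mul_neg, Finsupp.sum, Finset.sum_neg_distrib]
  ring

/-- The basis vectors of `𝔞₊`, and the negatives of the weights of the basis vectors of `𝔞₋`, exhaust
the positive roots. -/
theorem exists_index_equiv (hθ : IsHighest T b θ) :
    ∃ e : ((affineBigraded T b θ).idx fun i j => (i < 0 ∨ i = 0 ∧ 0 < j) ∧ 0 < i + coxeter T b θ * j) ⊕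
        ((affineBigraded T b θ).idx fun i j => (i < 0 ∨ i = 0 ∧ 0 < j) ∧ i + coxeter T b θ * j ≤ 0) ≃
        PosIndex T b θ,
      (∀ r, affineWt T (e (Sum.inl r)).1 = affineWt T r.1) ∧
      ∀ r, affineWt T (e (Sum.inr r)).1 = -affineWt T r.1 := by
  obtain ⟨ν, hν⟩ := exists_neg_index T b
  have hI := hθ.coxeter_pos
  have hmul : ∀ j, 0 < coxeter T b θ * j ↔ 0 < j := fun j => mul_pos_iff_of_pos_left hI
  have hneg : ∀ r : AffineIndex T, ((affineHgt T b r < 0 ∨ affineHgt T b r = 0 ∧ 0 < affineMo T r) ∧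
      affineHgt T b r + coxeter T b θ * affineMo T r ≤ 0) ↔
      0 < affineHgt T b (ν r) + coxeter T b θ * affineMo T (ν r) ∧
      ¬((affineHgt T b (ν r) < 0 ∨ affineHgt T b (ν r) = 0 ∧ 0 < affineMo T (ν r)) ∧
        0 < affineHgt T b (ν r) + coxeter T b θ * affineMo T (ν r)) := by
    intro r
    have h1 := hθ.hgt_eq_zero r
    have h2 := hmul (affineMo T r)
    have h3 := hmul (-affineMo T r)
    rw [(hν r).2.1, (hν r).2.2]
    rw [mul_neg] at h3 ⊢
    omega
  let f : ((affineBigraded T b θ).idx fun i j => (i < 0 ∨ i = 0 ∧ 0 < j) ∧ 0 < i + coxeter T b θ * j) ⊕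
        ((affineBigraded T b θ).idx fun i j => (i < 0 ∨ i = 0 ∧ 0 < j) ∧ i + coxeter T b θ * j ≤ 0) →
        PosIndex T b θ :=
    Sum.elim (fun r => ⟨r.1, r.2.2⟩) fun r => ⟨ν r.1, ((hneg r.1).1 r.2).1⟩
  refine ⟨Equiv.ofBijective f ⟨?_, ?_⟩, fun r => rfl, fun r => (hν r.1).1⟩
  · rintro (r | r) (s | s) h
    · have h1 : r.1 = s.1 := congrArg (fun q : PosIndex T b θ => q.1) h
      exact congrArg Sum.inl (Subtype.ext h1)
    · have h1 : r.1 = ν s.1 := congrArg Subtype.val h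
      exact (((hneg s.1).1 s.2).2 (h1 ▸ r.2)).elim
    · have h1 : ν r.1 = s.1 := congrArg Subtype.val h
      exact (((hneg r.1).1 r.2).2 (h1 ▸ s.2)).elim
    · have h1 : ν r.1 = ν s.1 := congrArg Subtype.val h
      exact congrArg Sum.inr (Subtype.ext (ν.injective h1))
  · rintro ⟨r, hr⟩
    by_cases hc : (affineHgt T b r < 0 ∨ affineHgt T b r = 0 ∧ 0 < affineMo T r) ∧
        0 < affineHgt T b r + coxeter T b θ * affineMo T r
    · exact ⟨Sum.inl ⟨r, hc⟩, rfl⟩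
    · refine ⟨Sum.inr ⟨ν.symm r, (hneg _).2 ?_⟩, Subtype.ext (ν.apply_symm_apply r)⟩
      rw [ν.apply_symm_apply]
      exact ⟨hr, hc⟩

theorem aBarChar_cartan (lam : Module.Dual ℂ (T × ℂ × ℂ)) (h : T × ℂ × ℂ)
    (hh : cartan T θ h ∈ aBar T b θ) : aBarChar b lam ⟨cartan T θ h, hh⟩ = lam h :=
  congrArg lam (projCartan_cartan T θ h)

/-- The vector `(∏ x_i^{n_i})^* ⊗ ∏ y_j^{l_j} ⊗ w_λ` has weight `λ` minus the weights of the `x_i`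
plus the weights of the `y_j`, with multiplicities. -/
theorem characterEq_wakimoto (hθ : IsHighest T b θ) (lam : Module.Dual ℂ (T × ℂ × ℂ)) :
    CharacterEq T b θ lam (actWakimoto T b θ lam) (partitionSeries (rootCoord hθ) Set.univ) := by
  classical
  let Y := affineFrame hθ lam
  let _ : ∀ p, LinearOrder ((affineBigraded T b θ).idx p) := fun p => linearOrderOfSTO WellOrderingRel
  let x := (affineBigraded T b θ).subBasis (Y.ap_eq)
  let y := (affineBigraded T b θ).subBasis (Y.am_eq)
  have hdx : ∀ i : (affineBigraded T b θ).idx fun i j => (i < 0 ∨ i = 0 ∧ 0 < j) ∧ 0 < i + Y.I * j,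
      ((Y.deg i.1).toNat : ℤ) = Y.deg i.1 ∧ 0 < (Y.deg i.1).toNat := fun i => by
    have h : 0 < Y.deg i.1 := i.2.2
    omega
  have hdy : ∀ i : (affineBigraded T b θ).idx fun i j => (i < 0 ∨ i = 0 ∧ 0 < j) ∧ i + Y.I * j ≤ 0,
      ((-Y.deg i.1).toNat : ℤ) = -Y.deg i.1 := fun i => by
    have h : Y.deg i.1 ≤ 0 := i.2.2
    omega
  let W := Y.toSemiInductionFrame x y (fun i => (Y.deg i.1).toNat) (fun i => (-Y.deg i.1).toNat)
    (fun i => by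
      rw [BigradedBasis.subBasis_apply, Y.lie_delta_v, ← Int.cast_natCast, (hdx i).1])
    (fun i => by
      rw [BigradedBasis.subBasis_apply, Y.lie_delta_v, ← Int.cast_natCast, hdy i, Int.cast_neg, neg_neg])
    (fun i => (hdx i).2)
    (fun n => by
      refine Set.Finite.of_finite_image ((hθ.deg_fin n).subset ?_) Subtype.val_injective.injOn
      rintro _ ⟨r, hr, rfl⟩
      rw [Set.mem_ofPred_eq] at hr ⊢
      rw [← hr, (hdx r).1]
      rfl)
  obtain ⟨e, he1, he2⟩ := exists_index_equiv hθ
  refine characterEq_of_basis hθ lam _ ((finHomBasis W.c W.d).map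
    (W.resEquiv (aBarRep T b θ lam) (aBarRep_apply lam)).symm)
    (Finsupp.sumFinsuppEquivProdFinsupp.symm.trans (Finsupp.domCongr e).toEquiv) ?_
  rintro ⟨n, l⟩ h
  have hmem : cartan T θ h ∈ Y.Hm := hθ.cartan_mem Y.Hm_eq (by omega) h
  have h1 := W.act_eq_smul (aBarRep T b θ lam) (aBarRep_apply lam) ⟨cartan T θ h, hmem⟩
    (fun n => n.sum fun r k => k * affineWt T r.1 h) (fun n => pbwBasis_mem_eigU Y.ap_eq h n) n l
    (pbwBasis_mem_eigU Y.am_eq h l) (((finHomBasis W.c W.d).map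
      (W.resEquiv (aBarRep T b θ lam) (aBarRep_apply lam)).symm) (n, l)) (by
        rw [Module.Basis.map_apply, LinearEquiv.apply_symm_apply, finHomBasis_apply])
  refine h1.trans ?_
  congr 1
  rw [aBarChar_cartan, add_sub_assoc, sub_eq_add_neg (lam h)]
  congr 1
  exact (neg_sum_domCongr_sumElim e (fun q => affineWt T q.1 h) n l (fun r => by rw [he1])
    fun r => by rw [he2, LinearMap.neg_apply]).symm

variable (b) in
/-- The character `λ` of `𝔤̂₊ ⊕ 𝔤̂₀`. -/
def borelChar (lam : Module.Dual ℂ (T × ℂ × ℂ)) : affineBorel T b θ →ₗ[ℂ] ℂ :=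
  lam ∘ₗ projCartan T θ ∘ₗ (affineBorel T b θ).toSubmodule.subtype

variable (b) in
/-- The character `λ` of `𝔤̂₋`. -/
def minusChar (lam : Module.Dual ℂ (T × ℂ × ℂ)) : affineMinus T b θ →ₗ[ℂ] ℂ :=
  lam ∘ₗ projCartan T θ ∘ₗ (affineMinus T b θ).toSubmodule.subtype

theorem borelChar_lie (hθ : IsHighest T b θ) (lam : Module.Dual ℂ (T × ℂ × ℂ))
    (x y : affineBorel T b θ) : borelChar b lam ⁅x, y⁆ = 0 :=
  charRep_lie (P := fun α m => 0 ≤ wtHeight T b α + coxeter T b θ * m) _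
    (fun α β m n h1 h2 h hmn => by
      have h3 := wtHeight_add_eq_zero T b h
      refine hθ.isolated h ?_
      have h4 : coxeter T b θ * m + coxeter T b θ * n = 0 := by rw [← mul_add, hmn, mul_zero]
      omega) lam x y

theorem minusChar_lie (hθ : IsHighest T b θ) (lam : Module.Dual ℂ (T × ℂ × ℂ))
    (x y : affineMinus T b θ) : minusChar b lam ⁅x, y⁆ = 0 :=
  charRep_lie (P := fun α m => wtHeight T b α + coxeter T b θ * m ≤ 0) _
    (fun α β m n h1 h2 h hmn => by
      have h3 := wtHeight_add_eq_zero T b h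
      refine hθ.isolated h ?_
      have h4 : coxeter T b θ * m + coxeter T b θ * n = 0 := by rw [← mul_add, hmn, mul_zero]
      omega) lam x y

/-- The Verma module has the basis of ordered monomials in a basis of the part of negative degree.
-/
theorem characterEq_verma (hθ : IsHighest T b θ) (lam : Module.Dual ℂ (T × ℂ × ℂ)) :
    CharacterEq T b θ lam (actVerma lam hθ) (partitionSeries (rootCoord hθ) Set.univ) := by
  classical
  let _ : ∀ p, LinearOrder ((affineBigraded T b θ).idx p) := fun p => linearOrderOfSTO WellOrderingRel
  let Z := affineBigraded T b θ
  let N : LieSubalgebra ℂ (AffineLie T θ) := Z.SpLie (fun i j => i + coxeter T b θ * j < 0)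
    fun i j k l h1 h2 => by rw [mul_add]; omega
  have hN : N.toSubmodule = Z.Sp fun i j => i + coxeter T b θ * j < 0 := rfl
  have htop : (⊤ : LieSubalgebra ℂ (AffineLie T θ)).toSubmodule = Z.Sp fun _ _ => True := by
    refine (eq_top_iff.2 fun x _ => Z.mem_Sp.2 fun _ _ => trivial).symm
  have hbij : Function.Bijective fun z : N × affineBorel T b θ =>
      N.incl z.1 + (affineBorel T b θ).incl z.2 := by
    have h1 := Z.bijective_inclusion hN (affineBorel_eq T b θ) htop le_top le_top
      (fun i j _ => lt_or_ge _ _) (fun i j h h' => by omega)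
    exact (LieSubalgebra.topEquiv (R := ℂ) (L := AffineLie T θ)).bijective.comp h1
  have hσ : ∀ h z, borelRep lam hθ h z = borelChar b lam h * z := fun h z => rfl
  let Φ := LinearEquiv.ofBijective (uToInd N (borelRep lam hθ))
    (uToInd_bijective (borelRep lam hθ) (borelChar b lam) (borelChar_lie hθ lam) hσ hbij)
  obtain ⟨ν, hν⟩ := exists_neg_index T b
  let e : Z.idx (fun i j => i + coxeter T b θ * j < 0) ≃ PosIndex T b θ :=
    ν.subtypeEquiv fun r => by
      change affineHgt T b r + coxeter T b θ * affineMo T r < 0 ↔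
        0 < affineHgt T b (ν r) + coxeter T b θ * affineMo T (ν r)
      rw [(hν r).2.1, (hν r).2.2, mul_neg]
      omega
  refine characterEq_of_basis hθ lam _ ((pbwBasis (Z.subBasis hN)).map Φ) (Finsupp.domCongr e).toEquiv ?_
  intro n h
  have hmem : cartan T θ h ∈ affineBorel T b θ := hθ.cartan_mem (affineBorel_eq T b θ) (by omega) h
  have h1 := actInd_uToInd (borelRep lam hθ) (borelChar b lam) hσ (h := ⟨cartan T θ h, hmem⟩)
    (pbwBasis_mem_eigU hN h n)
  refine h1.trans ?_
  congr 1
  have h2 : borelChar b lam ⟨cartan T θ h, hmem⟩ = lam h := congrArg lam (projCartan_cartan T θ h)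
  have h3 : (Finsupp.domCongr e).toEquiv n = Finsupp.domCongr e n := rfl
  have he : ∀ r, affineWt T (e r).1 h = -affineWt T r.1 h := fun r => by
    rw [← LinearMap.neg_apply, ← (hν r.1).1]; rfl
  rw [h2, h3, sum_domCongr_mul e _ fun q => affineWt T q.1 h, sub_eq_add_neg]
  simp only [he, mul_neg, Finsupp.sum, Finset.sum_neg_distrib, neg_neg]
  rfl

/-- The contragredient Verma module has the basis dual to the ordered monomials of `U(𝔤̂₊)`. -/
theorem characterEq_contragredientVerma (hθ : IsHighest T b θ) (lam : Module.Dual ℂ (T × ℂ × ℂ)) :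
    CharacterEq T b θ lam (actContragredientVerma lam hθ)
      (partitionSeries (rootCoord hθ) Set.univ) := by
  classical
  let Y := affineFrame hθ lam
  let _ : ∀ p, LinearOrder ((affineBigraded T b θ).idx p) := fun p => linearOrderOfSTO WellOrderingRel
  let F := Y.toFrame
  have hσ : ∀ h z, minusRep lam hθ h z = minusChar b lam h * z := fun h z => rfl
  let Φ := F.coindEquiv (minusRep lam hθ) (minusChar b lam) (minusChar_lie hθ lam) hσ
  refine characterEq_of_basis hθ lam (V := Coind (affineMinus T b θ) (minusRep lam hθ)
    (affineSemiInfinite T b θ)) _ ((finHomBasis F.a (Module.Basis.singleton Unit ℂ)).map Φ)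
    (Equiv.prodPUnit _) ?_
  rintro ⟨n, u⟩ h
  have hmem : cartan T θ h ∈ affineMinus T b θ := hθ.cartan_mem (affineMinus_eq T b θ) (by omega) h
  have h1 := F.actCoind_coindEquiv (minusRep lam hθ) (minusChar b lam) (minusChar_lie hθ lam) hσ
    (h := ⟨cartan T θ h, hmem⟩) (fun n => n.sum fun r k => k * affineWt T r.1 h)
    (fun n => pbwBasis_mem_eigU Y.P_eq h n) (i := n)
    (φ := finHomBasis F.a (Module.Basis.singleton Unit ℂ) (n, u)) (by
      rw [finHomBasis_apply, Module.Basis.singleton_apply])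
  refine h1.trans ?_
  congr 1
  have h2 : minusChar b lam ⟨cartan T θ h, hmem⟩ = lam h := congrArg lam (projCartan_cartan T θ h)
  rw [h2]
  rfl

end Characters

end Wakimoto

end

theorem proposition2p2 {𝔤 : Type*} [LieRing 𝔤] [LieAlgebra ℂ 𝔤] [FiniteDimensional ℂ 𝔤]
    [LieAlgebra.IsSimple ℂ 𝔤] (T : LieSubalgebra ℂ 𝔤) [T.IsCartanSubalgebra]
    (b : (LieAlgebra.IsKilling.rootSystem T).Base)
    (θ : T.root) (hθ : Wakimoto.IsHighest T b θ) (lam : Module.Dual ℂ (T × ℂ × ℂ)) :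
    (∀ {ι κ : Type*} [LinearOrder ι] [LinearOrder κ]
      (x : Module.Basis ι ℂ (Wakimoto.aPlus T b θ)) (y : Module.Basis κ ℂ (Wakimoto.aMinus T b θ)),
      (∀ i, ∃ γ, (x i : Wakimoto.AffineLie T θ) ∈ Wakimoto.affineRootSpace T θ γ) →
      (∀ j, ∃ γ, (y j : Wakimoto.AffineLie T θ) ∈ Wakimoto.affineRootSpace T θ γ) →
      ∃ B : Module.Basis ((ι →₀ ℕ) × (κ →₀ ℕ)) ℂ (Wakimoto.WakimotoModule T b θ lam),
        ∀ n l v, Wakimoto.IsBasisVector T b θ lam (fun i => (x i : Wakimoto.AffineLie T θ))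
          (fun j => (y j : Wakimoto.AffineLie T θ)) n l v ↔ v = B (n, l)) ∧
    (∃ F : MvPowerSeries (Option b.support) ℤ, Wakimoto.IsRootProduct T b θ F ∧
      Wakimoto.CharacterEq T b θ lam (Wakimoto.actWakimoto T b θ lam) F ∧
      Wakimoto.CharacterEq T b θ lam (Wakimoto.actVerma lam hθ) F ∧
      Wakimoto.CharacterEq T b θ lam (Wakimoto.actContragredientVerma lam hθ) F) ∧
    Wakimoto.formalCharacter T θ (Wakimoto.actWakimoto T b θ lam) =
      Wakimoto.formalCharacter T θ (Wakimoto.actVerma lam hθ) ∧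
    Wakimoto.formalCharacter T θ (Wakimoto.actWakimoto T b θ lam) =
      Wakimoto.formalCharacter T θ (Wakimoto.actContragredientVerma lam hθ) :=
  have hW := Wakimoto.characterEq_wakimoto hθ lam
  have hV := Wakimoto.characterEq_verma hθ lam
  have hC := Wakimoto.characterEq_contragredientVerma hθ lam
  ⟨fun x y hx hy => Wakimoto.exists_basis_wakimoto hθ lam x y hx hy,
    ⟨_, Wakimoto.isRootProduct_partitionSeries hθ, hW, hV, hC⟩,
    hW.formalCharacter_eq hV, hW.formalCharacter_eq hC⟩
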